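/- Let $k$ be a perfect field of characteristic $p$ (written $\mathbb F$ in the source), $\mathfrak S=W(k)[[u]]$ with Frobenius $\varphi$ ($\varphi$ is the Witt vector Frobenius on $W(k)$ and $\varphi(u)=u^p$), let $E\in W(k)[u]$ be a (monic) Eisenstein polynomial of degree $e\ge 1$, and let $\mathrm{Mod}^\varphi_{\mathfrak S}$ be the category of finitely generated $\mathfrak S$-modules $M$ with an isomorphism $\varphi_M:\varphi^*M[\frac1E]\simeq M[\frac1E]$. A *Kisin module* is an object $M$ of this category which is free over $\mathfrak S$; its rank is $\operatorname{rank}_{\mathfrak S}M$ and its degree is the relative index $\deg M=\nu(M_{(E)},\varphi_M\varphi^*M_{(E)})$, i.e. $\sum_i a_i$ if the lattice $M_{(E)}$ has a basis $(e_i)$ such that $(E^{-a_i}e_i)$ is a basis of $\varphi_M\varphi^*M_{(E)}$. A *$p^\infty$-torsion Kisin module* is an object of $\mathrm{Mod}^\varphi_{\mathfrak S}$ killed by a power of $p$ and without $u$-torsion; its rank is $\operatorname{length}(M/uM)$ and its degree is $\frac1e\bigl(i\operatorname{rank}M-\operatorname{length}_{\mathfrak S}(M/u^i\varphi_M\varphi^*M)\bigr)$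 for $i$ large. The slope of a nonzero object is $\mu=\deg/\operatorname{rank}$. A nonzero $p^\infty$-torsion Kisin module is semi-stable if $\mu(N)\le\mu(M)$ for every nonzero subobject $N\subset M$ such that $M/N$ has no $u$-torsion; every $p^\infty$-torsion Kisin module has a Harder–Narasimhan filtration $\mathcal F_{F,t}^{\ge\gamma}$ (the *Fargues filtration*) with concave polygon $\mathbf t_{F,t}(M):[0,\operatorname{rank}M]\to\mathbb R$. A Kisin module $M$ is *semi-stable* if $M/pM$ is. For a Kisin module $M$, $n\ge1$ and $x\in[0,\operatorname{rank}M]$ put $\mathbf t_{F,n}(M)(x)=\frac1n\mathbf t_{F,t}(M/p^nM)(nx)$ and $\mathbf t_{F,\infty}(M)=\inf_{n\ge1}\mathbf t_{F,n}(M)$ (also the limit along the divisibility order). **Proposition 3.23.** Let $M$ be a Kisin module. The following are equivalent: 1. There is a flag $0=M_0\subset M_1\subset\dots\subset M_r=M$ of Kisin submodules such that, for $1\le i\le r$, the module $M_i/M_{i-1}$ is free and semi-stable, of slope $\mu_i$, with $\mu_1>\dots>\mu_r$. 2. $\mathbf t_{F,\infty}(M)=\mathbf t_{F,1}(M)$ on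 $[0,\operatorname{rank}M]$. Moreover, if these conditions hold, then: (a) the flag is unique, $M_i=\varprojlim_n\mathcal F_{F,t}^{\ge\mu_i}(M/p^nM)$ for $1\le i\le r$, and $\mathbf t_{F,\infty}(M)$ is the concave polygon with slopes $\mu_1,\dots,\mu_r$, where $\mu_i$ has multiplicity $\operatorname{rank}(M_i/M_{i-1})$; (b) for every $n\ge1$ the reduction of the flag modulo $p^n$ is the Harder–Narasimhan flag of $M/p^nM$, with the same slopes $\mu_i$; (c) for $1\le i\le r$, $M_i\otimes\mathbb Q_p=\mathcal F_{F,\circ}^{\ge\mu_i}(M\otimes\mathbb Q_p)$ and $M_i[\frac1p]=\mathcal F_{F,\mathfrak S[1/p]}^{\ge\mu_i}(M[\frac1p])$, where $\mathcal F_{F,\circ}$ and $\mathcal F_{F,\mathfrak S[1/p]}$ are the Harder–Narasimhan filtrations (for the generic rank and the degree $\nu(N_{(E)},\varphi_N\varphi^*N_{(E)})$) in the isogeny category $\mathrm{Mod}^\varphi_{\mathfrak S}\otimes\mathbb Q_p$ and in the category of finitely generated $\mathfrak S[\frac1p]$-modules $N$ with an isomorphism $\varphi^*N[\frac1E]\simeq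 N[\frac1E]$. -/

import Mathlib

open scoped Classical TensorProduct Pointwise Polynomial PowerSeries

universe u v

noncomputable section

namespace Kisin

/-! ### Modules with a Frobenius -/

section PhiModules

variable {A : Type u} [CommRing A]

/-- The `A`-module obtained from `T` by restriction of scalars along `φ : A → A`. -/
def Twist (_φ : A →+* A) (T : Type v) : Type v := T

instance (φ : A →+* A) (T : Type v) [AddCommGroup T] : AddCommGroup (Twist φ T) :=
  inferInstanceAs (AddCommGroup T)

instance (φ : A →+* A) (T : Type v) [AddCommGroup T] [Module A T] : Module A (Twist φ T) :=
  Module.compHom T φ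

/-- The identity, as an additive isomorphism from `T` with the twisted structure to `T`. -/
def Twist.equiv {φ : A →+* A} {T : Type v} [AddCommGroup T] : Twist φ T ≃+ T := AddEquiv.refl T

theorem Twist.equiv_smul {φ : A →+* A} {T : Type v} [AddCommGroup T] [Module A T] (a : A)
    (x : Twist φ T) : Twist.equiv (a • x) = φ a • Twist.equiv x := rfl

/-- The localization `T[1/a]` of an `A`-module `T`. -/
abbrev Inv (a : A) (T : Type v) [AddCommGroup T] [Module A T] : Type (max u v) :=
  LocalizedModule (Submonoid.powers a) T

/-- The canonical map `T → T[1/a]`. -/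
abbrev toInv (a : A) (T : Type v) [AddCommGroup T] [Module A T] : T →ₗ[A] Inv a T :=
  LocalizedModule.mkLinearMap (Submonoid.powers a) T

/-- Functoriality of `T ↦ T[1/a]`. -/
abbrev invMap (a : A) {T T' : Type*} [AddCommGroup T] [Module A T] [AddCommGroup T'] [Module A T']
    (f : T →ₗ[A] T') : Inv a T →ₗ[A] Inv a T' :=
  IsLocalizedModule.map (Submonoid.powers a) (toInv a T) (toInv a T') f

/-- An `A`-module `M` together with a `φ`-semilinear map `M → M[1/E]`. By adjunction such a map is
the same as an `A[1/E]`-linear map `φ_M : (φ^* M)[1/E] → M[1/E]`, namely its linearization (see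
`PhiModule.linearization`); that the latter is an isomorphism is the condition
`PhiModule.IsEtale`. -/
structure PhiModule (φ : A →+* A) (E : A) where
  carrier : Type v
  [addCommGroup : AddCommGroup carrier]
  [module : Module A carrier]
  frob : carrier →ₛₗ[φ] Inv E carrier

attribute [instance] PhiModule.addCommGroup PhiModule.module

namespace PhiModule

variable {φ : A →+* A} {E : A}

instance : CoeSort (PhiModule.{u, v} φ E) (Type v) := ⟨PhiModule.carrier⟩

/-- The linearization `φ_M : (φ^* M)[1/E] → M[1/E]`, `a ⊗ m ↦ a • frob m`. Here `(φ^* M)[1/E]` is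
the tensor product over `A` of `A[1/E]`, seen as an `A`-module via `φ`, with `M`. -/
def linearization (M : PhiModule.{u, v} φ E) :
    (Twist φ (Localization.Away E) ⊗[A] M) →+ Inv E M :=
  TensorProduct.liftAddHom
    (AddMonoidHom.mk'
      (fun a => (DistribSMul.toAddMonoidHom (Inv E M) (Twist.equiv a)).comp M.frob.toAddMonoidHom)
      (fun a b => AddMonoidHom.ext fun m => by
        simp [add_smul]))
    (by
      intro r a m
      change Twist.equiv (r • a) • M.frob m = Twist.equiv a • M.frob (r • m)
      rw [M.frob.map_smulₛₗ, Twist.equiv_smul, smul_assoc, smul_comm])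

/-- `φ_M : (φ^* M)[1/E] → M[1/E]` is an isomorphism. -/
def IsEtale (M : PhiModule.{u, v} φ E) : Prop := Function.Bijective M.linearization

/-- The `A`-submodule `N` satisfies `φ_M ((φ^* N)[1/E]) ⊆ N[1/E]`. -/
def IsStable (M : PhiModule.{u, v} φ E) (N : Submodule A M) : Prop :=
  ∀ x ∈ N, M.frob x ∈ LinearMap.range (invMap E N.subtype)

theorem invMap_subtype_injective (M : PhiModule.{u, v} φ E) (N : Submodule A M) :
    Function.Injective (invMap E N.subtype) :=
  IsLocalizedModule.map_injective _ _ _ _ N.injective_subtype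

/-- The Frobenius induced on a stable submodule. -/
def subFrob (M : PhiModule.{u, v} φ E) (N : Submodule A M) (h : M.IsStable N) :
    N →ₛₗ[φ] Inv E N :=
  (LinearEquiv.ofInjective (invMap E N.subtype)
      (M.invMap_subtype_injective N)).symm.toLinearMap.comp
    ((M.frob.comp N.subtype).codRestrict (LinearMap.range (invMap E N.subtype))
      (fun x => h x x.2))

/-- The Frobenius induced on the quotient by a stable submodule. -/
def quotFrob (M : PhiModule.{u, v} φ E) (N : Submodule A M) (h : M.IsStable N) :
    (M ⧸ N) →ₛₗ[φ] Inv E (M ⧸ N) :=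
  N.liftQ ((invMap E N.mkQ).comp M.frob) (by
    intro x hx
    obtain ⟨y, hy⟩ := h x hx
    rw [LinearMap.mem_ker, LinearMap.comp_apply, ← hy]
    have : (invMap E N.mkQ).comp (invMap E N.subtype) = 0 := by
      rw [← IsLocalizedModule.map_comp']
      have h0 : N.mkQ ∘ₗ N.subtype = 0 := by
        ext x
        simp
      rw [h0, map_zero]
    exact LinearMap.congr_fun this y)

/-- A stable submodule with the induced Frobenius. (The value for a submodule which is not stable
is irrelevant: the construction is only used for stable submodules.) -/
def sub (M : PhiModule.{u, v} φ E) (N : Submodule A M) : PhiModule.{u, v} φ E where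
  carrier := N
  frob := if h : M.IsStable N then M.subFrob N h else 0

/-- The quotient by a stable submodule with the induced Frobenius. (The value for a submodule which
is not stable is irrelevant.) -/
def quot (M : PhiModule.{u, v} φ E) (N : Submodule A M) : PhiModule.{u, v} φ E where
  carrier := M ⧸ N
  frob := if h : M.IsStable N then M.quotFrob N h else 0

/-- The subquotient `N' / N` of `M`, for stable submodules `N ⊆ N'`. -/
def gr (M : PhiModule.{u, v} φ E) (N N' : Submodule A M) : PhiModule.{u, v} φ E :=
  (M.sub N').quot (N.submoduleOf N')

/-- The submodule `p ^ n M`. -/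
def pPow (M : PhiModule.{u, v} φ E) (p n : ℕ) : Submodule A M := ((p : A) ^ n) • ⊤

/-- The reduction `M / p ^ n M`, with the reduction of the Frobenius. -/
def modPow (M : PhiModule.{u, v} φ E) (p n : ℕ) : PhiModule.{u, v} φ E := M.quot (M.pPow p n)

/-- The reduction map `M → M / p ^ n M`. -/
def reduce (M : PhiModule.{u, v} φ E) (p n : ℕ) : M →ₗ[A] M.modPow p n := (M.pPow p n).mkQ

theorem bijective_pow_smul (p k : ℕ) (M : PhiModule.{u, v} φ E) :
    Function.Bijective (fun y : Inv E (Inv (p : A) M) => (p : A) ^ k • y) := by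
  have h1 : IsUnit (algebraMap A (Module.End A (Inv (p : A) M)) ((p : A) ^ k)) :=
    IsLocalizedModule.map_units (toInv (p : A) M)
      (⟨(p : A) ^ k, k, rfl⟩ : Submonoid.powers (p : A))
  obtain ⟨g, hg⟩ := h1.exists_right_inv
  obtain ⟨g', hg'⟩ := h1.exists_left_inv
  have h2 : (algebraMap A (Module.End A (Inv (p : A) M)) ((p : A) ^ k))
      = ((p : A) ^ k) • LinearMap.id := Algebra.algebraMap_eq_smul_one _
  rw [h2] at hg hg'
  have hg1 : (((p : A) ^ k) • LinearMap.id) ∘ₗ g = LinearMap.id := hg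
  have hg2 : g' ∘ₗ (((p : A) ^ k) • LinearMap.id) = LinearMap.id := hg'
  have key : ∀ y : Inv E (Inv (p : A) M),
      (invMap E (((p : A) ^ k) • LinearMap.id)) y = ((p : A) ^ k) • y := by
    intro y
    have h3 := LinearMap.congr_fun (map_smul (IsLocalizedModule.map (Submonoid.powers E)
      (toInv E (Inv (p : A) M)) (toInv E (Inv (p : A) M))) ((p : A) ^ k) LinearMap.id) y
    rw [IsLocalizedModule.map_id] at h3
    exact h3
  constructor
  · intro y z hyz
    have h3 : (invMap E (((p : A) ^ k) • LinearMap.id)) y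
        = (invMap E (((p : A) ^ k) • LinearMap.id)) z := by
      rw [key, key]
      exact hyz
    have h4 := congrArg (invMap E g') h3
    rw [← LinearMap.comp_apply, ← LinearMap.comp_apply, ← IsLocalizedModule.map_comp', hg2,
      IsLocalizedModule.map_id] at h4
    exact h4
  · intro y
    refine ⟨invMap E g y, ?_⟩
    change (p : A) ^ k • invMap E g y = y
    rw [← key, ← LinearMap.comp_apply, ← IsLocalizedModule.map_comp', hg1,
      IsLocalizedModule.map_id]
    rfl

theorem isUnit_twist (p : ℕ) (M : PhiModule.{u, v} φ E) (x : Submonoid.powers (p : A)) :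
    IsUnit (algebraMap A (Module.End A (Twist φ (Inv E (Inv (p : A) M)))) x) := by
  obtain ⟨_, k, rfl⟩ := x
  rw [Module.End.isUnit_iff]
  have h : ∀ y : Twist φ (Inv E (Inv (p : A) M)),
      (algebraMap A (Module.End A (Twist φ (Inv E (Inv (p : A) M)))) ((p : A) ^ k)) y
        = Twist.equiv.symm ((p : A) ^ k • Twist.equiv y) := by
    intro y
    rw [Module.algebraMap_end_apply]
    apply Twist.equiv.injective
    rw [Twist.equiv_smul, map_pow, map_natCast, AddEquiv.apply_symm_apply]
  rw [show ⇑((algebraMap A (Module.End A (Twist φ (Inv E (Inv (p : A) M))))) ((p : A) ^ k))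
    = _ from funext h]
  exact Twist.equiv.symm.bijective.comp
    ((bijective_pow_smul p k M).comp Twist.equiv.bijective)

/-- The module `M[1/p]` with the Frobenius `p ^ (-k) m ↦ p ^ (-k) frob m`. It is an
`A[1/p]`-module, regarded as an `A`-module on which `p` is invertible. -/
def invert (M : PhiModule.{u, v} φ E) (p : ℕ) : PhiModule.{u, max u v} φ E where
  carrier := Inv (p : A) M
  frob :=
    let g : M →ₗ[A] Twist φ (Inv E (Inv (p : A) M)) :=
      { toFun := fun m => Twist.equiv.symm (invMap E (toInv (p : A) M) (M.frob m))
        map_add' := fun m m' => by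
          rw [map_add, map_add, map_add]
        map_smul' := fun a m => by
          rw [M.frob.map_smulₛₗ, map_smul]
          rfl }
    let G : Inv (p : A) M →ₗ[A] Twist φ (Inv E (Inv (p : A) M)) :=
      LocalizedModule.lift (Submonoid.powers (p : A)) g (isUnit_twist p M)
    { toFun := fun m => Twist.equiv (G m)
      map_add' := fun m m' => G.map_add m m'
      map_smul' := fun a m => G.map_smul a m }

/-- The submodule `N[1/p]` of `M[1/p]`. -/
def invertSub (M : PhiModule.{u, v} φ E) (p : ℕ) (N : Submodule A M) :
    Submodule A (M.invert p) :=
  let P : Submodule A (Inv (p : A) M) :=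
    N.localized₀ (Submonoid.powers (p : A)) (toInv (p : A) M)
  P

/-- The lattice `M` in `M[1/E]`, i.e. the image of `M → M[1/E]`. -/
def lattice (M : PhiModule.{u, v} φ E) : Submodule A (Inv E M) := LinearMap.range (toInv E M)

/-- The lattice `φ_M (φ^* M)` in `M[1/E]`. -/
def frobLattice (M : PhiModule.{u, v} φ E) : Submodule A (Inv E M) :=
  Submodule.span A (Set.range M.frob)

end PhiModule

/-- The elements of `A` which are not zero divisors modulo `E`; for a prime element `E` this is the
complement of the prime ideal `(E)`. -/
def away (E : A) : Submonoid A :=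
  (nonZeroDivisors (A ⧸ Ideal.span {E})).comap (Ideal.Quotient.mk (Ideal.span {E}))

theorem mem_away_iff {E : A} (hE : Prime E) (a : A) : a ∈ away E ↔ ¬ E ∣ a := by
  have hp : (Ideal.span {E}).IsPrime := (Ideal.span_singleton_prime hE.ne_zero).mpr hE
  rw [away, Submonoid.mem_comap, mem_nonZeroDivisors_iff_ne_zero, Ne,
    Ideal.Quotient.eq_zero_iff_mem, Ideal.mem_span_singleton]

/-- The length over `A_(E)` of the localization `Q_(E)`. -/
def localLength (E : A) (Q : Type v) [AddCommGroup Q] [Module A Q] : ℕ :=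
  (Module.length (Localization (away E)) (LocalizedModule (away E) Q)).toNat

/-- The relative index `ν(L₁, L₂)` at `E` of two lattices: the length of
`(L₂ / L₁ ∩ L₂)_(E)` minus the length of `(L₁ / L₁ ∩ L₂)_(E)`. If `L₁ = ⨁ A_(E) e_i` and
`L₂ = ⨁ A_(E) E ^ (- a_i) e_i` after localization at `(E)`, then `ν(L₁, L₂) = ∑ a_i`. -/
def relIndex (E : A) {V : Type v} [AddCommGroup V] [Module A V] (L₁ L₂ : Submodule A V) : ℤ :=
  (localLength E (L₂ ⧸ L₁.submoduleOf L₂) : ℤ) - localLength E (L₁ ⧸ L₂.submoduleOf L₁)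

end PhiModules

/-! ### Harder-Narasimhan flags, filtrations and polygons -/

section HN

variable {A : Type u} [CommRing A] {φ : A →+* A} {E : A}

/-- A category of modules with Frobenius (through its class of objects, and the class of those
objects which are zero in it), together with a rank and a degree function. -/
structure SlopeData (φ : A →+* A) (E : A) where
  IsObj : PhiModule.{u, v} φ E → Prop
  IsNull : PhiModule.{u, v} φ E → Prop
  rank : PhiModule.{u, v} φ E → ℕ
  deg : PhiModule.{u, v} φ E → ℚ

namespace SlopeData

variable (D : SlopeData.{u, v} φ E)

/-- The slope `μ = deg / rank` of a nonzero object. -/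
def slope (M : PhiModule.{u, v} φ E) : ℚ := D.deg M / D.rank M

/-- `N` is a strict subobject of `M`: it is stable, and `N` and `M / N` are objects. -/
def IsStrictSub (M : PhiModule.{u, v} φ E) (N : Submodule A M) : Prop :=
  M.IsStable N ∧ D.IsObj (M.sub N) ∧ D.IsObj (M.quot N)

/-- `M` is a nonzero object such that `μ(N) ≤ μ(M)` for every nonzero strict subobject `N`. -/
def IsSemistable (M : PhiModule.{u, v} φ E) : Prop :=
  D.IsObj M ∧ ¬ D.IsNull M ∧
    ∀ N : Submodule A M, D.IsStrictSub M N → ¬ D.IsNull (M.sub N) → D.slope (M.sub N) ≤ D.slope M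

/-- `0 = N 0 ⊆ N 1 ⊆ ⋯ ⊆ N r = M` is the Harder-Narasimhan flag of `M`: the `N i` are strict
subobjects, and the graded pieces `N (i + 1) / N i` are semistable of strictly decreasing slopes.
(The values `N i` for `i > r` play no role.) -/
structure IsHNFlag (M : PhiModule.{u, v} φ E) (r : ℕ) (N : ℕ → Submodule A M) : Prop where
  zero : N 0 = ⊥
  last : N r = ⊤
  le_succ : ∀ i < r, N i ≤ N (i + 1)
  strict : ∀ i ≤ r, D.IsStrictSub M (N i)
  semistable : ∀ i < r, D.IsSemistable (M.gr (N i) (N (i + 1)))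
  slope_lt : ∀ i j, i < j → j < r →
    D.slope (M.gr (N j) (N (j + 1))) < D.slope (M.gr (N i) (N (i + 1)))

/-- The step `F^{≥ γ} M` of the Harder-Narasimhan filtration: the last member `N (i + 1)` of the
Harder-Narasimhan flag such that `N (i + 1) / N i` has slope at least `γ` (zero if there is none).
(In the isogeny category, where a subobject has many representatives, this is the largest
representative.) -/
def hnFil (M : PhiModule.{u, v} φ E) (γ : ℚ) : Submodule A M :=
  sSup {P | ∃ (r : ℕ) (N : ℕ → Submodule A M) (i : ℕ), D.IsHNFlag M r N ∧ i < r ∧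
    γ ≤ D.slope (M.gr (N i) (N (i + 1))) ∧ P = N (i + 1)}

end SlopeData

/-- The concave polygon starting at `(0, 0)` whose slopes are `μ 0 > ⋯ > μ (r - 1)`, the slope
`μ i` occurring on an interval of length `m i`. -/
def polygon (r : ℕ) (m : ℕ → ℕ) (μ : ℕ → ℚ) (x : ℝ) : ℝ :=
  ∑ i ∈ Finset.range r,
    (μ i : ℝ) * max 0 (min (x - ∑ j ∈ Finset.range i, (m j : ℝ)) (m i : ℝ))

/-- The Harder-Narasimhan polygon of `M`: its slopes are the slopes of the graded pieces of the
Harder-Narasimhan flag of `M`, with multiplicity the rank of the graded piece. -/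
def SlopeData.hnPolygon (D : SlopeData.{u, v} φ E) (M : PhiModule.{u, v} φ E) : ℝ → ℝ :=
  if h : ∃ f : ℕ × (ℕ → Submodule A M), D.IsHNFlag M f.1 f.2 then
    polygon h.choose.1
      (fun i => D.rank (M.gr (h.choose.2 i) (h.choose.2 (i + 1))))
      (fun i => D.slope (M.gr (h.choose.2 i) (h.choose.2 (i + 1))))
  else 0

end HN

/-! ### Kisin modules -/

section Kisin

variable (p : ℕ) [hp : Fact p.Prime] (k : Type u) [Field k]

/-- The ring `𝔖 = W(k)[[u]]`. -/
abbrev Sring : Type u := (WittVector p k)⟦X⟧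

/-- The Frobenius of `𝔖`: the Witt vector Frobenius on `W(k)`, and `u ↦ u ^ p`. -/
def frobS [CharP k p] : Sring p k →+* Sring p k :=
  ((PowerSeries.expand p hp.out.ne_zero : Sring p k →ₐ[WittVector p k] Sring p k) :
    Sring p k →+* Sring p k).comp (PowerSeries.map WittVector.frobenius)

variable {p k} [CharP k p]

/-- Modules over `𝔖` with a Frobenius `(φ^* M)[1/E] → M[1/E]`. -/
abbrev PhiMod (E : (WittVector p k)[X]) : Type (max u (v + 1)) :=
  PhiModule.{u, v} (frobS p k) (E : Sring p k)

variable {E : (WittVector p k)[X]}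

/-- Kisin modules: finite free `𝔖`-modules with an isomorphism `(φ^* M)[1/E] ≃ M[1/E]`. -/
def IsKisin (M : PhiMod.{u, v} E) : Prop :=
  Module.Finite (Sring p k) M ∧ Module.Free (Sring p k) M ∧ M.IsEtale

/-- The degree `ν(M_(E), φ_M (φ^* M)_(E))`. -/
def deg (M : PhiMod.{u, v} E) : ℚ := relIndex (E : Sring p k) M.lattice M.frobLattice

/-- The (generic) rank over `𝔖`. -/
def rank (M : PhiMod.{u, v} E) : ℕ := Module.finrank (Sring p k) M

/-- The slope `deg / rank` of a nonzero Kisin module. -/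
def slope (M : PhiMod.{u, v} E) : ℚ := deg M / rank M

/-- The rank of a `p^∞`-torsion Kisin module: the length of `M / u M` (over `W(k) = 𝔖 / u 𝔖`, or
equivalently over `𝔖`). -/
def torsionRank (M : PhiMod.{u, v} E) : ℕ :=
  (Module.length (Sring p k) (M ⧸ ((PowerSeries.X : Sring p k) • (⊤ : Submodule (Sring p k) M)))).toNat

/-- The least `i` such that the twist `(M, u ^ i φ_M)` is effective. -/
def twistExp (M : PhiMod.{u, v} E) : ℕ :=
  sInf {i | (PowerSeries.X : Sring p k) ^ i • M.frobLattice ≤ M.lattice}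

/-- The degree of a `p^∞`-torsion Kisin module, normalized by `e = deg E`:
`(i * rank M - length (M / u ^ i φ_M (φ^* M))) / e` for `i` large enough. -/
def torsionDeg (M : PhiMod.{u, v} E) : ℚ :=
  ((twistExp M : ℚ) * torsionRank M -
    ((Module.length (Sring p k) (M.lattice ⧸
      (((PowerSeries.X : Sring p k) ^ twistExp M • M.frobLattice).submoduleOf M.lattice))).toNat : ℚ))
    / E.natDegree

/-- The category of `p^∞`-torsion Kisin modules, with its rank and degree: finitely generated
`𝔖`-modules killed by a power of `p` and without `u`-torsion (for finitely generated modules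
killed by a power of `p`, this means that the projective dimension is at most one), with an
isomorphism `(φ^* M)[1/E] ≃ M[1/E]`. -/
def torsionData (E : (WittVector p k)[X]) : SlopeData.{u, v} (frobS p k) (E : Sring p k) where
  IsObj M := Module.Finite (Sring p k) M ∧ M.IsEtale ∧
    (∃ n : ℕ, ∀ x : M, (p : Sring p k) ^ n • x = 0) ∧
    (∀ x : M, (PowerSeries.X : Sring p k) • x = 0 → x = 0)
  IsNull M := Subsingleton M
  rank := torsionRank
  deg := torsionDeg

/-- The isogeny category of finitely generated `𝔖`-modules with an isomorphism
`(φ^* M)[1/E] ≃ M[1/E]` (same objects, morphisms tensored with `ℚ_p`), with its rank and degree. An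
object is zero in it when it is killed by a power of `p`. A monomorphism `N ⊗ ℚ_p → M ⊗ ℚ_p` is,
up to a power of `p`, induced by a morphism `N → M` with `p`-power torsion kernel, so every
subobject of `M ⊗ ℚ_p` is `N ⊗ ℚ_p` for some subobject `N ⊆ M`. -/
def isogenyData (E : (WittVector p k)[X]) : SlopeData.{u, v} (frobS p k) (E : Sring p k) where
  IsObj M := Module.Finite (Sring p k) M ∧ M.IsEtale
  IsNull M := ∃ n : ℕ, ∀ x : M, (p : Sring p k) ^ n • x = 0
  rank := rank
  deg := deg

/-- The submodules `N` and `N'` of `M` define the same subobject `N ⊗ ℚ_p = N' ⊗ ℚ_p` of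
`M ⊗ ℚ_p`. -/
def IsogenySame {M : PhiMod.{u, v} E} (N N' : Submodule (Sring p k) M) : Prop :=
  ∃ n : ℕ, (p : Sring p k) ^ n • N ≤ N' ∧ (p : Sring p k) ^ n • N' ≤ N

/-- The category of finitely generated `𝔖[1/p]`-modules with an isomorphism
`(φ^* M)[1/E] ≃ M[1/E]`, with its rank and degree. An `𝔖[1/p]`-module is regarded as an
`𝔖`-module on which `p` is bijective. -/
def rationalData (E : (WittVector p k)[X]) : SlopeData.{u, v} (frobS p k) (E : Sring p k) where
  IsObj M := Function.Bijective (fun x : M => (p : Sring p k) • x) ∧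
    (∃ N : Submodule (Sring p k) M, N.FG ∧ ∀ x : M, ∃ n : ℕ, (p : Sring p k) ^ n • x ∈ N) ∧
    M.IsEtale
  IsNull M := Subsingleton M
  rank := rank
  deg := deg

/-- A Kisin module `M` is semistable when `M / p M` is semistable. -/
def IsSemistable (M : PhiMod.{u, v} E) : Prop :=
  IsKisin M ∧ (torsionData E).IsSemistable (M.modPow p 1)

/-- `0 = N 0 ⊆ N 1 ⊆ ⋯ ⊆ N r = M` is a flag of Kisin submodules of `M` whose graded pieces
are free and semistable, of strictly decreasing slopes. -/
structure IsHNFlag (M : PhiMod.{u, v} E) (r : ℕ) (N : ℕ → Submodule (Sring p k) M) : Prop where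
  zero : N 0 = ⊥
  last : N r = ⊤
  le_succ : ∀ i < r, N i ≤ N (i + 1)
  kisin : ∀ i ≤ r, M.IsStable (N i) ∧ IsKisin (M.sub (N i))
  free : ∀ i < r, Module.Free (Sring p k) (M.gr (N i) (N (i + 1)))
  semistable : ∀ i < r, IsSemistable (M.gr (N i) (N (i + 1)))
  slope_lt : ∀ i j, i < j → j < r →
    slope (M.gr (N j) (N (j + 1))) < slope (M.gr (N i) (N (i + 1)))

/-- The renormalized polygon `t_{F,n}(M)(x) = (1 / n) t_F(M / p ^ n M)(n x)`, for `n ≥ 1`. -/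
def tF (M : PhiMod.{u, v} E) (n : ℕ) (x : ℝ) : ℝ :=
  (1 / (n : ℝ)) * (torsionData E).hnPolygon (M.modPow p n) (n * x)

/-- The Fargues polygon `t_{F,∞}(M) = inf_{n ≥ 1} t_{F,n}(M)`, which is also the limit of the
`t_{F,n}(M)` along the divisibility order, for which they decrease. -/
def tFInf (M : PhiMod.{u, v} E) (x : ℝ) : ℝ := ⨅ n : ℕ+, tF M n x

end Kisin

end Kisin

end

/-!
A Kisin module `M` is studied through its reductions `M / p ^ n M`, which form extensions
`0 → M / p ^ a → M / p ^ (a + b) → M / p ^ b → 0`.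

*Three slope categories.* The torsion objects, the isogeny category and the modules over `𝔖[1/p]`
carry a rank and a degree which are additive, and strict subobjects admit intersections and sums along
which the degree is supermodular (`torsionData_isGood`, `isogenyData_isGood`, `rationalData_isGood`).
This suffices for the usual Harder-Narasimhan theory: for a slope `γ`, the height `deg P - γ rank P`
of a strict subobject `P` is maximal exactly on the subobjects between two steps of the flag, which
gives the uniqueness of flags and the shape of polygons. Behind additivity lies the injectivity of the
linearization of the Frobenius. As `𝔖` is free over `φ(𝔖)` on `1, u, …, u ^ (p - 1)`, each element
of the lattice generated by the Frobenius has unique coordinates (`eq_zero_of_sum_frob_eq_zero`).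
Hence the passage to submodules and quotients is exact for both lattices that enter the degree.

*From the flag to the polygons.* The rank and the degree of `M / p M` are those of `M`
(`IsKisin.torsionRank_modPow_one`, `IsKisin.torsionDeg_modPow_one`). By dévissage, `M / p ^ n M` has
`n` times that rank and degree, and it is semistable if `M / p M` is. Consequently a flag with free
semistable quotients of decreasing slopes reduces to the Harder-Narasimhan flag of each `M / p ^ n M`
(`IsHNFlag.modPow`), so that the normalized polygons all agree. Krull's intersection theorem recovers
the flag from its reductions. A subobject of a semistable Kisin module up to isogeny can be replaced by
a saturated submodule, whose slope is seen modulo `p` (`IsSemistable.deg_sub_le`); hence the flag is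
also the Harder-Narasimhan flag in the isogeny category and after inverting `p`.

*From the polygons to the flag.* Let `c` be the height of a step of the flag of `M / p M`, for a slope
`γ` which it separates. By dévissage `n c` bounds the heights of the subobjects of `M / p ^ n M`. If
the polygons of the `M / p ^ n M` do not drop below that of `M / p M`, the bound is attained, and only
by a step of the filtration (`hnFil_unique`). In the extensions above, a subobject of maximal height
induces subobjects of maximal height on both sides, provided that its image in the quotient has no
room to grow. This holds since the degree of a subobject increases strictly under saturation with
respect to `u` (`satX_eq_of_torsionDeg_eq`): adjoining an element `x` to the subobject adjoins
`φ(x), u φ(x), …, u ^ (p - 1) φ(x)` to the Frobenius lattice. So the steps of the filtrations of the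
`M / p ^ n M` form a compatible system, whose limit lifts the step for `M / p M` (`limit_hnFil`). The
quotients of the limits are free, since `(p, u)` is a regular sequence on them (`free_of_regular`), and
their reductions are the semistable quotients of the flag of `M / p M` (`isHNFlag_of_lift`).
-/

universe v₁ v₂ v₃ v₄

noncomputable section

namespace Kisin

/-! ### Morphisms and étale submodules of modules with Frobenius -/

section Localization

variable {A : Type u} [CommRing A] {a : A}
variable {T : Type v₁} {T' : Type v₂} {T'' : Type v₃} [AddCommGroup T] [Module A T]
  [AddCommGroup T'] [Module A T'] [AddCommGroup T''] [Module A T'']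

theorem invMap_toInv (f : T →ₗ[A] T') (x : T) : invMap a f (toInv a T x) = toInv a T' (f x) :=
  IsLocalizedModule.map_apply _ _ _ _ _

theorem invMap_invMap (f : T →ₗ[A] T') (g : T' →ₗ[A] T'') (y : Inv a T) :
    invMap a g (invMap a f y) = invMap a (g ∘ₗ f) y := by
  rw [← LinearMap.comp_apply, ← IsLocalizedModule.map_comp']

theorem invMap_injective {f : T →ₗ[A] T'} (hf : Function.Injective f) :
    Function.Injective (invMap a f) := IsLocalizedModule.map_injective _ _ _ _ hf

theorem invMap_surjective {f : T →ₗ[A] T'} (hf : Function.Surjective f) :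
    Function.Surjective (invMap a f) := IsLocalizedModule.map_surjective _ _ _ _ hf

theorem invMap_exact {f : T →ₗ[A] T'} {g : T' →ₗ[A] T''} (h : Function.Exact f g) :
    Function.Exact (invMap a f) (invMap a g) := IsLocalizedModule.map_exact _ _ _ _ _ _ h

theorem exists_pow_smul_eq_toInv (y : Inv a T) : ∃ (n : ℕ) (x : T), a ^ n • y = toInv a T x := by
  obtain ⟨⟨x, ⟨_, n, rfl⟩⟩, h⟩ := IsLocalizedModule.surj (Submonoid.powers a) (toInv a T) y
  exact ⟨n, x, h⟩

theorem toInv_eq_zero {x : T} : toInv a T x = 0 ↔ ∃ n : ℕ, a ^ n • x = 0 := by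
  rw [IsLocalizedModule.eq_zero_iff (Submonoid.powers a) (toInv a T)]
  constructor
  · rintro ⟨⟨_, n, rfl⟩, h⟩
    exact ⟨n, h⟩
  · rintro ⟨n, h⟩
    exact ⟨⟨_, n, rfl⟩, h⟩

theorem pow_smul_inv_injective (n : ℕ) :
    Function.Injective (fun y : Inv a T => a ^ n • y) :=
  IsLocalizedModule.smul_injective (toInv a T) (⟨a ^ n, n, rfl⟩ : Submonoid.powers a)

theorem pow_smul_inv_surjective (n : ℕ) :
    Function.Surjective (fun y : Inv a T => a ^ n • y) :=
  ((Module.End.isUnit_iff _).mp (IsLocalizedModule.map_units (toInv a T)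
    (⟨a ^ n, n, rfl⟩ : Submonoid.powers a))).2

theorem away_exists (c : Localization.Away a) :
    ∃ (n : ℕ) (b : A), a ^ n • c = algebraMap A (Localization.Away a) b := by
  obtain ⟨⟨b, ⟨_, n, rfl⟩⟩, h⟩ := IsLocalization.surj (Submonoid.powers a) c
  exact ⟨n, b, by rw [Algebra.smul_def, mul_comm]; exact h⟩

theorem mem_of_pow_smul_mem {P : Submodule (Localization.Away a) (Inv a T)} {n : ℕ} {y : Inv a T}
    (h : a ^ n • y ∈ P) : y ∈ P := by
  have h1 : (IsLocalization.mk' (Localization.Away a) (1 : A)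
      (⟨a ^ n, n, rfl⟩ : Submonoid.powers a)) • (a ^ n • y) = y := by
    rw [← algebraMap_smul (Localization.Away a) (a ^ n) y, smul_smul]
    have : IsLocalization.mk' (Localization.Away a) (1 : A)
      (⟨a ^ n, n, rfl⟩ : Submonoid.powers a) * algebraMap A _ (a ^ n) = 1 := by
      have := IsLocalization.mk'_spec (Localization.Away a) (1 : A)
        (⟨a ^ n, n, rfl⟩ : Submonoid.powers a)
      rw [map_one] at this
      exact this
    rw [this, one_smul]
  rw [← h1]
  exact P.smul_mem _ h

theorem smul_mem_away {P : Submodule (Localization.Away a) (Inv a T)} (b : A) {y : Inv a T}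
    (h : y ∈ P) : b • y ∈ P := by
  rw [← algebraMap_smul (Localization.Away a) b y]
  exact P.smul_mem _ h

theorem invMap_away_smul (f : T →ₗ[A] T') (c : Localization.Away a) (y : Inv a T) :
    invMap a f (c • y) = c • invMap a f y := by
  obtain ⟨n, b, h⟩ := away_exists c
  apply pow_smul_inv_injective (a := a) n
  change a ^ n • invMap a f (c • y) = a ^ n • (c • invMap a f y)
  rw [← map_smul, ← smul_assoc, ← smul_assoc, h, algebraMap_smul, algebraMap_smul, map_smul]

end Localization

namespace PhiModule

variable {A : Type u} [CommRing A] {φ : A →+* A} {E : A}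

section Hom

variable {M : PhiModule.{u, v₁} φ E} {M' : PhiModule.{u, v₂} φ E} {M'' : PhiModule.{u, v₃} φ E}

/-- The linear map `f` commutes with the Frobenius maps. -/
def IsHom (f : M →ₗ[A] M') : Prop := ∀ x, invMap E f (M.frob x) = M'.frob (f x)

/-- There is an isomorphism of modules with Frobenius between `M` and `M'`. The carriers may live
in different universes. -/
def Iso (M : PhiModule.{u, v₁} φ E) (M' : PhiModule.{u, v₂} φ E) : Prop :=
  ∃ e : M ≃ₗ[A] M', IsHom (M := M) (M' := M') e.toLinearMap

theorem IsHom.comp {f : M →ₗ[A] M'} {g : M' →ₗ[A] M''} (hg : IsHom g) (hf : IsHom f) :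
    IsHom (g ∘ₗ f) := fun x => by
  rw [← invMap_invMap, hf, hg, LinearMap.comp_apply]

theorem isHom_id : IsHom (LinearMap.id : M →ₗ[A] M) := fun x => by
  rw [invMap, IsLocalizedModule.map_id]
  rfl

theorem isHom_natCast_smul (n : ℕ) : IsHom ((n : A) • LinearMap.id : M →ₗ[A] M) := fun x => by
  rw [invMap, map_smul, IsLocalizedModule.map_id]
  simp only [LinearMap.smul_apply, LinearMap.id_apply]
  rw [M.frob.map_smulₛₗ, map_natCast]

theorem IsHom.symm {e : M ≃ₗ[A] M'} (h : IsHom (M := M) (M' := M') e.toLinearMap) :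
    IsHom (M := M') (M' := M) e.symm.toLinearMap := fun x => by
  apply invMap_injective (a := E) (f := e.toLinearMap) e.injective
  rw [h, invMap_invMap, LinearEquiv.comp_coe, LinearEquiv.symm_trans_self]
  simp only [LinearEquiv.coe_coe, LinearEquiv.apply_symm_apply]
  exact isHom_id (M := M') x

theorem Iso.symm (h : Iso M M') : Iso M' M := by
  obtain ⟨e, he⟩ := h
  exact ⟨e.symm, he.symm⟩

theorem linearization_tmul (M : PhiModule.{u, v₁} φ E) (c : Twist φ (Localization.Away E)) (x : M) :
    M.linearization (c ⊗ₜ x) = Twist.equiv c • M.frob x := rfl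

theorem IsHom.map_linearization {f : M →ₗ[A] M'} (hf : IsHom f)
    (t : Twist φ (Localization.Away E) ⊗[A] M) :
    invMap E f (M.linearization t) = M'.linearization (f.lTensor _ t) := by
  induction t with
  | zero => simp
  | add x y hx hy => rw [map_add, map_add, map_add, map_add, hx, hy]
  | tmul c x => rw [linearization_tmul, invMap_away_smul, hf, LinearMap.lTensor_tmul,
      linearization_tmul]

end Hom

section EtaleSub

variable (M : PhiModule.{u, v₁} φ E) {M' : PhiModule.{u, v₂} φ E}

/-- The submodule `N[1/E]` of `M[1/E]`. -/
def loc (N : Submodule A M) : Submodule A (Inv E M) := LinearMap.range (invMap E N.subtype)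

/-- The `A[1/E]`-submodule `φ_M ((φ^* N)[1/E])` of `M[1/E]`. -/
def gen (N : Submodule A M) : Submodule (Localization.Away E) (Inv E M) :=
  Submodule.span _ (M.frob '' N)

/-- The submodule `N` satisfies `φ_M ((φ^* N)[1/E]) = N[1/E]`. -/
def IsEtaleSub (N : Submodule A M) : Prop :=
  M.IsStable N ∧ ∀ x ∈ N, toInv E M x ∈ M.gen N

variable {M}

theorem mem_loc {N : Submodule A M} {y : Inv E M} :
    y ∈ M.loc N ↔ ∃ (n : ℕ) (x : M), x ∈ N ∧ E ^ n • y = toInv E M x := by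
  constructor
  · rintro ⟨z, rfl⟩
    obtain ⟨n, x, h⟩ := exists_pow_smul_eq_toInv z
    exact ⟨n, x, x.2, by rw [← map_smul, h, invMap_toInv]; rfl⟩
  · rintro ⟨n, x, hx, h⟩
    obtain ⟨z, hz⟩ := pow_smul_inv_surjective (a := E) n (toInv E N ⟨x, hx⟩)
    refine ⟨z, pow_smul_inv_injective (a := E) n ?_⟩
    change E ^ n • invMap E N.subtype z = E ^ n • y
    rw [h, ← map_smul]
    change invMap E N.subtype (E ^ n • z) = _
    rw [show E ^ n • z = _ from hz, invMap_toInv]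
    rfl

theorem toInv_mem_loc {N : Submodule A M} {x : M} :
    toInv E M x ∈ M.loc N ↔ ∃ n : ℕ, E ^ n • x ∈ N := by
  rw [mem_loc]
  constructor
  · rintro ⟨n, z, hz, h⟩
    rw [← map_smul, ← sub_eq_zero, ← map_sub, toInv_eq_zero] at h
    obtain ⟨m, h⟩ := h
    rw [smul_sub, sub_eq_zero, smul_smul, ← pow_add] at h
    exact ⟨m + n, h ▸ N.smul_mem _ hz⟩
  · rintro ⟨n, h⟩
    exact ⟨n, _, h, (map_smul _ _ _).symm⟩

theorem loc_mono {N N' : Submodule A M} (h : N ≤ N') : M.loc N ≤ M.loc N' := fun y hy => by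
  obtain ⟨n, x, hx, hy⟩ := mem_loc.mp hy
  exact mem_loc.mpr ⟨n, x, h hx, hy⟩

theorem gen_mono {N N' : Submodule A M} (h : N ≤ N') : M.gen N ≤ M.gen N' :=
  Submodule.span_mono (Set.image_mono h)

theorem loc_top : M.loc ⊤ = ⊤ := by
  rw [eq_top_iff]
  intro y _
  obtain ⟨n, x, h⟩ := exists_pow_smul_eq_toInv y
  exact mem_loc.mpr ⟨n, x, trivial, h⟩

theorem loc_ker (f : M →ₗ[A] M') : M.loc (LinearMap.ker f) = LinearMap.ker (invMap E f) := by
  have h : Function.Exact (LinearMap.ker f).subtype f := by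
    rw [LinearMap.exact_iff, Submodule.range_subtype]
  exact ((LinearMap.exact_iff).mp (invMap_exact (a := E) h)).symm

theorem mem_gen {N : Submodule A M} {y : Inv E M} :
    y ∈ M.gen N ↔ ∃ t : Twist φ (Localization.Away E) ⊗[A] N,
      M.linearization (N.subtype.lTensor _ t) = y := by
  constructor
  · intro h
    induction h using Submodule.closure_induction with
    | zero => exact ⟨0, by simp⟩
    | add x y _ _ hx hy =>
      obtain ⟨s, rfl⟩ := hx
      obtain ⟨t, rfl⟩ := hy
      exact ⟨s + t, by simp⟩
    | smul_mem r x hx =>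
      obtain ⟨z, hz, rfl⟩ := hx
      exact ⟨(Twist.equiv.symm r : Twist φ (Localization.Away E)) ⊗ₜ ⟨z, hz⟩, rfl⟩
  · rintro ⟨t, rfl⟩
    induction t with
    | zero => simp
    | add x y hx hy =>
      rw [map_add, map_add]
      exact add_mem hx hy
    | tmul c x =>
      exact Submodule.smul_mem _ _ (Submodule.subset_span ⟨x, x.2, rfl⟩)

theorem linearization_mem_gen_top (t : Twist φ (Localization.Away E) ⊗[A] M) :
    M.linearization t ∈ M.gen ⊤ := by
  induction t with
  | zero => simp
  | add x y hx hy =>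
    rw [map_add]
    exact add_mem hx hy
  | tmul c x => exact Submodule.smul_mem _ _ (Submodule.subset_span ⟨x, trivial, rfl⟩)

theorem gen_top_iff : (∀ x : M, toInv E M x ∈ M.gen ⊤) ↔ Function.Surjective M.linearization := by
  constructor
  · intro h y
    have hy : y ∈ M.gen ⊤ := by
      obtain ⟨n, x, hx⟩ := exists_pow_smul_eq_toInv y
      exact mem_of_pow_smul_mem (hx ▸ h x)
    obtain ⟨t, ht⟩ := mem_gen.mp hy
    exact ⟨_, ht⟩
  · intro h x
    obtain ⟨t, ht⟩ := h (toInv E M x)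
    rw [← ht]
    exact linearization_mem_gen_top t

theorem isStable_top (M : PhiModule.{u, v₁} φ E) : M.IsStable ⊤ := fun x _ => by
  change _ ∈ M.loc ⊤
  rw [loc_top]
  trivial

theorem isStable_bot (M : PhiModule.{u, v₁} φ E) : M.IsStable ⊥ := fun x hx => by
  rw [(Submodule.mem_bot A).mp hx, map_zero]
  exact zero_mem _

theorem IsEtale.isEtaleSub_top (hM : M.IsEtale) : M.IsEtaleSub ⊤ :=
  ⟨M.isStable_top, fun x _ => gen_top_iff.mpr hM.2 x⟩

theorem IsStable.sup {N N' : Submodule A M} (h : M.IsStable N) (h' : M.IsStable N') :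
    M.IsStable (N ⊔ N') := fun x hx => by
  obtain ⟨y, hy, z, hz, rfl⟩ := Submodule.mem_sup.mp hx
  rw [map_add]
  exact add_mem (loc_mono le_sup_left (h y hy)) (loc_mono le_sup_right (h' z hz))

theorem IsEtaleSub.sup {N N' : Submodule A M} (h : M.IsEtaleSub N) (h' : M.IsEtaleSub N') :
    M.IsEtaleSub (N ⊔ N') := by
  refine ⟨h.1.sup h'.1, fun x hx => ?_⟩
  obtain ⟨y, hy, z, hz, rfl⟩ := Submodule.mem_sup.mp hx
  rw [map_add]
  exact add_mem (gen_mono le_sup_left (h.2 y hy)) (gen_mono le_sup_right (h'.2 z hz))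

theorem IsHom.map_mem_loc {f : M →ₗ[A] M'} {N : Submodule A M} {y : Inv E M} (h : y ∈ M.loc N) :
    invMap E f y ∈ M'.loc (N.map f) := by
  obtain ⟨n, x, hx, h⟩ := mem_loc.mp h
  exact mem_loc.mpr ⟨n, f x, ⟨x, hx, rfl⟩, by rw [← map_smul, h, invMap_toInv]⟩

theorem IsHom.map_mem_gen {f : M →ₗ[A] M'} (hf : IsHom f) {N : Submodule A M} {y : Inv E M}
    (h : y ∈ M.gen N) : invMap E f y ∈ M'.gen (N.map f) := by
  induction h using Submodule.closure_induction with
  | zero => simp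
  | add x y _ _ hx hy =>
    rw [map_add]
    exact add_mem hx hy
  | smul_mem r x hx =>
    obtain ⟨z, hz, rfl⟩ := hx
    rw [invMap_away_smul, hf]
    exact Submodule.smul_mem _ _ (Submodule.subset_span ⟨f z, ⟨z, hz, rfl⟩, rfl⟩)

theorem IsHom.isStable_map {f : M →ₗ[A] M'} (hf : IsHom f) {N : Submodule A M}
    (h : M.IsStable N) : M'.IsStable (N.map f) := by
  rintro _ ⟨x, hx, rfl⟩
  rw [← hf]
  exact map_mem_loc (h x hx)

theorem IsHom.isEtaleSub_map {f : M →ₗ[A] M'} (hf : IsHom f) {N : Submodule A M}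
    (h : M.IsEtaleSub N) : M'.IsEtaleSub (N.map f) := by
  refine ⟨hf.isStable_map h.1, ?_⟩
  rintro _ ⟨x, hx, rfl⟩
  rw [← invMap_toInv]
  exact hf.map_mem_gen (h.2 x hx)

theorem IsHom.isStable_ker {f : M →ₗ[A] M'} (hf : IsHom f) : M.IsStable (LinearMap.ker f) := by
  intro x hx
  change _ ∈ M.loc _
  rw [loc_ker, LinearMap.mem_ker, hf, show f x = 0 from hx, map_zero]

theorem IsHom.isStable_comap {f : M →ₗ[A] M'} (hf : IsHom f) {N : Submodule A M'}
    (h : M'.IsStable N) : M.IsStable (N.comap f) := by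
  intro x hx
  obtain ⟨n, y, hy⟩ := exists_pow_smul_eq_toInv (M.frob x)
  have h1 := h (f x) hx
  rw [← hf] at h1
  have h2 : toInv E M' (f y) ∈ M'.loc N := by
    rw [← invMap_toInv, ← hy, map_smul]
    exact Submodule.smul_mem _ _ h1
  obtain ⟨m, h3⟩ := toInv_mem_loc.mp h2
  refine mem_loc.mpr ⟨m + n, E ^ m • y, ?_, by rw [pow_add, mul_smul, hy, map_smul]⟩
  rw [Submodule.mem_comap, map_smul]
  exact h3

/-! The Frobenius of submodules and quotients. -/

/-- The inclusion of a submodule, as a map between carriers of modules with Frobenius. -/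
def incl (M : PhiModule.{u, v₁} φ E) (N : Submodule A M) : M.sub N →ₗ[A] M := N.subtype

/-- The projection to a quotient, as a map between carriers of modules with Frobenius. -/
def proj (M : PhiModule.{u, v₁} φ E) (N : Submodule A M) : M →ₗ[A] M.quot N := N.mkQ

theorem incl_injective (N : Submodule A M) : Function.Injective (M.incl N) := N.injective_subtype

theorem range_incl (N : Submodule A M) : LinearMap.range (M.incl N) = N := N.range_subtype

theorem proj_surjective (N : Submodule A M) : Function.Surjective (M.proj N) := N.mkQ_surjective

theorem ker_proj (N : Submodule A M) : LinearMap.ker (M.proj N) = N := N.ker_mkQ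

theorem isHom_incl {N : Submodule A M} (h : M.IsStable N) : IsHom (M.incl N) := fun x => by
  have h1 : (M.sub N).frob = M.subFrob N h := dif_pos h
  rw [h1]
  exact congrArg Subtype.val ((LinearEquiv.ofInjective (invMap E N.subtype)
      (M.invMap_subtype_injective N)).apply_symm_apply _)

theorem isHom_proj {N : Submodule A M} (h : M.IsStable N) : IsHom (M.proj N) := fun x => by
  have h1 : (M.quot N).frob = M.quotFrob N h := dif_pos h
  rw [h1]
  rfl

theorem IsHom.isEtale_of_surjective {f : M →ₗ[A] M'} (hf : IsHom f) (hs : Function.Surjective f)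
    (hM : ∀ x : M, toInv E M x ∈ M.gen ⊤) (x : M') : toInv E M' x ∈ M'.gen ⊤ := by
  obtain ⟨y, rfl⟩ := hs x
  rw [← invMap_toInv]
  exact gen_mono le_top (hf.map_mem_gen (hM y))

theorem Iso.isEtale (h : Iso M M') (hM : M.IsEtale) : M'.IsEtale := by
  obtain ⟨e, he⟩ := h
  have h1 : ⇑M'.linearization = invMap E e.toLinearMap ∘ M.linearization ∘
      (e.symm.toLinearMap.lTensor (Twist φ (Localization.Away E))) := by
    funext t
    have := he.map_linearization (e.symm.toLinearMap.lTensor _ t)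
    rw [← LinearMap.comp_apply (LinearMap.lTensor _ _), ← LinearMap.lTensor_comp,
      LinearEquiv.comp_coe, LinearEquiv.symm_trans_self] at this
    simp only [LinearEquiv.refl_toLinearMap, LinearMap.lTensor_id, LinearMap.id_apply] at this
    exact this.symm
  have h2 : ⇑(e.symm.toLinearMap.lTensor (Twist φ (Localization.Away E)))
      = e.symm.lTensor (Twist φ (Localization.Away E)) := rfl
  rw [IsEtale, h1, h2]
  exact Function.Bijective.comp ⟨invMap_injective (a := E) e.injective,
    invMap_surjective (a := E) e.surjective⟩
    (hM.comp (e.symm.lTensor (Twist φ (Localization.Away E))).bijective)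

/-- The target of a surjective morphism with étale source is étale as soon as the kernel is an
étale submodule. -/
theorem IsHom.isEtale_of_surjective_of_ker {f : M →ₗ[A] M'} (hf : IsHom f)
    (hs : Function.Surjective f) (hM : M.IsEtale) (hk : M.IsEtaleSub (LinearMap.ker f)) :
    M'.IsEtale := by
  refine ⟨?_, gen_top_iff.mp (hf.isEtale_of_surjective hs (gen_top_iff.mpr hM.2))⟩
  rw [injective_iff_map_eq_zero]
  intro t ht
  obtain ⟨s, rfl⟩ := LinearMap.lTensor_surjective (Twist φ (Localization.Away E)) hs t
  rw [← hf.map_linearization, ← LinearMap.mem_ker, ← loc_ker] at ht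
  obtain ⟨n, x, hx, h⟩ := mem_loc.mp ht
  have h1 : M.linearization s ∈ M.gen (LinearMap.ker f) :=
    mem_of_pow_smul_mem (h ▸ hk.2 x hx)
  obtain ⟨r, hr⟩ := mem_gen.mp h1
  rw [← hM.1 hr, ← LinearMap.comp_apply, ← LinearMap.lTensor_comp]
  have h2 : f ∘ₗ (LinearMap.ker f).subtype = 0 := by
    ext x
    exact x.2
  rw [h2, LinearMap.lTensor_zero, LinearMap.zero_apply]

theorem IsEtaleSub.quot_isEtale {N : Submodule A M} (h : M.IsEtaleSub N) (hM : M.IsEtale) :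
    (M.quot N).IsEtale :=
  (isHom_proj h.1).isEtale_of_surjective_of_ker (proj_surjective N) hM
    (by rwa [ker_proj])

variable [Module.Flat A (Twist φ (Localization.Away E))]

theorem IsHom.isEtaleSub_ker {f : M →ₗ[A] M'} (hf : IsHom f) (hM : M.IsEtale) (hM' : M'.IsEtale) :
    M.IsEtaleSub (LinearMap.ker f) := by
  refine ⟨hf.isStable_ker, fun x hx => ?_⟩
  obtain ⟨t, ht⟩ := hM.2 (toInv E M x)
  have h1 : f.lTensor (Twist φ (Localization.Away E)) t = 0 := by
    apply hM'.1
    rw [← hf.map_linearization, ht, invMap_toInv, show f x = 0 from hx, map_zero, map_zero]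
  have h2 : Function.Exact (LinearMap.ker f).subtype f := by
    rw [LinearMap.exact_iff, Submodule.range_subtype]
  obtain ⟨s, hs⟩ :=
    (Module.Flat.lTensor_exact (Twist φ (Localization.Away E)) h2 t).mp h1
  exact mem_gen.mpr ⟨s, by rw [hs, ht]⟩

theorem IsHom.linearization_injective {f : M →ₗ[A] M'} (hf : IsHom f) (hi : Function.Injective f)
    (hM' : Function.Injective M'.linearization) : Function.Injective M.linearization := by
  rw [injective_iff_map_eq_zero]
  intro t ht
  have h1 : M'.linearization (f.lTensor _ t) = 0 := by
    rw [← hf.map_linearization, ht, map_zero]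
  have h2 := Module.Flat.lTensor_preserves_injective_linearMap
    (M := Twist φ (Localization.Away E)) f hi
  exact (map_eq_zero_iff _ h2).mp ((map_eq_zero_iff _ hM').mp h1)

/-- For a morphism `f` with étale target, being étale can be checked on submodules of the target.-/
theorem IsHom.isEtale_iff_of_injective {f : M →ₗ[A] M'} (hf : IsHom f) (hi : Function.Injective f)
    (hM' : M'.IsEtale) : M.IsEtale ↔ M'.IsEtaleSub (LinearMap.range f) := by
  rw [← Submodule.map_top]
  constructor
  · exact fun h => hf.isEtaleSub_map h.isEtaleSub_top
  · intro h
    refine ⟨hf.linearization_injective hi hM'.1, gen_top_iff.mp fun x => ?_⟩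
    have h1 := h.2 (f x) ⟨x, trivial, rfl⟩
    have h2 : ∀ y ∈ M'.gen ((⊤ : Submodule A M).map f), ∃ z ∈ M.gen ⊤, invMap E f z = y := by
      intro y hy
      induction hy using Submodule.closure_induction with
      | zero => exact ⟨0, zero_mem _, map_zero _⟩
      | add x y _ _ hx hy =>
        obtain ⟨z, hz, rfl⟩ := hx
        obtain ⟨w, hw, rfl⟩ := hy
        exact ⟨z + w, add_mem hz hw, map_add _ _ _⟩
      | smul_mem r x hx =>
        obtain ⟨_, ⟨z, -, rfl⟩, rfl⟩ := hx
        exact ⟨r • M.frob z, Submodule.smul_mem _ _ (Submodule.subset_span ⟨z, trivial, rfl⟩), by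
          rw [invMap_away_smul, hf]⟩
    obtain ⟨z, hz, h3⟩ := h2 _ h1
    rw [← invMap_toInv] at h3
    rwa [← invMap_injective (a := E) hi h3]

theorem IsStable.sub_isEtale_iff {N : Submodule A M} (h : M.IsStable N) (hM : M.IsEtale) :
    (M.sub N).IsEtale ↔ M.IsEtaleSub N := by
  have h1 := (isHom_incl h).isEtale_iff_of_injective (incl_injective N) hM
  rwa [range_incl] at h1

theorem IsEtaleSub.sub_isEtale {N : Submodule A M} (h : M.IsEtaleSub N) (hM : M.IsEtale) :
    (M.sub N).IsEtale := (h.1.sub_isEtale_iff hM).mpr h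

/-- An extension of étale modules is étale. -/
theorem IsHom.isEtale_of_exact {f : M →ₗ[A] M'} (hf : IsHom f) (hs : Function.Surjective f)
    {K : PhiModule.{u, v₃} φ E} {i : K →ₗ[A] M} (hi : IsHom i) (hinj : Function.Injective i)
    (hr : LinearMap.range i = LinearMap.ker f) (hK : K.IsEtale) (hM' : M'.IsEtale) :
    M.IsEtale := by
  have hex : Function.Exact i f := (LinearMap.exact_iff).mpr hr.symm
  have hexE := invMap_exact (a := E) hex
  have hexT := Module.Flat.lTensor_exact (Twist φ (Localization.Away E)) hex
  constructor
  · rw [injective_iff_map_eq_zero]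
    intro t ht
    have h1 : f.lTensor (Twist φ (Localization.Away E)) t = 0 := by
      apply hM'.1
      rw [← hf.map_linearization, ht, map_zero, map_zero]
    obtain ⟨s, rfl⟩ := (hexT t).mp h1
    rw [← hi.map_linearization] at ht
    have h2 := (map_eq_zero_iff _ (invMap_injective (a := E) hinj)).mp ht
    rw [(map_eq_zero_iff _ hK.1).mp h2, map_zero]
  · intro y
    obtain ⟨t, ht⟩ := hM'.2 (invMap E f y)
    obtain ⟨s, rfl⟩ := LinearMap.lTensor_surjective (Twist φ (Localization.Away E)) hs t
    rw [← hf.map_linearization] at ht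
    have h1 : invMap E f (y - M.linearization s) = 0 := by rw [map_sub, ht, sub_self]
    obtain ⟨z, hz⟩ := (hexE _).mp h1
    obtain ⟨r, rfl⟩ := hK.2 z
    refine ⟨i.lTensor _ r + s, ?_⟩
    rw [map_add, ← hi.map_linearization, hz, sub_add_cancel]

theorem IsStable.isEtale_of_sub_quot {N : Submodule A M} (h : M.IsStable N)
    (h1 : (M.sub N).IsEtale) (h2 : (M.quot N).IsEtale) : M.IsEtale :=
  (isHom_proj h).isEtale_of_exact (proj_surjective N) (isHom_incl h) (incl_injective N)
    (by rw [range_incl, ker_proj]) h1 h2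

theorem IsStable.isEtaleSub_of_quot {N : Submodule A M} (h : M.IsStable N)
    (hM : M.IsEtale) (h2 : (M.quot N).IsEtale) : M.IsEtaleSub N := by
  have h1 := (isHom_proj h).isEtaleSub_ker hM h2
  rwa [ker_proj] at h1

theorem IsHom.isEtaleSub_comap {f : M →ₗ[A] M'} (hf : IsHom f) (hM : M.IsEtale) (hM' : M'.IsEtale)
    {N : Submodule A M'} (h : M'.IsEtaleSub N) : M.IsEtaleSub (N.comap f) := by
  have h1 := ((isHom_proj h.1).comp hf).isEtaleSub_ker hM (h.quot_isEtale hM')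
  rwa [LinearMap.ker_comp, ker_proj] at h1

theorem IsEtaleSub.inf {N N' : Submodule A M} (hM : M.IsEtale) (h : M.IsEtaleSub N)
    (h' : M.IsEtaleSub N') : M.IsEtaleSub (N ⊓ N') := by
  have h1 := (isHom_incl h.1).isEtaleSub_comap (h.sub_isEtale hM) hM h'
  have h2 := (isHom_incl h.1).isEtaleSub_map h1
  rwa [Submodule.map_comap_eq, range_incl] at h2

end EtaleSub

end PhiModule

end Kisin

end

noncomputable section

namespace Kisin

/-! ### Subquotients of modules with Frobenius -/

namespace PhiModule

variable {A : Type u} [CommRing A] {φ : A →+* A} {E : A}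

section

variable {X : PhiModule.{u, v₁} φ E} {Y : PhiModule.{u, v₂} φ E} {Z : PhiModule.{u, v₃} φ E}

theorem IsHom.of_comp_injective {f : X →ₗ[A] Y} {g : Y →ₗ[A] Z} (hg : IsHom g)
    (hi : Function.Injective g) (h : IsHom (g ∘ₗ f)) : IsHom f := fun x => by
  apply invMap_injective (a := E) hi
  rw [invMap_invMap, h, hg, LinearMap.comp_apply]

theorem IsHom.of_comp_surjective {f : X →ₗ[A] Y} {g : Y →ₗ[A] Z} (hf : IsHom f)
    (hs : Function.Surjective f) (h : IsHom (g ∘ₗ f)) : IsHom g := fun y => by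
  obtain ⟨x, rfl⟩ := hs y
  rw [← hf, invMap_invMap, h, LinearMap.comp_apply]

theorem iso_of_bijective {f : X →ₗ[A] Y} (hf : IsHom f) (hb : Function.Bijective f) : Iso X Y :=
  ⟨LinearEquiv.ofBijective f hb, hf⟩

/-- A presentation of `Q` as the subquotient `N' / N` of `X`. -/
structure Subquot (X : PhiModule.{u, v₁} φ E) (N N' : Submodule A X) (Q : PhiModule.{u, v₂} φ E)
    where
  le : N ≤ N'
  stable : X.IsStable N'
  π : X.sub N' →ₗ[A] Q
  isHom : IsHom π
  surj : Function.Surjective π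
  ker : ∀ x, π x = 0 ↔ X.incl N' x ∈ N

/-- An element of a submodule. -/
def mkSub {N : Submodule A X} (x : X) (hx : x ∈ N) : X.sub N := (⟨x, hx⟩ : N)

theorem incl_mkSub {N : Submodule A X} (x : X) (hx : x ∈ N) : X.incl N (mkSub x hx) = x := rfl

/-- The inclusion between two submodules. -/
def inclOfLE {N N' : Submodule A X} (h : N ≤ N') : X.sub N →ₗ[A] X.sub N' :=
  Submodule.inclusion h

theorem incl_inclOfLE {N N' : Submodule A X} (h : N ≤ N') (x : X.sub N) :
    X.incl N' (inclOfLE h x) = X.incl N x := rfl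

theorem isHom_inclOfLE {N N' : Submodule A X} (h : N ≤ N') (hN : X.IsStable N)
    (hN' : X.IsStable N') : IsHom (X.inclOfLE h) :=
  (isHom_incl hN').of_comp_injective (incl_injective N') (isHom_incl hN)

namespace Subquot

/-- The submodule of `X` corresponding to a submodule of the subquotient `N' / N`. -/
def lift {N N' : Submodule A X} {Q : PhiModule.{u, v₂} φ E} (h : Subquot X N N' Q)
    (P : Submodule A Q) : Submodule A X := (P.comap h.π).map (X.incl N')

section

variable {N N' : Submodule A X} {Q : PhiModule.{u, v₂} φ E} (h : Subquot X N N' Q)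

theorem mem_lift {P : Submodule A Q} {x : X} :
    x ∈ h.lift P ↔ ∃ y : X.sub N', X.incl N' y = x ∧ h.π y ∈ P := by
  simp only [lift, Submodule.mem_map, Submodule.mem_comap]
  exact ⟨fun ⟨y, a, b⟩ => ⟨y, b, a⟩, fun ⟨y, a, b⟩ => ⟨y, b, a⟩⟩

theorem incl_mem_lift {P : Submodule A Q} {y : X.sub N'} :
    X.incl N' y ∈ h.lift P ↔ h.π y ∈ P := by
  rw [mem_lift]
  constructor
  · rintro ⟨z, hz, h1⟩
    rwa [← incl_injective N' hz]
  · exact fun h1 => ⟨y, rfl, h1⟩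

theorem lift_le (P : Submodule A Q) : h.lift P ≤ N' := by
  intro x hx
  obtain ⟨y, rfl, -⟩ := h.mem_lift.mp hx
  exact y.2

theorem le_lift (P : Submodule A Q) : N ≤ h.lift P := by
  intro x hx
  rw [← incl_mkSub x (h.le hx), incl_mem_lift, (h.ker _).mpr hx]
  exact zero_mem _

theorem lift_bot : h.lift ⊥ = N := by
  apply le_antisymm _ (h.le_lift _)
  intro x hx
  obtain ⟨y, rfl, h1⟩ := h.mem_lift.mp hx
  exact (h.ker y).mp h1

theorem lift_top : h.lift ⊤ = N' := by
  apply le_antisymm (h.lift_le _)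
  intro x hx
  exact h.mem_lift.mpr ⟨mkSub x hx, rfl, trivial⟩

theorem lift_mono {P P' : Submodule A Q} (hP : P ≤ P') : h.lift P ≤ h.lift P' :=
  Submodule.map_mono (Submodule.comap_mono hP)

theorem exists_lift_eq {P : Submodule A X} (h1 : N ≤ P) (h2 : P ≤ N') :
    ∃ P' : Submodule A Q, h.lift P' = P := by
  refine ⟨(P.comap (X.incl N')).map h.π, le_antisymm ?_ ?_⟩
  · intro x hx
    obtain ⟨y, rfl, z, hz, h3⟩ := h.mem_lift.mp hx
    rw [← sub_eq_zero, ← map_sub, h.ker, map_sub] at h3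
    have := P.sub_mem (show X.incl N' z ∈ P from hz) (h1 h3)
    simpa using this
  · intro x hx
    exact h.mem_lift.mpr ⟨mkSub x (h2 hx), rfl, ⟨mkSub x (h2 hx), hx, rfl⟩⟩

theorem isStable_lift {P : Submodule A Q} (hP : Q.IsStable P) : X.IsStable (h.lift P) :=
  (isHom_incl h.stable).isStable_map (h.isHom.isStable_comap hP)

theorem map_comap_lift (P : Submodule A Q) : ((h.lift P).comap (X.incl N')).map h.π = P := by
  rw [lift, Submodule.comap_map_eq_of_injective (incl_injective N'),
    Submodule.map_comap_eq_of_surjective h.surj]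

theorem isStable_iff {P : Submodule A Q} : Q.IsStable P ↔ X.IsStable (h.lift P) := by
  refine ⟨h.isStable_lift, fun h1 => ?_⟩
  have h2 := h.isHom.isStable_map ((isHom_incl h.stable).isStable_comap h1)
  rwa [map_comap_lift] at h2

/-- Subquotients of subquotients are subquotients. -/
def trans {P P' : Submodule A Q} {R : PhiModule.{u, v₃} φ E} (h' : Subquot Q P P' R) :
    Subquot X (h.lift P) (h.lift P') R :=
  have hs : X.IsStable (h.lift P') := h.isStable_lift h'.stable
  let j : X.sub (h.lift P') →ₗ[A] X.sub N' := inclOfLE (h.lift_le P')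
  have hj : IsHom j := isHom_inclOfLE _ hs h.stable
  let k : X.sub (h.lift P') →ₗ[A] Q.sub P' := (h.π ∘ₗ j).codRestrict P' (fun x => by
    rw [LinearMap.comp_apply, ← h.incl_mem_lift]
    exact x.2)
  have hk0 : Q.incl P' ∘ₗ k = h.π ∘ₗ j := rfl
  have hk : IsHom k := (isHom_incl h'.stable).of_comp_injective (incl_injective P')
    (by rw [hk0]; exact h.isHom.comp hj)
  { le := h.lift_mono h'.le
    stable := hs
    π := h'.π ∘ₗ k
    isHom := h'.isHom.comp hk
    surj := by
      intro r
      obtain ⟨q, rfl⟩ := h'.surj r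
      obtain ⟨y, hy⟩ := h.surj (Q.incl P' q)
      have hy' : X.incl N' y ∈ h.lift P' := by
        rw [h.incl_mem_lift, hy]
        exact q.2
      refine ⟨mkSub (X.incl N' y) hy', ?_⟩
      rw [LinearMap.comp_apply]
      congr 1
      apply incl_injective P'
      rw [← hy]
      rfl
    ker := by
      intro x
      rw [LinearMap.comp_apply, h'.ker, ← LinearMap.comp_apply, hk0, LinearMap.comp_apply,
        ← h.incl_mem_lift]
      rfl }

/-- Two subquotients of `X` which are related as in the second isomorphism theorem are isomorphic. -/
theorem iso_of_le (h : Subquot X N N' Q) {N₂ N₂' : Submodule A X} {Q₂ : PhiModule.{u, v₃} φ E} (h₂ : Subquot X N₂ N₂' Q₂)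
    (h1 : N ≤ N₂) (h2 : N' ≤ N₂') (h3 : N' ⊓ N₂ ≤ N) (h4 : N₂' ≤ N' ⊔ N₂) : Iso Q Q₂ := by
  let g : X.sub N' →ₗ[A] Q₂ := h₂.π ∘ₗ inclOfLE h2
  have hg : IsHom g := h₂.isHom.comp (isHom_inclOfLE h2 h.stable h₂.stable)
  have hgs : Function.Surjective g := by
    intro q
    obtain ⟨y, rfl⟩ := h₂.surj q
    obtain ⟨a, ha, b, hb, hab⟩ := Submodule.mem_sup.mp (h4 y.2)
    refine ⟨mkSub a ha, ?_⟩
    rw [← sub_eq_zero]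
    change h₂.π _ - _ = 0
    rw [← map_sub, h₂.ker, map_sub, incl_inclOfLE]
    have h5 : X.incl N₂' y = a + b := hab.symm
    rw [h5, incl_mkSub]
    simpa using hb
  have hk : LinearMap.ker h.π = LinearMap.ker g := by
    ext x
    rw [LinearMap.mem_ker, LinearMap.mem_ker, h.ker]
    change _ ↔ h₂.π _ = 0
    rw [h₂.ker, incl_inclOfLE]
    exact ⟨fun h5 => h1 h5, fun h5 => h3 ⟨x.2, h5⟩⟩
  let e : Q ≃ₗ[A] Q₂ := (h.π.quotKerEquivOfSurjective h.surj).symm ≪≫ₗ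
    Submodule.quotEquivOfEq _ _ hk ≪≫ₗ g.quotKerEquivOfSurjective hgs
  have he : e.toLinearMap ∘ₗ h.π = g := by
    ext x
    simp only [e, LinearMap.comp_apply, LinearEquiv.coe_coe, LinearEquiv.trans_apply]
    rw [show (h.π.quotKerEquivOfSurjective h.surj).symm (h.π x) = Submodule.Quotient.mk x from
      (LinearEquiv.symm_apply_eq _).mpr rfl]
    rfl
  exact ⟨e, h.isHom.of_comp_surjective h.surj (by rw [he]; exact hg)⟩

theorem iso (h : Subquot X N N' Q) {Q₂ : PhiModule.{u, v₃} φ E} (h₂ : Subquot X N N' Q₂) : Iso Q Q₂ :=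
  h.iso_of_le h₂ le_rfl le_rfl inf_le_right le_sup_left

/-- Transport of a presentation along equalities of submodules. -/
def cast {N₂ N₂' : Submodule A X} (e : N = N₂) (e' : N' = N₂') : Subquot X N₂ N₂' Q :=
  e ▸ e' ▸ h

end

/-- A stable submodule as a subquotient. -/
def ofSub {N : Submodule A X} (hN : X.IsStable N) : Subquot X ⊥ N (X.sub N) where
  le := bot_le
  stable := hN
  π := LinearMap.id
  isHom := isHom_id
  surj := Function.surjective_id
  ker x := by
    rw [Submodule.mem_bot, map_eq_zero_iff _ (incl_injective N)]
    rfl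

/-- The target of a surjective morphism as a subquotient. -/
def ofSurjective {f : X →ₗ[A] Y} (hf : IsHom f) (hs : Function.Surjective f) :
    Subquot X (LinearMap.ker f) ⊤ Y where
  le := le_top
  stable := X.isStable_top
  π := f ∘ₗ X.incl ⊤
  isHom := hf.comp (isHom_incl X.isStable_top)
  surj y := by
    obtain ⟨x, rfl⟩ := hs y
    exact ⟨mkSub x trivial, rfl⟩
  ker _ := Iff.rfl

/-- The quotient by a stable submodule as a subquotient. -/
def ofQuot {N : Submodule A X} (hN : X.IsStable N) : Subquot X N ⊤ (X.quot N) :=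
  (ofSurjective (isHom_proj hN) (proj_surjective N)).cast (ker_proj N) rfl

/-- The subquotient `gr`. -/
def ofGr {N N' : Submodule A X} (hN : X.IsStable N) (hN' : X.IsStable N') (hle : N ≤ N') :
    Subquot X N N' (X.gr N N') where
  le := hle
  stable := hN'
  π := (X.sub N').proj (N.comap (X.incl N'))
  isHom := isHom_proj ((isHom_incl hN').isStable_comap hN)
  surj := proj_surjective _
  ker x := SetLike.ext_iff.mp (ker_proj (N.comap (X.incl N'))) x

section

variable {N N' : Submodule A X} {Q : PhiModule.{u, v₂} φ E} (h : Subquot X N N' Q)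

/-- A subobject of a subquotient. -/
def sub {P : Submodule A Q} (hP : Q.IsStable P) : Subquot X N (h.lift P) (Q.sub P) :=
  (h.trans (ofSub hP)).cast h.lift_bot rfl

/-- A quotient of a subquotient. -/
def quot {P : Submodule A Q} (hP : Q.IsStable P) : Subquot X (h.lift P) N' (Q.quot P) :=
  (h.trans (ofQuot hP)).cast rfl h.lift_top

/-- A subquotient of a subquotient. -/
def gr {P P' : Submodule A Q} (hP : Q.IsStable P) (hP' : Q.IsStable P') (hle : P ≤ P') :
    Subquot X (h.lift P) (h.lift P') (Q.gr P P') :=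
  h.trans (ofGr hP hP' hle)

variable [Module.Flat A (Twist φ (Localization.Away E))]

theorem isEtale (h : Subquot X N N' Q) (hX : X.IsEtale) (hN : X.IsEtaleSub N) (hN' : X.IsEtaleSub N') : Q.IsEtale := by
  refine h.isHom.isEtale_of_surjective_of_ker h.surj (hN'.sub_isEtale hX) ?_
  have h1 := (isHom_incl h.stable).isEtaleSub_comap (hN'.sub_isEtale hX) hX hN
  have h2 : N.comap (X.incl N') = LinearMap.ker h.π := by
    ext x
    exact (h.ker x).symm
  rwa [h2] at h1

end

end Subquot

end

end PhiModule

end Kisin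

end

noncomputable section

namespace Kisin

/-! ### Concave polygons -/

section Polygon

variable {r : ℕ} {m : ℕ → ℕ} {μ : ℕ → ℚ}

/-- The length of the part of `[0, x]` on which the polygon has slope `μ i`. -/
def polygonWeight (m : ℕ → ℕ) (i : ℕ) (x : ℝ) : ℝ :=
  max 0 (min (x - ∑ j ∈ Finset.range i, (m j : ℝ)) (m i : ℝ))

theorem polygon_eq (x : ℝ) :
    polygon r m μ x = ∑ i ∈ Finset.range r, (μ i : ℝ) * polygonWeight m i x := rfl

theorem polygonWeight_nonneg (i : ℕ) (x : ℝ) : 0 ≤ polygonWeight m i x := le_max_left _ _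

theorem polygonWeight_le (i : ℕ) (x : ℝ) : polygonWeight m i x ≤ m i :=
  max_le (Nat.cast_nonneg _) (min_le_right _ _)

theorem sum_polygonWeight {x : ℝ} (hx : 0 ≤ x) (r : ℕ) :
    ∑ i ∈ Finset.range r, polygonWeight m i x = min x (∑ j ∈ Finset.range r, (m j : ℝ)) := by
  induction r with
  | zero => simp [hx]
  | succ r ih =>
    rw [Finset.sum_range_succ, Finset.sum_range_succ, ih, polygonWeight]
    have h : (0 : ℝ) ≤ m r := Nat.cast_nonneg _
    rcases le_total x (∑ j ∈ Finset.range r, (m j : ℝ)) with h1 | h1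
    · rw [min_eq_left h1, max_eq_left (le_trans (min_le_left _ _) (by linarith)),
        min_eq_left (by linarith), add_zero]
    · rw [min_eq_right h1, max_eq_right (le_min (by linarith) h)]
      rcases le_total (x - ∑ j ∈ Finset.range r, (m j : ℝ)) (m r) with h2 | h2
      · rw [min_eq_left h2, min_eq_left (by linarith)]
        ring
      · rw [min_eq_right h2, min_eq_right (by linarith)]

theorem polygonWeight_eq_of_pos {i j : ℕ} (hij : j < i) {x : ℝ} (h : 0 < polygonWeight m i x) :
    polygonWeight m j x = m j := by
  have h1 : ∑ l ∈ Finset.range i, (m l : ℝ) < x := by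
    by_contra h2
    push Not at h2
    rw [polygonWeight, max_eq_left (le_trans (min_le_left _ _) (by linarith))] at h
    exact lt_irrefl _ h
  have h2 : ∑ l ∈ Finset.range (j + 1), (m l : ℝ) ≤ ∑ l ∈ Finset.range i, (m l : ℝ) :=
    Finset.sum_le_sum_of_subset_of_nonneg (Finset.range_subset_range.mpr hij)
      (fun _ _ _ => Nat.cast_nonneg _)
  rw [Finset.sum_range_succ] at h2
  rw [polygonWeight, min_eq_right (by linarith), max_eq_right (Nat.cast_nonneg _)]

theorem polygon_sub {x : ℝ} (hx : 0 ≤ x) (hx' : x ≤ ∑ j ∈ Finset.range r, (m j : ℝ)) (γ : ℝ) :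
    polygon r m μ x - γ * x = ∑ i ∈ Finset.range r, ((μ i : ℝ) - γ) * polygonWeight m i x := by
  have h := sum_polygonWeight (m := m) hx r
  rw [min_eq_left hx'] at h
  rw [polygon_eq]
  conv_lhs => rw [← h]
  rw [Finset.mul_sum, ← Finset.sum_sub_distrib]
  exact Finset.sum_congr rfl fun i _ => by rw [h]; ring

theorem polygon_le {x : ℝ} (hx : 0 ≤ x) (hx' : x ≤ ∑ j ∈ Finset.range r, (m j : ℝ)) {γ : ℚ} {j : ℕ}
    (hj : j ≤ r) (h1 : ∀ i < j, γ ≤ μ i) (h2 : ∀ i, j ≤ i → i < r → μ i ≤ γ) :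
    polygon r m μ x ≤ γ * x + ∑ i ∈ Finset.range j, ((μ i : ℝ) - γ) * m i := by
  have h := polygon_sub (μ := μ) hx hx' γ
  have h3 : ∑ i ∈ Finset.range r, ((μ i : ℝ) - γ) * polygonWeight m i x ≤
      ∑ i ∈ Finset.range j, ((μ i : ℝ) - γ) * m i := by
    rw [← Finset.sum_range_add_sum_Ico _ hj]
    have h4 : ∑ i ∈ Finset.Ico j r, ((μ i : ℝ) - γ) * polygonWeight m i x ≤ 0 := by
      refine Finset.sum_nonpos fun i hi => ?_
      rw [Finset.mem_Ico] at hi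
      have : (μ i : ℝ) ≤ γ := by exact_mod_cast h2 i hi.1 hi.2
      exact mul_nonpos_of_nonpos_of_nonneg (by linarith) (polygonWeight_nonneg _ _)
    have h5 : ∑ i ∈ Finset.range j, ((μ i : ℝ) - γ) * polygonWeight m i x ≤
        ∑ i ∈ Finset.range j, ((μ i : ℝ) - γ) * m i := by
      refine Finset.sum_le_sum fun i hi => ?_
      have : (γ : ℝ) ≤ μ i := by exact_mod_cast h1 i (Finset.mem_range.mp hi)
      exact mul_le_mul_of_nonneg_left (polygonWeight_le _ _) (by linarith)
    linarith
  linarith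

/-- A concave polygon lies above its chord. -/
theorem le_polygon {x : ℝ} (hx : 0 ≤ x) (hx' : x ≤ ∑ j ∈ Finset.range r, (m j : ℝ)) {γ : ℚ} {j : ℕ}
    (h1 : ∀ i < j, γ ≤ μ i) (h2 : ∀ i, j ≤ i → i < r → μ i ≤ γ)
    (hγ : ∑ i ∈ Finset.range r, ((μ i : ℝ) - γ) * m i = 0) : γ * x ≤ polygon r m μ x := by
  have h := polygon_sub (μ := μ) hx hx' γ
  suffices h3 : 0 ≤ ∑ i ∈ Finset.range r, ((μ i : ℝ) - γ) * polygonWeight m i x by linarith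
  by_cases h4 : ∃ i, j ≤ i ∧ i < r ∧ 0 < polygonWeight m i x
  · obtain ⟨i, hi, -, hpos⟩ := h4
    rw [← hγ]
    refine Finset.sum_le_sum fun l hl => ?_
    rcases lt_or_ge l j with hlj | hlj
    · rw [polygonWeight_eq_of_pos (lt_of_lt_of_le hlj hi) hpos]
    · have : (μ l : ℝ) ≤ γ := by exact_mod_cast h2 l hlj (Finset.mem_range.mp hl)
      exact mul_le_mul_of_nonpos_left (polygonWeight_le _ _) (by linarith)
  · push Not at h4
    refine Finset.sum_nonneg fun l hl => ?_
    rcases lt_or_ge l j with hlj | hlj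
    · have : (γ : ℝ) ≤ μ l := by exact_mod_cast h1 l hlj
      exact mul_nonneg (by linarith) (polygonWeight_nonneg _ _)
    · rw [le_antisymm (h4 l hlj (Finset.mem_range.mp hl)) (polygonWeight_nonneg _ _), mul_zero]

theorem polygon_breakpoint {j : ℕ} (hj : j ≤ r) :
    polygon r m μ (∑ i ∈ Finset.range j, (m i : ℝ)) = ∑ i ∈ Finset.range j, (μ i : ℝ) * m i := by
  rw [polygon_eq, ← Finset.sum_range_add_sum_Ico _ hj]
  have h1 : ∑ i ∈ Finset.Ico j r, (μ i : ℝ) * polygonWeight m i (∑ i ∈ Finset.range j, (m i : ℝ))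
      = 0 := by
    refine Finset.sum_eq_zero fun i hi => ?_
    rw [Finset.mem_Ico] at hi
    have h2 : ∑ l ∈ Finset.range j, (m l : ℝ) ≤ ∑ l ∈ Finset.range i, (m l : ℝ) :=
      Finset.sum_le_sum_of_subset_of_nonneg (Finset.range_subset_range.mpr hi.1)
        (fun _ _ _ => Nat.cast_nonneg _)
    rw [polygonWeight, max_eq_left (le_trans (min_le_left _ _) (by linarith)), mul_zero]
  rw [h1, add_zero]
  refine Finset.sum_congr rfl fun i hi => ?_
  have h2 : ∑ l ∈ Finset.range (i + 1), (m l : ℝ) ≤ ∑ l ∈ Finset.range j, (m l : ℝ) :=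
    Finset.sum_le_sum_of_subset_of_nonneg
      (Finset.range_subset_range.mpr (Finset.mem_range.mp hi)) (fun _ _ _ => Nat.cast_nonneg _)
  rw [Finset.sum_range_succ] at h2
  rw [polygonWeight, min_eq_right (by linarith), max_eq_right (Nat.cast_nonneg _)]

theorem polygon_scale {n : ℕ} (hn : 1 ≤ n) (x : ℝ) :
    1 / (n : ℝ) * polygon r (fun i => n * m i) μ (n * x) = polygon r m μ x := by
  have hn' : (0 : ℝ) < n := by exact_mod_cast hn
  rw [polygon_eq, polygon_eq, Finset.mul_sum]
  refine Finset.sum_congr rfl fun i _ => ?_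
  have h : polygonWeight (fun i => n * m i) i (n * x) = n * polygonWeight m i x := by
    simp only [polygonWeight, Nat.cast_mul]
    rw [← Finset.mul_sum, ← mul_sub, ← mul_min_of_nonneg _ _ hn'.le, mul_max_of_nonneg _ _ hn'.le,
      mul_zero]
  rw [h]
  field_simp

theorem polygon_congr {m' : ℕ → ℕ} {μ' : ℕ → ℚ} (hm : ∀ i < r, m i = m' i)
    (hμ : ∀ i < r, μ i = μ' i) (x : ℝ) : polygon r m μ x = polygon r m' μ' x := by
  refine Finset.sum_congr rfl fun i hi => ?_
  have hi' := Finset.mem_range.mp hi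
  rw [hm i hi', hμ i hi']
  congr 4
  exact Finset.sum_congr rfl fun j hj => by
    rw [hm j (lt_trans (Finset.mem_range.mp hj) hi')]

theorem exists_slope_split (hμ : ∀ i j, i < j → j < r → μ j < μ i) (γ : ℚ) :
    ∃ j ≤ r, (∀ i < j, γ ≤ μ i) ∧ ∀ i, j ≤ i → i < r → μ i < γ := by
  induction r with
  | zero => exact ⟨0, le_rfl, fun i hi => absurd hi (Nat.not_lt_zero _),
      fun i _ hi => absurd hi (Nat.not_lt_zero _)⟩
  | succ r ih =>
    rcases le_or_gt γ (μ r) with h | h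
    · refine ⟨r + 1, le_rfl, fun i hi => ?_, fun i h1 h2 => absurd h2 (not_lt.mpr h1)⟩
      rcases Nat.lt_succ_iff_lt_or_eq.mp hi with h1 | rfl
      · exact h.trans (hμ i r h1 (Nat.lt_succ_self r)).le
      · exact h
    · obtain ⟨j, hj, h1, h2⟩ := ih (fun i j h1 h2 => hμ i j h1 (h2.trans (Nat.lt_succ_self r)))
      refine ⟨j, hj.trans (Nat.le_succ r), h1, fun i h3 h4 => ?_⟩
      rcases Nat.lt_succ_iff_lt_or_eq.mp h4 with h5 | rfl
      · exact h2 i h3 h5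
      · exact h

end Polygon

end Kisin

end

noncomputable section

namespace Kisin

/-! ### Harder-Narasimhan theory for categories of modules with Frobenius -/

namespace SlopeData

open PhiModule

variable {A : Type u} [CommRing A] {φ : A →+* A} {E : A}

/-- The properties of a category of modules with Frobenius and of its rank and degree functions on
which Harder-Narasimhan theory rests: strict subobjects form a lattice, on which the rank is modular
and the degree is supermodular. -/
structure IsGood (D : SlopeData.{u, v} φ E) : Prop where
  iso_obj : ∀ {M M' : PhiModule.{u, v} φ E}, Iso M M' → D.IsObj M → D.IsObj M'
  iso_rank : ∀ {M M' : PhiModule.{u, v} φ E}, Iso M M' → D.rank M = D.rank M'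
  iso_deg : ∀ {M M' : PhiModule.{u, v} φ E}, Iso M M' → D.deg M = D.deg M'
  null_iff : ∀ {M : PhiModule.{u, v} φ E}, D.IsObj M → (D.IsNull M ↔ D.rank M = 0)
  deg_null : ∀ {M : PhiModule.{u, v} φ E}, D.IsObj M → D.rank M = 0 → D.deg M = 0
  quot_top : ∀ {M : PhiModule.{u, v} φ E}, D.IsObj M → D.IsObj (M.quot ⊤)
  ext : ∀ {M : PhiModule.{u, v} φ E} {N : Submodule A M}, M.IsStable N → D.IsObj (M.sub N) →
    D.IsObj (M.quot N) → D.IsObj M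
  ker : ∀ {M : PhiModule.{u, v} φ E} {N : Submodule A M}, D.IsObj M → M.IsStable N →
    D.IsObj (M.quot N) → D.IsObj (M.sub N)
  rank_add : ∀ {M : PhiModule.{u, v} φ E} {N : Submodule A M}, D.IsObj M → D.IsStrictSub M N →
    D.rank M = D.rank (M.sub N) + D.rank (M.quot N)
  deg_add : ∀ {M : PhiModule.{u, v} φ E} {N : Submodule A M}, D.IsObj M → D.IsStrictSub M N →
    D.deg M = D.deg (M.sub N) + D.deg (M.quot N)
  inf : ∀ {M : PhiModule.{u, v} φ E} {N N' : Submodule A M}, D.IsObj M → D.IsStrictSub M N →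
    D.IsStrictSub M N' → D.IsStrictSub M (N ⊓ N')
  sup : ∀ {M : PhiModule.{u, v} φ E} {N N' : Submodule A M}, D.IsObj M → D.IsStrictSub M N →
    D.IsStrictSub M N' → ∃ J, D.IsStrictSub M J ∧ N ≤ J ∧ N' ≤ J ∧
      (∀ Z, D.IsStrictSub M Z → N ≤ Z → N' ≤ Z → J ≤ Z) ∧
      D.rank (M.sub J) + D.rank (M.sub (N ⊓ N')) = D.rank (M.sub N) + D.rank (M.sub N') ∧
      D.deg (M.sub N) + D.deg (M.sub N') ≤ D.deg (M.sub J) + D.deg (M.sub (N ⊓ N'))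

/-- A flag of strict subobjects with semistable graded pieces, without a condition on the slopes. -/
structure IsFlag (D : SlopeData.{u, v} φ E) (M : PhiModule.{u, v} φ E) (r : ℕ)
    (N : ℕ → Submodule A M) : Prop where
  zero : N 0 = ⊥
  last : N r = ⊤
  le_succ : ∀ i < r, N i ≤ N (i + 1)
  strict : ∀ i ≤ r, D.IsStrictSub M (N i)
  semistable : ∀ i < r, D.IsSemistable (M.gr (N i) (N (i + 1)))

variable {D : SlopeData.{u, v} φ E} {M : PhiModule.{u, v} φ E}

theorem IsHNFlag.isFlag {r : ℕ} {N : ℕ → Submodule A M} (h : D.IsHNFlag M r N) :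
    D.IsFlag M r N := ⟨h.zero, h.last, h.le_succ, h.strict, h.semistable⟩

namespace IsGood

theorem strict_top (hD : D.IsGood) (hM : D.IsObj M) : D.IsStrictSub M ⊤ :=
  ⟨M.isStable_top, hD.ker hM M.isStable_top (hD.quot_top hM), hD.quot_top hM⟩

theorem iso_sub_top (M : PhiModule.{u, v} φ E) : Iso (M.sub ⊤) M :=
  iso_of_bijective (isHom_incl M.isStable_top)
    ⟨incl_injective ⊤, LinearMap.range_eq_top.mp (range_incl ⊤)⟩

theorem iso_quot_bot (M : PhiModule.{u, v} φ E) : Iso M (M.quot ⊥) :=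
  iso_of_bijective (isHom_proj M.isStable_bot)
    ⟨LinearMap.ker_eq_bot.mp (ker_proj ⊥), proj_surjective ⊥⟩

theorem strict_bot (hD : D.IsGood) (hM : D.IsObj M) : D.IsStrictSub M ⊥ :=
  have h : D.IsObj (M.quot ⊥) := hD.iso_obj (iso_quot_bot M) hM
  ⟨M.isStable_bot, hD.ker hM M.isStable_bot h, h⟩

theorem isObj_of_subquot (hD : D.IsGood) {N N' : Submodule A M}
    {Q : PhiModule.{u, v} φ E} (h : Subquot M N N' Q) (hN : D.IsStrictSub M N)
    (hN' : D.IsStrictSub M N') : D.IsObj Q := by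
  let h0 := Subquot.ofQuot hN.1
  obtain ⟨P, hP⟩ := h0.exists_lift_eq h.le le_top
  have hPs : (M.quot N).IsStable P := h0.isStable_iff.mpr (hP ▸ hN'.1)
  have h1 : D.IsObj ((M.quot N).quot P) :=
    hD.iso_obj ((Subquot.ofQuot hN'.1).iso ((h0.quot hPs).cast hP rfl)) hN'.2.2
  exact hD.iso_obj (((h0.sub hPs).cast rfl hP).iso h) (hD.ker hN.2.2 hPs h1)

theorem exists_strict_in_sub (hD : D.IsGood) {N N' : Submodule A M} (hle : N ≤ N')
    (hN : D.IsStrictSub M N) (hN' : D.IsStrictSub M N') :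
    ∃ P : Submodule A (M.sub N'), D.IsStrictSub (M.sub N') P ∧ Iso ((M.sub N').sub P) (M.sub N) ∧
      ∀ {Q : PhiModule.{u, v} φ E}, Subquot M N N' Q → Iso ((M.sub N').quot P) Q := by
  let h0 := Subquot.ofSub hN'.1
  obtain ⟨P, hP⟩ := h0.exists_lift_eq bot_le hle
  have hPs : (M.sub N').IsStable P := h0.isStable_iff.mpr (hP ▸ hN.1)
  have h1 := ((h0.sub hPs).cast rfl hP).iso (Subquot.ofSub hN.1)
  have h2 : ∀ {Q : PhiModule.{u, v} φ E}, Subquot M N N' Q → Iso ((M.sub N').quot P) Q :=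
    fun h => ((h0.quot hPs).cast hP rfl).iso h
  have h3 := Subquot.ofGr hN.1 hN'.1 hle
  exact ⟨P, ⟨hPs, hD.iso_obj h1.symm hN.2.1,
    hD.iso_obj (h2 h3).symm (hD.isObj_of_subquot h3 hN hN')⟩, h1, h2⟩

theorem rank_subquot (hD : D.IsGood) {N N' : Submodule A M}
    {Q : PhiModule.{u, v} φ E} (h : Subquot M N N' Q) (hN : D.IsStrictSub M N)
    (hN' : D.IsStrictSub M N') : D.rank (M.sub N') = D.rank (M.sub N) + D.rank Q := by
  obtain ⟨P, hP, h1, h2⟩ := hD.exists_strict_in_sub h.le hN hN'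
  rw [hD.rank_add hN'.2.1 hP, hD.iso_rank h1, hD.iso_rank (h2 h)]

theorem deg_subquot (hD : D.IsGood) {N N' : Submodule A M}
    {Q : PhiModule.{u, v} φ E} (h : Subquot M N N' Q) (hN : D.IsStrictSub M N)
    (hN' : D.IsStrictSub M N') : D.deg (M.sub N') = D.deg (M.sub N) + D.deg Q := by
  obtain ⟨P, hP, h1, h2⟩ := hD.exists_strict_in_sub h.le hN hN'
  rw [hD.deg_add hN'.2.1 hP, hD.iso_deg h1, hD.iso_deg (h2 h)]

theorem strict_iff (hD : D.IsGood) {N N' : Submodule A M}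
    {Q : PhiModule.{u, v} φ E} (h : Subquot M N N' Q) (hN : D.IsStrictSub M N)
    (hN' : D.IsStrictSub M N') {P : Submodule A Q} :
    D.IsStrictSub Q P ↔ D.IsStrictSub M (h.lift P) := by
  constructor
  · intro hP
    have hs := h.isStable_lift hP.1
    refine ⟨hs, ?_, ?_⟩
    · let h0 := Subquot.ofSub hs
      obtain ⟨N₀, hN₀⟩ := h0.exists_lift_eq bot_le (h.le_lift P)
      have hN₀s : (M.sub (h.lift P)).IsStable N₀ := h0.isStable_iff.mpr (by rw [hN₀]; exact hN.1)
      exact hD.ext hN₀s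
        (hD.iso_obj ((Subquot.ofSub hN.1).iso ((h0.sub hN₀s).cast rfl hN₀)) hN.2.1)
        (hD.iso_obj ((h.sub hP.1).iso ((h0.quot hN₀s).cast hN₀ rfl)) hP.2.1)
    · let h0 := Subquot.ofQuot hs
      obtain ⟨N₀, hN₀⟩ := h0.exists_lift_eq (h.lift_le P) le_top
      have hN₀s : (M.quot (h.lift P)).IsStable N₀ := h0.isStable_iff.mpr (by rw [hN₀]; exact hN'.1)
      exact hD.ext hN₀s
        (hD.iso_obj ((h.quot hP.1).iso ((h0.sub hN₀s).cast rfl hN₀)) hP.2.2)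
        (hD.iso_obj ((Subquot.ofQuot hN'.1).iso ((h0.quot hN₀s).cast hN₀ rfl)) hN'.2.2)
  · intro hP
    have hs : Q.IsStable P := h.isStable_iff.mpr hP.1
    exact ⟨hs, hD.isObj_of_subquot (h.sub hs) hN hP, hD.isObj_of_subquot (h.quot hs) hP hN'⟩

theorem rank_mono (hD : D.IsGood) {N N' : Submodule A M} (hle : N ≤ N')
    (hN : D.IsStrictSub M N) (hN' : D.IsStrictSub M N') : D.rank (M.sub N) ≤ D.rank (M.sub N') := by
  rw [hD.rank_subquot (Subquot.ofGr hN.1 hN'.1 hle) hN hN']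
  exact Nat.le_add_right _ _

theorem deg_eq_of_rank_eq (hD : D.IsGood) {N N' : Submodule A M} (hle : N ≤ N')
    (hN : D.IsStrictSub M N) (hN' : D.IsStrictSub M N')
    (h : D.rank (M.sub N) = D.rank (M.sub N')) : D.deg (M.sub N) = D.deg (M.sub N') := by
  have h0 := Subquot.ofGr hN.1 hN'.1 hle
  have h1 := hD.rank_subquot h0 hN hN'
  rw [hD.deg_subquot h0 hN hN',
    hD.deg_null (hD.isObj_of_subquot h0 hN hN') (by omega), add_zero]

theorem rank_bot (hD : D.IsGood) (hM : D.IsObj M) : D.rank (M.sub ⊥) = 0 := by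
  have h := hD.rank_add hM (hD.strict_bot hM)
  rw [← hD.iso_rank (iso_quot_bot M)] at h
  omega

theorem deg_bot (hD : D.IsGood) (hM : D.IsObj M) : D.deg (M.sub ⊥) = 0 :=
  hD.deg_null (hD.strict_bot hM).2.1 (hD.rank_bot hM)

theorem slope_mul_rank (hD : D.IsGood) {Q : PhiModule.{u, v} φ E} (hQ : D.IsObj Q) :
    D.slope Q * D.rank Q = D.deg Q := by
  by_cases h : D.rank Q = 0
  · rw [h, hD.deg_null hQ h]
    simp
  · exact div_mul_cancel₀ _ (by exact_mod_cast h)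

theorem semistable_le (hD : D.IsGood) {N N' : Submodule A M}
    {Q : PhiModule.{u, v} φ E} (h : Subquot M N N' Q) (hN : D.IsStrictSub M N)
    (hN' : D.IsStrictSub M N') (hss : D.IsSemistable Q) {P : Submodule A M}
    (hP : D.IsStrictSub M P) (h1 : N ≤ P) (h2 : P ≤ N') :
    D.deg (M.sub P) - D.deg (M.sub N) ≤ D.slope Q * (D.rank (M.sub P) - D.rank (M.sub N)) := by
  obtain ⟨P', rfl⟩ := h.exists_lift_eq h1 h2
  have hP' := (hD.strict_iff h hN hN').mpr hP
  have h3 := h.sub hP'.1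
  rw [hD.rank_subquot h3 hN hP, hD.deg_subquot h3 hN hP]
  push_cast
  rw [add_sub_cancel_left, add_sub_cancel_left, ← hD.slope_mul_rank hP'.2.1]
  by_cases h4 : D.rank (Q.sub P') = 0
  · simp [h4]
  · refine mul_le_mul_of_nonneg_right (hss.2.2 P' hP' ?_) (Nat.cast_nonneg _)
    rwa [hD.null_iff hP'.2.1]

theorem isSemistable_of_le (hD : D.IsGood) {N N' : Submodule A M}
    {Q : PhiModule.{u, v} φ E} (h : Subquot M N N' Q) (hN : D.IsStrictSub M N)
    (hN' : D.IsStrictSub M N') (hlt : D.rank (M.sub N) < D.rank (M.sub N'))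
    (hss : ∀ P, D.IsStrictSub M P → N ≤ P → P ≤ N' →
      D.deg (M.sub P) - D.deg (M.sub N) ≤ D.slope Q * (D.rank (M.sub P) - D.rank (M.sub N))) :
    D.IsSemistable Q := by
  have hQ := hD.isObj_of_subquot h hN hN'
  refine ⟨hQ, ?_, fun P hP hnull => ?_⟩
  · rw [hD.null_iff hQ]
    have := hD.rank_subquot h hN hN'
    omega
  · have hP' := (hD.strict_iff h hN hN').mp hP
    have h1 := hss _ hP' (h.le_lift P) (h.lift_le P)
    have h3 := h.sub hP.1
    rw [hD.rank_subquot h3 hN hP', hD.deg_subquot h3 hN hP'] at h1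
    push_cast at h1
    rw [add_sub_cancel_left, add_sub_cancel_left] at h1
    rw [hD.null_iff hP.2.1] at hnull
    have h4 : (0 : ℚ) < D.rank (Q.sub P) := by exact_mod_cast Nat.pos_of_ne_zero hnull
    rw [slope, div_le_iff₀ h4]
    exact h1

theorem iso_isSemistable (hD : D.IsGood) {Q Q' : PhiModule.{u, v} φ E} (h : Iso Q Q')
    (hQ : D.IsSemistable Q) : D.IsSemistable Q' := by
  have h0 : Subquot Q' ⊥ ⊤ Q := by
    have h0 := h.symm
    choose e he using h0
    have hr : LinearMap.ker e.toLinearMap = ⊥ := LinearMap.ker_eq_bot.mpr e.injective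
    exact (Subquot.ofSurjective he e.surjective).cast hr rfl
  have h1 : Subquot Q' ⊥ ⊤ Q' := (Subquot.ofSurjective isHom_id Function.surjective_id).cast
    LinearMap.ker_id rfl
  have hQ' := hD.iso_obj h hQ.1
  refine hD.isSemistable_of_le h1 (hD.strict_bot hQ') (hD.strict_top hQ') ?_
    fun P hP h2 h3 => ?_
  · have h4 := hD.rank_subquot h0 (hD.strict_bot hQ') (hD.strict_top hQ')
    have h5 := hQ.2.1
    rw [hD.null_iff hQ.1] at h5
    omega
  · have h6 : D.slope Q' = D.slope Q := by
      rw [slope, slope, hD.iso_deg h, hD.iso_rank h]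
    rw [h6]
    exact hD.semistable_le h0 (hD.strict_bot hQ') (hD.strict_top hQ') hQ hP h2 h3

theorem iso_slope (hD : D.IsGood) {Q Q' : PhiModule.{u, v} φ E} (h : Iso Q Q') :
    D.slope Q = D.slope Q' := by rw [slope, slope, hD.iso_deg h, hD.iso_rank h]

end IsGood

namespace IsFlag

variable {r : ℕ} {N : ℕ → Submodule A M}

theorem isObj (hD : D.IsGood) (h : D.IsFlag M r N) : D.IsObj M := by
  have h1 := (h.strict r le_rfl).2.1
  rw [h.last] at h1
  exact hD.iso_obj (IsGood.iso_sub_top M) h1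

theorem le_of_le (h : D.IsFlag M r N) {i j : ℕ} (hij : i ≤ j) (hj : j ≤ r) : N i ≤ N j := by
  induction j, hij using Nat.le_induction with
  | base => exact le_rfl
  | succ j hij ih => exact (ih (by omega)).trans (h.le_succ j (by omega))

/-- The subquotient of a flag. -/
def subquot (h : D.IsFlag M r N) {i : ℕ} (hi : i < r) :
    Subquot M (N i) (N (i + 1)) (M.gr (N i) (N (i + 1))) :=
  Subquot.ofGr (h.strict i hi.le).1 (h.strict (i + 1) hi).1 (h.le_succ i hi)

theorem rank_succ (hD : D.IsGood) (h : D.IsFlag M r N) {i : ℕ} (hi : i < r) :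
    D.rank (M.sub (N (i + 1))) = D.rank (M.sub (N i)) + D.rank (M.gr (N i) (N (i + 1))) :=
  hD.rank_subquot (h.subquot hi) (h.strict i hi.le) (h.strict (i + 1) hi)

theorem deg_succ (hD : D.IsGood) (h : D.IsFlag M r N) {i : ℕ} (hi : i < r) :
    D.deg (M.sub (N (i + 1))) = D.deg (M.sub (N i)) +
      D.slope (M.gr (N i) (N (i + 1))) * D.rank (M.gr (N i) (N (i + 1))) := by
  rw [hD.deg_subquot (h.subquot hi) (h.strict i hi.le) (h.strict (i + 1) hi),
    hD.slope_mul_rank (h.semistable i hi).1]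

theorem rank_pos (hD : D.IsGood) (h : D.IsFlag M r N) {i : ℕ} (hi : i < r) :
    0 < D.rank (M.gr (N i) (N (i + 1))) := by
  have h1 := (h.semistable i hi).2.1
  rw [hD.null_iff (h.semistable i hi).1] at h1
  omega

theorem rank_eq_sum (hD : D.IsGood) (h : D.IsFlag M r N) {j : ℕ} (hj : j ≤ r) :
    D.rank (M.sub (N j)) = ∑ i ∈ Finset.range j, D.rank (M.gr (N i) (N (i + 1))) := by
  induction j with
  | zero => rw [h.zero, hD.rank_bot (h.isObj hD)]; rfl
  | succ j ih => rw [Finset.sum_range_succ, ← ih (by omega), h.rank_succ hD hj]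

theorem deg_eq_sum (hD : D.IsGood) (h : D.IsFlag M r N) {j : ℕ} (hj : j ≤ r) :
    D.deg (M.sub (N j)) = ∑ i ∈ Finset.range j,
      D.slope (M.gr (N i) (N (i + 1))) * D.rank (M.gr (N i) (N (i + 1))) := by
  induction j with
  | zero => rw [h.zero, hD.deg_bot (h.isObj hD)]; rfl
  | succ j ih => rw [Finset.sum_range_succ, ← ih (by omega), h.deg_succ hD hj]

/-- The traces of a strict subobject on the steps of a flag grow no faster in degree than the slopes
of the flag allow, by supermodularity of the degree. -/
theorem trace_le (hD : D.IsGood) (h : D.IsFlag M r N) {P : Submodule A M}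
    (hP : D.IsStrictSub M P) {i : ℕ} (hi : i < r) :
    D.rank (M.sub (P ⊓ N i)) ≤ D.rank (M.sub (P ⊓ N (i + 1))) ∧
    D.rank (M.sub (P ⊓ N (i + 1))) + D.rank (M.sub (N i)) ≤
      D.rank (M.sub (P ⊓ N i)) + D.rank (M.sub (N (i + 1))) ∧
    D.deg (M.sub (P ⊓ N (i + 1))) - D.deg (M.sub (P ⊓ N i)) ≤
      D.slope (M.gr (N i) (N (i + 1))) *
        (D.rank (M.sub (P ⊓ N (i + 1))) - D.rank (M.sub (P ⊓ N i))) := by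
  have hM := h.isObj hD
  have hs := h.strict i hi.le
  have hs' := h.strict (i + 1) hi
  have ha' := hD.inf hM hP hs'
  have hle := h.le_succ i hi
  have he : P ⊓ N (i + 1) ⊓ N i = P ⊓ N i := by
    rw [inf_assoc, inf_eq_right.mpr hle]
  -- `J` is the saturation of the sum of `P ∩ N (i + 1)` and `N i`: its rank is given by the modular law,
  -- and its degree is at least as large as the modular law predicts.
  obtain ⟨J, hJ, h1, h2, h3, h4, h5⟩ := hD.sup hM ha' hs
  rw [he] at h4 h5
  have h6 := h3 _ hs' inf_le_right hle
  have h7 := hD.semistable_le (h.subquot hi) hs hs' (h.semistable i hi) hJ h2 h6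
  have h8 := hD.rank_mono h6 hJ hs'
  refine ⟨hD.rank_mono (inf_le_inf_left _ hle) (hD.inf hM hP hs) ha', by omega, ?_⟩
  have h9 : (D.rank (M.sub J) : ℚ) - D.rank (M.sub (N i)) =
      D.rank (M.sub (P ⊓ N (i + 1))) - D.rank (M.sub (P ⊓ N i)) := by
    have : (D.rank (M.sub J) : ℚ) + D.rank (M.sub (P ⊓ N i)) =
      D.rank (M.sub (P ⊓ N (i + 1))) + D.rank (M.sub (N i)) := by exact_mod_cast h4
    linarith
  rw [h9] at h7
  linarith

/-- Below the slopes of the flag, the height `deg - γ rank` of a trace `P ∩ N j` is at most that of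
`N j`, with equality (for slopes strictly larger than `γ`) only if the ranks agree. -/
theorem bound_low (hD : D.IsGood) (h : D.IsFlag M r N) {P : Submodule A M}
    (hP : D.IsStrictSub M P) {γ : ℚ} {j : ℕ} (hj : j ≤ r)
    (h1 : ∀ i < j, γ ≤ D.slope (M.gr (N i) (N (i + 1)))) :
    D.deg (M.sub (P ⊓ N j)) - γ * D.rank (M.sub (P ⊓ N j)) ≤
      D.deg (M.sub (N j)) - γ * D.rank (M.sub (N j)) ∧
    ((∀ i < j, γ < D.slope (M.gr (N i) (N (i + 1)))) →
      D.deg (M.sub (N j)) - γ * D.rank (M.sub (N j)) ≤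
        D.deg (M.sub (P ⊓ N j)) - γ * D.rank (M.sub (P ⊓ N j)) →
      D.rank (M.sub (P ⊓ N j)) = D.rank (M.sub (N j))) := by
  induction j with
  | zero =>
    have : P ⊓ N 0 = N 0 := by rw [h.zero, inf_bot_eq]
    rw [this]
    exact ⟨le_rfl, fun _ _ => rfl⟩
  | succ j ih =>
    obtain ⟨h2, h3⟩ := ih (by omega) fun i hi => h1 i (by omega)
    obtain ⟨ht1, ht2, ht3⟩ := h.trace_le hD hP (i := j) hj
    have h4 := h.deg_succ hD (i := j) hj
    have h5 := h.rank_succ hD (i := j) hj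
    have h6 : (D.rank (M.sub (N (j + 1))) : ℚ) = D.rank (M.sub (N j)) +
      D.rank (M.gr (N j) (N (j + 1))) := by exact_mod_cast h5
    have h7 : (0 : ℚ) ≤ D.rank (M.sub (P ⊓ N j)) + D.rank (M.sub (N (j + 1))) -
      (D.rank (M.sub (P ⊓ N (j + 1))) + D.rank (M.sub (N j))) := by
      rw [sub_nonneg]
      exact_mod_cast ht2
    have h8 := h1 j (by omega)
    have h9 := mul_nonneg (sub_nonneg.mpr h8) h7
    refine ⟨by rw [h4, h6] at *; linarith, fun hlt heq => ?_⟩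
    have h10 := h3 (fun i hi => hlt i (by omega)) (by rw [h4, h6] at *; linarith)
    have h11 : (D.slope (M.gr (N j) (N (j + 1))) - γ) * (D.rank (M.sub (P ⊓ N j)) +
      D.rank (M.sub (N (j + 1))) - (D.rank (M.sub (P ⊓ N (j + 1))) + D.rank (M.sub (N j)))) ≤ 0 := by
      rw [h4, h6] at *
      linarith
    have h12 : (0 : ℚ) < D.slope (M.gr (N j) (N (j + 1))) - γ := sub_pos.mpr (hlt j (by omega))
    have h13 : (D.rank (M.sub (P ⊓ N j)) : ℚ) + D.rank (M.sub (N (j + 1))) ≤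
      D.rank (M.sub (P ⊓ N (j + 1))) + D.rank (M.sub (N j)) := by
      by_contra h14
      push Not at h14
      exact absurd h11 (not_le.mpr (mul_pos h12 (sub_pos.mpr h14)))
    have h14 : D.rank (M.sub (P ⊓ N j)) + D.rank (M.sub (N (j + 1))) ≤
      D.rank (M.sub (P ⊓ N (j + 1))) + D.rank (M.sub (N j)) := by exact_mod_cast h13
    omega

/-- Above the slopes of the flag, the height `deg - γ rank` of the traces `P ∩ N l` decreases, and
(for slopes strictly smaller than `γ`) stays constant only if the rank does. -/
theorem bound_high (hD : D.IsGood) (h : D.IsFlag M r N) {P : Submodule A M}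
    (hP : D.IsStrictSub M P) {γ : ℚ} {j l : ℕ} (hjl : j ≤ l) (hl : l ≤ r)
    (h1 : ∀ i, j ≤ i → i < l → D.slope (M.gr (N i) (N (i + 1))) ≤ γ) :
    D.deg (M.sub (P ⊓ N l)) - γ * D.rank (M.sub (P ⊓ N l)) ≤
      D.deg (M.sub (P ⊓ N j)) - γ * D.rank (M.sub (P ⊓ N j)) ∧
    ((∀ i, j ≤ i → i < l → D.slope (M.gr (N i) (N (i + 1))) < γ) →
      D.deg (M.sub (P ⊓ N j)) - γ * D.rank (M.sub (P ⊓ N j)) ≤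
        D.deg (M.sub (P ⊓ N l)) - γ * D.rank (M.sub (P ⊓ N l)) →
      D.rank (M.sub (P ⊓ N j)) = D.rank (M.sub (P ⊓ N l))) := by
  induction l, hjl using Nat.le_induction with
  | base => exact ⟨le_rfl, fun _ _ => rfl⟩
  | succ l hjl ih =>
    obtain ⟨h2, h3⟩ := ih (by omega) fun i hi hi' => h1 i hi (by omega)
    obtain ⟨ht1, ht2, ht3⟩ := h.trace_le hD hP (i := l) hl
    have h7 : (0 : ℚ) ≤ D.rank (M.sub (P ⊓ N (l + 1))) - D.rank (M.sub (P ⊓ N l)) := by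
      rw [sub_nonneg]
      exact_mod_cast ht1
    have h9 := mul_nonneg (sub_nonneg.mpr (h1 l hjl (by omega))) h7
    refine ⟨by linarith, fun hlt heq => ?_⟩
    have h10 := h3 (fun i hi hi' => hlt i hi (by omega)) (by linarith)
    have h11 : (γ - D.slope (M.gr (N l) (N (l + 1)))) *
      (D.rank (M.sub (P ⊓ N (l + 1))) - D.rank (M.sub (P ⊓ N l))) ≤ 0 := by linarith
    have h12 := sub_pos.mpr (hlt l hjl (by omega))
    have h13 : (D.rank (M.sub (P ⊓ N (l + 1))) : ℚ) ≤ D.rank (M.sub (P ⊓ N l)) := by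
      by_contra h14
      push Not at h14
      exact absurd h11 (not_le.mpr (mul_pos h12 (sub_pos.mpr h14)))
    have h14 : D.rank (M.sub (P ⊓ N (l + 1))) ≤ D.rank (M.sub (P ⊓ N l)) := by exact_mod_cast h13
    omega

theorem inf_last (h : D.IsFlag M r N) (P : Submodule A M) : P ⊓ N r = P := by
  rw [h.last, inf_top_eq]

/-- The `j`-th member of a flag maximizes `deg - γ * rank` if `γ` separates the slopes. -/
theorem bound (hD : D.IsGood) (h : D.IsFlag M r N) {P : Submodule A M}
    (hP : D.IsStrictSub M P) {γ : ℚ} {j : ℕ} (hj : j ≤ r)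
    (h1 : ∀ i < j, γ ≤ D.slope (M.gr (N i) (N (i + 1))))
    (h2 : ∀ i, j ≤ i → i < r → D.slope (M.gr (N i) (N (i + 1))) ≤ γ) :
    D.deg (M.sub P) - γ * D.rank (M.sub P) ≤ D.deg (M.sub (N j)) - γ * D.rank (M.sub (N j)) := by
  have h3 := (h.bound_high hD hP hj le_rfl h2).1
  rw [h.inf_last] at h3
  exact h3.trans (h.bound_low hD hP hj h1).1

theorem rank_inf_eq (hD : D.IsGood) (h : D.IsFlag M r N) {P : Submodule A M}
    (hP : D.IsStrictSub M P) {γ : ℚ} {j : ℕ} (hj : j ≤ r)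
    (h1 : ∀ i < j, γ ≤ D.slope (M.gr (N i) (N (i + 1))))
    (h2 : ∀ i, j ≤ i → i < r → D.slope (M.gr (N i) (N (i + 1))) < γ)
    (heq : D.deg (M.sub (N j)) - γ * D.rank (M.sub (N j)) ≤
      D.deg (M.sub P) - γ * D.rank (M.sub P)) :
    D.rank (M.sub (P ⊓ N j)) = D.rank (M.sub P) := by
  have h3 := h.bound_high hD hP hj le_rfl fun i hi hi' => (h2 i hi hi').le
  rw [h.inf_last] at h3
  exact h3.2 h2 ((h.bound_low hD hP hj h1).1.trans heq)

theorem rank_inf_eq' (hD : D.IsGood) (h : D.IsFlag M r N) {P : Submodule A M}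
    (hP : D.IsStrictSub M P) {γ : ℚ} {j : ℕ} (hj : j ≤ r)
    (h1 : ∀ i < j, γ < D.slope (M.gr (N i) (N (i + 1))))
    (h2 : ∀ i, j ≤ i → i < r → D.slope (M.gr (N i) (N (i + 1))) ≤ γ)
    (heq : D.deg (M.sub (N j)) - γ * D.rank (M.sub (N j)) ≤
      D.deg (M.sub P) - γ * D.rank (M.sub P)) :
    D.rank (M.sub (P ⊓ N j)) = D.rank (M.sub (N j)) := by
  have h3 := (h.bound_high hD hP hj le_rfl h2).1
  rw [h.inf_last] at h3
  exact (h.bound_low hD hP hj fun i hi => (h1 i hi).le).2 h1 (heq.trans h3)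

end IsFlag

/-- If `γ` separates the slopes of a Harder-Narasimhan flag, then the corresponding member of the
flag is the step of the Harder-Narasimhan filtration. -/
theorem IsHNFlag.hnFil_eq (hD : D.IsGood) {r : ℕ} {N : ℕ → Submodule A M} (h : D.IsHNFlag M r N)
    {γ : ℚ} {j : ℕ} (hj : j ≤ r) (h1 : ∀ i < j, γ ≤ D.slope (M.gr (N i) (N (i + 1))))
    (h2 : ∀ i, j ≤ i → i < r → D.slope (M.gr (N i) (N (i + 1))) < γ)
    (hred : ∀ P, D.IsStrictSub M P → D.rank (M.sub (P ⊓ N j)) = D.rank (M.sub P) → P ≤ N j) :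
    D.hnFil M γ = N j := by
  apply le_antisymm
  · refine sSup_le ?_
    rintro _ ⟨r', N', i, h', hi, hγ, rfl⟩
    obtain ⟨j', hj', h3, h4⟩ := exists_slope_split h'.slope_lt γ
    have h5 : i + 1 ≤ j' := by
      by_contra h5
      exact absurd hγ (not_le.mpr (h4 i (by omega) hi))
    refine (h'.isFlag.le_of_le h5 hj').trans (hred _ (h'.strict j' hj') ?_)
    exact h.isFlag.rank_inf_eq hD (h'.strict j' hj') hj h1 h2
      (h'.isFlag.bound hD (h.strict j hj) hj' h3 fun i hi hi' => (h4 i hi hi').le)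
  · rcases Nat.eq_zero_or_pos j with rfl | hpos
    · rw [h.zero]
      exact bot_le
    · obtain ⟨i, rfl⟩ : ∃ i, j = i + 1 := ⟨j - 1, by omega⟩
      exact le_sSup ⟨r, N, i, h, hj, h1 i (Nat.lt_succ_self i), rfl⟩

theorem IsHNFlag.hnFil_slope (hD : D.IsGood) {r : ℕ} {N : ℕ → Submodule A M}
    (h : D.IsHNFlag M r N) {i : ℕ} (hi : i < r)
    (hred : ∀ P, D.IsStrictSub M P →
      D.rank (M.sub (P ⊓ N (i + 1))) = D.rank (M.sub P) → P ≤ N (i + 1)) :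
    D.hnFil M (D.slope (M.gr (N i) (N (i + 1)))) = N (i + 1) := by
  refine h.hnFil_eq hD hi (fun l hl => ?_) (fun l hl hl' => h.slope_lt i l hl hl') hred
  rcases Nat.lt_succ_iff_lt_or_eq.mp hl with h1 | rfl
  · exact (h.slope_lt l i h1 hi).le
  · exact le_rfl

/-- Null objects are zero: a strict subobject is determined within a larger one by its rank. -/
def IsReduced (D : SlopeData.{u, v} φ E) : Prop :=
  ∀ {M : PhiModule.{u, v} φ E}, D.IsObj M → D.rank M = 0 → Subsingleton M

theorem IsReduced.eq_of_rank_eq (hR : D.IsReduced) (hD : D.IsGood)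
    {N N' : Submodule A M} (hle : N ≤ N') (hN : D.IsStrictSub M N) (hN' : D.IsStrictSub M N')
    (h : D.rank (M.sub N) = D.rank (M.sub N')) : N = N' := by
  have h0 := Subquot.ofGr hN.1 hN'.1 hle
  have h1 := hD.rank_subquot h0 hN hN'
  have h2 := hR (hD.isObj_of_subquot h0 hN hN') (by omega)
  refine le_antisymm hle fun x hx => ?_
  exact (h0.ker (mkSub x hx)).mp (Subsingleton.elim _ _)

theorem IsReduced.le_of_rank_inf (hR : D.IsReduced) (hD : D.IsGood) (hM : D.IsObj M)
    {N P : Submodule A M} (hN : D.IsStrictSub M N) (hP : D.IsStrictSub M P)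
    (h : D.rank (M.sub (P ⊓ N)) = D.rank (M.sub P)) : P ≤ N := by
  rw [← hR.eq_of_rank_eq hD inf_le_left (hD.inf hM hP hN) hP h]
  exact inf_le_right

theorem IsHNFlag.mem_other (hD : D.IsGood) (hR : D.IsReduced) {r r' : ℕ}
    {N N' : ℕ → Submodule A M} (h : D.IsHNFlag M r N) (h' : D.IsHNFlag M r' N') {j : ℕ}
    (hj : j ≤ r) : ∃ j' ≤ r', N' j' = N j := by
  have hM := h.isFlag.isObj hD
  rcases Nat.eq_zero_or_pos j with rfl | hpos
  · exact ⟨0, Nat.zero_le _, by rw [h.zero, h'.zero]⟩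
  · obtain ⟨i, rfl⟩ : ∃ i, j = i + 1 := ⟨j - 1, by omega⟩
    obtain ⟨j', hj', h3, h4⟩ := exists_slope_split h'.slope_lt (D.slope (M.gr (N i) (N (i + 1))))
    refine ⟨j', hj', ?_⟩
    rw [← h.hnFil_slope hD hj fun P hP => hR.le_of_rank_inf hD hM (h.strict _ hj) hP]
    exact (h'.hnFil_eq hD hj' h3 h4
      fun P hP => hR.le_of_rank_inf hD hM (h'.strict _ hj') hP).symm

theorem IsFlag.strictMono (hD : D.IsGood) {r : ℕ} {N : ℕ → Submodule A M} (h : D.IsFlag M r N) :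
    StrictMono (fun i : Fin (r + 1) => N i) := by
  refine Fin.strictMono_iff_lt_succ.mpr fun i => ?_
  have hi : (i : ℕ) < r := i.2
  have h1 : N i ≤ N (i + 1) := h.le_succ i hi
  refine lt_of_le_of_ne h1 fun h2 => ?_
  change N i = N (i + 1) at h2
  have h3 := h.rank_succ hD hi
  have h4 := h.rank_pos hD hi
  rw [← h2] at h3
  rw [← h2] at h4
  omega

theorem IsHNFlag.unique (hD : D.IsGood) (hR : D.IsReduced) {r r' : ℕ}
    {N N' : ℕ → Submodule A M} (h : D.IsHNFlag M r N) (h' : D.IsHNFlag M r' N') :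
    r' = r ∧ ∀ i ≤ r, N' i = N i := by
  have hm := h.isFlag.strictMono hD
  have hm' := h'.isFlag.strictMono hD
  have hr : Set.range (fun i : Fin (r + 1) => N i) = Set.range (fun i : Fin (r' + 1) => N' i) := by
    apply Set.Subset.antisymm
    · rintro _ ⟨i, rfl⟩
      obtain ⟨j, hj, h1⟩ := h.mem_other hD hR h' (Nat.lt_succ_iff.mp i.2)
      exact ⟨⟨j, Nat.lt_succ_iff.mpr hj⟩, h1⟩
    · rintro _ ⟨i, rfl⟩
      obtain ⟨j, hj, h1⟩ := h'.mem_other hD hR h (Nat.lt_succ_iff.mp i.2)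
      exact ⟨⟨j, Nat.lt_succ_iff.mpr hj⟩, h1⟩
  have hc : r + 1 = r' + 1 := by
    have h1 := Nat.card_congr (Equiv.ofInjective _ hm.injective)
    have h2 := Nat.card_congr (Equiv.ofInjective _ hm'.injective)
    rw [hr, ← h2, Nat.card_fin, Nat.card_fin] at h1
    exact h1
  obtain rfl : r = r' := by omega
  refine ⟨rfl, fun i hi => ?_⟩
  exact (congrFun ((StrictMono.range_inj hm hm').mp hr) ⟨i, Nat.lt_succ_iff.mpr hi⟩).symm

theorem IsHNFlag.hnPolygon_eq (hD : D.IsGood) (hR : D.IsReduced) {r : ℕ}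
    {N : ℕ → Submodule A M} (h : D.IsHNFlag M r N) (x : ℝ) :
    D.hnPolygon M x = polygon r (fun i => D.rank (M.gr (N i) (N (i + 1))))
      (fun i => D.slope (M.gr (N i) (N (i + 1)))) x := by
  have hex : ∃ f : ℕ × (ℕ → Submodule A M), D.IsHNFlag M f.1 f.2 := ⟨(r, N), h⟩
  rw [hnPolygon, dif_pos hex]
  obtain ⟨h1, h2⟩ := h.unique hD hR hex.choose_spec
  rw [h1]
  apply polygon_congr
  · intro i hi
    rw [h2 i hi.le, h2 (i + 1) hi]
  · intro i hi
    rw [h2 i hi.le, h2 (i + 1) hi]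

/-- Among the strict subobjects containing `N` with larger rank there is one, `N₁`, of maximal slope
`σ` over `N` and of maximal rank for this property; hence slopes over `N₁` are smaller than `σ`. The
maximum exists since degrees are bounded and have a common denominator. -/
theorem IsGood.exists_max_slope (hD : D.IsGood) (hM : D.IsObj M)
    (hint : ∃ e : ℕ, 0 < e ∧ ∀ P, D.IsStrictSub M P → ∃ z : ℤ, (e : ℚ) * D.deg (M.sub P) = z)
    (hbd : ∃ B : ℚ, ∀ P, D.IsStrictSub M P → D.deg (M.sub P) ≤ B)
    {N : Submodule A M} (hN : D.IsStrictSub M N) (hlt : D.rank (M.sub N) < D.rank M) :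
    ∃ (N₁ : Submodule A M) (σ : ℚ), D.IsStrictSub M N₁ ∧ N ≤ N₁ ∧
      D.rank (M.sub N) < D.rank (M.sub N₁) ∧
      D.deg (M.sub N₁) - D.deg (M.sub N) = σ * (D.rank (M.sub N₁) - D.rank (M.sub N)) ∧
      (∀ P, D.IsStrictSub M P → N ≤ P → D.rank (M.sub N) < D.rank (M.sub P) →
        D.deg (M.sub P) - D.deg (M.sub N) ≤ σ * (D.rank (M.sub P) - D.rank (M.sub N))) ∧
      (∀ P, D.IsStrictSub M P → N₁ ≤ P → D.rank (M.sub N₁) < D.rank (M.sub P) →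
        D.deg (M.sub P) - D.deg (M.sub N₁) < σ * (D.rank (M.sub P) - D.rank (M.sub N₁))) := by
  obtain ⟨e, he, hint⟩ := hint
  obtain ⟨B, hB⟩ := hbd
  have htop : D.rank (M.sub ⊤) = D.rank M := hD.iso_rank (IsGood.iso_sub_top M)
  have hrk : ∀ P, D.IsStrictSub M P → D.rank (M.sub P) ≤ D.rank M := fun P hP => by
    rw [← htop]
    exact hD.rank_mono le_top hP (hD.strict_top hM)
  -- Slopes of subobjects of `M / N` have the common denominator `K`.
  set K : ℚ := e * (D.rank M).factorial with hK
  have hKpos : 0 < K := mul_pos (by exact_mod_cast he) (by exact_mod_cast Nat.factorial_pos _)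
  obtain ⟨zN, hzN⟩ := hint N hN
  let s : Submodule A M → ℚ := fun P =>
    (D.deg (M.sub P) - D.deg (M.sub N)) / (D.rank (M.sub P) - D.rank (M.sub N))
  have hs : ∀ P, D.rank (M.sub N) < D.rank (M.sub P) →
      D.deg (M.sub P) - D.deg (M.sub N) = s P * (D.rank (M.sub P) - D.rank (M.sub N)) := by
    intro P h
    have : (D.rank (M.sub N) : ℚ) < D.rank (M.sub P) := by exact_mod_cast h
    rw [div_mul_cancel₀]
    linarith
  have hz : ∀ P, D.IsStrictSub M P → D.rank (M.sub N) < D.rank (M.sub P) →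
      ∃ z : ℤ, K * s P = z := by
    intro P hP h
    obtain ⟨z, hz⟩ := hint P hP
    obtain ⟨c, hc⟩ := Nat.dvd_factorial (m := D.rank (M.sub P) - D.rank (M.sub N))
      (n := D.rank M) (by omega) (by have := hrk P hP; omega)
    refine ⟨(z - zN) * c, ?_⟩
    have h1 : ((D.rank M).factorial : ℚ) = (D.rank (M.sub P) - D.rank (M.sub N)) * c := by
      rw [hc]
      push_cast [Nat.cast_sub h.le]
      ring
    calc K * s P = e * (s P * (D.rank (M.sub P) - D.rank (M.sub N))) * c := by
          rw [hK, h1]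
          ring
      _ = _ := by
          rw [← hs P h, mul_sub, hz, hzN]
          push_cast
          ring
  obtain ⟨z, ⟨P₀, hP₀, hNP₀, hlt₀, hz₀⟩, hmax⟩ := Int.exists_greatest_of_bdd
    (P := fun z => ∃ P, D.IsStrictSub M P ∧ N ≤ P ∧ D.rank (M.sub N) < D.rank (M.sub P) ∧
      K * s P = z)
    ⟨⌈K * |B - D.deg (M.sub N)|⌉, by
      rintro z ⟨P, hP, -, h, hzP⟩
      rw [← Int.cast_le (R := ℚ), ← hzP]
      refine le_trans (mul_le_mul_of_nonneg_left ?_ hKpos.le) (Int.le_ceil _)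
      have h1 : (1 : ℚ) ≤ D.rank (M.sub P) - D.rank (M.sub N) := by
        rw [le_sub_iff_add_le, add_comm]
        exact_mod_cast h
      have h2 : D.deg (M.sub P) - D.deg (M.sub N) ≤ |B - D.deg (M.sub N)| :=
        le_trans (by linarith [hB P hP]) (le_abs_self _)
      exact (div_le_iff₀ (by linarith)).mpr
        (h2.trans (le_mul_of_one_le_right (abs_nonneg _) h1))⟩
    (by
      obtain ⟨z, hz⟩ := hz ⊤ (hD.strict_top hM) (by rw [htop]; exact hlt)
      exact ⟨z, ⊤, hD.strict_top hM, le_top, by rw [htop]; exact hlt, hz⟩)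
  -- Among the subobjects of maximal slope, take one of maximal rank.
  obtain ⟨w, ⟨N₁, hN₁, hNN₁, hlt₁, hz₁, hw⟩, hmax'⟩ := Int.exists_greatest_of_bdd
    (P := fun w => ∃ P, D.IsStrictSub M P ∧ N ≤ P ∧ D.rank (M.sub N) < D.rank (M.sub P) ∧
      K * s P = z ∧ (D.rank (M.sub P) : ℤ) = w)
    ⟨D.rank M, by
      rintro w ⟨P, hP, -, -, -, rfl⟩
      exact_mod_cast hrk P hP⟩
    ⟨_, P₀, hP₀, hNP₀, hlt₀, hz₀, rfl⟩
  have hle : ∀ P, D.IsStrictSub M P → N ≤ P → D.rank (M.sub N) < D.rank (M.sub P) →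
      s P ≤ s N₁ := by
    intro P hP h1 h2
    obtain ⟨y, hy⟩ := hz P hP h2
    have h3 : (y : ℚ) ≤ z := by exact_mod_cast hmax y ⟨P, hP, h1, h2, hy⟩
    rw [← hy, ← hz₁] at h3
    exact le_of_mul_le_mul_left h3 hKpos
  refine ⟨N₁, s N₁, hN₁, hNN₁, hlt₁, hs N₁ hlt₁, fun P hP h1 h2 => ?_, fun P hP h1 h2 => ?_⟩
  · rw [hs P h2]
    refine mul_le_mul_of_nonneg_right (hle P hP h1 h2) (sub_nonneg.mpr ?_)
    exact_mod_cast h2.le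
  · have h3 := hlt₁.trans h2
    have h4 := hle P hP (hNN₁.trans h1) h3
    have h5 : s P < s N₁ := by
      refine lt_of_le_of_ne h4 fun h6 => ?_
      have := hmax' _ ⟨P, hP, hNN₁.trans h1, h3, by rw [h6, hz₁], rfl⟩
      rw [← hw] at this
      omega
    have h6 := hs P h3
    have h7 := hs N₁ hlt₁
    have h8 : (0 : ℚ) < D.rank (M.sub P) - D.rank (M.sub N) := sub_pos.mpr (by exact_mod_cast h3)
    have h9 := mul_lt_mul_of_pos_right h5 h8
    linarith

/-- Existence of the Harder-Narasimhan flag: each step is the strict subobject of maximal slope, and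
of maximal rank among these, modulo the preceding step. -/
theorem IsGood.exists_isHNFlag (hD : D.IsGood) (hR : D.IsReduced) (hM : D.IsObj M)
    (hint : ∃ e : ℕ, 0 < e ∧ ∀ P, D.IsStrictSub M P → ∃ z : ℤ, (e : ℚ) * D.deg (M.sub P) = z)
    (hbd : ∃ B : ℚ, ∀ P, D.IsStrictSub M P → D.deg (M.sub P) ≤ B) :
    ∃ (r : ℕ) (N : ℕ → Submodule A M), D.IsHNFlag M r N := by
  have htop : D.rank (M.sub ⊤) = D.rank M := hD.iso_rank (IsGood.iso_sub_top M)
  -- Flags are built from `N` up to `M` by induction on the corank of `N`; the last clause, comparing the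
  -- first slope of the flag with the slopes of subobjects over `N`, makes the slopes decrease.
  have key : ∀ (n : ℕ) (N : Submodule A M), D.IsStrictSub M N → D.rank M - D.rank (M.sub N) = n →
      ∃ (r : ℕ) (C : ℕ → Submodule A M), C 0 = N ∧ C r = ⊤ ∧ (∀ i < r, C i ≤ C (i + 1)) ∧
        (∀ i ≤ r, D.IsStrictSub M (C i)) ∧
        (∀ i < r, D.IsSemistable (M.gr (C i) (C (i + 1)))) ∧
        (∀ i j, i < j → j < r →
          D.slope (M.gr (C j) (C (j + 1))) < D.slope (M.gr (C i) (C (i + 1)))) ∧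
        ∀ σ : ℚ, 0 < r → (∀ P, D.IsStrictSub M P → N ≤ P →
          D.rank (M.sub N) < D.rank (M.sub P) →
          D.deg (M.sub P) - D.deg (M.sub N) < σ * (D.rank (M.sub P) - D.rank (M.sub N))) →
          D.slope (M.gr (C 0) (C 1)) < σ := by
    intro n
    induction n using Nat.strong_induction_on with
    | _ n ih =>
      intro N hN hn
      have hle : D.rank (M.sub N) ≤ D.rank M := htop ▸ hD.rank_mono le_top hN (hD.strict_top hM)
      rcases hle.eq_or_lt with heq | hlt
      · have h1 := hR.eq_of_rank_eq hD le_top hN (hD.strict_top hM) (by rw [heq, htop])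
        refine ⟨0, fun _ => N, rfl, h1, fun i hi => absurd hi (Nat.not_lt_zero _),
          fun i _ => hN, fun i hi => absurd hi (Nat.not_lt_zero _),
          fun i j _ hj => absurd hj (Nat.not_lt_zero _), fun σ h0 => absurd h0 (lt_irrefl _)⟩
      · obtain ⟨N₁, σ₁, hN₁, hNN₁, hlt₁, heq₁, hmax, hmax'⟩ :=
          hD.exists_max_slope hM hint hbd hN hlt
        have hle₁ : D.rank (M.sub N₁) ≤ D.rank M :=
          htop ▸ hD.rank_mono le_top hN₁ (hD.strict_top hM)
        obtain ⟨r, C, h0, hr, hC1, hC2, hC3, hC4, hC5⟩ := ih _ (by omega) N₁ hN₁ rfl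
        have hg := Subquot.ofGr hN.1 hN₁.1 hNN₁
        have hrk := hD.rank_subquot hg hN hN₁
        have hobj := hD.isObj_of_subquot hg hN hN₁
        have hslope : D.slope (M.gr N N₁) = σ₁ := by
          have h1 := hD.deg_subquot hg hN hN₁
          rw [hrk] at heq₁
          push_cast at heq₁
          rw [h1, add_sub_cancel_left, add_sub_cancel_left] at heq₁
          have h2 : (D.rank (M.gr N N₁) : ℚ) ≠ 0 := by
            have : D.rank (M.gr N N₁) ≠ 0 := by omega
            exact_mod_cast this
          rw [slope, heq₁, mul_div_assoc, div_self h2, mul_one]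
        -- Prepend `N` to the flag from `N₁` to `M`.
        let C' : ℕ → Submodule A M := fun i => Nat.casesOn i N C
        have hC'1 : C' 1 = N₁ := h0
        have hhead : 0 < r → D.slope (M.gr (C 0) (C 1)) < σ₁ := fun h => hC5 σ₁ h hmax'
        refine ⟨r + 1, C', rfl, hr, ?_, ?_, ?_, ?_, ?_⟩
        · rintro (_ | i) hi
          · change N ≤ C 0
            rw [h0]
            exact hNN₁
          · exact hC1 i (by omega)
        · rintro (_ | i) hi
          · exact hN
          · exact hC2 i (by omega)
        · rintro (_ | i) hi
          · change D.IsSemistable (M.gr N (C 0))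
            rw [h0]
            refine hD.isSemistable_of_le hg hN hN₁ hlt₁ fun P hP h1 h2 => ?_
            rw [hslope]
            rcases (hD.rank_mono h1 hN hP).eq_or_lt with h3 | h3
            · rw [hD.deg_eq_of_rank_eq h1 hN hP h3, h3]
              simp
            · exact hmax P hP h1 h3
          · exact hC3 i (by omega)
        · rintro (_ | i) (_ | j) hij hj
          · exact absurd hij (lt_irrefl _)
          · change D.slope (M.gr (C j) (C (j + 1))) < D.slope (M.gr N (C 0))
            rw [h0, hslope]
            rcases Nat.eq_zero_or_pos j with rfl | hpos
            · exact hhead (by omega)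
            · exact (hC4 0 j hpos (by omega)).trans (hhead (by omega))
          · exact absurd hij (Nat.not_lt_zero _)
          · exact hC4 i j (by omega) (by omega)
        · intro σ _ hσ
          change D.slope (M.gr N (C 0)) < σ
          rw [h0, hslope]
          have h1 := hσ N₁ hN₁ hNN₁ hlt₁
          rw [heq₁] at h1
          refine lt_of_mul_lt_mul_right h1 (sub_nonneg.mpr ?_)
          exact_mod_cast hlt₁.le
  obtain ⟨r, C, h0, hr, h1, h2, h3, h4, -⟩ := key _ ⊥ (hD.strict_bot hM) rfl
  exact ⟨r, C, ⟨h0, hr, h1, h2, h3, h4⟩⟩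

end SlopeData

end Kisin

end

universe w w'

noncomputable section

namespace Kisin

/-! ### Length functions and relative indices of lattices -/

section Length

variable {A : Type u} [CommRing A]

/-- An additive function on modules with values in `ℕ∞`, such as the length or the length of a
localization. -/
structure LengthFn (A : Type u) [CommRing A] where
  toFun : ∀ (Q : Type w) [AddCommGroup Q] [Module A Q], ℕ∞
  exact : ∀ {N M P : Type w} [AddCommGroup N] [AddCommGroup M] [AddCommGroup P] [Module A N]
    [Module A M] [Module A P] (f : N →ₗ[A] M) (g : M →ₗ[A] P), Function.Injective f →
    Function.Surjective g → Function.Exact f g → toFun M = toFun N + toFun P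
  of_subsingleton : ∀ (Q : Type w) [AddCommGroup Q] [Module A Q] [Subsingleton Q], toFun Q = 0

namespace LengthFn

variable (lam : LengthFn.{u, w} A)

theorem congr {Q Q' : Type w} [AddCommGroup Q] [Module A Q] [AddCommGroup Q'] [Module A Q']
    (e : Q ≃ₗ[A] Q') : lam.toFun Q = lam.toFun Q' := by
  have h := lam.exact (N := Q) (M := Q') (P := PUnit) e.toLinearMap 0 e.injective
    (fun x => ⟨0, Subsingleton.elim _ _⟩)
    (fun x => ⟨fun _ => e.surjective x, fun _ => rfl⟩)
  rw [lam.of_subsingleton PUnit, add_zero] at h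
  exact h.symm

/-- The value of a length function at `L / K ∩ L`. -/
def quo {V : Type w} [AddCommGroup V] [Module A V] (K L : Submodule A V) : ℕ∞ :=
  lam.toFun (L ⧸ K.submoduleOf L)

variable {V V' V'' : Type w} [AddCommGroup V] [Module A V] [AddCommGroup V'] [Module A V']
  [AddCommGroup V''] [Module A V'']

theorem quo_eq_of_surjective {K L : Submodule A V} {Q : Type w} [AddCommGroup Q] [Module A Q]
    (g : L →ₗ[A] Q) (hg : Function.Surjective g) (hk : LinearMap.ker g = K.submoduleOf L) :
    lam.quo K L = lam.toFun Q :=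
  lam.congr ((Submodule.quotEquivOfEq _ _ hk.symm).trans (g.quotKerEquivOfSurjective hg))

theorem quo_add {K L N : Submodule A V} (h1 : K ≤ L) (h2 : L ≤ N) :
    lam.quo K N = lam.quo K L + lam.quo L N := by
  refine lam.exact
    ((K.submoduleOf L).mapQ (K.submoduleOf N) (Submodule.inclusion h2) (fun x hx => hx))
    ((K.submoduleOf N).mapQ (L.submoduleOf N) LinearMap.id (fun x hx => h1 hx)) ?_ ?_ ?_
  · rw [injective_iff_map_eq_zero]
    intro y hy
    obtain ⟨x, rfl⟩ := Submodule.Quotient.mk_surjective _ y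
    exact (Submodule.Quotient.mk_eq_zero _).mpr ((Submodule.Quotient.mk_eq_zero (K.submoduleOf N)).mp hy)
  · intro y
    obtain ⟨x, rfl⟩ := Submodule.Quotient.mk_surjective _ y
    exact ⟨Submodule.Quotient.mk x, rfl⟩
  · intro y
    obtain ⟨x, rfl⟩ := Submodule.Quotient.mk_surjective _ y
    constructor
    · intro h
      have h3 : (x : V) ∈ L := (Submodule.Quotient.mk_eq_zero (L.submoduleOf N)).mp h
      exact ⟨Submodule.Quotient.mk ⟨x, h3⟩, rfl⟩
    · rintro ⟨z, hz⟩
      obtain ⟨z, rfl⟩ := Submodule.Quotient.mk_surjective _ z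
      rw [← hz]
      exact (Submodule.Quotient.mk_eq_zero (L.submoduleOf N)).mpr z.2

theorem quo_self (K : Submodule A V) : lam.quo K K = 0 := by
  have h : Subsingleton (K ⧸ K.submoduleOf K) := by
    rw [Submodule.submoduleOf_self]
    infer_instance
  exact lam.of_subsingleton _

/-- Additivity of the length of `L / K` along an exact sequence. -/
theorem quo_exact {f : V' →ₗ[A] V} {g : V →ₗ[A] V''}
    (hex : Function.Exact f g) {K L : Submodule A V} (h : K ≤ L) :
    lam.quo K L = lam.quo (K.comap f) (L.comap f) + lam.quo (K.map g) (L.map g) := by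
  have h1 : ∀ x ∈ L.comap f, f x ∈ L := fun x hx => hx
  have h2 : ∀ x ∈ L, g x ∈ L.map g := fun x hx => ⟨x, hx, rfl⟩
  refine lam.exact
    (((K.comap f).submoduleOf (L.comap f)).mapQ (K.submoduleOf L) (f.restrict h1)
      (fun x hx => hx))
    ((K.submoduleOf L).mapQ ((K.map g).submoduleOf (L.map g)) (g.restrict h2)
      (fun x hx => ⟨x, hx, rfl⟩)) ?_ ?_ ?_
  · rw [injective_iff_map_eq_zero]
    intro y hy
    obtain ⟨x, rfl⟩ := Submodule.Quotient.mk_surjective _ y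
    exact (Submodule.Quotient.mk_eq_zero _).mpr ((Submodule.Quotient.mk_eq_zero (K.submoduleOf L)).mp hy)
  · intro y
    obtain ⟨⟨_, x, hx, rfl⟩, rfl⟩ := Submodule.Quotient.mk_surjective _ y
    exact ⟨Submodule.Quotient.mk ⟨x, hx⟩, rfl⟩
  · intro y
    obtain ⟨x, rfl⟩ := Submodule.Quotient.mk_surjective _ y
    constructor
    · intro h3
      obtain ⟨z, hz, h4⟩ : g x ∈ K.map g :=
        (Submodule.Quotient.mk_eq_zero ((K.map g).submoduleOf (L.map g))).mp h3
      obtain ⟨t, ht⟩ := (hex (x - z)).mp (by rw [map_sub, h4, sub_self])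
      refine ⟨Submodule.Quotient.mk ⟨t, ?_⟩, ?_⟩
      · rw [Submodule.mem_comap, ht]
        exact L.sub_mem x.2 (h hz)
      · refine (Submodule.Quotient.eq _).mpr ?_
        change f t - x ∈ K
        rw [ht, sub_sub_cancel_left]
        exact K.neg_mem hz
    · rintro ⟨z, hz⟩
      obtain ⟨z, rfl⟩ := Submodule.Quotient.mk_surjective _ z
      rw [← hz]
      refine (Submodule.Quotient.mk_eq_zero ((K.map g).submoduleOf (L.map g))).mpr ?_
      change g (f z) ∈ K.map g
      rw [hex.apply_apply_eq_zero]
      exact zero_mem _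

theorem quo_map {f : V' →ₗ[A] V} (hf : Function.Injective f) (K L : Submodule A V') :
    lam.quo (K.map f) (L.map f) = lam.quo K L := by
  symm
  refine lam.quo_eq_of_surjective (((K.map f).submoduleOf (L.map f)).mkQ ∘ₗ
    f.restrict (p := L) (q := L.map f) (fun x hx => ⟨x, hx, rfl⟩)) ?_ ?_
  · refine (Submodule.mkQ_surjective _).comp ?_
    rintro ⟨_, x, hx, rfl⟩
    exact ⟨⟨x, hx⟩, rfl⟩
  · ext x
    rw [LinearMap.mem_ker, LinearMap.comp_apply, Submodule.mkQ_apply,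
      Submodule.Quotient.mk_eq_zero]
    constructor
    · rintro ⟨y, hy, h⟩
      have := hf h
      subst this
      exact hy
    · exact fun h => ⟨x, h, rfl⟩

theorem quo_sup (K L : Submodule A V) : lam.quo K (K ⊔ L) = lam.quo K L := by
  symm
  refine lam.quo_eq_of_surjective ((K.submoduleOf (K ⊔ L)).mkQ ∘ₗ
    Submodule.inclusion (le_sup_right : L ≤ K ⊔ L)) ?_ ?_
  · intro y
    obtain ⟨⟨x, hx⟩, rfl⟩ := Submodule.mkQ_surjective _ y
    obtain ⟨a, ha, b, hb, rfl⟩ := Submodule.mem_sup.mp hx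
    refine ⟨⟨b, hb⟩, ?_⟩
    refine (Submodule.Quotient.eq _).mpr ?_
    change b - (a + b) ∈ K
    simpa using ha
  · ext x
    rw [LinearMap.mem_ker, LinearMap.comp_apply, Submodule.mkQ_apply,
      Submodule.Quotient.mk_eq_zero]
    rfl

theorem quo_inf (K L : Submodule A V) : lam.quo (K ⊓ L) L = lam.quo K L := by
  have h : (K ⊓ L).submoduleOf L = K.submoduleOf L := by
    ext x
    exact ⟨fun h => h.1, fun h => ⟨h, x.2⟩⟩
  rw [quo, h, quo]

theorem quo_mono_right {K L L' : Submodule A V} (h1 : K ≤ L) (h : L ≤ L') :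
    lam.quo K L ≤ lam.quo K L' := by
  rw [lam.quo_add h1 h]
  exact le_self_add

theorem quo_anti_left {K K' L : Submodule A V} (h : K ≤ K') (h1 : K' ≤ L) :
    lam.quo K' L ≤ lam.quo K L := by
  rw [lam.quo_add h h1]
  exact le_add_self

/-- The index of two lattices with respect to a length function. -/
def idx (L₁ L₂ : Submodule A V) : ℤ := ((lam.quo L₁ L₂).toNat : ℤ) - (lam.quo L₂ L₁).toNat

theorem idx_eq {K L₁ L₂ : Submodule A V} (h1 : K ≤ L₁) (h2 : K ≤ L₂) (hf1 : lam.quo K L₁ ≠ ⊤)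
    (hf2 : lam.quo K L₂ ≠ ⊤) :
    lam.idx L₁ L₂ = ((lam.quo K L₂).toNat : ℤ) - (lam.quo K L₁).toNat := by
  have e1 := lam.quo_add (le_inf h1 h2) (inf_le_left : L₁ ⊓ L₂ ≤ L₁)
  have e2 := lam.quo_add (le_inf h1 h2) (inf_le_right : L₁ ⊓ L₂ ≤ L₂)
  rw [lam.quo_inf] at e2
  rw [inf_comm, lam.quo_inf, inf_comm] at e1
  rw [e1] at hf1 ⊢
  rw [e2] at hf2 ⊢
  rw [Ne, ENat.add_eq_top, not_or] at hf1 hf2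
  rw [ENat.toNat_add hf1.1 hf1.2, ENat.toNat_add hf2.1 hf2.2, idx]
  push_cast
  ring

theorem idx_add {K L₁ L₂ L₃ : Submodule A V} (h1 : K ≤ L₁) (h2 : K ≤ L₂) (h3 : K ≤ L₃)
    (hf1 : lam.quo K L₁ ≠ ⊤) (hf2 : lam.quo K L₂ ≠ ⊤) (hf3 : lam.quo K L₃ ≠ ⊤) :
    lam.idx L₁ L₃ = lam.idx L₁ L₂ + lam.idx L₂ L₃ := by
  rw [lam.idx_eq h1 h3 hf1 hf3, lam.idx_eq h1 h2 hf1 hf2, lam.idx_eq h2 h3 hf2 hf3]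
  ring

theorem idx_of_le {L₁ L₂ : Submodule A V} (h : L₁ ≤ L₂) :
    lam.idx L₁ L₂ = (lam.quo L₁ L₂).toNat := by
  have h1 : lam.quo L₂ L₁ = 0 := by
    rw [← lam.quo_inf, inf_eq_right.mpr h, quo_self]
  rw [idx, h1]
  simp

theorem idx_self (L : Submodule A V) : lam.idx L L = 0 := by
  rw [lam.idx_of_le le_rfl, quo_self]
  rfl

theorem idx_symm (L₁ L₂ : Submodule A V) : lam.idx L₂ L₁ = - lam.idx L₁ L₂ := by
  rw [idx, idx, neg_sub]

theorem idx_map {f : V' →ₗ[A] V} (hf : Function.Injective f) (L₁ L₂ : Submodule A V') :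
    lam.idx (L₁.map f) (L₂.map f) = lam.idx L₁ L₂ := by
  rw [idx, idx, lam.quo_map hf, lam.quo_map hf]

theorem idx_exact {f : V' →ₗ[A] V} {g : V →ₗ[A] V''}
    (hex : Function.Exact f g) {K L₁ L₂ : Submodule A V} (h1 : K ≤ L₁) (h2 : K ≤ L₂)
    (hf1 : lam.quo K L₁ ≠ ⊤) (hf2 : lam.quo K L₂ ≠ ⊤) :
    lam.idx L₁ L₂ = lam.idx (L₁.comap f) (L₂.comap f) + lam.idx (L₁.map g) (L₂.map g) := by
  rw [lam.idx_eq h1 h2 hf1 hf2]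
  rw [lam.quo_exact hex h1] at hf1 ⊢
  rw [lam.quo_exact hex h2] at hf2 ⊢
  rw [Ne, ENat.add_eq_top, not_or] at hf1 hf2
  rw [lam.idx_eq (Submodule.comap_mono h1) (Submodule.comap_mono h2) hf1.1 hf2.1,
    lam.idx_eq (Submodule.map_mono h1) (Submodule.map_mono h2) hf1.2 hf2.2,
    ENat.toNat_add hf1.1 hf1.2, ENat.toNat_add hf2.1 hf2.2]
  push_cast
  ring

end LengthFn

/-- The length as a length function. -/
def lengthFn (A : Type u) [CommRing A] : LengthFn.{u, w} A where
  toFun Q _ _ := Module.length A Q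
  exact f g hf hg hfg := Module.length_eq_add_of_exact f g hf hg hfg
  of_subsingleton _ _ _ _ := Module.length_eq_zero

theorem length_localization_eq_zero (S : Submonoid A) {Q : Type w} [AddCommGroup Q] [Module A Q]
    (h : ∀ x : Q, ∃ s ∈ S, s • x = 0) :
    Module.length (Localization S) (LocalizedModule S Q) = 0 := by
  have : Subsingleton (LocalizedModule S Q) := by
    refine subsingleton_of_forall_eq 0 fun y => ?_
    induction y with
    | h m s =>
      obtain ⟨t, ht, h1⟩ := h m
      rw [← LocalizedModule.zero_mk (1 : S), LocalizedModule.mk_eq]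
      refine ⟨⟨t, ht⟩, ?_⟩
      rw [one_smul, smul_zero, smul_zero]
      exact h1
  exact Module.length_eq_zero

/-- The length of the localization at a submonoid as a length function. -/
def localLengthFn (S : Submonoid A) : LengthFn.{u, w} A where
  toFun Q _ _ := Module.length (Localization S) (LocalizedModule S Q)
  exact f g hf hg hfg := Module.length_eq_add_of_exact (LocalizedModule.map S f)
    (LocalizedModule.map S g) (LocalizedModule.map_injective S f hf)
    (LocalizedModule.map_surjective S g hg) (LocalizedModule.map_exact S f g hfg)
  of_subsingleton _ _ _ _ := length_localization_eq_zero S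
    fun _ => ⟨1, S.one_mem, Subsingleton.elim _ _⟩

theorem localLengthFn_quo_eq_zero (S : Submonoid A) {V : Type w} [AddCommGroup V] [Module A V]
    {K L : Submodule A V} (h : ∀ x ∈ L, ∃ s ∈ S, s • x ∈ K) : (localLengthFn S).quo K L = 0 := by
  refine length_localization_eq_zero S fun y => ?_
  obtain ⟨x, rfl⟩ := Submodule.mkQ_surjective _ y
  obtain ⟨s, hs, h1⟩ := h x x.2
  exact ⟨s, hs, (Submodule.Quotient.mk_eq_zero _).mpr h1⟩

theorem relIndex_eq_idx (E : A) {V : Type w} [AddCommGroup V] [Module A V]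
    (L₁ L₂ : Submodule A V) : relIndex E L₁ L₂ = (localLengthFn (away E)).idx L₁ L₂ := rfl

theorem localLength_congr (E : A) {Q : Type w} {Q' : Type w'} [AddCommGroup Q] [Module A Q]
    [AddCommGroup Q'] [Module A Q'] (e : Q ≃ₗ[A] Q') : localLength E Q = localLength E Q' := by
  have h : Function.Bijective (LocalizedModule.map (away E) e.toLinearMap) :=
    ⟨LocalizedModule.map_injective _ _ e.injective, LocalizedModule.map_surjective _ _ e.surjective⟩
  rw [localLength, localLength, (LinearEquiv.ofBijective _ h).length_eq]

theorem relIndex_map_of_injective (E : A) {V : Type w} {V' : Type w'} [AddCommGroup V] [Module A V]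
    [AddCommGroup V'] [Module A V'] {f : V →ₗ[A] V'} (hf : Function.Injective f)
    (L₁ L₂ : Submodule A V) : relIndex E (L₁.map f) (L₂.map f) = relIndex E L₁ L₂ := by
  have key : ∀ K L : Submodule A V,
      Nonempty ((L ⧸ K.submoduleOf L) ≃ₗ[A] (L.map f ⧸ (K.map f).submoduleOf (L.map f))) := by
    intro K L
    refine ⟨Submodule.Quotient.equiv _ _ (Submodule.equivMapOfInjective f hf L) ?_⟩
    ext ⟨y, hy⟩
    constructor
    · rintro ⟨x, hx, h⟩
      exact ⟨x, hx, congrArg Subtype.val h⟩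
    · rintro ⟨x, hx, h⟩
      obtain ⟨z, hz, h'⟩ := hy
      have h2 : x = z := hf (h.trans h'.symm)
      subst h2
      exact ⟨⟨x, hz⟩, hx, Subtype.ext h⟩
  obtain ⟨e⟩ := key L₁ L₂
  obtain ⟨e'⟩ := key L₂ L₁
  rw [relIndex, relIndex, localLength_congr E e, localLength_congr E e']

end Length

end Kisin

end

noncomputable section

namespace Kisin

/-! ### Finitely generated modules over a noetherian local ring -/

section LocalRing

variable {A : Type u} [CommRing A] [IsNoetherianRing A] [IsLocalRing A]
variable {Y : Type v₁} [AddCommGroup Y] [Module A Y] [Module.Finite A Y]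

/-- Submodules of finitely generated modules are closed for the topology defined by powers of a
non-unit. -/
theorem mem_of_forall_mem_pow {N : Submodule A Y} {a : A} (ha : ¬ IsUnit a) {y : Y}
    (h : ∀ n : ℕ, ∃ z, y - a ^ n • z ∈ N) : y ∈ N := by
  have h1 := Ideal.iInf_pow_smul_eq_bot_of_isLocalRing (M := Y ⧸ N) (Ideal.span {a})
    (by rwa [Ne, Ideal.span_singleton_eq_top])
  have h2 : N.mkQ y ∈ (⊥ : Submodule A (Y ⧸ N)) := by
    rw [← h1, Submodule.mem_iInf]
    intro n
    obtain ⟨z, hz⟩ := h n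
    have h3 : N.mkQ y = a ^ n • N.mkQ z := by
      rw [← map_smul, ← sub_eq_zero, ← map_sub]
      exact (Submodule.Quotient.mk_eq_zero N).mpr hz
    rw [h3]
    exact Submodule.smul_mem_smul (Ideal.pow_mem_pow (Ideal.mem_span_singleton_self a) n) trivial
  exact (Submodule.Quotient.mk_eq_zero N).mp h2

theorem nakayama {N N' : Submodule A Y} {a : A} (ha : ¬ IsUnit a) (h : ∀ y ∈ N', ∃ z ∈ N', y - a • z ∈ N) :
    N' ≤ N := by
  intro y hy
  refine mem_of_forall_mem_pow ha fun n => ?_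
  suffices ∃ z ∈ N', y - a ^ n • z ∈ N by
    obtain ⟨z, -, hz⟩ := this
    exact ⟨z, hz⟩
  induction n with
  | zero => exact ⟨y, hy, by simp⟩
  | succ n ih =>
    obtain ⟨z, hz, h1⟩ := ih
    obtain ⟨t, ht, h2⟩ := h z hz
    refine ⟨t, ht, ?_⟩
    have h3 : y - a ^ (n + 1) • t = (y - a ^ n • z) + a ^ n • (z - a • t) := by
      rw [smul_sub, smul_smul, pow_succ]
      abel
    rw [h3]
    exact N.add_mem h1 (N.smul_mem _ h2)

/-- If the maximal ideal is generated by `a` and `b`, then a finitely generated module `Y` without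
`a`-torsion such that `Y / a Y` has no `b`-torsion is free. -/
theorem free_of_regular {a b : A} (hm : IsLocalRing.maximalIdeal A = Ideal.span {a, b})
    (ha : ∀ y : Y, a • y = 0 → y = 0) (hb : ∀ y z : Y, b • y = a • z → ∃ t, y = a • t) :
    Module.Free A Y := by
  have ham : a ∈ IsLocalRing.maximalIdeal A := hm ▸ Ideal.subset_span (Set.mem_insert _ _)
  have hbm : b ∈ IsLocalRing.maximalIdeal A :=
    hm ▸ Ideal.subset_span (Set.mem_insert_of_mem _ rfl)
  have hau : ¬ IsUnit a := (IsLocalRing.mem_maximalIdeal a).mp ham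
  have hbu : ¬ IsUnit b := (IsLocalRing.mem_maximalIdeal b).mp hbm
  set m := IsLocalRing.maximalIdeal A with hmdef
  let K := A ⧸ m
  let : Field K := Ideal.Quotient.field m
  let W := Y ⧸ (m • (⊤ : Submodule A Y))
  have : Module.Finite K W := Module.Finite.of_restrictScalars_finite A K W
  let bs := Module.finBasis K W
  -- Lifts of a basis of `Y / m Y` generate `Y`, by Nakayama.
  let y : Fin (Module.finrank K W) → Y := fun i => (Submodule.mkQ_surjective _ (bs i)).choose
  have hy : ∀ i, Submodule.Quotient.mk (p := m • (⊤ : Submodule A Y)) (y i) = bs i :=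
    fun i => (Submodule.mkQ_surjective _ (bs i)).choose_spec
  have hspan : ⊤ ≤ Submodule.span A (Set.range y) := by
    refine Submodule.le_of_le_smul_of_le_jacobson_bot (I := m) (Module.Finite.fg_top)
      (IsLocalRing.maximalIdeal_le_jacobson ⊥) ?_
    intro z _
    have h1 := bs.sum_repr (Submodule.Quotient.mk z)
    choose c hc using fun i => Ideal.Quotient.mk_surjective (bs.repr (Submodule.Quotient.mk z) i)
    have h2 : Submodule.Quotient.mk (p := m • (⊤ : Submodule A Y)) (∑ i, c i • y i)
        = Submodule.Quotient.mk z := by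
      rw [← h1, ← Submodule.mkQ_apply, map_sum]
      refine Finset.sum_congr rfl fun i _ => ?_
      rw [map_smul, Submodule.mkQ_apply, hy, ← hc]
      rfl
    rw [eq_comm, Submodule.Quotient.eq] at h2
    rw [Submodule.mem_sup]
    exact ⟨_, Submodule.sum_mem _ fun i _ => Submodule.smul_mem _ (c i)
      (Submodule.subset_span ⟨i, rfl⟩), _, h2, by abel⟩
  -- A relation modulo `m` has coefficients in `m`.
  have hrel : ∀ (c : Fin (Module.finrank K W) → A), ∑ i, c i • y i ∈ m • (⊤ : Submodule A Y) →
      ∀ i, c i ∈ m := by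
    intro c hc
    have h1 : ∑ i, (Ideal.Quotient.mk m (c i)) • bs i = 0 := by
      rw [← (Submodule.Quotient.mk_eq_zero _).mpr hc, ← Submodule.mkQ_apply, map_sum]
      refine Finset.sum_congr rfl fun i _ => ?_
      rw [map_smul, Submodule.mkQ_apply, hy]
      rfl
    intro i
    exact Ideal.Quotient.eq_zero_iff_mem.mp
      (Fintype.linearIndependent_iff.mp bs.linearIndependent _ h1 i)
  -- A relation modulo `a` has coefficients divisible by `a`.
  have hrel_a : ∀ (c : Fin (Module.finrank K W) → A), (∃ z, ∑ i, c i • y i = a • z) →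
      ∀ i, ∃ d, c i = a * d := by
    intro c hc i
    -- The coefficients lie in `m = (a, b)`; modulo `a` they can be divided by `b`, and the quotient is
    -- again a relation modulo `a`. Krull's intersection theorem concludes.
    have h1 : ∀ n : ℕ, ∃ d : Fin (Module.finrank K W) → A, (∃ z, ∑ i, d i • y i = a • z) ∧
        ∀ i, c i - b ^ n * d i ∈ Ideal.span {a} := by
      intro n
      induction n with
      | zero => exact ⟨c, hc, fun i => by simp⟩
      | succ n ih =>
        obtain ⟨d, ⟨z, hz⟩, hd⟩ := ih
        have h2 := hrel d (by rw [hz]; exact Submodule.smul_mem_smul ham trivial)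
        have h3 : ∀ i, ∃ s t, s * a + t * b = d i := fun i => by
          have := h2 i
          rw [hm] at this
          exact Ideal.mem_span_pair.mp this
        choose s t hst using h3
        refine ⟨t, ?_, fun i => ?_⟩
        · have h4 : b • ∑ i, t i • y i = a • (z - ∑ i, s i • y i) := by
            rw [smul_sub, ← hz, Finset.smul_sum, Finset.smul_sum, ← Finset.sum_sub_distrib]
            refine Finset.sum_congr rfl fun i _ => ?_
            rw [smul_smul, smul_smul, ← sub_smul, ← hst i]
            congr 1
            ring
          exact hb _ _ h4
        · have h4 : c i - b ^ (n + 1) * t i = (c i - b ^ n * d i) + b ^ n * s i * a := by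
            rw [← hst i]
            ring
          rw [h4]
          exact Ideal.add_mem _ (hd i)
            (Ideal.mul_mem_left _ _ (Ideal.mem_span_singleton_self a))
    have h2 : c i ∈ Ideal.span {a} := by
      refine mem_of_forall_mem_pow (Y := A) (N := Ideal.span {a}) hbu fun n => ?_
      obtain ⟨d, -, hd⟩ := h1 n
      exact ⟨d i, hd i⟩
    exact Ideal.mem_span_singleton.mp h2
  -- A relation has coefficients divisible by `a`, and can be divided by `a`, indefinitely.
  have hind : LinearIndependent A y := by
    rw [Fintype.linearIndependent_iff]
    intro c hc i
    have h1 : ∀ n : ℕ, ∃ d : Fin (Module.finrank K W) → A, ∑ i, d i • y i = 0 ∧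
        ∀ i, c i = a ^ n * d i := by
      intro n
      induction n with
      | zero => exact ⟨c, hc, fun i => by simp⟩
      | succ n ih =>
        obtain ⟨d, hz, hd⟩ := ih
        have h2 := hrel_a d ⟨0, by rw [hz, smul_zero]⟩
        choose t ht using h2
        refine ⟨t, ha _ ?_, fun i => by rw [hd i, ht i]; ring⟩
        rw [Finset.smul_sum, ← hz]
        exact Finset.sum_congr rfl fun i _ => by rw [smul_smul, ← ht i]
    have h2 : c i ∈ (⊥ : Ideal A) := by
      refine mem_of_forall_mem_pow (Y := A) (N := ⊥) hau fun n => ?_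
      obtain ⟨d, -, hd⟩ := h1 n
      exact ⟨d i, by rw [hd i, smul_eq_mul, sub_self]; exact zero_mem _⟩
    exact h2
  exact Module.Free.of_basis (Module.Basis.mk hind hspan)

end LocalRing

end Kisin

end

noncomputable section

namespace Kisin

/-! ### The ring `W(k)⟦u⟧` and Eisenstein polynomials -/

section Ring

variable {p : ℕ} [hp : Fact p.Prime] {k : Type u} [Field k] [CharP k p]

/-- Reduction modulo `p`, from `W(k)⟦u⟧` to `k⟦u⟧`. -/
def redS (p : ℕ) [Fact p.Prime] (k : Type u) [Field k] : Sring p k →+* k⟦X⟧ :=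
  PowerSeries.map WittVector.constantCoeff

/-- The conditions on the polynomial `E`: it is monic and Eisenstein, of positive degree. -/
structure IsEis (E : (WittVector p k)[X]) : Prop where
  monic : E.Monic
  eis : E.IsEisensteinAt (Ideal.span {(p : WittVector p k)})
  pos : 0 < E.natDegree

theorem coe_natCast_eq_C : ((p : ℕ) : Sring p k) = PowerSeries.C (p : WittVector p k) :=
  (map_natCast (PowerSeries.C (R := WittVector p k)) p).symm

theorem frobS_natCast : frobS p k (p : Sring p k) = p := map_natCast _ _

theorem frobS_X : frobS p k PowerSeries.X = PowerSeries.X ^ p := by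
  change PowerSeries.expand p hp.out.ne_zero (PowerSeries.map _ PowerSeries.X) = _
  rw [PowerSeries.map_X, PowerSeries.expand_X]

theorem coeff_frobS (a : Sring p k) (n : ℕ) : PowerSeries.coeff n (frobS p k a)
    = if p ∣ n then WittVector.frobenius (PowerSeries.coeff (n / p) a) else 0 := by
  change PowerSeries.coeff n (PowerSeries.expand p hp.out.ne_zero (PowerSeries.map _ a)) = _
  rw [PowerSeries.coeff_expand, PowerSeries.coeff_map]

theorem constantCoeff_frobS (a : Sring p k) :
    PowerSeries.constantCoeff (frobS p k a) = WittVector.frobenius (PowerSeries.constantCoeff a) := by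
  rw [← PowerSeries.coeff_zero_eq_constantCoeff_apply, coeff_frobS]
  simp

theorem redS_surjective : Function.Surjective (redS p k) :=
  PowerSeries.map_surjective _ (WittVector.constantCoeff_surjective p)

theorem order_map_of_injective {R R' : Type*} [Semiring R] [Semiring R'] {f : R →+* R'}
    (hf : Function.Injective f) (a : R⟦X⟧) : (PowerSeries.map f a).order = a.order := by
  refine le_antisymm ?_ (PowerSeries.le_order_map f)
  refine PowerSeries.le_order _ _ fun i hi => hf ?_
  rw [map_zero, ← PowerSeries.coeff_map]
  exact PowerSeries.coeff_of_lt_order _ hi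

variable [PerfectRing k p]

theorem redS_eq_zero_iff {a : Sring p k} : redS p k a = 0 ↔ (p : Sring p k) ∣ a := by
  constructor
  · intro h
    have h1 : ∀ n, ∃ c, PowerSeries.coeff n a = (p : WittVector p k) * c := by
      intro n
      have h2 := congrArg (PowerSeries.coeff n) h
      rw [redS, PowerSeries.coeff_map, map_zero] at h2
      exact Ideal.mem_span_singleton.mp
        ((WittVector.mem_span_p_iff_coeff_zero_eq_zero _).mpr h2)
    choose c hc using h1
    refine ⟨PowerSeries.mk c, PowerSeries.ext fun n => ?_⟩
    rw [coe_natCast_eq_C, PowerSeries.coeff_C_mul, PowerSeries.coeff_mk, hc]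
  · rintro ⟨c, rfl⟩
    rw [map_mul, map_natCast, ← map_natCast (PowerSeries.C (R := k)), CharP.cast_eq_zero, map_zero,
      zero_mul]


theorem not_isUnit_p : ¬ IsUnit (p : Sring p k) := by
  intro h
  have h1 := h.map (redS p k)
  rw [redS_eq_zero_iff.mpr dvd_rfl] at h1
  exact not_isUnit_zero h1

theorem not_isUnit_X : ¬ IsUnit (PowerSeries.X : Sring p k) := by
  rw [PowerSeries.isUnit_iff_constantCoeff, PowerSeries.constantCoeff_X]
  exact not_isUnit_zero

theorem p_ne_zero : (p : Sring p k) ≠ 0 := by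
  rw [coe_natCast_eq_C, Ne, ← map_zero (PowerSeries.C (R := WittVector p k)),
    PowerSeries.C_injective.eq_iff]
  exact (WittVector.irreducible p).ne_zero

theorem p_prime : Prime (p : Sring p k) := by
  refine ⟨p_ne_zero, not_isUnit_p, fun a b h => ?_⟩
  rw [← redS_eq_zero_iff, map_mul, mul_eq_zero, redS_eq_zero_iff, redS_eq_zero_iff] at h
  exact h

theorem isUnit_of_redS_constantCoeff {a : Sring p k}
    (h : PowerSeries.constantCoeff (redS p k a) ≠ 0) : IsUnit a := by
  rw [PowerSeries.isUnit_iff_constantCoeff]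
  exact WittVector.isUnit_of_coeff_zero_ne_zero _ h

theorem maximalIdeal_S : IsLocalRing.maximalIdeal (Sring p k)
    = Ideal.span {(p : Sring p k), PowerSeries.X} := by
  refine le_antisymm (fun a ha => ?_) ?_
  · have h0 : PowerSeries.constantCoeff (redS p k a) = 0 := by
      by_contra h
      exact (IsLocalRing.mem_maximalIdeal a).mp ha (isUnit_of_redS_constantCoeff h)
    obtain ⟨b, hb⟩ := PowerSeries.X_dvd_iff.mpr h0
    obtain ⟨c, rfl⟩ := redS_surjective b
    have h1 : redS p k (a - PowerSeries.X * c) = 0 := by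
      rw [map_sub, map_mul, hb]
      simp [redS]
    obtain ⟨d, hd⟩ := redS_eq_zero_iff.mp h1
    rw [Ideal.mem_span_pair]
    exact ⟨d, c, by rw [mul_comm d, ← hd]; ring⟩
  · rw [Ideal.span_le]
    rintro _ (rfl | rfl)
    · exact (IsLocalRing.mem_maximalIdeal _).mpr not_isUnit_p
    · exact (IsLocalRing.mem_maximalIdeal _).mpr not_isUnit_X

theorem redS_X : redS p k PowerSeries.X = PowerSeries.X := PowerSeries.map_X _

theorem redS_frobS (a : Sring p k) : redS p k (frobS p k a)
    = PowerSeries.expand p hp.out.ne_zero (PowerSeries.map (frobenius k p) (redS p k a)) := by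
  refine PowerSeries.ext fun n => ?_
  rw [PowerSeries.coeff_expand, PowerSeries.coeff_map, redS, PowerSeries.coeff_map, coeff_frobS]
  split
  · rw [PowerSeries.coeff_map]
    change (WittVector.frobenius _).coeff 0 = frobenius k p (WittVector.coeff _ 0)
    rw [WittVector.coeff_frobenius_charP]
    rfl
  · rw [map_zero]

theorem order_redS_frobS (a : Sring p k) :
    (redS p k (frobS p k a)).order = p • (redS p k a).order := by
  rw [redS_frobS, PowerSeries.order_expand, order_map_of_injective (frobenius_inj k p)]

theorem order_frobS (a : Sring p k) : (frobS p k a).order = p • a.order := by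
  change (PowerSeries.expand p hp.out.ne_zero (PowerSeries.map _ a)).order = _
  rw [PowerSeries.order_expand, order_map_of_injective (WittVector.frobenius_bijective p k).1]

theorem frobS_injective : Function.Injective (frobS p k) := by
  rw [injective_iff_map_eq_zero]
  intro a ha
  have h := order_frobS a
  rw [ha, PowerSeries.order_zero] at h
  rw [← PowerSeries.order_eq_top]
  by_contra h1
  obtain ⟨n, hn⟩ := ENat.ne_top_iff_exists.mp h1
  rw [← hn, nsmul_eq_mul] at h
  exact ENat.natCast_ne_top (p * n) (by push_cast; exact h.symm)

/-- A nonzero ideal of `W(k)⟦u⟧` modulo which `p` is not a zero divisor is principal: it is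
generated by any of its elements whose reduction has minimal order. -/
theorem exists_eq_span_of_saturated {I : Ideal (Sring p k)}
    (hI : ∀ a, (p : Sring p k) * a ∈ I → a ∈ I) : ∃ d, I = Ideal.span {d} := by
  by_cases h0 : I = ⊥
  · exact ⟨0, by rw [h0, Ideal.span_singleton_zero]⟩
  -- By Nakayama and saturation, `I` does not vanish modulo `p`.
  have h1 : ∃ a ∈ I, redS p k a ≠ 0 := by
    by_contra! h
    refine h0 (le_bot_iff.mp (nakayama (Y := Sring p k) (a := (p : Sring p k)) not_isUnit_p
      fun y hy => ?_))
    obtain ⟨z, hz⟩ := redS_eq_zero_iff.mp (h y hy)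
    exact ⟨z, hI z (hz ▸ hy), by rw [hz, smul_eq_mul, sub_self]; exact zero_mem _⟩
  have h2 : ∃ n : ℕ, ∃ a ∈ I, (redS p k a).order = n := by
    obtain ⟨a, ha, h⟩ := h1
    obtain ⟨n, hn⟩ := ENat.ne_top_iff_exists.mp (mt PowerSeries.order_eq_top.mp h)
    exact ⟨n, a, ha, hn.symm⟩
  obtain ⟨d, hd, hn⟩ := Nat.find_spec h2
  refine ⟨d, le_antisymm ?_ ((Ideal.span_singleton_le_iff_mem I).mpr hd)⟩
  -- By Nakayama it suffices to generate `I` modulo `p`, in the discrete valuation ring `k⟦u⟧`.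
  refine nakayama (Y := Sring p k) (a := (p : Sring p k)) not_isUnit_p fun y hy => ?_
  have h3 : redS p k d ∣ redS p k y := by
    by_cases hy0 : redS p k y = 0
    · rw [hy0]
      exact dvd_zero _
    obtain ⟨m, hm⟩ := ENat.ne_top_iff_exists.mp (mt PowerSeries.order_eq_top.mp hy0)
    have h4 : Nat.find h2 ≤ m := Nat.find_min' h2 ⟨y, hy, hm.symm⟩
    have hd0 : redS p k d ≠ 0 := by
      intro h
      rw [h, PowerSeries.order_zero] at hn
      exact ENat.natCast_ne_top _ hn.symm
    have h5 : Associated (redS p k d) (PowerSeries.X ^ Nat.find h2) := by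
      have h6 := PowerSeries.X_pow_order_mul_divXPowOrder (f := redS p k d)
      rw [hn, ENat.toNat_natCast] at h6
      rw [← h6]
      exact associated_mul_unit_left _ _ (PowerSeries.isUnit_divided_by_X_pow_order hd0)
    refine h5.dvd.trans (PowerSeries.X_pow_dvd_iff.mpr fun i hi => ?_)
    refine PowerSeries.coeff_of_lt_order _ ?_
    rw [← hm]
    exact_mod_cast hi.trans_le h4
  obtain ⟨c, hc⟩ := h3
  obtain ⟨c, rfl⟩ := redS_surjective c
  have h6 : redS p k (y - d * c) = 0 := by
    rw [map_sub, map_mul, hc, sub_self]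
  obtain ⟨z, hz⟩ := redS_eq_zero_iff.mp h6
  refine ⟨z, hI z ?_, ?_⟩
  · rw [← hz]
    exact sub_mem hy (Ideal.mul_mem_right _ _ hd)
  · rw [smul_eq_mul, ← hz, sub_sub_cancel]
    exact Ideal.mul_mem_right _ _ (Ideal.mem_span_singleton_self d)

variable {E : (WittVector p k)[X]}

theorem IsEis.redS_coe (hE : IsEis E) :
    redS p k (E : Sring p k) = PowerSeries.X ^ E.natDegree := by
  refine PowerSeries.ext fun n => ?_
  rw [redS, PowerSeries.coeff_map, Polynomial.coeff_coe, PowerSeries.coeff_X_pow]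
  rcases lt_trichotomy n E.natDegree with h | h | h
  · rw [if_neg h.ne]
    exact (WittVector.mem_span_p_iff_coeff_zero_eq_zero _).mp (hE.eis.mem h)
  · rw [if_pos h, h, hE.monic.coeff_natDegree, map_one]
  · rw [if_neg h.ne', Polynomial.coeff_eq_zero_of_natDegree_lt h, map_zero]

theorem IsEis.constantCoeff_coe (hE : IsEis E) :
    ∃ w : (WittVector p k)ˣ, PowerSeries.constantCoeff (E : Sring p k) = p * w := by
  rw [← PowerSeries.coeff_zero_eq_constantCoeff_apply, Polynomial.coeff_coe]
  obtain ⟨w, hw⟩ := Ideal.mem_span_singleton.mp (hE.eis.mem hE.pos)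
  have h : IsUnit w := by
    refine WittVector.isUnit_of_coeff_zero_ne_zero w fun h0 => hE.eis.notMem ?_
    obtain ⟨t, rfl⟩ := Ideal.mem_span_singleton.mp
      ((WittVector.mem_span_p_iff_coeff_zero_eq_zero _).mpr h0)
    rw [hw, Ideal.span_singleton_pow, Ideal.mem_span_singleton]
    exact ⟨t, by ring⟩
  exact ⟨h.unit, hw⟩

theorem IsEis.dvd_X_pow_sub (hE : IsEis E) :
    (p : Sring p k) ∣ (E : Sring p k) - PowerSeries.X ^ E.natDegree := by
  rw [← redS_eq_zero_iff, map_sub, hE.redS_coe, map_pow, redS_X, sub_self]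

theorem IsEis.not_p_dvd (hE : IsEis E) : ¬ (p : Sring p k) ∣ (E : Sring p k) := by
  rw [← redS_eq_zero_iff, hE.redS_coe]
  exact pow_ne_zero _ PowerSeries.X_ne_zero

theorem IsEis.ne_zero (hE : IsEis E) : (E : Sring p k) ≠ 0 :=
  fun h => hE.not_p_dvd (h ▸ dvd_zero _)

theorem IsEis.not_isUnit (hE : IsEis E) : ¬ IsUnit (E : Sring p k) := by
  rw [PowerSeries.isUnit_iff_constantCoeff]
  obtain ⟨w, hw⟩ := hE.constantCoeff_coe
  rw [hw]
  exact fun h => (WittVector.irreducible p).not_isUnit (isUnit_of_mul_isUnit_left h)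

theorem IsEis.dvd_of_dvd_p_mul (hE : IsEis E) {a : Sring p k} (n : ℕ)
    (h : (E : Sring p k) ∣ (p : Sring p k) ^ n * a) : (E : Sring p k) ∣ a := by
  induction n with
  | zero => simpa using h
  | succ n ih =>
    refine ih ?_
    obtain ⟨b, hb⟩ := h
    have h1 : (p : Sring p k) ∣ E * b := ⟨(p : Sring p k) ^ n * a, by rw [← hb]; ring⟩
    obtain ⟨c, rfl⟩ := (p_prime.dvd_or_dvd h1).resolve_left hE.not_p_dvd
    refine ⟨c, mul_left_cancel₀ (p_ne_zero (p := p) (k := k)) ?_⟩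
    rw [← mul_assoc, ← pow_succ', hb]
    ring

/-- The ideal generated by `E` and an element not divisible by `E` contains a power of `p`. -/
theorem IsEis.exists_pow_eq (hE : IsEis E) {a : Sring p k} (ha : ¬ (E : Sring p k) ∣ a) :
    ∃ (n : ℕ) (s t : Sring p k), (p : Sring p k) ^ n = s * E + t * a := by
  -- The `p`-saturation of the ideal `(E, a)`. It is principal, generated by a divisor `d` of `E`.
  let I : Ideal (Sring p k) :=
    { carrier := {x | ∃ n : ℕ, (p : Sring p k) ^ n * x ∈ Ideal.span {(E : Sring p k), a}}
      zero_mem' := ⟨0, by simp⟩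
      add_mem' := by
        rintro x y ⟨n, hn⟩ ⟨m, hm⟩
        refine ⟨n + m, ?_⟩
        have h : (p : Sring p k) ^ (n + m) * (x + y) = (p : Sring p k) ^ m * ((p : Sring p k) ^ n * x)
            + (p : Sring p k) ^ n * ((p : Sring p k) ^ m * y) := by ring
        rw [h]
        exact Ideal.add_mem _ (Ideal.mul_mem_left _ _ hn) (Ideal.mul_mem_left _ _ hm)
      smul_mem' := by
        rintro c x ⟨n, hn⟩
        refine ⟨n, ?_⟩
        rw [smul_eq_mul, mul_left_comm]
        exact Ideal.mul_mem_left _ _ hn }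
  obtain ⟨d, hd⟩ := exists_eq_span_of_saturated (I := I)
    (fun x ⟨n, hn⟩ => ⟨n + 1, by rw [pow_succ, mul_assoc]; exact hn⟩)
  have hEI : (E : Sring p k) ∈ I :=
    ⟨0, by rw [pow_zero, one_mul]; exact Ideal.subset_span (Set.mem_insert _ _)⟩
  have haI : a ∈ I :=
    ⟨0, by rw [pow_zero, one_mul]; exact Ideal.subset_span (Set.mem_insert_of_mem _ rfl)⟩
  rw [hd, Ideal.mem_span_singleton] at hEI haI
  obtain ⟨c, hc⟩ := hEI
  -- The constant coefficient of `E` is irreducible, so `d` is a unit or associated to `E`; the latter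
  -- is excluded since `d` divides `a`.
  have hdu : IsUnit d := by
    obtain ⟨w, hw⟩ := hE.constantCoeff_coe
    rw [hc, map_mul] at hw
    have h1 : Irreducible ((p : WittVector p k) * w) :=
      (irreducible_mul_units w).mpr (WittVector.irreducible p)
    rw [← hw] at h1
    rcases h1.isUnit_or_isUnit rfl with h | h
    · rwa [PowerSeries.isUnit_iff_constantCoeff]
    · rw [← PowerSeries.isUnit_iff_constantCoeff] at h
      refine absurd (dvd_trans ?_ haI) ha
      rw [hc]
      exact (h.mul_right_dvd).mpr dvd_rfl
  obtain ⟨n, hn⟩ : (1 : Sring p k) ∈ I := by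
    rw [hd, Ideal.mem_span_singleton]
    exact hdu.dvd
  rw [mul_one, Ideal.mem_span_pair] at hn
  obtain ⟨s, t, h⟩ := hn
  exact ⟨n, s, t, h.symm⟩

theorem IsEis.prime (hE : IsEis E) : Prime (E : Sring p k) := by
  refine ⟨hE.ne_zero, hE.not_isUnit, fun a b h => ?_⟩
  by_contra! h'
  obtain ⟨n, s, t, h1⟩ := hE.exists_pow_eq h'.1
  refine h'.2 (hE.dvd_of_dvd_p_mul n ?_)
  rw [h1, add_mul, mul_assoc t]
  exact dvd_add ⟨s * b, by ring⟩ (Dvd.dvd.mul_left h t)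

theorem IsEis.mem_away (hE : IsEis E) {a : Sring p k} :
    a ∈ away (E : Sring p k) ↔ ¬ (E : Sring p k) ∣ a := mem_away_iff hE.prime a

theorem IsEis.pow_mem_away (hE : IsEis E) (n : ℕ) :
    (p : Sring p k) ^ n ∈ away (E : Sring p k) := by
  rw [hE.mem_away]
  intro h
  have := hE.dvd_of_dvd_p_mul (a := 1) n (by rwa [mul_one])
  exact hE.not_isUnit (isUnit_of_dvd_one this)

/-- `E ^ m ≡ u ^ (e m)` modulo `p ^ n` for `m` divisible by a large power of `p`. -/
theorem IsEis.pow_dvd_pow_sub (hE : IsEis E) (n m : ℕ) : (p : Sring p k) ^ n ∣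
    (E : Sring p k) ^ (p ^ n * m) - PowerSeries.X ^ (E.natDegree * (p ^ n * m)) := by
  rw [pow_mul, pow_mul, pow_mul]
  refine dvd_trans ?_ (sub_dvd_pow_sub_pow _ _ m)
  exact (pow_dvd_pow _ n.le_succ).trans (dvd_sub_pow_of_dvd_sub hE.dvd_X_pow_sub n)

/-! The decomposition `𝔖 = ⨁ u ^ j φ(𝔖)`, for `0 ≤ j < p`. -/

/-- The coefficients of an element of `W(k)⟦u⟧` in the basis `1, u, …, u ^ (p - 1)` over the image
of the Frobenius. -/
def frobCoeff (j : Fin p) (a : Sring p k) : Sring p k :=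
  PowerSeries.mk fun i => (WittVector.frobeniusEquiv p k).symm (PowerSeries.coeff (p * i + j) a)

theorem coeff_sum_X_pow_mul_frobS (c : Fin p → Sring p k) (i : ℕ) (l : Fin p) :
    PowerSeries.coeff (p * i + l) (∑ j : Fin p, PowerSeries.X ^ (j : ℕ) * frobS p k (c j))
      = WittVector.frobenius (PowerSeries.coeff i (c l)) := by
  rw [map_sum, Finset.sum_eq_single l]
  · rw [PowerSeries.coeff_X_pow_mul, coeff_frobS, if_pos ⟨i, rfl⟩,
      Nat.mul_div_cancel_left _ hp.out.pos]
  · intro j _ hj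
    rw [PowerSeries.coeff_X_pow_mul']
    split
    · rename_i h
      rw [coeff_frobS, if_neg]
      rintro ⟨t, ht⟩
      have h1 : p * i + (l : ℕ) = p * t + j := by omega
      have h2 := congrArg (· % p) h1
      simp only [Nat.mul_add_mod, Nat.mod_eq_of_lt l.2, Nat.mod_eq_of_lt j.2] at h2
      exact hj (Fin.ext h2.symm)
    · rfl
  · exact fun h => absurd (Finset.mem_univ _) h

theorem sum_frobCoeff (a : Sring p k) :
    ∑ j : Fin p, PowerSeries.X ^ (j : ℕ) * frobS p k (frobCoeff j a) = a := by
  refine PowerSeries.ext fun n => ?_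
  have h := coeff_sum_X_pow_mul_frobS (fun j => frobCoeff j a) (n / p)
    ⟨n % p, Nat.mod_lt _ hp.out.pos⟩
  rw [show p * (n / p) + ((⟨n % p, Nat.mod_lt _ hp.out.pos⟩ : Fin p) : ℕ) = n from
    Nat.div_add_mod n p] at h
  rw [h, frobCoeff, PowerSeries.coeff_mk, Nat.div_add_mod]
  exact (WittVector.frobeniusEquiv p k).apply_symm_apply _

/-- `𝔖` is free of rank `p` over itself via the Frobenius. -/
def frobBasis : (Fin p → Sring p k) ≃ₗ[Sring p k] Twist (frobS p k) (Sring p k) :=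
  LinearEquiv.ofBijective
    { toFun := fun c => (Twist.equiv.symm (∑ j : Fin p, PowerSeries.X ^ (j : ℕ) * frobS p k (c j)) :
        Twist (frobS p k) (Sring p k))
      map_add' := fun c d => by
        rw [← map_add, ← Finset.sum_add_distrib]
        simp only [Pi.add_apply, map_add, mul_add]
      map_smul' := fun s c => by
        apply Twist.equiv.injective
        rw [RingHom.id_apply, Twist.equiv_smul, AddEquiv.apply_symm_apply,
          AddEquiv.apply_symm_apply, smul_eq_mul, Finset.mul_sum]
        refine Finset.sum_congr rfl fun j _ => ?_
        rw [Pi.smul_apply, smul_eq_mul, map_mul]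
        ring }
    (by
      constructor
      · intro c d h
        have h1 : ∑ j : Fin p, PowerSeries.X ^ (j : ℕ) * frobS p k (c j)
          = ∑ j : Fin p, PowerSeries.X ^ (j : ℕ) * frobS p k (d j) := h
        funext l
        refine PowerSeries.ext fun i => (WittVector.frobenius_bijective p k).1 ?_
        rw [← coeff_sum_X_pow_mul_frobS, ← coeff_sum_X_pow_mul_frobS, h1]
      · intro a
        exact ⟨fun j => frobCoeff j (Twist.equiv a), sum_frobCoeff (Twist.equiv a)⟩)

instance : Module.Free (Sring p k) (Twist (frobS p k) (Sring p k)) :=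
  Module.Free.of_equiv frobBasis

instance : Module.Finite (Sring p k) (Twist (frobS p k) (Sring p k)) :=
  Module.Finite.equiv frobBasis

/-- The linearization of the Frobenius is defined on an exact functor of `M`: `𝔖[1/E]` is flat over
`𝔖` via the Frobenius, as `𝔖` is free over its image. -/
instance flat_twist (e : Sring p k) :
    Module.Flat (Sring p k) (Twist (frobS p k) (Localization.Away e)) := by
  have h1 : (frobS p k).Flat := by
    let _ := (frobS p k).toAlgebra
    have : Module.Flat (Sring p k) (Twist (frobS p k) (Sring p k)) := inferInstance
    exact this
  have h2 : (algebraMap (Sring p k) (Localization.Away e)).Flat := by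
    rw [RingHom.flat_algebraMap_iff]
    exact IsLocalization.flat _ (Submonoid.powers e)
  refine (congrArg (fun m : Module (Sring p k) (Localization.Away e) =>
    @Module.Flat (Sring p k) (Localization.Away e) _ _ m) ?_).mp (RingHom.Flat.comp h1 h2)
  refine Module.ext' _ _ fun a x => ?_
  exact (Algebra.smul_def (frobS p k a) x).symm

end Ring

end Kisin

end

noncomputable section

namespace Kisin

/-! ### Lengths of finitely generated modules over `W(k)⟦u⟧` -/

section QuoSmul

variable {A : Type u} [CommRing A] (lam : LengthFn.{u, w} A)
variable {V V' V'' : Type w} [AddCommGroup V] [Module A V] [AddCommGroup V'] [Module A V']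
  [AddCommGroup V''] [Module A V'']

theorem LengthFn.quo_top (K : Submodule A V) : lam.quo K ⊤ = lam.toFun (V ⧸ K) := by
  refine lam.quo_eq_of_surjective (K.mkQ ∘ₗ Submodule.subtype ⊤) ?_ ?_
  · intro y
    obtain ⟨x, rfl⟩ := K.mkQ_surjective y
    exact ⟨⟨x, trivial⟩, rfl⟩
  · ext x
    rw [LinearMap.mem_ker, LinearMap.comp_apply, Submodule.mkQ_apply, Submodule.Quotient.mk_eq_zero]
    rfl

theorem LengthFn.quo_smul_congr (a : A) (e : V ≃ₗ[A] V') :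
    lam.quo (a • ⊤ : Submodule A V) ⊤ = lam.quo (a • ⊤ : Submodule A V') ⊤ := by
  rw [← lam.quo_map (f := e.toLinearMap) e.injective, Submodule.map_pointwise_smul, Submodule.map_top,
    LinearMap.range_eq_top.mpr e.surjective]

/-- Additivity of the length of `V / a V` when `a` is not a zero divisor on the quotient. -/
theorem LengthFn.quo_smul_exact {f : V' →ₗ[A] V} {g : V →ₗ[A] V''} (hf : Function.Injective f)
    (hg : Function.Surjective g) (hex : Function.Exact f g) {a : A}
    (ha : ∀ x : V'', a • x = 0 → x = 0) :
    lam.quo (a • ⊤ : Submodule A V) ⊤ = lam.quo (a • ⊤ : Submodule A V') ⊤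
      + lam.quo (a • ⊤ : Submodule A V'') ⊤ := by
  rw [lam.quo_exact hex le_top, Submodule.map_pointwise_smul, Submodule.map_top,
    LinearMap.range_eq_top.mpr hg, Submodule.comap_top]
  congr 2
  ext x
  constructor
  · rintro ⟨y, -, hy⟩
    change a • y = f x at hy
    obtain ⟨z, rfl⟩ := (hex y).mp (ha _ (by rw [← map_smul, hy, hex.apply_apply_eq_zero]))
    rw [← map_smul] at hy
    exact ⟨z, trivial, hf hy⟩
  · rintro ⟨y, -, rfl⟩
    exact ⟨f y, trivial, (map_smul f a y).symm⟩

theorem LengthFn.quo_smul_smul {a : A} (ha : ∀ x : V, a • x = 0 → x = 0) (K L : Submodule A V) :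
    lam.quo (a • K) (a • L) = lam.quo K L := by
  have h : ∀ K : Submodule A V, a • K = K.map (DistribSMul.toLinearMap A V a) := fun K => rfl
  rw [h, h]
  refine lam.quo_map ?_ K L
  rw [injective_iff_map_eq_zero]
  exact ha

theorem smul_submodule_le (a : A) (L : Submodule A V) : a • L ≤ L := by
  rintro _ ⟨x, hx, rfl⟩
  exact L.smul_mem a hx

theorem LengthFn.quo_pow_smul {a : A} (ha : ∀ x : V, a • x = 0 → x = 0) (n : ℕ)
    (L : Submodule A V) : lam.quo (a ^ n • L) L = n * lam.quo (a • L) L := by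
  induction n with
  | zero => rw [pow_zero, one_smul, quo_self, Nat.cast_zero, zero_mul]
  | succ n ih =>
    have han : ∀ x : V, a ^ n • x = 0 → x = 0 := by
      clear ih
      induction n with
      | zero => intro x hx; rwa [pow_zero, one_smul] at hx
      | succ n ih => intro x hx; exact ih x (ha _ (by rwa [smul_smul, ← pow_succ']))
    have h1 : a ^ (n + 1) • L = a ^ n • (a • L) := by rw [smul_smul, pow_succ]
    rw [lam.quo_add (L := a ^ n • L) _ (smul_submodule_le _ _), h1, lam.quo_smul_smul han, ih]
    · push_cast
      ring
    · rw [h1]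
      exact smul_mono_right _ (smul_submodule_le _ _)

end QuoSmul

section Lengths

variable {p : ℕ} [hp : Fact p.Prime] {k : Type u} [Field k] [CharP k p] [PerfectRing k p]

/-- Finitely generated modules over `W(k)⟦u⟧` are complete for the `p`-adic topology. -/
theorem exists_sum_pow_smul {Y : Type v} [AddCommGroup Y] [Module (Sring p k) Y]
    [Module.Finite (Sring p k) Y] (z : ℕ → Y) : ∃ y : Y, ∀ n : ℕ, ∃ t : Y,
      y = ∑ i ∈ Finset.range n, (p : Sring p k) ^ i • z i + (p : Sring p k) ^ n • t := by
  -- First for `W(k)`, then coefficientwise for `W(k)⟦u⟧`, then for a quotient of a free module.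
  have hW : ∀ c : ℕ → WittVector p k, ∃ y, ∀ n : ℕ, ∃ t,
      y = ∑ i ∈ Finset.range n, (p : WittVector p k) ^ i * c i + (p : WittVector p k) ^ n * t := by
    intro c
    have hc : IsPrecomplete (Ideal.span {(p : WittVector p k)}) (WittVector p k) := inferInstance
    have hmem : ∀ (n : ℕ) (x : WittVector p k), x ∈ (Ideal.span {(p : WittVector p k)} ^ n •
        (⊤ : Submodule (WittVector p k) (WittVector p k))) ↔ ∃ t, x = (p : WittVector p k) ^ n * t := by
      intro n x
      rw [Ideal.span_singleton_pow, smul_eq_mul, Ideal.mul_top, Ideal.mem_span_singleton]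
      rfl
    obtain ⟨L, hL⟩ := hc.prec
      (f := fun n => ∑ i ∈ Finset.range n, (p : WittVector p k) ^ i * c i) (by
        intro m n hmn
        rw [SModEq.sub_mem, ← neg_sub, neg_mem_iff, ← Finset.sum_Ico_eq_sub _ hmn, hmem]
        refine ⟨∑ i ∈ Finset.Ico m n, (p : WittVector p k) ^ (i - m) * c i, ?_⟩
        rw [Finset.mul_sum]
        refine Finset.sum_congr rfl fun i hi => ?_
        rw [← mul_assoc, ← pow_add, Nat.add_sub_cancel' (Finset.mem_Ico.mp hi).1])
    refine ⟨L, fun n => ?_⟩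
    have h := hL n
    rw [SModEq.sub_mem, ← neg_sub, neg_mem_iff, hmem] at h
    obtain ⟨t, ht⟩ := h
    exact ⟨t, by rw [← ht, add_sub_cancel]⟩
  have hS : ∀ c : ℕ → Sring p k, ∃ y, ∀ n : ℕ, ∃ t,
      y = ∑ i ∈ Finset.range n, (p : Sring p k) ^ i * c i + (p : Sring p k) ^ n * t := by
    intro c
    choose L t ht using fun m => hW fun i => PowerSeries.coeff m (c i)
    refine ⟨PowerSeries.mk L, fun n => ⟨PowerSeries.mk fun m => t m n, PowerSeries.ext fun m => ?_⟩⟩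
    rw [PowerSeries.coeff_mk, map_add, map_sum, ht m n]
    simp only [coe_natCast_eq_C, ← map_pow, PowerSeries.coeff_C_mul, PowerSeries.coeff_mk]
  obtain ⟨r, f, hf⟩ := Module.Finite.exists_fin' (Sring p k) Y
  choose c hc using fun i => hf (z i)
  choose L t ht using fun j => hS fun i => c i j
  refine ⟨f L, fun n => ⟨f fun j => t j n, ?_⟩⟩
  simp only [← hc, ← map_smul, ← map_sum, ← map_add]
  congr 1
  funext j
  rw [ht j n]
  simp [Finset.sum_apply]

variable {E : (WittVector p k)[X]}

theorem IsEis.exists_p_eq (hE : IsEis E) : ∃ c d : Sring p k,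
    (p : Sring p k) = c * (E : Sring p k) + d * PowerSeries.X ^ E.natDegree ∧ IsUnit d := by
  obtain ⟨c, hc⟩ := hE.dvd_X_pow_sub
  have hu : IsUnit c := by
    rw [PowerSeries.isUnit_iff_constantCoeff]
    obtain ⟨w, hw⟩ := hE.constantCoeff_coe
    have h1 := congrArg PowerSeries.constantCoeff hc
    rw [map_sub, hw, map_pow, PowerSeries.constantCoeff_X, zero_pow hE.pos.ne', sub_zero, map_mul,
      map_natCast] at h1
    rw [← mul_left_cancel₀ (WittVector.irreducible p).ne_zero h1]
    exact w.isUnit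
  obtain ⟨b, hb⟩ := hu.exists_right_inv
  refine ⟨b, -b, ?_, (IsUnit.of_mul_eq_one _ ((mul_comm _ _).trans hb)).neg⟩
  have : (p : Sring p k) = b * ((E : Sring p k) - PowerSeries.X ^ E.natDegree) := by
    rw [hc]
    calc (p : Sring p k) = p * (c * b) := by rw [hb, mul_one]
      _ = _ := by ring
  rw [this]
  ring

theorem IsEis.X_mul_sub_ne_one (hE : IsEis E) (b c : Sring p k) :
    PowerSeries.X * b - (E : Sring p k) * c ≠ 1 := by
  intro h
  have h1 : IsUnit (PowerSeries.X * b - (E : Sring p k) * c) := h ▸ isUnit_one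
  exact (IsLocalRing.mem_maximalIdeal _).mp (Ideal.sub_mem _
    (Ideal.mul_mem_right _ _ ((IsLocalRing.mem_maximalIdeal _).mpr not_isUnit_X))
    (Ideal.mul_mem_right _ _ ((IsLocalRing.mem_maximalIdeal _).mpr hE.not_isUnit))) h1

/-- The discrete valuation ring `W(k)⟦u⟧ / E`. -/
abbrev EisQuot (E : (WittVector p k)[X]) : Type u := Sring p k ⧸ Ideal.span {(E : Sring p k)}

theorem eisQuot_smul_eq_zero (x : EisQuot E) : (E : Sring p k) • x = 0 := by
  obtain ⟨a, rfl⟩ := Submodule.mkQ_surjective _ x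
  exact (Submodule.Quotient.mk_eq_zero _).mpr (Ideal.mem_span_singleton.mpr ⟨a, rfl⟩)

theorem IsEis.isDomain (hE : IsEis E) : IsDomain (EisQuot E) :=
  (Ideal.Quotient.isDomain_iff_prime _).mpr ((Ideal.span_singleton_prime hE.ne_zero).mpr hE.prime)

theorem IsEis.isPrincipalIdealRing (hE : IsEis E) : IsPrincipalIdealRing (EisQuot E) := by
  have := hE.isDomain
  have hloc : IsLocalRing (EisQuot E) :=
    IsLocalRing.of_surjective' (Ideal.Quotient.mk _) Ideal.Quotient.mk_surjective
  refine ((tfae_of_isNoetherianRing_of_isLocalRing_of_isDomain (EisQuot E)).out 0 4).mpr ?_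
  refine ⟨Ideal.Quotient.mk _ PowerSeries.X, le_antisymm ?_ ?_⟩
  · intro x hx
    obtain ⟨a, rfl⟩ := Ideal.Quotient.mk_surjective x
    have h1 : a ∈ IsLocalRing.maximalIdeal (Sring p k) :=
      (IsLocalRing.mem_maximalIdeal a).mpr
        fun h => (IsLocalRing.mem_maximalIdeal _).mp hx (h.map _)
    rw [maximalIdeal_S, Ideal.mem_span_pair] at h1
    obtain ⟨s, t, rfl⟩ := h1
    obtain ⟨c, d, h2, -⟩ := hE.exists_p_eq
    obtain ⟨e, he⟩ := Nat.exists_eq_succ_of_ne_zero hE.pos.ne'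
    refine Ideal.mem_span_singleton.mpr ⟨Ideal.Quotient.mk _ (s * d * PowerSeries.X ^ e + t), ?_⟩
    rw [← map_mul, Ideal.Quotient.eq, Ideal.mem_span_singleton, h2, he]
    exact ⟨s * c, by rw [pow_succ]; ring⟩
  · rw [Submodule.span_singleton_le_iff_mem, IsLocalRing.mem_maximalIdeal]
    intro h
    obtain ⟨y, hy⟩ := h.exists_right_inv
    obtain ⟨b, rfl⟩ := Ideal.Quotient.mk_surjective y
    rw [← map_mul, ← map_one (Ideal.Quotient.mk _), Ideal.Quotient.eq, Ideal.mem_span_singleton] at hy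
    obtain ⟨c, hc⟩ := hy
    exact hE.X_mul_sub_ne_one b c (by rw [← hc, sub_sub_cancel])

theorem IsEis.length_quo_X (hE : IsEis E) : (lengthFn.{u, u} (Sring p k)).quo
    ((PowerSeries.X : Sring p k) • (⊤ : Submodule (Sring p k) (EisQuot E))) ⊤ = 1 := by
  rw [LengthFn.quo_top]
  refine (Module.length_eq_one_iff).mpr (isSimpleModule_iff_quot_maximal.mpr
    ⟨IsLocalRing.maximalIdeal (Sring p k), inferInstance, ?_⟩)
  let g : Sring p k →ₗ[Sring p k] EisQuot E ⧸ ((PowerSeries.X : Sring p k) •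
      (⊤ : Submodule (Sring p k) (EisQuot E))) :=
    Submodule.mkQ _ ∘ₗ (Ideal.span {(E : Sring p k)}).mkQ
  have hg : Function.Surjective g := (Submodule.mkQ_surjective _).comp (Submodule.mkQ_surjective _)
  have hk : LinearMap.ker g = IsLocalRing.maximalIdeal (Sring p k) := by
    refine ((IsLocalRing.maximalIdeal.isMaximal _).eq_of_le (fun h => ?_) ?_).symm
    · have h1 : (1 : Sring p k) ∈ LinearMap.ker g := h ▸ trivial
      have h2 := (Submodule.Quotient.mk_eq_zero _).mp (LinearMap.mem_ker.mp h1)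
      obtain ⟨y, -, hy⟩ := h2
      obtain ⟨b, rfl⟩ := Submodule.mkQ_surjective _ y
      have h3 := (Submodule.Quotient.eq _).mp hy
      rw [Ideal.mem_span_singleton] at h3
      obtain ⟨c, hc⟩ := h3
      exact hE.X_mul_sub_ne_one b c (by rw [← hc]; exact sub_sub_cancel _ _)
    · rw [maximalIdeal_S, Ideal.span_le]
      have hX : (PowerSeries.X : Sring p k) ∈ LinearMap.ker g :=
        (Submodule.Quotient.mk_eq_zero _).mpr
          ⟨(Ideal.span {(E : Sring p k)}).mkQ 1, trivial, by
            refine ((Ideal.span {(E : Sring p k)}).mkQ.map_smul PowerSeries.X 1).symm.trans ?_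
            rw [smul_eq_mul, mul_one]⟩
      have hE' : (E : Sring p k) ∈ LinearMap.ker g := by
        rw [LinearMap.mem_ker, LinearMap.comp_apply, Submodule.mkQ_apply _ (E : Sring p k),
          (Submodule.Quotient.mk_eq_zero _).mpr (Ideal.mem_span_singleton_self _), map_zero]
      rintro _ (rfl | rfl)
      · obtain ⟨c, d, h2, -⟩ := hE.exists_p_eq
        obtain ⟨e, he⟩ := Nat.exists_eq_succ_of_ne_zero hE.pos.ne'
        rw [SetLike.mem_coe, h2, he, pow_succ, ← mul_assoc]
        exact Submodule.add_mem _ (Submodule.smul_mem _ _ hE') (Submodule.smul_mem _ _ hX)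
      · exact hX
  exact ⟨((Submodule.quotEquivOfEq _ _ hk.symm).trans (g.quotKerEquivOfSurjective hg)).symm⟩

/-- In `W(k)⟦u⟧ / E`, the element `p` is a unit times `u ^ e`. -/
theorem IsEis.length_quo_p (hE : IsEis E) : (lengthFn.{u, u} (Sring p k)).quo
    ((p : Sring p k) • (⊤ : Submodule (Sring p k) (EisQuot E))) ⊤ = E.natDegree := by
  have h1 : (p : Sring p k) • (⊤ : Submodule (Sring p k) (EisQuot E))
      = (PowerSeries.X : Sring p k) ^ E.natDegree • ⊤ := by
    obtain ⟨c, d, h2, hd⟩ := hE.exists_p_eq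
    obtain ⟨b, hb⟩ := hd.exists_right_inv
    have h3 : ∀ x : EisQuot E, (p : Sring p k) • x = (PowerSeries.X : Sring p k) ^ E.natDegree • d • x := by
      intro x
      rw [h2, add_smul, mul_smul, eisQuot_smul_eq_zero, smul_zero, zero_add, mul_comm, mul_smul]
    ext y
    constructor
    · rintro ⟨x, -, rfl⟩
      exact ⟨d • x, trivial, (h3 x).symm⟩
    · rintro ⟨x, -, rfl⟩
      refine ⟨b • x, trivial, ?_⟩
      change (p : Sring p k) • b • x = _
      rw [h3, smul_smul d, hb, one_smul]
      rfl
  rw [h1, LengthFn.quo_pow_smul, hE.length_quo_X, mul_one]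
  -- Multiplication by `u` is injective on `W(k)⟦u⟧ / E`: the prime element `E` does not divide `u`, by
  -- comparison of the constant coefficients.
  intro x hx
  obtain ⟨a, rfl⟩ := Submodule.mkQ_surjective _ x
  rw [← map_smul] at hx
  have h4 := Ideal.mem_span_singleton.mp ((Submodule.Quotient.mk_eq_zero _).mp hx)
  refine (Submodule.Quotient.mk_eq_zero _).mpr (Ideal.mem_span_singleton.mpr
    ((hE.prime.dvd_or_dvd h4).resolve_left fun h5 => ?_))
  have h6 := map_dvd PowerSeries.constantCoeff h5
  obtain ⟨c, hc⟩ := h5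
  have h7 := congrArg (redS p k) hc
  have h8 := congrArg PowerSeries.constantCoeff hc
  obtain ⟨w, hw⟩ := hE.constantCoeff_coe
  rw [PowerSeries.constantCoeff_X, map_mul, hw] at h8
  have h9 : PowerSeries.constantCoeff c = 0 := by
    rcases mul_eq_zero.mp h8.symm with h | h
    · exact absurd h (mul_ne_zero (WittVector.irreducible p).ne_zero w.ne_zero)
    · exact h
  obtain ⟨c', rfl⟩ := PowerSeries.X_dvd_iff.mpr h9
  refine hE.not_isUnit (IsUnit.of_mul_eq_one c' (mul_left_cancel₀
    (PowerSeries.X_ne_zero (R := WittVector p k)) ?_))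
  rw [mul_one]
  refine Eq.trans ?_ hc.symm
  ring

theorem IsEis.localLength_eisQuot (hE : IsEis E) :
    (localLengthFn.{u, u} (away (E : Sring p k))).toFun (EisQuot E) = 1 := by
  refine Module.length_eq_one_iff.mpr (isSimpleModule_iff_toSpanSingleton_surjective.mpr ⟨?_, ?_⟩)
  · refine ⟨⟨LocalizedModule.mk (Submodule.Quotient.mk 1) 1, 0, fun h => ?_⟩⟩
    rw [← LocalizedModule.zero_mk (1 : away (E : Sring p k)), LocalizedModule.mk_eq] at h
    obtain ⟨⟨s, hs⟩, h⟩ := h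
    rw [one_smul, smul_zero, smul_zero] at h
    have h1 := (Submodule.Quotient.mk_eq_zero _).mp h
    have h2 : s • (1 : Sring p k) ∈ Ideal.span {(E : Sring p k)} := h1
    rw [smul_eq_mul, mul_one, Ideal.mem_span_singleton] at h2
    exact hE.mem_away.mp hs h2
  · intro y hy z
    induction y with
    | h m s =>
    induction z with
    | h n t =>
    obtain ⟨a, rfl⟩ := Submodule.mkQ_surjective _ m
    obtain ⟨b, rfl⟩ := Submodule.mkQ_surjective _ n
    have ha : a ∈ away (E : Sring p k) := by
      rw [hE.mem_away]
      intro h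
      refine hy ?_
      have : (Ideal.span {(E : Sring p k)}).mkQ a = 0 :=
        (Submodule.Quotient.mk_eq_zero _).mpr (Ideal.mem_span_singleton.mpr h)
      rw [this, LocalizedModule.zero_mk]
    refine ⟨Localization.mk ((s : Sring p k) * b) (⟨a, ha⟩ * t), ?_⟩
    rw [LinearMap.toSpanSingleton_apply, LocalizedModule.mk_smul_mk, LocalizedModule.mk_eq]
    refine ⟨1, ?_⟩
    rw [one_smul, one_smul, ← map_smul]
    change (Ideal.span {(E : Sring p k)}).mkQ ((t : Sring p k) • _)
      = (Ideal.span {(E : Sring p k)}).mkQ ((a * (t : Sring p k) * (s : Sring p k)) • b)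
    congr 1
    simp only [smul_eq_mul]
    ring

theorem IsEis.eisQuot_p_smul (hE : IsEis E) {x : EisQuot E} (hx : (p : Sring p k) • x = 0) :
    x = 0 := by
  obtain ⟨a, rfl⟩ := Submodule.mkQ_surjective _ x
  rw [← map_smul] at hx
  have h4 := Ideal.mem_span_singleton.mp ((Submodule.Quotient.mk_eq_zero _).mp hx)
  exact (Submodule.Quotient.mk_eq_zero _).mpr (Ideal.mem_span_singleton.mpr
    (hE.dvd_of_dvd_p_mul 1 (by rwa [pow_one])))

/-- For a finitely generated module killed by a power of `E` and without `p`-torsion, the length of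
`Q / p Q` is `e` times the length of `Q` at `(E)`: by dévissage this reduces to the case of
`W(k)⟦u⟧ / E`. -/
theorem IsEis.length_quo_p_eq (hE : IsEis E) {Q : Type (max u v)} [AddCommGroup Q]
    [Module (Sring p k) Q] [Module.Finite (Sring p k) Q] (n : ℕ)
    (hn : ∀ x : Q, (E : Sring p k) ^ n • x = 0) (hp0 : ∀ x : Q, (p : Sring p k) • x = 0 → x = 0) :
    (localLengthFn.{u, max u v} (away (E : Sring p k))).toFun Q ≠ ⊤ ∧
    (lengthFn.{u, max u v} (Sring p k)).quo ((p : Sring p k) • (⊤ : Submodule (Sring p k) Q)) ⊤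
      = E.natDegree * (localLengthFn.{u, max u v} (away (E : Sring p k))).toFun Q := by
  -- The assertion holds for free modules over `W(k)⟦u⟧ / E`.
  let T : ℕ → Type (max u v) := fun r => Fin r → ULift.{max u v} (EisQuot E)
  have hT : ∀ r (x : T r), (p : Sring p k) • x = 0 → x = 0 := fun r x hx => by
    funext i
    have h1 : (p : Sring p k) • (x i).down = 0 := congrArg ULift.down (congrFun hx i)
    exact ULift.ext _ _ (hE.eisQuot_p_smul h1)
  have hfree : ∀ r : ℕ, (localLengthFn.{u, max u v} (away (E : Sring p k))).toFun (T r) ≠ ⊤ ∧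
      (lengthFn.{u, max u v} (Sring p k)).quo ((p : Sring p k) •
        (⊤ : Submodule (Sring p k) (T r))) ⊤ = E.natDegree *
      (localLengthFn.{u, max u v} (away (E : Sring p k))).toFun (T r) := by
    intro r
    induction r with
    | zero =>
      have : Subsingleton (T 0) := inferInstanceAs (Subsingleton (Fin 0 → ULift (EisQuot E)))
      rw [LengthFn.quo_top, LengthFn.of_subsingleton, LengthFn.of_subsingleton]
      exact ⟨ENat.zero_ne_top, (mul_zero _).symm⟩
    | succ r ih =>
      let f : ULift.{max u v} (EisQuot E) →ₗ[Sring p k] T (r + 1) :=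
        LinearMap.pi (Fin.cases LinearMap.id fun _ => 0)
      let g : T (r + 1) →ₗ[Sring p k] T r :=
        LinearMap.funLeft (Sring p k) (ULift.{max u v} (EisQuot E)) Fin.succ
      have hf : Function.Injective f := fun x y h => congrFun h 0
      have hg : Function.Surjective g :=
        LinearMap.funLeft_surjective_of_injective _ _ _ (Fin.succ_injective r)
      have hfg : Function.Exact f g := by
        intro x
        constructor
        · intro hx
          refine ⟨x 0, ?_⟩
          funext i
          refine Fin.cases ?_ (fun j => ?_) i
          · rfl
          · exact (congrFun hx j).symm
        · rintro ⟨y, rfl⟩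
          rfl
      have hl : (localLengthFn.{u, max u v} (away (E : Sring p k))).toFun
          (ULift.{max u v} (EisQuot E)) = 1 := by
        have e : ULift.{max u v} (EisQuot E) ≃ₗ[Sring p k] EisQuot E := ULift.moduleEquiv
        have h : Function.Bijective (LocalizedModule.map (away (E : Sring p k)) e.toLinearMap) :=
          ⟨LocalizedModule.map_injective _ _ e.injective,
            LocalizedModule.map_surjective _ _ e.surjective⟩
        exact ((LinearEquiv.ofBijective _ h).length_eq).trans hE.localLength_eisQuot
      have hq : (lengthFn.{u, max u v} (Sring p k)).quo ((p : Sring p k) •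
          (⊤ : Submodule (Sring p k) (ULift.{max u v} (EisQuot E)))) ⊤ = E.natDegree := by
        have e : ULift.{max u v} (EisQuot E) ≃ₗ[Sring p k] EisQuot E := ULift.moduleEquiv
        rw [← hE.length_quo_p, LengthFn.quo_top, LengthFn.quo_top]
        refine (Submodule.Quotient.equiv _ _ e ?_).length_eq
        change Submodule.map e.toLinearMap _ = _
        rw [Submodule.map_pointwise_smul, Submodule.map_top, LinearMap.range_eq_top.mpr e.surjective]
      rw [LengthFn.exact _ f g hf hg hfg, LengthFn.quo_smul_exact _ hf hg hfg (hT r), hl, hq, ih.2]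
      refine ⟨?_, by rw [mul_add, mul_one]⟩
      rw [Ne, ENat.add_eq_top, not_or]
      exact ⟨ENat.one_ne_top, ih.1⟩
  -- Multiplication by `E` presents `Q` as an extension of `E Q` by its kernel, which is a torsion-free
  -- module over the principal ideal domain `W(k)⟦u⟧ / E`, hence free.
  induction n generalizing Q with
  | zero =>
    have : Subsingleton Q := subsingleton_of_forall_eq 0 fun x => by
      have := hn x
      rwa [pow_zero, one_smul] at this
    rw [LengthFn.quo_top, LengthFn.of_subsingleton, LengthFn.of_subsingleton]
    exact ⟨ENat.zero_ne_top, (mul_zero _).symm⟩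
  | succ n ih =>
    let f : Q →ₗ[Sring p k] Q := DistribSMul.toLinearMap (Sring p k) Q (E : Sring p k)
    have hK := LengthFn.exact (localLengthFn.{u, max u v} (away (E : Sring p k)))
      (LinearMap.ker f).subtype f.rangeRestrict (Submodule.injective_subtype _)
      (LinearMap.surjective_rangeRestrict f) (by
        rw [LinearMap.exact_iff, LinearMap.ker_rangeRestrict, Submodule.range_subtype])
    have hK' := (lengthFn.{u, max u v} (Sring p k)).quo_smul_exact
      (Submodule.injective_subtype (LinearMap.ker f))
      (LinearMap.surjective_rangeRestrict f) (by
        rw [LinearMap.exact_iff, LinearMap.ker_rangeRestrict, Submodule.range_subtype])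
      (a := (p : Sring p k)) (fun x hx => Subtype.ext (hp0 _ (congrArg Subtype.val hx)))
    obtain ⟨h1, h2⟩ := ih (Q := LinearMap.range f) (by
        rintro ⟨_, x, rfl⟩
        refine Subtype.ext ?_
        change (E : Sring p k) ^ n • (E : Sring p k) • x = 0
        rw [smul_smul, ← pow_succ, hn])
      (fun x hx => Subtype.ext (hp0 _ (congrArg Subtype.val hx)))
    obtain ⟨h3, h4⟩ : (localLengthFn.{u, max u v} (away (E : Sring p k))).toFun (LinearMap.ker f) ≠ ⊤ ∧
        (lengthFn.{u, max u v} (Sring p k)).quo ((p : Sring p k) •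
          (⊤ : Submodule (Sring p k) (LinearMap.ker f))) ⊤ = E.natDegree *
        (localLengthFn.{u, max u v} (away (E : Sring p k))).toFun (LinearMap.ker f) := by
      have htors : Module.IsTorsionBySet (Sring p k) (LinearMap.ker f)
          (Ideal.span {(E : Sring p k)} : Ideal (Sring p k)) := by
        rw [← Module.isTorsionBySet_iff_is_torsion_by_span, Module.isTorsionBySet_singleton_iff]
        exact fun x => Subtype.ext x.2
      let := htors.module
      have := htors.isScalarTower (S := Sring p k)
      have := hE.isDomain
      have := hE.isPrincipalIdealRing
      have : Module.Finite (EisQuot E) (LinearMap.ker f) :=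
        Module.Finite.of_restrictScalars_finite (Sring p k) _ _
      have : Module.IsTorsionFree (EisQuot E) (LinearMap.ker f) := by
        refine ⟨fun r hr x y hxy => ?_⟩
        obtain ⟨a, rfl⟩ := Ideal.Quotient.mk_surjective r
        have ha : ¬ (E : Sring p k) ∣ a := fun h => hr.ne_zero
          (Ideal.Quotient.eq_zero_iff_mem.mpr (Ideal.mem_span_singleton.mpr h))
        obtain ⟨n, s, t, h⟩ := hE.exists_pow_eq ha
        have h5 : a • (x - y) = 0 := by
          rw [smul_sub, sub_eq_zero]
          exact hxy
        have h6 : (E : Sring p k) • (x - y) = 0 := Subtype.ext (x - y).2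
        have h7 : (p : Sring p k) ^ n • (x - y) = 0 := by
          rw [h, add_smul, mul_smul, mul_smul, h5, h6, smul_zero, smul_zero, add_zero]
        refine sub_eq_zero.mp ?_
        generalize x - y = z at h7
        clear h
        induction n with
        | zero => rwa [pow_zero, one_smul] at h7
        | succ n ih =>
          refine ih (Subtype.ext (hp0 _ ?_))
          rw [pow_succ', mul_smul] at h7
          exact congrArg Subtype.val h7
      have : Module.Free (EisQuot E) (LinearMap.ker f) := Module.free_of_finite_type_torsion_free'
      let e : LinearMap.ker f ≃ₗ[Sring p k] T (Module.finrank (EisQuot E) (LinearMap.ker f)) :=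
        ((Module.finBasis (EisQuot E) (LinearMap.ker f)).equivFun.restrictScalars (Sring p k)).trans
          (LinearEquiv.piCongrRight fun _ => ULift.moduleEquiv.symm)
      rw [LengthFn.congr _ e, LengthFn.quo_smul_congr _ _ e]
      exact hfree _
    rw [hK, hK', h2, h4]
    exact ⟨by rw [Ne, ENat.add_eq_top, not_or]; exact ⟨h3, h1⟩, (mul_add _ _ _).symm⟩

end Lengths

end Kisin

end

noncomputable section

namespace Kisin

/-! ### Frobenius relations and torsion in étale modules -/

section Twist

variable {A : Type u} [CommRing A] (φ : A →+* A)

/-- Functoriality of the restriction of scalars along `φ`. -/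
def Twist.map {T : Type v₁} {T' : Type v₂} [AddCommGroup T] [Module A T] [AddCommGroup T']
    [Module A T'] (f : T →ₗ[A] T') : Twist φ T →ₗ[A] Twist φ T' where
  toFun x := Twist.equiv.symm (f (Twist.equiv x))
  map_add' x y := by rw [map_add, map_add, map_add]
  map_smul' a x := by
    apply Twist.equiv.injective
    rw [AddEquiv.apply_symm_apply, Twist.equiv_smul, map_smul, RingHom.id_apply, Twist.equiv_smul,
      AddEquiv.apply_symm_apply]

theorem Twist.equiv_map {T : Type v₁} {T' : Type v₂} [AddCommGroup T] [Module A T] [AddCommGroup T']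
    [Module A T'] (f : T →ₗ[A] T') (x : Twist φ T) :
    Twist.equiv (Twist.map φ f x) = f (Twist.equiv x) := rfl

namespace PhiModule

variable {φ} {E : A} {X : PhiModule.{u, v} φ E}

/-- The `A[1/E]`-span of `frob N` is the localization of its `A`-span. -/
theorem mem_gen_iff_exists_pow {N : Submodule A X} {y : Inv E X} :
    y ∈ X.gen N ↔ ∃ n : ℕ, E ^ n • y ∈ Submodule.span A (X.frob '' N) := by
  constructor
  · intro h
    induction h using Submodule.closure_induction with
    | zero => exact ⟨0, by simp⟩
    | add x y _ _ hx hy =>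
      obtain ⟨n, hn⟩ := hx
      obtain ⟨m, hm⟩ := hy
      refine ⟨n + m, ?_⟩
      have h : E ^ (n + m) • (x + y) = E ^ m • (E ^ n • x) + E ^ n • (E ^ m • y) := by
        rw [smul_smul, smul_smul, smul_add, pow_add, mul_comm (E ^ m)]
      rw [h]
      exact Submodule.add_mem _ (Submodule.smul_mem _ _ hn) (Submodule.smul_mem _ _ hm)
    | smul_mem r x hx =>
      obtain ⟨n, b, h⟩ := away_exists r
      refine ⟨n, ?_⟩
      have h1 : E ^ n • r • x = b • x := by
        rw [← smul_assoc, h, algebraMap_smul]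
      rw [h1]
      exact Submodule.smul_mem _ _ (Submodule.subset_span hx)
  · rintro ⟨n, h⟩
    refine mem_of_pow_smul_mem (n := n) ?_
    generalize E ^ n • y = z at h
    induction h using Submodule.span_induction with
    | mem x hx => exact Submodule.subset_span hx
    | zero => exact zero_mem _
    | add x y _ _ hx hy => exact add_mem hx hy
    | smul a x _ hx => exact smul_mem_away a hx

end PhiModule

end Twist

section Frob

variable {p : ℕ} [hp : Fact p.Prime] {k : Type u} [Field k] [CharP k p] [PerfectRing k p]

theorem frobBasis_symm (a : Sring p k) (j : Fin p) :
    frobBasis.symm (Twist.equiv.symm a) j = frobCoeff j a := by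
  have h : frobBasis (fun j => frobCoeff j a) = (Twist.equiv.symm a : Twist (frobS p k) (Sring p k)) :=
    congrArg Twist.equiv.symm (sum_frobCoeff a)
  rw [← h, LinearEquiv.symm_apply_apply]

/-- The coefficient `frobCoeff j` as a linear map. -/
def frobCoeffMap (j : Fin p) : Twist (frobS p k) (Sring p k) →ₗ[Sring p k] Sring p k :=
  LinearMap.proj j ∘ₗ frobBasis.symm.toLinearMap

theorem frobCoeffMap_apply (j : Fin p) (a : Sring p k) :
    frobCoeffMap j (Twist.equiv.symm a) = frobCoeff j a := frobBasis_symm a j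

theorem frobCoeff_add (j : Fin p) (a b : Sring p k) :
    frobCoeff j (a + b) = frobCoeff j a + frobCoeff j b := by
  rw [← frobCoeffMap_apply, map_add, map_add, frobCoeffMap_apply, frobCoeffMap_apply]

theorem frobCoeff_frobS_mul (j : Fin p) (b a : Sring p k) :
    frobCoeff j (frobS p k b * a) = b * frobCoeff j a := by
  rw [← frobCoeffMap_apply, ← frobCoeffMap_apply, ← smul_eq_mul b, ← map_smul]
  rfl

theorem frobCoeff_X_pow (l j : Fin p) :
    frobCoeff l ((PowerSeries.X : Sring p k) ^ (j : ℕ)) = if j = l then 1 else 0 := by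
  rw [← frobBasis_symm]
  have h : frobBasis (Pi.single j 1) =
      (Twist.equiv.symm (PowerSeries.X ^ (j : ℕ)) : Twist (frobS p k) (Sring p k)) := by
    have h1 : ∑ i : Fin p, PowerSeries.X ^ (i : ℕ) * frobS p k ((Pi.single j 1 : Fin p → Sring p k) i)
        = PowerSeries.X ^ (j : ℕ) := ?_
    · exact congrArg Twist.equiv.symm h1
    rw [Finset.sum_eq_single j]
    · rw [Pi.single_eq_same, map_one, mul_one]
    · intro i _ hi
      rw [Pi.single_eq_of_ne hi, map_zero, mul_zero]
    · exact fun h => absurd (Finset.mem_univ _) h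
  rw [← h, LinearEquiv.symm_apply_apply, Pi.single_apply]
  simp only [eq_comm]

/-- Every nonzero element divides a nonzero element of the image of the Frobenius, since `𝔖` is
finite over this image. -/
theorem exists_dvd_frobS {a : Sring p k} (ha : a ≠ 0) : ∃ b, b ≠ 0 ∧ a ∣ frobS p k b := by
  let := (frobS p k).toAlgebra
  have : Module.Finite (Sring p k) (Twist (frobS p k) (Sring p k)) := inferInstance
  have h1 : (frobS p k).Finite := this
  have h2 := Ideal.comap_ne_bot_of_integral_mem (R := Sring p k) (S := Sring p k) ha
    (Ideal.mem_span_singleton_self a) (h1.to_isIntegral a)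
  obtain ⟨b, hb, hb0⟩ := Submodule.exists_mem_ne_zero_of_ne_bot h2
  exact ⟨b, hb0, Ideal.mem_span_singleton.mp hb⟩

variable {E : (WittVector p k)[X]} {X : PhiMod.{u, v} E}

theorem mem_span_frob_iff {N : Submodule (Sring p k) X} {y : Inv (E : Sring p k) X} :
    y ∈ Submodule.span (Sring p k) (X.frob '' N) ↔ ∃ x : Fin p → X, (∀ j, x j ∈ N) ∧
      y = ∑ j : Fin p, (PowerSeries.X : Sring p k) ^ (j : ℕ) • X.frob (x j) := by
  constructor
  · intro h
    induction h using Submodule.closure_induction with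
    | zero => exact ⟨0, fun j => zero_mem _, by
        simp only [Pi.zero_apply, map_zero, smul_zero, Finset.sum_const_zero]⟩
    | add x y _ _ hx hy =>
      obtain ⟨x, hx, rfl⟩ := hx
      obtain ⟨y, hy, rfl⟩ := hy
      refine ⟨x + y, fun j => add_mem (hx j) (hy j), ?_⟩
      rw [← Finset.sum_add_distrib]
      refine Finset.sum_congr rfl fun j _ => ?_
      rw [Pi.add_apply, map_add, smul_add]
    | smul_mem r x hx =>
      obtain ⟨z, hz, rfl⟩ := hx
      refine ⟨fun j => frobCoeff j r • z, fun j => N.smul_mem _ hz, ?_⟩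
      conv_lhs => rw [← sum_frobCoeff r, Finset.sum_smul]
      refine Finset.sum_congr rfl fun j _ => ?_
      rw [X.frob.map_smulₛₗ, smul_smul]
  · rintro ⟨x, hx, rfl⟩
    exact Submodule.sum_mem _ fun j _ => Submodule.smul_mem _ _ (Submodule.subset_span ⟨_, hx j, rfl⟩)

theorem frobLattice_eq : X.frobLattice = Submodule.span (Sring p k) (X.frob '' (⊤ : Submodule (Sring p k) X)) := by
  rw [PhiModule.frobLattice, Submodule.top_coe, Set.image_univ]

theorem mem_frobLattice_iff {y : Inv (E : Sring p k) X} : y ∈ X.frobLattice ↔ ∃ x : Fin p → X,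
      y = ∑ j : Fin p, (PowerSeries.X : Sring p k) ^ (j : ℕ) • X.frob (x j) := by
  rw [frobLattice_eq, mem_span_frob_iff]
  simp

/-- The injectivity of the linearization of the Frobenius in terms of coordinates: a relation
between values of the Frobenius comes, after multiplication by a power of `E`, from relations in
the module. -/
theorem exists_coeff_of_sum_frob_eq_zero (hE : IsEis E) (hX : X.IsEtale) {ι : Type*} [Fintype ι] {s : ι → Sring p k}
    {x : ι → X} (h : ∑ i, s i • X.frob (x i) = 0) :
    ∃ n : ℕ, ∀ a l, ∑ i, frobCoeff l (a * (E : Sring p k) ^ n * s i) • x i = 0 := by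
  let T := Twist (frobS p k) (Localization.Away (E : Sring p k))
  let T₀ := Twist (frobS p k) (Sring p k)
  let j : T₀ →ₗ[Sring p k] T :=
    Twist.map (frobS p k) (Algebra.linearMap (Sring p k) (Localization.Away (E : Sring p k)))
  let mulT : Sring p k → T →ₗ[Sring p k] T := fun a =>
    Twist.map (frobS p k) (a • LinearMap.id)
  let mulT₀ : Sring p k → T₀ →ₗ[Sring p k] T₀ := fun a =>
    Twist.map (frobS p k) (a • LinearMap.id)
  have hj : Function.Injective j :=
    (IsLocalization.injective (Localization.Away (E : Sring p k))
      (powers_le_nonZeroDivisors_of_noZeroDivisors hE.ne_zero))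
  let P : Submodule (Sring p k) T := LinearMap.range j
  have hP : P.FG := by
    rw [show P = _ from LinearMap.range_eq_map j]
    exact Module.Finite.fg_top.map j
  let t : P ⊗[Sring p k] X := ∑ i, (⟨j (Twist.equiv.symm (s i)), _, rfl⟩ : P) ⊗ₜ x i
  have ht : P.subtype.rTensor X t = 0 := by
    apply hX.1
    rw [map_zero, ← h, map_sum, map_sum]
    refine Finset.sum_congr rfl fun i _ => ?_
    rw [LinearMap.rTensor_tmul, PhiModule.linearization_tmul]
    exact algebraMap_smul (Localization.Away (E : Sring p k)) (s i) (X.frob (x i))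
  -- Injectivity of the linearization makes the tensor vanish in `𝔖[1/E] ⊗ X`, hence already in `Q ⊗ X`
  -- for a finitely generated submodule `Q` of `𝔖[1/E]`. A power of `E` maps `Q` into `𝔖`.
  obtain ⟨Q, hPQ, hQ, hQ0⟩ := TensorProduct.eq_zero_of_fg_of_subtype_eq_zero hP ht
  have hn : ∃ n : ℕ, ∀ q ∈ Q, mulT ((E : Sring p k) ^ n) q ∈ P := by
    obtain ⟨S, rfl⟩ := hQ
    choose m b hm using fun c : Localization.Away (E : Sring p k) => away_exists c
    refine ⟨∑ q ∈ S, m (Twist.equiv q), fun q hq => ?_⟩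
    have h1 : Submodule.span (Sring p k) (S : Set T) ≤
        P.comap (mulT ((E : Sring p k) ^ (∑ q ∈ S, m (Twist.equiv q)))) := by
      rw [Submodule.span_le]
      intro q hq
      refine ⟨Twist.equiv.symm ((E : Sring p k) ^ (∑ q ∈ S.erase q, m (Twist.equiv q)) * b (Twist.equiv q)), ?_⟩
      apply Twist.equiv.injective
      rw [Twist.equiv_map, Twist.equiv_map, LinearMap.smul_apply, LinearMap.id_apply,
        AddEquiv.apply_symm_apply, Algebra.linearMap_apply, ← Finset.sum_erase_add _ _ hq, pow_add, mul_smul, hm, Algebra.smul_def, ← map_mul]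
    exact h1 hq
  obtain ⟨n, hn⟩ := hn
  let g : Q →ₗ[Sring p k] T₀ := (LinearEquiv.ofInjective j hj).symm.toLinearMap ∘ₗ
    (mulT ((E : Sring p k) ^ n)).restrict hn
  refine ⟨n, fun a l => ?_⟩
  -- Apply the coordinate map `frobCoeff l`, linear over `𝔖` acting through the Frobenius.
  have h2 := congrArg (TensorProduct.lid (Sring p k) X) (congrArg
    (LinearMap.rTensor X (frobCoeffMap l ∘ₗ mulT₀ a ∘ₗ g)) hQ0)
  rw [map_zero, map_zero, map_sum, map_sum, map_sum] at h2
  rw [← h2]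
  refine Finset.sum_congr rfl fun i _ => ?_
  rw [LinearMap.rTensor_tmul, LinearMap.rTensor_tmul, TensorProduct.lid_tmul]
  congr 1
  have h3 : g (Submodule.inclusion hPQ ⟨j (Twist.equiv.symm (s i)), _, rfl⟩)
      = Twist.equiv.symm ((E : Sring p k) ^ n * s i) := by
    apply hj
    have h4 : j (g (Submodule.inclusion hPQ ⟨j (Twist.equiv.symm (s i)), _, rfl⟩))
        = mulT ((E : Sring p k) ^ n) (j (Twist.equiv.symm (s i))) :=
      congrArg Subtype.val (LinearEquiv.apply_symm_apply (LinearEquiv.ofInjective j hj) _)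
    rw [h4]
    apply Twist.equiv.injective
    rw [Twist.equiv_map, Twist.equiv_map, Twist.equiv_map, LinearMap.smul_apply, LinearMap.id_apply,
      AddEquiv.apply_symm_apply, AddEquiv.apply_symm_apply, Algebra.linearMap_apply,
      Algebra.linearMap_apply, map_mul, Algebra.smul_def]
  rw [← frobCoeffMap_apply, LinearMap.comp_apply, LinearMap.comp_apply, h3]
  congr 1
  apply Twist.equiv.injective
  change _ = a • ((E : Sring p k) ^ n * s i)
  rw [AddEquiv.apply_symm_apply, smul_eq_mul, mul_assoc]

/-- In an étale module killed by `p ^ N`, the elements `x_j` of a relation `∑ u ^ j φ(x_j) = 0` are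
killed by a power of `u`, because `E ^ n` divides a power of `u ^ p` modulo `p ^ N`. -/
theorem exists_X_pow_smul_eq_zero (hE : IsEis E) (hX : X.IsEtale) {N : ℕ}
    (hN : ∀ x : X, (p : Sring p k) ^ N • x = 0)
    {x : Fin p → X} (h : ∑ j : Fin p, (PowerSeries.X : Sring p k) ^ (j : ℕ) • X.frob (x j) = 0) :
    ∃ c : ℕ, ∀ l, (PowerSeries.X : Sring p k) ^ c • x l = 0 := by
  obtain ⟨n, hn⟩ := exists_coeff_of_sum_frob_eq_zero hE hX h
  -- Modulo `p ^ N`, a power of `u ^ p` is a multiple of `E ^ n`.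
  obtain ⟨d, hd⟩ := hE.pow_dvd_pow_sub N (p * n)
  set c := E.natDegree * (p ^ N * n) with hc
  obtain ⟨q, hq⟩ : ∃ q, p ^ N * (p * n) = q + n := by
    refine ⟨p ^ N * (p * n) - n, (Nat.sub_add_cancel ?_).symm⟩
    calc n = 1 * (1 * n) := by ring
      _ ≤ p ^ N * (p * n) := Nat.mul_le_mul (Nat.one_le_pow _ _ hp.out.pos)
        (Nat.mul_le_mul_right _ hp.out.one_lt.le)
  have h1 : (E : Sring p k) ^ q * (E : Sring p k) ^ n
      = frobS p k (PowerSeries.X ^ c) + frobS p k ((p : Sring p k) ^ N) * d := by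
    rw [← pow_add, ← hq, map_pow, map_pow, frobS_X, frobS_natCast, ← hd, ← pow_mul, hc]
    have : E.natDegree * (p ^ N * (p * n)) = p * (E.natDegree * (p ^ N * n)) := by ring
    rw [this]
    ring
  refine ⟨c, fun l => ?_⟩
  have h2 := hn ((E : Sring p k) ^ q) l
  rw [← h2, Finset.sum_congr rfl fun i _ => ?_, Finset.sum_ite_eq' Finset.univ l fun i =>
    (PowerSeries.X : Sring p k) ^ c • x i, if_pos (Finset.mem_univ _)]
  rw [h1, add_mul, frobCoeff_add, frobCoeff_frobS_mul, frobCoeff_X_pow, mul_assoc,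
    frobCoeff_frobS_mul, add_smul, mul_comm ((p : Sring p k) ^ N), mul_smul _ ((p : Sring p k) ^ N),
    hN, smul_zero, add_zero]
  split
  · rw [mul_one]
  · rw [mul_zero, zero_smul]

/-- If the module is killed by `p ^ N` and has no `u`-torsion, then its Frobenius lattice is
a direct sum of `p` copies of the module. -/
theorem eq_zero_of_sum_frob_eq_zero (hE : IsEis E) (hX : X.IsEtale) {N : ℕ}
    (hN : ∀ x : X, (p : Sring p k) ^ N • x = 0) (hu : ∀ x : X, (PowerSeries.X : Sring p k) • x = 0 → x = 0)
    {x : Fin p → X} (h : ∑ j : Fin p, (PowerSeries.X : Sring p k) ^ (j : ℕ) • X.frob (x j) = 0)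
    (l : Fin p) : x l = 0 := by
  obtain ⟨c, hc⟩ := exists_X_pow_smul_eq_zero hE hX hN h
  have hun : ∀ (m : ℕ) (x : X), (PowerSeries.X : Sring p k) ^ m • x = 0 → x = 0 := by
    intro m
    induction m with
    | zero => intro x hx; rwa [pow_zero, one_smul] at hx
    | succ m ih => intro x hx; exact ih x (hu _ (by rwa [smul_smul, ← pow_succ']))
  exact hun c _ (hc l)

/-- If `∑ u ^ j φ(x_j)` is killed by a power of `u`, then so are the `x_j`. -/
theorem exists_X_pow_smul_eq_zero_of_smul (hE : IsEis E) (hX : X.IsEtale) {N : ℕ}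
    (hN : ∀ x : X, (p : Sring p k) ^ N • x = 0) {x : Fin p → X} {a : ℕ}
    (h : (PowerSeries.X : Sring p k) ^ a •
      ∑ j : Fin p, (PowerSeries.X : Sring p k) ^ (j : ℕ) • X.frob (x j) = 0) :
    ∃ c : ℕ, ∀ l, (PowerSeries.X : Sring p k) ^ c • x l = 0 := by
  have h1 : ∑ j : Fin p, (PowerSeries.X : Sring p k) ^ (j : ℕ) •
      X.frob ((PowerSeries.X : Sring p k) ^ a • x j) = 0 := by
    have h2 : ∀ j : Fin p, (PowerSeries.X : Sring p k) ^ (j : ℕ) •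
        X.frob ((PowerSeries.X : Sring p k) ^ a • x j) = (PowerSeries.X : Sring p k) ^ (p * a) •
        (PowerSeries.X : Sring p k) ^ (j : ℕ) • X.frob (x j) := by
      intro j
      rw [X.frob.map_smulₛₗ, map_pow, frobS_X, ← pow_mul, smul_comm]
    rw [Finset.sum_congr rfl fun j _ => h2 j, ← Finset.smul_sum]
    have h3 : p * a = (p * a - a) + a :=
      (Nat.sub_add_cancel (Nat.le_mul_of_pos_left _ hp.out.pos)).symm
    rw [h3, pow_add, mul_smul, h, smul_zero]
  obtain ⟨c, hc⟩ := exists_X_pow_smul_eq_zero hE hX hN h1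
  exact ⟨c + a, fun l => by rw [pow_add, mul_smul, hc]⟩

/-- In an étale module, the coordinates with respect to the Frobenius of a torsion element are
torsion. -/
theorem exists_frob_torsion (hE : IsEis E) (hX : X.IsEtale) {s : Sring p k} (hs : s ≠ 0)
    {x : Fin p → X} (h : s • ∑ j : Fin p, (PowerSeries.X : Sring p k) ^ (j : ℕ) • X.frob (x j) = 0) :
    ∃ b : Sring p k, b ≠ 0 ∧ ∀ j, b • x j = 0 := by
  obtain ⟨b, hb0, hb⟩ := exists_dvd_frobS hs
  have h1 : ∑ j : Fin p, (PowerSeries.X : Sring p k) ^ (j : ℕ) • X.frob (b • x j) = 0 := by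
    obtain ⟨c, hc⟩ := hb
    rw [← smul_zero c, ← h, smul_smul, mul_comm c, ← hc, Finset.smul_sum]
    refine Finset.sum_congr rfl fun j _ => ?_
    rw [X.frob.map_smulₛₗ, smul_comm]
  obtain ⟨n, hn⟩ := exists_coeff_of_sum_frob_eq_zero hE hX h1
  obtain ⟨c, hc0, a, hc⟩ := exists_dvd_frobS (pow_ne_zero n hE.ne_zero)
  refine ⟨c * b, mul_ne_zero hc0 hb0, fun l => ?_⟩
  rw [mul_smul, ← hn a l, Finset.sum_congr rfl fun i _ => ?_, Finset.sum_ite_eq' Finset.univ l fun i =>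
    c • b • x i, if_pos (Finset.mem_univ _)]
  rw [mul_comm a, ← hc, frobCoeff_frobS_mul, frobCoeff_X_pow]
  split
  · rw [mul_one]
  · rw [mul_zero, zero_smul]

theorem exists_pow_smul_toInv_eq (hX : X.IsEtale) (y : X) : ∃ (n : ℕ) (x : Fin p → X),
    (E : Sring p k) ^ n • toInv (E : Sring p k) X y
      = ∑ j : Fin p, (PowerSeries.X : Sring p k) ^ (j : ℕ) • X.frob (x j) := by
  obtain ⟨n, hn⟩ := PhiModule.mem_gen_iff_exists_pow.mp (hX.isEtaleSub_top.2 y trivial)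
  obtain ⟨x, -, hx⟩ := mem_span_frob_iff.mp hn
  exact ⟨n, x, hx⟩

/-- A module is finitely generated up to `p`-power torsion: some finitely generated submodule
contains a `p`-power multiple of every element. -/
def IsAlmostFG (p : ℕ) [Fact p.Prime] (k : Type u) [Field k] (Y : Type v) [AddCommGroup Y] [Module (Sring p k) Y] : Prop :=
  ∃ N : Submodule (Sring p k) Y, N.FG ∧ ∀ x : Y, ∃ n : ℕ, (p : Sring p k) ^ n • x ∈ N

theorem IsAlmostFG.of_finite (Y : Type v) [AddCommGroup Y] [Module (Sring p k) Y]
    [Module.Finite (Sring p k) Y] : IsAlmostFG p k Y :=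
  ⟨⊤, Module.Finite.fg_top, fun _ => ⟨0, trivial⟩⟩

/-- The elements of `𝔖` which kill a set of elements up to powers of `p` form an ideal. -/
def pTorsionAnn {Y : Type v} [AddCommGroup Y] [Module (Sring p k) Y] (T : Set Y) :
    Ideal (Sring p k) where
  carrier := {a | ∀ x ∈ T, ∃ n : ℕ, (p : Sring p k) ^ n • a • x = 0}
  zero_mem' := fun x _ => ⟨0, by simp⟩
  add_mem' := fun {a b} ha hb x hx => by
    obtain ⟨n, hn⟩ := ha x hx
    obtain ⟨m, hm⟩ := hb x hx
    refine ⟨n + m, ?_⟩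
    rw [add_smul, smul_add, pow_add, mul_smul _ _ (b • x), hm, mul_comm, mul_smul _ _ (a • x), hn,
      smul_zero, smul_zero, add_zero]
  smul_mem' := fun c a ha x hx => by
    obtain ⟨n, hn⟩ := ha x hx
    exact ⟨n, by rw [smul_assoc, smul_comm _ c, hn, smul_zero]⟩

theorem pTorsionAnn_saturated {Y : Type v} [AddCommGroup Y] [Module (Sring p k) Y] (T : Set Y)
    (n : ℕ) {a : Sring p k} (h : (p : Sring p k) ^ n * a ∈ pTorsionAnn T) : a ∈ pTorsionAnn T := by
  intro x hx
  obtain ⟨m, hm⟩ := h x hx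
  exact ⟨m + n, by rw [pow_add, mul_smul, ← mul_smul _ a, hm]⟩

theorem order_eq_zero_iff_constantCoeff_ne_zero {R : Type w} [Semiring R] {a : R⟦X⟧} :
    a.order = 0 ↔ PowerSeries.constantCoeff a ≠ 0 := by
  rw [← not_iff_not, not_not]
  exact PowerSeries.order_ne_zero_iff_constCoeff_eq_zero

theorem eq_of_irreducible_pow_mul {R : Type w} [CommRing R] [IsDomain R] {π a b c d : R}
    (hπ : Irreducible π) {n i t : ℕ} (ha : IsUnit a) (hb : IsUnit b) (hc : IsUnit c) (hd : IsUnit d)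
    (h : (π * a) ^ n * (π ^ t * b) = π ^ t * c * ((π * a) ^ i * d)) : n = i := by
  have h4 : π ^ n * (a ^ n * b) = π ^ i * (a ^ i * c * d) := by
    refine mul_left_cancel₀ (pow_ne_zero t hπ.ne_zero) ?_
    rw [mul_pow, mul_pow] at h
    linear_combination h
  have hu1 : IsUnit (a ^ n * b) := (ha.pow n).mul hb
  have hu2 : IsUnit (a ^ i * c * d) := ((ha.pow i).mul hc).mul hd
  have h5 : π ^ n ∣ π ^ i := (hu2.dvd_mul_right).mp (h4 ▸ dvd_mul_right _ _)
  have h6 : π ^ i ∣ π ^ n := (hu1.dvd_mul_right).mp (h4 ▸ dvd_mul_right _ _)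
  exact le_antisymm ((pow_dvd_pow_iff hπ.ne_zero hπ.not_isUnit).mp h5)
    ((pow_dvd_pow_iff hπ.ne_zero hπ.not_isUnit).mp h6)

/-- An element which is not divisible by `p`, and which agrees with its image under the Frobenius up
to divisors of powers of `E`, is a unit: comparing the valuations of `d` and `φ(d)` shows that
neither the constant coefficient of `d` nor its reduction vanishes. -/
theorem isUnit_of_frobS_dvd (hE : IsEis E) {d : Sring p k} (hd : ¬ (p : Sring p k) ∣ d) {n m : ℕ}
    (h1 : d ∣ (E : Sring p k) ^ n * frobS p k d) (h2 : frobS p k d ∣ (E : Sring p k) ^ m * d) :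
    IsUnit d := by
  obtain ⟨v, hv⟩ := h1
  obtain ⟨w, hw⟩ := h2
  have hd0 : d ≠ 0 := fun h => hd (h ▸ dvd_zero _)
  have hvw : v * w = (E : Sring p k) ^ (n + m) := by
    refine mul_left_cancel₀ hd0 ?_
    rw [← mul_assoc, ← hv, mul_assoc, ← hw, pow_add]
    ring
  obtain ⟨i, hi, hvi⟩ := (dvd_prime_pow hE.prime _).mp (Dvd.intro w hvw)
  obtain ⟨ε, hε⟩ := hvi.symm
  obtain ⟨e₀, he₀⟩ := hE.constantCoeff_coe
  have hE0 : PowerSeries.constantCoeff (E : Sring p k) ≠ 0 := by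
    rw [he₀]
    exact mul_ne_zero (WittVector.irreducible p).ne_zero e₀.ne_zero
  have hεu : IsUnit (ε : Sring p k) := ε.isUnit
  rw [← hε] at hv
  -- The `u`-adic valuations show that the constant coefficient of `d` is not zero.
  have hc : PowerSeries.constantCoeff d ≠ 0 := by
    intro h0
    have h3 := congrArg PowerSeries.order hv
    rw [PowerSeries.order_mul, PowerSeries.order_mul, PowerSeries.order_mul, PowerSeries.order_pow,
      PowerSeries.order_pow, order_eq_zero_iff_constantCoeff_ne_zero.mpr hE0, order_frobS, nsmul_zero, nsmul_zero, zero_add, zero_add,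
      order_eq_zero_iff_constantCoeff_ne_zero.mpr (((PowerSeries.isUnit_iff_constantCoeff).mp hεu).ne_zero), add_zero] at h3
    obtain ⟨t, ht⟩ := ENat.ne_top_iff_exists.mp (mt PowerSeries.order_eq_top.mp hd0)
    rw [← ht, nsmul_eq_mul] at h3
    have h4 : p * t = t := by exact_mod_cast h3
    have h5 : t = 0 := by
      by_contra h
      have := Nat.mul_lt_mul_of_pos_right hp.out.one_lt (Nat.pos_of_ne_zero h)
      omega
    rw [h5] at ht
    exact (order_eq_zero_iff_constantCoeff_ne_zero.mp ht.symm) h0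
  -- The `p`-adic valuations of the constant coefficients show that `n = i`.
  have hni : n = i := by
    have h3 := congrArg PowerSeries.constantCoeff hv
    rw [map_mul, map_mul, map_mul, map_pow, map_pow, constantCoeff_frobS, he₀] at h3
    set δ := PowerSeries.constantCoeff d
    obtain ⟨t, b, hb⟩ := WittVector.exists_eq_pow_p_mul' δ hc
    rw [hb, map_mul, map_pow, map_natCast] at h3
    exact eq_of_irreducible_pow_mul (WittVector.irreducible p) e₀.isUnit (b.isUnit.map _) b.isUnit
      ((PowerSeries.isUnit_iff_constantCoeff).mp hεu) h3
  -- The `u`-adic valuations modulo `p` show that `d` is a unit.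
  refine isUnit_of_redS_constantCoeff fun h0 => ?_
  have h3 := congrArg (fun a => (redS p k a).order) hv
  simp only [map_mul, map_pow] at h3
  rw [PowerSeries.order_mul, PowerSeries.order_mul, PowerSeries.order_mul, order_redS_frobS, hni,
    order_eq_zero_iff_constantCoeff_ne_zero.mpr (((PowerSeries.isUnit_iff_constantCoeff).mp (hεu.map (redS p k))).ne_zero), add_zero,
    add_comm, PowerSeries.order_pow, hE.redS_coe, PowerSeries.order_X_pow] at h3
  obtain ⟨t, ht⟩ := ENat.ne_top_iff_exists.mp (mt PowerSeries.order_eq_top.mp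
    (mt redS_eq_zero_iff.mp hd))
  rw [← ht, nsmul_eq_mul, nsmul_eq_mul] at h3
  have h4 : p * t + i * E.natDegree = t + i * E.natDegree := by exact_mod_cast h3
  have h5 : t = 0 := by
    by_contra h
    have := Nat.mul_lt_mul_of_pos_right hp.out.one_lt (Nat.pos_of_ne_zero h)
    omega
  rw [h5] at ht
  exact (order_eq_zero_iff_constantCoeff_ne_zero.mp ht.symm) h0

/-- Torsion elements of an étale module which is finitely generated up to `p`-power torsion are
`p`-power torsion. -/
theorem exists_p_pow_smul_eq_zero (hE : IsEis E) (hX : X.IsEtale) (hfg : IsAlmostFG p k X)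
    {x : X} {a : Sring p k} (ha : a ≠ 0) (hax : a • x = 0) : ∃ n : ℕ, (p : Sring p k) ^ n • x = 0 := by
  obtain ⟨N, hN, hNp⟩ := hfg
  let τ : Submodule (Sring p k) X := Submodule.torsion (Sring p k) X
  have mem_τ : ∀ y : X, y ∈ τ ↔ ∃ b : Sring p k, b ≠ 0 ∧ b • y = 0 := by
    intro y
    rw [Submodule.mem_torsion_iff]
    constructor
    · rintro ⟨b, hb⟩
      exact ⟨b, nonZeroDivisors.ne_zero b.2, hb⟩
    · rintro ⟨b, hb, h⟩
      exact ⟨⟨b, mem_nonZeroDivisors_of_ne_zero hb⟩, h⟩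
  have : Module.Finite (Sring p k) N := Module.Finite.iff_fg.mpr hN
  have hτN : (τ ⊓ N).FG := by
    have : (Submodule.comap N.subtype τ).FG := IsNoetherian.noetherian _
    have h := this.map N.subtype
    rwa [Submodule.map_comap_subtype, inf_comm] at h
  obtain ⟨S, hS⟩ := hτN
  have hSτ : ∀ y ∈ S, y ∈ τ := fun y hy =>
    (hS ▸ Submodule.subset_span hy : y ∈ τ ⊓ N).1
  -- It suffices to treat the finitely many generators of the torsion of `N`.
  let J := pTorsionAnn (p := p) (k := k) (S : Set X)
  have hJ : ∀ c ∈ J, ∀ y ∈ τ, ∃ n : ℕ, (p : Sring p k) ^ n • c • y = 0 := by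
    intro c hc y hy
    obtain ⟨n, hn⟩ := hNp y
    have h1 : ∀ z ∈ τ ⊓ N, ∃ n : ℕ, (p : Sring p k) ^ n • c • z = 0 := by
      intro z hz
      rw [← hS] at hz
      induction hz using Submodule.span_induction with
      | mem z hz => exact hc z hz
      | zero => exact ⟨0, by simp⟩
      | add z z' _ _ h h' =>
        obtain ⟨n, h⟩ := h
        obtain ⟨m, h'⟩ := h'
        refine ⟨n + m, ?_⟩
        rw [smul_add, smul_add, pow_add, mul_smul _ _ (c • z'), h', mul_comm, mul_smul _ _ (c • z), h,
          smul_zero, smul_zero, add_zero]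
      | smul b z _ h =>
        obtain ⟨n, h⟩ := h
        exact ⟨n, by rw [smul_comm c, smul_comm _ b, h, smul_zero]⟩
    obtain ⟨m, hm⟩ := h1 _ ⟨τ.smul_mem _ hy, hn⟩
    exact ⟨m + n, by rw [pow_add, mul_smul, smul_comm _ c, hm]⟩
  have hJ0 : J ≠ ⊥ := by
    choose b hb0 hb using fun y : S => (mem_τ y).mp (hSτ y y.2)
    intro h
    have h1 : ∏ y : S, b y ∈ J := by
      intro y hy
      refine ⟨0, ?_⟩
      rw [pow_zero, one_smul, ← Finset.mul_prod_erase _ _ (Finset.mem_univ ⟨y, hy⟩), mul_comm, mul_smul,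
        hb ⟨y, hy⟩, smul_zero]
    rw [h] at h1
    exact Finset.prod_ne_zero_iff.mpr (fun y _ => hb0 y) h1
  -- The annihilator of the torsion up to powers of `p` is principal, generated by some `d`. Stability of
  -- the torsion under the Frobenius and its inverse gives divisibilities between `d` and `φ(d)`, up to
  -- powers of `E`, which force `d` to be a unit.
  obtain ⟨d, hd⟩ := exists_eq_span_of_saturated (I := J)
    (fun b hb => pTorsionAnn_saturated _ 1 (by rwa [pow_one]))
  have hdJ : d ∈ J := hd ▸ Ideal.mem_span_singleton_self d
  have hd0 : d ≠ 0 := fun h => hJ0 (by rw [hd, h, Ideal.span_singleton_zero])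
  have hpd : ¬ (p : Sring p k) ∣ d := by
    rintro ⟨b, hb⟩
    have h1 : b ∈ J := pTorsionAnn_saturated _ 1 (by rwa [pow_one, ← hb])
    rw [hd, Ideal.mem_span_singleton] at h1
    obtain ⟨c, rfl⟩ := h1
    refine not_isUnit_p (p := p) (k := k) (IsUnit.of_mul_eq_one c (mul_left_cancel₀ hd0 ?_))
    rw [mul_one]
    refine Eq.trans ?_ hb.symm
    ring
  -- `E ^ n φ(d)` kills the torsion up to powers of `p`.
  have h1 : ∃ n : ℕ, (E : Sring p k) ^ n * frobS p k d ∈ J := by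
    have h2 : ∀ y : S, ∃ n m : ℕ, (p : Sring p k) ^ m • ((E : Sring p k) ^ n * frobS p k d) • (y : X) = 0 := by
      intro y
      obtain ⟨b, hb0, hb⟩ := (mem_τ y).mp (hSτ y y.2)
      obtain ⟨n, z, hz⟩ := exists_pow_smul_toInv_eq hX (y : X)
      obtain ⟨c, hc0, hc⟩ := exists_frob_torsion hE hX hb0 (x := z) (by
        rw [← hz, smul_comm, ← map_smul, hb, map_zero, smul_zero])
      choose m hm using fun j => hJ d hdJ (z j) ((mem_τ _).mpr ⟨c, hc0, hc j⟩)
      have hm' : ∀ j, (p : Sring p k) ^ (∑ j, m j) • d • z j = 0 := fun j => by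
        rw [← Finset.sum_erase_add _ _ (Finset.mem_univ j), pow_add, mul_smul, hm, smul_zero]
      have h3 : toInv (E : Sring p k) X
          ((p : Sring p k) ^ (∑ j, m j) • ((E : Sring p k) ^ n * frobS p k d) • (y : X)) = 0 := by
        rw [map_smul, mul_comm, mul_smul, map_smul, map_smul, hz, Finset.smul_sum, Finset.smul_sum]
        refine Finset.sum_eq_zero fun j _ => ?_
        rw [smul_comm (frobS p k d), ← X.frob.map_smulₛₗ, smul_comm _ ((PowerSeries.X : Sring p k) ^ _),
          ← frobS_natCast (p := p) (k := k), ← map_pow, ← X.frob.map_smulₛₗ, hm' j, map_zero, smul_zero]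
      obtain ⟨l, hl⟩ := toInv_eq_zero.mp h3
      refine ⟨l + n, ∑ j, m j, ?_⟩
      rw [← hl, smul_comm ((E : Sring p k) ^ l), pow_add, mul_assoc, mul_smul _ _ (y : X)]
    choose n m hnm using h2
    refine ⟨∑ y, n y, fun y hy => ⟨m ⟨y, hy⟩, ?_⟩⟩
    rw [← Finset.sum_erase_add _ _ (Finset.mem_univ ⟨y, hy⟩), pow_add, mul_assoc, mul_smul, smul_comm,
      hnm ⟨y, hy⟩, smul_zero]
  -- The coordinates of `E ^ n d` kill the torsion up to powers of `p`.
  have h2 : ∃ n : ℕ, ∀ l, frobCoeff l ((E : Sring p k) ^ n * d) ∈ J := by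
    have h3 : ∀ y : S, ∃ n m : ℕ, ∀ a l,
        (p : Sring p k) ^ m • frobCoeff l (a * (E : Sring p k) ^ n * d) • (y : X) = 0 := by
      intro y
      obtain ⟨b, hb0, hb⟩ := (mem_τ y).mp (hSτ y y.2)
      obtain ⟨n, z, hz⟩ := exists_pow_smul_eq_toInv (X.frob (y : X))
      have h4 : frobS p k b • toInv (E : Sring p k) X z = 0 := by
        rw [← hz, smul_comm, ← X.frob.map_smulₛₗ, hb, map_zero, smul_zero]
      rw [← map_smul, toInv_eq_zero] at h4
      obtain ⟨l, hl⟩ := h4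
      rw [smul_smul] at hl
      obtain ⟨m, hm⟩ := hJ d hdJ z ((mem_τ _).mpr ⟨_, mul_ne_zero (pow_ne_zero _ hE.ne_zero)
        (fun h => hb0 (frobS_injective (h.trans (map_zero _).symm))), hl⟩)
      have h5 : ∑ _i : Unit, (frobS p k ((p : Sring p k) ^ m) * ((E : Sring p k) ^ n * d)) • X.frob (y : X) = 0 := by
        rw [Finset.univ_unique, Finset.sum_singleton, mul_comm ((E : Sring p k) ^ n), mul_smul, mul_smul, hz,
          ← map_smul, ← map_smul, map_pow, frobS_natCast, hm, map_zero]
      obtain ⟨n', h6⟩ := exists_coeff_of_sum_frob_eq_zero hE hX h5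
      refine ⟨n' + n, m, fun a l => ?_⟩
      have h7 := h6 a l
      rw [Finset.univ_unique, Finset.sum_singleton] at h7
      rw [smul_smul, ← frobCoeff_frobS_mul, ← h7]
      congr 2
      rw [pow_add]
      ring
    choose n m hnm using h3
    refine ⟨∑ y, n y, fun l y hy => ⟨m ⟨y, hy⟩, ?_⟩⟩
    rw [← Finset.sum_erase_add _ _ (Finset.mem_univ ⟨y, hy⟩), pow_add, hnm ⟨y, hy⟩]
  obtain ⟨n, h1⟩ := h1
  obtain ⟨m, h2⟩ := h2
  rw [hd, Ideal.mem_span_singleton] at h1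
  have h3 : frobS p k d ∣ (E : Sring p k) ^ m * d := by
    rw [← sum_frobCoeff ((E : Sring p k) ^ m * d)]
    refine Finset.dvd_sum fun j _ => Dvd.dvd.mul_left (map_dvd _ ?_) _
    have := h2 j
    rwa [hd, Ideal.mem_span_singleton] at this
  have hdu := isUnit_of_frobS_dvd hE hpd h1 h3
  have h4 : (1 : Sring p k) ∈ J := by
    rw [hd, Ideal.mem_span_singleton]
    exact hdu.dvd
  obtain ⟨n, hn⟩ := hJ 1 h4 x ((mem_τ x).mpr ⟨a, ha, hax⟩)
  exact ⟨n, by rwa [one_smul] at hn⟩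

end Frob

end Kisin

end

noncomputable section

namespace Kisin

/-! ### The lattice of a `p^∞`-torsion Kisin module and its Frobenius lattice -/

section

variable {A : Type u} [CommRing A]

theorem LengthFn.quo_eq_zero_of_le (lam : LengthFn.{u, w} A) {V : Type w} [AddCommGroup V] [Module A V]
    {K L : Submodule A V} (h : L ≤ K) : lam.quo K L = 0 := by
  rw [← lam.quo_inf, inf_eq_right.mpr h, quo_self]

theorem le_of_length_quo_eq_zero {V : Type w} [AddCommGroup V] [Module A V]
    {K L : Submodule A V} (h : (lengthFn.{u, w} A).quo K L = 0) : L ≤ K := by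
  have h1 : Subsingleton (L ⧸ K.submoduleOf L) := Module.length_eq_zero_iff.mp h
  intro x hx
  have h2 : (K.submoduleOf L).mkQ ⟨x, hx⟩ = 0 := Subsingleton.elim _ _
  exact (Submodule.Quotient.mk_eq_zero (K.submoduleOf L)).mp h2

theorem one_le_length_quo {V : Type w} [AddCommGroup V] [Module A V]
    {K L : Submodule A V} (h : ¬ L ≤ K) : 1 ≤ (lengthFn.{u, w} A).quo K L :=
  Order.one_le_iff_ne_zero.mpr (mt le_of_length_quo_eq_zero h)

theorem length_quo_span_singleton {V : Type w} [AddCommGroup V] [Module A V] [IsLocalRing A]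
    {K : Submodule A V} {x : V} (hx : x ∉ K) (hm : ∀ a ∈ IsLocalRing.maximalIdeal A, a • x ∈ K) :
    (lengthFn.{u, w} A).quo K (K ⊔ Submodule.span A {x}) = 1 := by
  rw [LengthFn.quo_sup]
  refine (Module.length_eq_one_iff).mpr (isSimpleModule_iff_quot_maximal.mpr
    ⟨IsLocalRing.maximalIdeal A, inferInstance, ?_⟩)
  let g : A →ₗ[A] (Submodule.span A {x} ⧸ K.submoduleOf (Submodule.span A {x})) :=
    Submodule.mkQ _ ∘ₗ LinearMap.toSpanSingleton A _ ⟨x, Submodule.mem_span_singleton_self x⟩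
  have hg : Function.Surjective g := by
    refine (Submodule.mkQ_surjective _).comp ?_
    rintro ⟨y, hy⟩
    obtain ⟨a, rfl⟩ := Submodule.mem_span_singleton.mp hy
    exact ⟨a, rfl⟩
  have hk : LinearMap.ker g = IsLocalRing.maximalIdeal A := by
    refine ((IsLocalRing.maximalIdeal.isMaximal _).eq_of_le (fun h => ?_) fun a ha => ?_).symm
    · have h1 : (1 : A) ∈ LinearMap.ker g := h ▸ trivial
      have h2 := (Submodule.Quotient.mk_eq_zero _).mp (LinearMap.mem_ker.mp h1)
      have h3 : (1 : A) • x ∈ K := h2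
      exact hx (by rwa [one_smul] at h3)
    · exact (Submodule.Quotient.mk_eq_zero _).mpr (hm a ha)
  exact ⟨((Submodule.quotEquivOfEq _ _ hk.symm).trans (g.quotKerEquivOfSurjective hg)).symm⟩

end

section

variable {p : ℕ} [hp : Fact p.Prime] {k : Type u} [Field k] [CharP k p] [PerfectRing k p]

/-- Quotients of finitely generated modules killed by powers of `p` and of `u` have finite length, since
`𝔖 / (p ^ n, u ^ m)` is artinian. -/
theorem length_quo_ne_top {V : Type w} [AddCommGroup V] [Module (Sring p k) V]
    {K L : Submodule (Sring p k) V} (hL : L.FG) {n m : ℕ} (h1 : ∀ x ∈ L, (p : Sring p k) ^ n • x ∈ K)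
    (h2 : ∀ x ∈ L, (PowerSeries.X : Sring p k) ^ m • x ∈ K) :
    (lengthFn.{u, w} (Sring p k)).quo K L ≠ ⊤ := by
  let I : Ideal (Sring p k) := Ideal.span {(p : Sring p k) ^ n, PowerSeries.X ^ m}
  have hI : Module.IsTorsionBySet (Sring p k) (L ⧸ K.submoduleOf L) I := by
    rw [← Module.isTorsionBySet_iff_is_torsion_by_span]
    rintro x ⟨_, rfl | rfl⟩ <;> obtain ⟨y, rfl⟩ := Submodule.mkQ_surjective _ x
    · exact (Submodule.Quotient.mk_eq_zero _).mpr (h1 y y.2)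
    · exact (Submodule.Quotient.mk_eq_zero _).mpr (h2 y y.2)
  have : IsArtinianRing (Sring p k ⧸ I) := by
    rw [isArtinianRing_iff_isNoetherianRing_krullDimLE_zero]
    refine ⟨inferInstance, Ring.krullDimLE_zero_iff.mpr fun P hP => ?_⟩
    have h3 : (P.comap (Ideal.Quotient.mk I)).IsPrime := hP.comap _
    have h4 : IsLocalRing.maximalIdeal (Sring p k) ≤ P.comap (Ideal.Quotient.mk I) := by
      have h5 : ∀ a ∈ I, a ∈ P.comap (Ideal.Quotient.mk I) := fun a ha => by
        rw [Ideal.mem_comap, Ideal.Quotient.eq_zero_iff_mem.mpr ha]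
        exact zero_mem _
      rw [maximalIdeal_S, Ideal.span_le]
      rintro _ (rfl | rfl)
      · exact h3.mem_of_pow_mem n (h5 _ (Ideal.subset_span (Set.mem_insert _ _)))
      · exact h3.mem_of_pow_mem m (h5 _ (Ideal.subset_span (Set.mem_insert_of_mem _ rfl)))
    have h6 := (IsLocalRing.maximalIdeal.isMaximal (Sring p k)).eq_of_le h3.ne_top h4
    have h7 : (P.comap (Ideal.Quotient.mk I)).IsMaximal := h6 ▸ inferInstance
    rcases Ideal.map_eq_top_or_isMaximal_of_surjective (Ideal.Quotient.mk I)
      Ideal.Quotient.mk_surjective h7 with h8 | h8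
    · rw [Ideal.map_comap_of_surjective _ Ideal.Quotient.mk_surjective] at h8
      exact absurd h8 hP.ne_top
    · rwa [Ideal.map_comap_of_surjective _ Ideal.Quotient.mk_surjective] at h8
  have : Module.Finite (Sring p k) L := Module.Finite.iff_fg.mpr hL
  let := hI.module
  have := hI.isScalarTower (S := Sring p k)
  have : Module.Finite (Sring p k ⧸ I) (L ⧸ K.submoduleOf L) :=
    Module.Finite.of_restrictScalars_finite (Sring p k) _ _
  have : IsArtinian (Sring p k) (L ⧸ K.submoduleOf L) :=
    isArtinian_of_surjective_algebraMap (R := Sring p k ⧸ I) Ideal.Quotient.mk_surjective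
  exact Module.length_ne_top

end

namespace PhiModule

section

variable {A : Type u} [CommRing A] {φ : A →+* A} {E : A}

/-- If a finitely generated submodule is contained in the union of an increasing sequence of
submodules, it is contained in one of them. -/
theorem exists_le_of_fg {V : Type w} [AddCommGroup V] [Module A V] {N : Submodule A V} (hN : N.FG)
    {P : ℕ → Submodule A V} (hP : Monotone P) (h : ∀ x ∈ N, ∃ n, x ∈ P n) : ∃ n, N ≤ P n := by
  obtain ⟨s, rfl⟩ := hN
  choose! n hn using h
  refine ⟨s.sup n, Submodule.span_le.mpr fun x hx => ?_⟩
  exact hP (Finset.le_sup hx) (hn x (Submodule.subset_span hx))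

variable (X : PhiModule.{u, v₁} φ E) {X' : PhiModule.{u, v₂} φ E}

/-- The image in `X[1/E]` of a submodule of `X`. -/
def latticeOf (K : Submodule A X) : Submodule A (Inv E X) := K.map (toInv E X)

/-- The `A`-submodule `φ_X (φ^* K)` of `X[1/E]` for a submodule `K` of `X`. -/
def frobSpan (K : Submodule A X) : Submodule A (Inv E X) := Submodule.span A (X.frob '' K)

variable {X}

theorem lattice_eq : X.lattice = X.latticeOf ⊤ := (Submodule.map_top _).symm

theorem frobLattice_eq_frobSpan : X.frobLattice = X.frobSpan ⊤ := by
  rw [frobLattice, frobSpan, Submodule.top_coe, Set.image_univ]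

theorem latticeOf_mono {K K' : Submodule A X} (h : K ≤ K') : X.latticeOf K ≤ X.latticeOf K' :=
  Submodule.map_mono h

theorem frobSpan_mono {K K' : Submodule A X} (h : K ≤ K') : X.frobSpan K ≤ X.frobSpan K' :=
  Submodule.span_mono (Set.image_mono h)

theorem map_latticeOf (f : X →ₗ[A] X') (K : Submodule A X) :
    (X.latticeOf K).map (invMap E f) = X'.latticeOf (K.map f) := by
  rw [latticeOf, latticeOf, ← Submodule.map_comp, ← Submodule.map_comp]
  congr 1
  ext x
  exact invMap_toInv f x

theorem IsHom.map_frobSpan {f : X →ₗ[A] X'} (hf : IsHom f) (K : Submodule A X) :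
    (X.frobSpan K).map (invMap E f) = X'.frobSpan (K.map f) := by
  rw [frobSpan, frobSpan, Submodule.map_span, Set.image_image, Submodule.map_coe, Set.image_image]
  simp only [hf _]

theorem frobSpan_span (s : Set X) : X.frobSpan (Submodule.span A s) = Submodule.span A (X.frob '' s) := by
  refine le_antisymm (Submodule.span_le.mpr ?_) (Submodule.span_mono (Set.image_mono Submodule.subset_span))
  rintro _ ⟨x, hx, rfl⟩
  rw [SetLike.mem_coe] at hx ⊢
  induction hx using Submodule.span_induction with
  | mem x hx => exact Submodule.subset_span ⟨x, hx, rfl⟩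
  | zero => rw [map_zero]; exact zero_mem _
  | add x y _ _ hx hy => rw [map_add]; exact add_mem hx hy
  | smul a x _ hx => rw [X.frob.map_smulₛₗ]; exact Submodule.smul_mem _ _ hx

theorem frobSpan_fg {K : Submodule A X} (hK : K.FG) : (X.frobSpan K).FG := by
  obtain ⟨s, rfl⟩ := hK
  rw [frobSpan_span]
  exact Submodule.fg_span (s.finite_toSet.image _)

theorem latticeOf_fg {K : Submodule A X} (hK : K.FG) : (X.latticeOf K).FG := hK.map _

theorem map_lattice (f : X →ₗ[A] X') : X.lattice.map (invMap E f) = X'.latticeOf (LinearMap.range f) := by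
  rw [lattice_eq, map_latticeOf, Submodule.map_top]

theorem IsHom.map_frobLattice {f : X →ₗ[A] X'} (hf : IsHom f) :
    X.frobLattice.map (invMap E f) = X'.frobSpan (LinearMap.range f) := by
  rw [frobLattice_eq_frobSpan, hf.map_frobSpan, Submodule.map_top]

end

end PhiModule

section

open PhiModule

variable {p : ℕ} [hp : Fact p.Prime] {k : Type u} [Field k] [CharP k p] [PerfectRing k p]
variable {E : (WittVector p k)[X]}

theorem IsEis.exists_X_pow_eq (hE : IsEis E) (N n : ℕ) : ∃ (c : ℕ) (a d : Sring p k),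
    (PowerSeries.X : Sring p k) ^ c = a * (E : Sring p k) ^ n + d * (p : Sring p k) ^ N := by
  obtain ⟨d, hd⟩ := hE.pow_dvd_pow_sub N n
  have h1 : n ≤ p ^ N * n := Nat.le_mul_of_pos_left n (pow_pos hp.out.pos N)
  refine ⟨E.natDegree * (p ^ N * n), (E : Sring p k) ^ (p ^ N * n - n), -d, ?_⟩
  rw [← pow_add, Nat.sub_add_cancel h1, neg_mul, mul_comm d, ← hd]
  ring

theorem pow_smul_eq_zero_imp {Y : Type v} [AddCommGroup Y] [Module (Sring p k) Y] {a : Sring p k}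
    (h : ∀ x : Y, a • x = 0 → x = 0) (n : ℕ) {x : Y} (hx : a ^ n • x = 0) : x = 0 := by
  induction n with
  | zero => rwa [pow_zero, one_smul] at hx
  | succ n ih => exact ih (h _ (by rwa [smul_smul, ← pow_succ']))

theorem IsEis.E_smul_eq_zero (hE : IsEis E) {Y : Type v} [AddCommGroup Y] [Module (Sring p k) Y]
    {N : ℕ} (hN : ∀ x : Y, (p : Sring p k) ^ N • x = 0)
    (hu : ∀ x : Y, (PowerSeries.X : Sring p k) • x = 0 → x = 0) {n : ℕ} {x : Y}
    (hx : (E : Sring p k) ^ n • x = 0) : x = 0 := by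
  obtain ⟨c, a, d, h⟩ := hE.exists_X_pow_eq N n
  refine pow_smul_eq_zero_imp hu c ?_
  rw [h, add_smul, mul_smul, mul_smul, hx, hN, smul_zero, smul_zero, add_zero]

theorem IsEis.toInv_injective (hE : IsEis E) {Y : Type v} [AddCommGroup Y] [Module (Sring p k) Y]
    {N : ℕ} (hN : ∀ x : Y, (p : Sring p k) ^ N • x = 0)
    (hu : ∀ x : Y, (PowerSeries.X : Sring p k) • x = 0 → x = 0) :
    Function.Injective (toInv (E : Sring p k) Y) := by
  rw [injective_iff_map_eq_zero]
  intro x hx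
  obtain ⟨n, hn⟩ := toInv_eq_zero.mp hx
  exact hE.E_smul_eq_zero hN hu hn

theorem smul_inv_eq_zero {A : Type u} [CommRing A] {a b : A} {Y : Type v} [AddCommGroup Y] [Module A Y]
    (h : ∀ x : Y, b • x = 0 → x = 0) (y : Inv a Y) (hy : b • y = 0) : y = 0 := by
  obtain ⟨n, x, hx⟩ := exists_pow_smul_eq_toInv y
  have h1 : toInv a Y (b • x) = 0 := by rw [map_smul, ← hx, smul_comm, hy, smul_zero]
  obtain ⟨m, hm⟩ := toInv_eq_zero.mp h1
  rw [smul_comm] at hm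
  have h2 : toInv a Y x = 0 := toInv_eq_zero.mpr ⟨m, h _ hm⟩
  refine pow_smul_inv_injective (a := a) n ?_
  change a ^ n • y = a ^ n • 0
  rw [hx, h2, smul_zero]

theorem smul_inv_of_forall {A : Type u} [CommRing A] {a b : A} {Y : Type v} [AddCommGroup Y] [Module A Y]
    (h : ∀ x : Y, b • x = 0) (y : Inv a Y) : b • y = 0 := by
  obtain ⟨n, x, hx⟩ := exists_pow_smul_eq_toInv y
  refine pow_smul_inv_injective (a := a) n ?_
  change a ^ n • b • y = a ^ n • 0
  rw [smul_comm, hx, ← map_smul, h, map_zero, smul_zero]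

variable {M : PhiMod.{u, v} E}

theorem torsionRank_eq (M : PhiMod.{u, v} E) : torsionRank M
    = ((lengthFn.{u, v} (Sring p k)).quo ((PowerSeries.X : Sring p k) • ⊤ : Submodule (Sring p k) M) ⊤).toNat := by
  rw [LengthFn.quo_top]
  rfl

/-- The lattice and the Frobenius lattice of a `p`-power torsion module are commensurable. -/
theorem exists_pow_smul_lattice_le (hE : IsEis E) [Module.Finite (Sring p k) M] (hM : M.IsEtale) {N : ℕ}
    (hN : ∀ x : M, (p : Sring p k) ^ N • x = 0) :
    ∃ c : ℕ, (PowerSeries.X : Sring p k) ^ c • M.lattice ≤ M.frobLattice ∧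
      (PowerSeries.X : Sring p k) ^ c • M.frobLattice ≤ M.lattice := by
  have hNi : ∀ y : Inv (E : Sring p k) M, (p : Sring p k) ^ N • y = 0 := smul_inv_of_forall hN
  have key : ∀ K L : Submodule (Sring p k) (Inv (E : Sring p k) M), K.FG →
      (∀ x ∈ K, ∃ n : ℕ, (E : Sring p k) ^ n • x ∈ L) →
      ∃ c₀ : ℕ, ∀ c, c₀ ≤ c → (PowerSeries.X : Sring p k) ^ c • K ≤ L := by
    intro K L hK h
    obtain ⟨n, hn⟩ := exists_le_of_fg hK
      (P := fun n => L.comap (DistribSMul.toLinearMap (Sring p k) _ ((E : Sring p k) ^ n)))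
      (monotone_nat_of_le_succ fun n x hx => by
        change (E : Sring p k) ^ (n + 1) • x ∈ L
        rw [pow_succ', mul_smul]
        exact L.smul_mem _ hx) h
    obtain ⟨c, a, d, h1⟩ := hE.exists_X_pow_eq N n
    refine ⟨c, fun c' hc' => ?_⟩
    rintro _ ⟨x, hx, rfl⟩
    change (PowerSeries.X : Sring p k) ^ c' • x ∈ L
    rw [← Nat.sub_add_cancel hc', pow_add, h1, mul_smul, add_smul, mul_smul, mul_smul, hNi, smul_zero, add_zero]
    exact L.smul_mem _ (L.smul_mem _ (hn hx))
  obtain ⟨c, hc⟩ := key M.lattice M.frobLattice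
    (lattice_eq (X := M) ▸ latticeOf_fg Module.Finite.fg_top) (by
      rintro _ ⟨x, rfl⟩
      obtain ⟨n, x', h⟩ := exists_pow_smul_toInv_eq hM x
      exact ⟨n, mem_frobLattice_iff.mpr ⟨x', h⟩⟩)
  obtain ⟨c', hc'⟩ := key M.frobLattice M.lattice
    (frobLattice_eq_frobSpan (X := M) ▸ frobSpan_fg Module.Finite.fg_top) (by
      intro y _
      obtain ⟨n, x, h⟩ := exists_pow_smul_eq_toInv y
      exact ⟨n, x, h.symm⟩)
  exact ⟨max c c', hc _ (le_max_left _ _), hc' _ (le_max_right _ _)⟩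

theorem length_quo_X_pow_smul_ne_top {V : Type w} [AddCommGroup V] [Module (Sring p k) V] {N : ℕ}
    (hN : ∀ x : V, (p : Sring p k) ^ N • x = 0) {L L' : Submodule (Sring p k) V} (hL' : L'.FG) {j : ℕ}
    (hj : (PowerSeries.X : Sring p k) ^ j • L' ≤ L) (m : ℕ) :
    (lengthFn.{u, w} (Sring p k)).quo ((PowerSeries.X : Sring p k) ^ m • L) L' ≠ ⊤ := by
  refine length_quo_ne_top hL' (n := N) (m := m + j) (fun x _ => ?_) (fun x hx => ?_)
  · rw [hN]
    exact zero_mem _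
  · rw [pow_add, mul_smul]
    exact Submodule.smul_mem_pointwise_smul _ _ _ (hj (Submodule.smul_mem_pointwise_smul _ _ _ hx))

theorem lattice_fg [Module.Finite (Sring p k) M] : M.lattice.FG :=
  lattice_eq (X := M) ▸ latticeOf_fg Module.Finite.fg_top

theorem frobLattice_fg [Module.Finite (Sring p k) M] : M.frobLattice.FG :=
  frobLattice_eq_frobSpan (X := M) ▸ frobSpan_fg Module.Finite.fg_top

theorem length_quo_lattice (hE : IsEis E) {N : ℕ}
    (hN : ∀ x : M, (p : Sring p k) ^ N • x = 0)
    (hu : ∀ x : M, (PowerSeries.X : Sring p k) • x = 0 → x = 0) :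
    (lengthFn.{u, max u v} (Sring p k)).quo ((PowerSeries.X : Sring p k) • M.lattice) M.lattice
    = (lengthFn.{u, v} (Sring p k)).quo ((PowerSeries.X : Sring p k) • ⊤ : Submodule (Sring p k) M) ⊤ := by
  let e : M ≃ₗ[Sring p k] M.lattice := LinearEquiv.ofInjective _ (hE.toInv_injective hN hu)
  rw [LengthFn.quo_top]
  refine (Submodule.Quotient.equiv _ _ e ?_).length_eq.symm
  ext ⟨x, hx⟩
  rw [Submodule.submoduleOf, Submodule.mem_comap, Submodule.mem_smul_pointwise_iff_exists]
  constructor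
  · rintro ⟨z, hz, h⟩
    obtain ⟨y, -, rfl⟩ := Submodule.mem_smul_pointwise_iff_exists _ _ _ |>.1 hz
    exact ⟨e y, (e y).2, (congrArg Subtype.val (map_smul e _ _)).symm.trans (congrArg Subtype.val h)⟩
  · rintro ⟨_, ⟨y, rfl⟩, h⟩
    exact ⟨(PowerSeries.X : Sring p k) • y, Submodule.smul_mem_pointwise_smul _ _ _ trivial,
      Subtype.ext ((map_smul (toInv (E : Sring p k) M) _ _).trans h)⟩

/-- The rank may be computed with the Frobenius lattice instead of the lattice. -/
theorem torsionRank_eq_frobLattice (hE : IsEis E) (hM : (torsionData E).IsObj M) :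
    (torsionRank M : ℤ) = (lengthFn.{u, max u v} (Sring p k)).idx
      ((PowerSeries.X : Sring p k) • M.frobLattice) M.frobLattice := by
  obtain ⟨hfin, het, ⟨N, hN⟩, hu⟩ := hM
  obtain ⟨c, h1, h2⟩ := exists_pow_smul_lattice_le hE het hN
  have hNi : ∀ y : Inv (E : Sring p k) M, (p : Sring p k) ^ N • y = 0 := smul_inv_of_forall hN
  have hui := smul_inv_eq_zero (a := (E : Sring p k)) hu
  set lam := lengthFn.{u, max u v} (Sring p k) with hlam
  have hX : ∀ L : Submodule (Sring p k) (Inv (E : Sring p k) M), (PowerSeries.X : Sring p k) • L ≤ L :=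
    smul_submodule_le _
  have e1 : (torsionRank M : ℤ) = lam.idx ((PowerSeries.X : Sring p k) • M.lattice) M.lattice := by
    rw [lam.idx_of_le (hX _), torsionRank_eq, length_quo_lattice hE hN hu]
  have hK : (PowerSeries.X : Sring p k) ^ (1 + c) • M.lattice ≤ (PowerSeries.X : Sring p k) • M.frobLattice := by
    rw [pow_add, pow_one, ← smul_smul]
    exact smul_mono_right _ h1
  have hK' : (PowerSeries.X : Sring p k) ^ (1 + c) • M.lattice ≤ (PowerSeries.X : Sring p k) • M.lattice := by
    rw [pow_add, pow_one, ← smul_smul]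
    exact smul_mono_right _ (smul_submodule_le _ _)
  have hf1 : lam.quo ((PowerSeries.X : Sring p k) ^ (1 + c) • M.lattice) M.lattice ≠ ⊤ :=
    length_quo_X_pow_smul_ne_top hNi lattice_fg (j := 0) (by rw [pow_zero, one_smul]) _
  have hf2 : lam.quo ((PowerSeries.X : Sring p k) ^ (1 + c) • M.lattice) M.frobLattice ≠ ⊤ :=
    length_quo_X_pow_smul_ne_top hNi frobLattice_fg h2 _
  have hf1' := ne_top_of_le_ne_top hf1 (lam.quo_mono_right hK' (hX _))
  have hf2' := ne_top_of_le_ne_top hf2 (lam.quo_mono_right hK (hX _))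
  have e2 := lam.idx_add hK' (hK'.trans (hX _)) (hK.trans (hX _)) hf1' hf1 hf2
  have e3 := lam.idx_add hK' hK (hK.trans (hX _)) hf1' hf2' hf2
  have e4 : lam.idx ((PowerSeries.X : Sring p k) • M.lattice) ((PowerSeries.X : Sring p k) • M.frobLattice)
      = lam.idx M.lattice M.frobLattice := by
    rw [LengthFn.idx, LengthFn.idx, lam.quo_smul_smul hui, lam.quo_smul_smul hui]
  rw [e1]
  linarith

/-- The degree of a `p^∞`-torsion Kisin module is the relative index of its lattice and of its
Frobenius lattice, up to the normalization. -/
theorem torsionDeg_eq (hE : IsEis E) (hM : (torsionData E).IsObj M) :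
    torsionDeg M = ((lengthFn.{u, max u v} (Sring p k)).idx M.lattice M.frobLattice : ℚ) / E.natDegree := by
  have hr := torsionRank_eq_frobLattice hE hM
  obtain ⟨hfin, het, ⟨N, hN⟩, hu⟩ := hM
  obtain ⟨c, h1, h2⟩ := exists_pow_smul_lattice_le hE het hN
  have hNi : ∀ y : Inv (E : Sring p k) M, (p : Sring p k) ^ N • y = 0 := smul_inv_of_forall hN
  have hui := smul_inv_eq_zero (a := (E : Sring p k)) hu
  set lam := lengthFn.{u, max u v} (Sring p k) with hlam
  set i := twistExp M with hi
  have hiL : (PowerSeries.X : Sring p k) ^ i • M.frobLattice ≤ M.lattice :=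
    Nat.sInf_mem (s := {i | (PowerSeries.X : Sring p k) ^ i • M.frobLattice ≤ M.lattice}) ⟨c, h2⟩
  have hK : (PowerSeries.X : Sring p k) ^ (i + c) • M.lattice ≤ (PowerSeries.X : Sring p k) ^ i • M.frobLattice := by
    rw [pow_add, ← smul_smul]
    exact smul_mono_right _ h1
  have hf1 : lam.quo ((PowerSeries.X : Sring p k) ^ (i + c) • M.lattice) M.lattice ≠ ⊤ :=
    length_quo_X_pow_smul_ne_top hNi lattice_fg (j := 0) (by rw [pow_zero, one_smul]) _
  have hf2 : lam.quo ((PowerSeries.X : Sring p k) ^ (i + c) • M.lattice) M.frobLattice ≠ ⊤ :=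
    length_quo_X_pow_smul_ne_top hNi frobLattice_fg h2 _
  have hf3 := ne_top_of_le_ne_top hf1 (lam.quo_mono_right hK hiL)
  -- The relative indices of `u ^ i φ_M(φ^* M) ⊆ M` and of `u ^ i φ_M(φ^* M) ⊆ φ_M(φ^* M)` differ by that
  -- of `M` and `φ_M(φ^* M)`; the second one is `i` times the rank.
  have e1 := lam.idx_add (hK.trans hiL) hK (hK.trans (smul_submodule_le _ _)) hf1 hf3 hf2
  rw [lam.idx_symm (_ • M.frobLattice) M.lattice, lam.idx_of_le hiL, lam.idx_of_le (smul_submodule_le _ _),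
    lam.quo_pow_smul hui, ENat.toNat_mul, ENat.toNat_natCast] at e1
  rw [lam.idx_of_le (smul_submodule_le _ _)] at hr
  rw [torsionDeg, e1]
  congr 1
  have hr' : (torsionRank M : ℚ) = ((lam.quo ((PowerSeries.X : Sring p k) • M.frobLattice) M.frobLattice).toNat : ℚ) := by
    exact_mod_cast hr
  rw [hr', ← hi]
  push_cast
  rw [sub_eq_neg_add]
  rfl

end

end Kisin

end

noncomputable section

namespace Kisin

/-! ### The category of `p^∞`-torsion Kisin modules -/

section

variable {A : Type u} [CommRing A]

/-- Length does not decrease along a strictly monotone map between lattices of submodules. -/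
theorem length_quo_le_of_strictMonoOn {V : Type w} {V' : Type w'} [AddCommGroup V] [Module A V]
    [AddCommGroup V'] [Module A V'] (F : Submodule A V → Submodule A V') {K L : Submodule A V}
    (hKL : K ≤ L) (hF : Monotone F) (hF' : ∀ P Q, K ≤ P → P ≤ Q → Q ≤ L → F Q ≤ F P → Q ≤ P) :
    (lengthFn.{u, w} A).quo K L ≤ (lengthFn.{u, w'} A).quo (F K) (F L) := by
  let up : Submodule A (L ⧸ K.submoduleOf L) → Submodule A V := fun P =>
    (P.comap (K.submoduleOf L).mkQ).map L.subtype
  have hup : ∀ P, K ≤ up P ∧ up P ≤ L := fun P => by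
    refine ⟨fun x hx => ⟨⟨x, hKL hx⟩, ?_, rfl⟩, Submodule.map_subtype_le _ _⟩
    change (K.submoduleOf L).mkQ ⟨x, hKL hx⟩ ∈ P
    rw [Submodule.mkQ_apply, (Submodule.Quotient.mk_eq_zero (K.submoduleOf L)).mpr hx]
    exact zero_mem _
  have hupm : ∀ P Q, up P ≤ up Q ↔ P ≤ Q := fun P Q => by
    rw [Submodule.map_le_map_iff_of_injective L.injective_subtype,
      Submodule.comap_le_comap_iff_of_surjective (Submodule.mkQ_surjective _)]
  let down : Submodule A V' → Submodule A (F L ⧸ (F K).submoduleOf (F L)) := fun P =>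
    (P.submoduleOf (F L)).map ((F K).submoduleOf (F L)).mkQ
  have hdown : ∀ P Q, F K ≤ P → F K ≤ Q → P ≤ F L → Q ≤ F L → (down P ≤ down Q ↔ P ≤ Q) := by
    intro P Q h1 h2 h3 h4
    refine ⟨fun h x hx => ?_, fun h => Submodule.map_mono (Submodule.comap_mono h)⟩
    obtain ⟨y, hy, hxy⟩ := h (⟨⟨x, h3 hx⟩, hx, rfl⟩ : ((F K).submoduleOf (F L)).mkQ ⟨x, h3 hx⟩ ∈ down P)
    have h5 := (Submodule.Quotient.eq ((F K).submoduleOf (F L))).mp hxy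
    have h6 : (y : V') - x ∈ Q := h2 h5
    have h7 := Q.sub_mem (show (y : V') ∈ Q from hy) h6
    rwa [sub_sub_cancel] at h7
  have hsm : StrictMono fun P => down (F (up P)) := by
    intro P Q hPQ
    have hd : ∀ P Q, down (F (up P)) ≤ down (F (up Q)) ↔ F (up P) ≤ F (up Q) := fun P Q =>
      hdown _ _ (hF (hup P).1) (hF (hup Q).1) (hF (hup P).2) (hF (hup Q).2)
    refine lt_of_le_not_ge ((hd _ _).mpr (hF ((hupm _ _).mpr hPQ.le))) fun h => hPQ.not_ge ?_
    exact (hupm _ _).mp (hF' _ _ (hup P).1 ((hupm _ _).mpr hPQ.le) (hup Q).2 ((hd _ _).mp h))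
  have h := Order.krullDim_le_of_strictMono _ hsm
  rw [← Module.coe_length, ← Module.coe_length] at h
  exact WithBot.coe_le_coe.mp h

theorem LengthFn.quo_smul_eq (lam : LengthFn.{u, w} A) {V : Type w} [AddCommGroup V] [Module A V]
    {a : A} (ha : ∀ x : V, a • x = 0 → x = 0) {S J : Submodule A V} (h : S ≤ J)
    (hf : lam.quo S J ≠ ⊤) : lam.quo (a • S) S = lam.quo (a • J) J := by
  have h1 := lam.quo_add (smul_submodule_le a S) h
  have h2 := lam.quo_add (smul_mono_right a h) (smul_submodule_le a J)
  rw [lam.quo_smul_smul ha, h1, add_comm] at h2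
  exact ENat.add_right_injective_of_ne_top hf h2

end

section

open PhiModule

variable {p : ℕ} [hp : Fact p.Prime] {k : Type u} [Field k] [CharP k p] [PerfectRing k p]
variable {E : (WittVector p k)[X]} {M M' M'' : PhiMod.{u, v} E}

theorem exact_incl_proj {A : Type u} [CommRing A] {φ : A →+* A} {e : A} {M : PhiModule.{u, v} φ e}
    (N : Submodule A M) : Function.Exact (M.incl N) (M.proj N) := by
  rw [LinearMap.exact_iff, ker_proj, range_incl]

theorem PhiModule.incl_mem {A : Type u} [CommRing A] {φ : A →+* A} {e : A} {M : PhiModule.{u, v} φ e}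
    {N : Submodule A M} (x : M.sub N) : M.incl N x ∈ N :=
  (range_incl N).le ⟨x, rfl⟩

theorem PhiModule.Subquot.exact {A : Type u} [CommRing A] {φ : A →+* A} {e : A}
    {M : PhiModule.{u, v} φ e} {N N' : Submodule A M} {Q : PhiModule.{u, w} φ e}
    (h : Subquot M N N' Q) : Function.Exact (inclOfLE h.le) h.π := by
  intro y
  rw [h.ker]
  constructor
  · intro hy
    exact ⟨mkSub _ hy, M.incl_injective N' (by rw [incl_inclOfLE, incl_mkSub])⟩
  · rintro ⟨x, rfl⟩
    rw [incl_inclOfLE]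
    exact incl_mem x

theorem torsionRank_iso (h : Iso M M') : torsionRank M = torsionRank M' := by
  obtain ⟨e, -⟩ := h
  rw [torsionRank_eq, torsionRank_eq, LengthFn.quo_smul_congr _ _ e]

theorem torsionDeg_iso (h : Iso M M') : torsionDeg M = torsionDeg M' := by
  have hr := torsionRank_iso h
  obtain ⟨e, he⟩ := h
  set f := invMap (E : Sring p k) e.toLinearMap with hf
  have hfi : Function.Injective f := invMap_injective e.injective
  have hrange : LinearMap.range e.toLinearMap = ⊤ := LinearMap.range_eq_top.mpr e.surjective
  have h1 : M.lattice.map f = M'.lattice := by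
    rw [hf, map_lattice, hrange, lattice_eq]
  have h2 : ∀ i : ℕ, ((PowerSeries.X : Sring p k) ^ i • M.frobLattice).map f
      = (PowerSeries.X : Sring p k) ^ i • M'.frobLattice := by
    intro i
    rw [Submodule.map_pointwise_smul, hf, he.map_frobLattice, hrange, frobLattice_eq_frobSpan]
  have h3 : twistExp M = twistExp M' := by
    rw [twistExp, twistExp]
    congr 1
    ext i
    rw [Set.mem_ofPred_eq, Set.mem_ofPred_eq, ← h1, ← h2, Submodule.map_le_map_iff_of_injective hfi]
  have h4 := (lengthFn.{u, max u v} (Sring p k)).quo_map hfi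
    ((PowerSeries.X : Sring p k) ^ twistExp M • M.frobLattice) M.lattice
  rw [h1, h2] at h4
  rw [torsionDeg, torsionDeg, ← h3, hr]
  change _ = (_ - (((lengthFn.{u, max u v} (Sring p k)).quo _ _).toNat : ℚ)) / _
  rw [h4]
  rfl

theorem torsionRank_quo_ne_top (hM : (torsionData E).IsObj M) :
    (lengthFn.{u, v} (Sring p k)).quo ((PowerSeries.X : Sring p k) • ⊤ : Submodule (Sring p k) M) ⊤ ≠ ⊤ := by
  obtain ⟨hfin, het, ⟨N, hN⟩, hu⟩ := hM
  have h := length_quo_X_pow_smul_ne_top hN (L := (⊤ : Submodule (Sring p k) M)) (L' := ⊤)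
    Module.Finite.fg_top (j := 0) le_top 1
  rwa [pow_one] at h

/-- The rank is additive in short exact sequences. -/
theorem torsionRank_exact {f : M →ₗ[Sring p k] M'} {g : M' →ₗ[Sring p k] M''}
    (hf : Function.Injective f) (hg : Function.Surjective g) (hex : Function.Exact f g)
    (hM' : (torsionData E).IsObj M') (hM'' : (torsionData E).IsObj M'') :
    torsionRank M' = torsionRank M + torsionRank M'' := by
  have h := (lengthFn.{u, v} (Sring p k)).quo_smul_exact hf hg hex hM''.2.2.2
  have h1 := torsionRank_quo_ne_top hM'
  rw [torsionRank_eq, torsionRank_eq, torsionRank_eq, h, ENat.toNat_add]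
  · exact fun h2 => h1 (by rw [h, h2, top_add])
  · exact fun h2 => h1 (by rw [h, h2, add_top])

/-- The degree is additive in short exact sequences: both lattices are exact functors. -/
theorem torsionDeg_exact (hE : IsEis E) {f : M →ₗ[Sring p k] M'} {g : M' →ₗ[Sring p k] M''}
    (hfh : IsHom f) (hgh : IsHom g)
    (hf : Function.Injective f) (hg : Function.Surjective g) (hex : Function.Exact f g)
    (hM : (torsionData E).IsObj M) (hM' : (torsionData E).IsObj M')
    (hM'' : (torsionData E).IsObj M'') :
    torsionDeg M' = torsionDeg M + torsionDeg M'' := by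
  rw [torsionDeg_eq hE hM, torsionDeg_eq hE hM', torsionDeg_eq hE hM'']
  obtain ⟨hfin, het, ⟨N, hN⟩, hu⟩ := hM'
  obtain ⟨hfin'', het'', ⟨N'', hN''⟩, hu''⟩ := hM''
  obtain ⟨c, h1, h2⟩ := exists_pow_smul_lattice_le hE het hN
  have hinj := hE.toInv_injective hN hu
  have hfi : Function.Injective (invMap (E : Sring p k) f) := invMap_injective hf
  have hrange : LinearMap.range g = ⊤ := LinearMap.range_eq_top.mpr hg
  have e := (lengthFn.{u, max u v} (Sring p k)).idx_exact (invMap_exact (a := (E : Sring p k)) hex)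
    (K := (PowerSeries.X : Sring p k) ^ c • M'.lattice) (L₁ := M'.lattice) (L₂ := M'.frobLattice)
    (smul_submodule_le _ _) h1
    (length_quo_X_pow_smul_ne_top (smul_inv_of_forall hN) lattice_fg (j := 0)
      (by rw [pow_zero, one_smul]) _)
    (length_quo_X_pow_smul_ne_top (smul_inv_of_forall hN) frobLattice_fg h2 _)
  have h3 : M'.lattice.map (invMap (E : Sring p k) g) = M''.lattice := by
    rw [map_lattice, hrange, lattice_eq]
  have h4 : M'.frobLattice.map (invMap (E : Sring p k) g) = M''.frobLattice := by
    rw [hgh.map_frobLattice, hrange, frobLattice_eq_frobSpan]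
  -- Since `M''` has no `E`-torsion, the lattice of `M'` meets `M[1/E]` in that of `M`.
  have h5 : M'.lattice.comap (invMap (E : Sring p k) f) = M.lattice := by
    apply le_antisymm
    · rintro y ⟨m, hm⟩
      obtain ⟨n, x, hx⟩ := exists_pow_smul_eq_toInv y
      have h6 : (E : Sring p k) ^ n • m = f x := hinj (by
        rw [map_smul, hm, ← map_smul, hx, invMap_toInv])
      have h7 : g m = 0 := hE.E_smul_eq_zero hN'' hu'' (n := n) (by
        rw [← map_smul, h6, hex.apply_apply_eq_zero])
      obtain ⟨m', rfl⟩ := (hex m).mp h7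
      exact ⟨m', hfi (by rw [invMap_toInv, hm])⟩
    · rintro _ ⟨x, rfl⟩
      exact ⟨f x, (invMap_toInv f x).symm⟩
  -- The same for the Frobenius lattices: the coordinates of an element of the Frobenius lattice of `M'`
  -- which vanishes in `M''[1/E]` vanish in `M''`.
  have h6 : M'.frobLattice.comap (invMap (E : Sring p k) f) = M.frobLattice := by
    apply le_antisymm
    · intro y hy
      obtain ⟨x, hx⟩ := mem_frobLattice_iff.mp hy
      have h7 : ∑ j : Fin p, (PowerSeries.X : Sring p k) ^ (j : ℕ) • M''.frob (g (x j)) = 0 := by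
        have h8 := congrArg (invMap (E : Sring p k) g) hx
        rw [(invMap_exact hex).apply_apply_eq_zero, map_sum] at h8
        rw [h8]
        exact Finset.sum_congr rfl fun j _ => by rw [map_smul, hgh]
      choose x' hx' using fun j => (hex (x j)).mp (eq_zero_of_sum_frob_eq_zero hE het'' hN'' hu'' h7 j)
      refine mem_frobLattice_iff.mpr ⟨x', hfi ?_⟩
      rw [hx, map_sum]
      exact Finset.sum_congr rfl fun j _ => by rw [map_smul, hfh, hx']
    · rw [← Submodule.map_le_iff_le_comap, hfh.map_frobLattice, frobLattice_eq_frobSpan]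
      exact frobSpan_mono le_top
  rw [h3, h4, h5, h6] at e
  rw [e]
  push_cast
  ring

theorem torsion_iso_obj (h : Iso M M') (hM : (torsionData E).IsObj M) : (torsionData E).IsObj M' := by
  have het := h.isEtale hM.2.1
  obtain ⟨e, -⟩ := h
  obtain ⟨hfin, -, ⟨N, hN⟩, hu⟩ := hM
  refine ⟨Module.Finite.equiv e, het, ⟨N, fun x => ?_⟩, fun x hx => ?_⟩
  · rw [← e.apply_symm_apply x, ← map_smul, hN, map_zero]
  · exact e.symm.map_eq_zero_iff.mp (hu _ (by rw [← map_smul, hx, map_zero]))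

/-- A submodule of a `p^∞`-torsion Kisin module is a subobject if it is étale. -/
theorem torsion_isObj_sub (hM : (torsionData E).IsObj M) {N : Submodule (Sring p k) M}
    (hN : M.IsEtaleSub N) : (torsionData E).IsObj (M.sub N) := by
  obtain ⟨hfin, het, ⟨n, hn⟩, hu⟩ := hM
  refine ⟨inferInstanceAs (Module.Finite (Sring p k) N), hN.sub_isEtale het, ⟨n, fun x => ?_⟩, fun x hx => ?_⟩
  · exact M.incl_injective N (by rw [map_smul, hn, map_zero])
  · exact M.incl_injective N (by rw [hu (M.incl N x) (by rw [← map_smul, hx, map_zero]), map_zero])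

theorem torsion_isStrictSub_iff (hM : (torsionData E).IsObj M) {N : Submodule (Sring p k) M} :
    (torsionData E).IsStrictSub M N ↔
      M.IsEtaleSub N ∧ ∀ x, (PowerSeries.X : Sring p k) • x ∈ N → x ∈ N := by
  have hx0 : ∀ x, M.proj N x = 0 ↔ x ∈ N := fun x => by
    rw [← LinearMap.mem_ker, ker_proj]
  constructor
  · rintro ⟨h1, h2, h3⟩
    refine ⟨h1.isEtaleSub_of_quot hM.2.1 h3.2.1, fun x hx => ?_⟩
    rw [← hx0] at hx ⊢
    exact h3.2.2.2 _ (by rw [← map_smul, hx])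
  · rintro ⟨h1, h2⟩
    have hM' := hM
    obtain ⟨hfin, het, ⟨n, hn⟩, hu⟩ := hM'
    refine ⟨h1.1, torsion_isObj_sub hM h1, Module.Finite.of_surjective _ (M.proj_surjective N), h1.quot_isEtale het,
      ⟨n, fun x => ?_⟩, fun x hx => ?_⟩
    · obtain ⟨x, rfl⟩ := M.proj_surjective N x
      rw [← map_smul, hn, map_zero]
    · obtain ⟨x, rfl⟩ := M.proj_surjective N x
      rw [← map_smul, hx0] at hx
      exact (hx0 _).mpr (h2 _ hx)

theorem torsion_subsingleton (hM : (torsionData E).IsObj M) (h : torsionRank M = 0) :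
    Subsingleton M := by
  have h1 := torsionRank_quo_ne_top hM
  have hfin := hM.1
  rw [torsionRank_eq, ENat.toNat_eq_zero, or_iff_left h1] at h
  have h2 := le_of_length_quo_eq_zero h
  have h3 : (⊤ : Submodule (Sring p k) M) ≤ ⊥ := nakayama (a := (PowerSeries.X : Sring p k)) not_isUnit_X fun y _ => by
    obtain ⟨z, -, rfl⟩ := h2 (trivial : y ∈ ⊤)
    exact ⟨z, trivial, by simp⟩
  exact subsingleton_of_forall_eq 0 fun x => h3 (trivial : x ∈ ⊤)

theorem torsionRank_subsingleton [Subsingleton M] : torsionRank M = 0 := by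
  rw [torsionRank_eq, LengthFn.quo_eq_zero_of_le, ENat.toNat_zero]
  exact fun x _ => by rw [Subsingleton.elim x 0]; exact zero_mem _

/-- The elements a multiple of which by a power of `u` lies in `S`. -/
def satX {V : Type w} [AddCommGroup V] [Module (Sring p k) V] (S : Submodule (Sring p k) V) :
    Submodule (Sring p k) V where
  carrier := {x | ∃ n : ℕ, (PowerSeries.X : Sring p k) ^ n • x ∈ S}
  add_mem' := by
    rintro x y ⟨n, hn⟩ ⟨m, hm⟩
    refine ⟨n + m, ?_⟩
    rw [smul_add, pow_add, mul_smul, mul_smul _ _ y]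
    refine S.add_mem ?_ (S.smul_mem _ hm)
    rw [smul_comm]
    exact S.smul_mem _ hn
  zero_mem' := ⟨0, by rw [smul_zero]; exact S.zero_mem⟩
  smul_mem' := by
    rintro a x ⟨n, hn⟩
    exact ⟨n, by rw [smul_comm]; exact S.smul_mem _ hn⟩

theorem le_satX {V : Type w} [AddCommGroup V] [Module (Sring p k) V] (S : Submodule (Sring p k) V) :
    S ≤ satX S := fun x hx => ⟨0, by rwa [pow_zero, one_smul]⟩

theorem mem_satX_of_smul_mem {V : Type w} [AddCommGroup V] [Module (Sring p k) V]
    {S : Submodule (Sring p k) V} {n : ℕ} {x : V} (h : (PowerSeries.X : Sring p k) ^ n • x ∈ satX S) :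
    x ∈ satX S := by
  obtain ⟨m, hm⟩ := h
  exact ⟨m + n, by rwa [pow_add, mul_smul]⟩

theorem satX_le {V : Type w} [AddCommGroup V] [Module (Sring p k) V] {S Z : Submodule (Sring p k) V}
    (h : S ≤ Z) (hZ : ∀ x, (PowerSeries.X : Sring p k) • x ∈ Z → x ∈ Z) : satX S ≤ Z := by
  rintro x ⟨n, hn⟩
  replace hn := h hn
  induction n with
  | zero => rwa [pow_zero, one_smul] at hn
  | succ n ih => exact ih (hZ _ (by rwa [smul_smul, ← pow_succ']))

/-- The `u`-saturation of an étale submodule is étale. -/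
theorem isEtaleSub_satX (hE : IsEis E) (hM : (torsionData E).IsObj M) {S : Submodule (Sring p k) M}
    (hS : M.IsEtaleSub S) : M.IsEtaleSub (satX S) := by
  obtain ⟨hfin, het, ⟨N, hN⟩, hu⟩ := hM
  constructor
  · intro x ⟨n, hn⟩
    change M.frob x ∈ M.loc (satX S)
    have h1 : M.frob ((PowerSeries.X : Sring p k) ^ n • x) ∈ M.loc S := hS.1 _ hn
    rw [M.frob.map_smulₛₗ, map_pow, frobS_X, ← pow_mul] at h1
    obtain ⟨m, z, hz⟩ := exists_pow_smul_eq_toInv (M.frob x)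
    have h2 := (M.loc S).smul_mem ((E : Sring p k) ^ m) h1
    rw [smul_comm, hz, ← map_smul, toInv_mem_loc] at h2
    obtain ⟨l, hl⟩ := h2
    refine mem_loc.mpr ⟨l + m, (E : Sring p k) ^ l • z, ⟨p * n, by rwa [smul_comm]⟩, ?_⟩
    rw [pow_add, mul_smul, hz, map_smul]
  · intro x ⟨a, ha⟩
    obtain ⟨n, x', hx'⟩ := exists_pow_smul_toInv_eq het x
    have hQ : (M.quot S).IsEtale := hS.quot_isEtale het
    have hQN : ∀ y : M.quot S, (p : Sring p k) ^ N • y = 0 := fun y => by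
      obtain ⟨y, rfl⟩ := M.proj_surjective S y
      rw [← map_smul, hN, map_zero]
    have h1 : ∑ j : Fin p, (PowerSeries.X : Sring p k) ^ (j : ℕ) • (M.quot S).frob (M.proj S (x' j))
        = (E : Sring p k) ^ n • toInv (E : Sring p k) (M.quot S) (M.proj S x) := by
      rw [← invMap_toInv, ← map_smul, hx', map_sum]
      exact Finset.sum_congr rfl fun j _ => by rw [map_smul, isHom_proj hS.1]
    obtain ⟨c, hc⟩ := exists_X_pow_smul_eq_zero_of_smul hE hQ hQN (x := fun j => M.proj S (x' j)) (a := a) (by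
      have h2 : M.proj S ((PowerSeries.X : Sring p k) ^ a • x) = 0 := by
        rwa [← LinearMap.mem_ker, ker_proj]
      rw [h1, smul_comm, ← map_smul (toInv _ _), ← map_smul (M.proj S), h2, map_zero, smul_zero])
    refine mem_gen_iff_exists_pow.mpr ⟨n, mem_span_frob_iff.mpr ⟨x', fun j => ⟨c, ?_⟩, hx'⟩⟩
    rw [← ker_proj S, LinearMap.mem_ker, map_smul, hc j]

theorem isStrictSub_satX (hE : IsEis E) (hM : (torsionData E).IsObj M) {S : Submodule (Sring p k) M}
    (hS : M.IsEtaleSub S) : (torsionData E).IsStrictSub M (satX S) :=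
  (torsion_isStrictSub_iff hM).mpr ⟨isEtaleSub_satX hE hM hS, fun x hx =>
    mem_satX_of_smul_mem (n := 1) (by rwa [pow_one])⟩

theorem torsionRank_sub (N : Submodule (Sring p k) M) :
    torsionRank (M.sub N) = ((lengthFn.{u, v} (Sring p k)).quo ((PowerSeries.X : Sring p k) • N) N).toNat := by
  have h := (lengthFn.{u, v} (Sring p k)).quo_map (M.incl_injective N) ((PowerSeries.X : Sring p k) • ⊤) ⊤
  rw [Submodule.map_pointwise_smul, Submodule.map_top, range_incl] at h
  rw [torsionRank_eq, h]

theorem torsionDeg_sub (hE : IsEis E) {N : Submodule (Sring p k) M} (hN : M.IsStable N)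
    (hN' : (torsionData E).IsObj (M.sub N)) :
    torsionDeg (M.sub N)
      = ((lengthFn.{u, max u v} (Sring p k)).idx (M.latticeOf N) (M.frobSpan N) : ℚ) / E.natDegree := by
  have h := (lengthFn.{u, max u v} (Sring p k)).idx_map
    (invMap_injective (a := (E : Sring p k)) (M.incl_injective N)) (M.sub N).lattice (M.sub N).frobLattice
  rw [map_lattice, (isHom_incl hN).map_frobLattice, range_incl] at h
  rw [torsionDeg_eq hE hN', h]

theorem exists_pow_smul_satX_le [Module.Finite (Sring p k) M] (S : Submodule (Sring p k) M) :
    ∃ c : ℕ, (PowerSeries.X : Sring p k) ^ c • satX S ≤ S := by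
  obtain ⟨c, hc⟩ := exists_le_of_fg (IsNoetherian.noetherian (satX S))
    (P := fun n => S.comap (DistribSMul.toLinearMap (Sring p k) _ ((PowerSeries.X : Sring p k) ^ n)))
    (monotone_nat_of_le_succ fun n x hx => by
      change (PowerSeries.X : Sring p k) ^ (n + 1) • x ∈ S
      rw [pow_succ', mul_smul]
      exact S.smul_mem _ hx) (fun x hx => hx)
  refine ⟨c, ?_⟩
  rintro _ ⟨x, hx, rfl⟩
  exact hc hx

theorem torsionRank_satX (hM : (torsionData E).IsObj M) (S : Submodule (Sring p k) M) :
    torsionRank (M.sub (satX S)) = torsionRank (M.sub S) := by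
  obtain ⟨hfin, het, ⟨N, hN⟩, hu⟩ := hM
  obtain ⟨c, hc⟩ := exists_pow_smul_satX_le S
  rw [torsionRank_sub, torsionRank_sub, LengthFn.quo_smul_eq _ hu (le_satX S)]
  refine length_quo_ne_top (IsNoetherian.noetherian _) (n := N) (m := c) (fun x _ => ?_)
    (fun x hx => hc (Submodule.smul_mem_pointwise_smul _ _ _ hx))
  rw [hN]
  exact zero_mem _

theorem frobSpan_le_frobSpan (hE : IsEis E) (hM : (torsionData E).IsObj M)
    {P Q : Submodule (Sring p k) M} (h : M.frobSpan Q ≤ M.frobSpan P) : Q ≤ P := by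
  obtain ⟨hfin, het, ⟨N, hN⟩, hu⟩ := hM
  intro x hx
  obtain ⟨y, hy, hxy⟩ := mem_span_frob_iff.mp (h (Submodule.subset_span ⟨x, hx, rfl⟩))
  have h0 : ∑ j : Fin p, (PowerSeries.X : Sring p k) ^ (j : ℕ) •
      M.frob (y j - if (j : ℕ) = 0 then x else 0) = 0 := by
    simp only [map_sub, smul_sub, Finset.sum_sub_distrib]
    rw [← hxy, Finset.sum_eq_single (⟨0, hp.out.pos⟩ : Fin p)]
    · simp
    · intro j _ hj
      have : (j : ℕ) ≠ 0 := fun h => hj (Fin.ext h)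
      simp [this]
    · simp
  have h1 := eq_zero_of_sum_frob_eq_zero hE het hN hu h0 ⟨0, hp.out.pos⟩
  rw [if_pos rfl, sub_eq_zero] at h1
  exact h1 ▸ hy _

theorem exists_pow_smul_latticeOf_le (hE : IsEis E) (hM : (torsionData E).IsObj M)
    {S : Submodule (Sring p k) M} (hS : M.IsEtaleSub S) :
    ∃ b : ℕ, (PowerSeries.X : Sring p k) ^ b • M.latticeOf S ≤ M.frobSpan S ∧
      (PowerSeries.X : Sring p k) ^ b • M.frobSpan S ≤ M.latticeOf S := by
  obtain ⟨hfin, het, ⟨N, hN⟩, hu⟩ := torsion_isObj_sub hM hS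
  obtain ⟨b, h1, h2⟩ := exists_pow_smul_lattice_le hE het hN
  refine ⟨b, ?_, ?_⟩
  · have h := Submodule.map_mono (f := invMap (E : Sring p k) (M.incl S)) h1
    rwa [Submodule.map_pointwise_smul, map_lattice, (isHom_incl hS.1).map_frobLattice, range_incl] at h
  · have h := Submodule.map_mono (f := invMap (E : Sring p k) (M.incl S)) h2
    rwa [Submodule.map_pointwise_smul, map_lattice, (isHom_incl hS.1).map_frobLattice, range_incl] at h

theorem length_quo_frobSpan_le (hE : IsEis E) (hM : (torsionData E).IsObj M)
    (S : Submodule (Sring p k) M) : (lengthFn.{u, v} (Sring p k)).quo S (satX S)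
      ≤ (lengthFn.{u, max u v} (Sring p k)).quo (M.frobSpan S) (M.frobSpan (satX S)) :=
  length_quo_le_of_strictMonoOn M.frobSpan (le_satX S) (fun _ _ h => frobSpan_mono h)
    (fun _ _ _ _ _ h => frobSpan_le_frobSpan hE hM h)

/-- When an étale submodule `S` is replaced by its saturation, the degree grows by the difference,
divided by `deg E`, between the length gained by the Frobenius lattice and that gained by `S`. -/
theorem torsionDeg_satX_sub (hE : IsEis E) (hM : (torsionData E).IsObj M)
    {S : Submodule (Sring p k) M} (hS : M.IsEtaleSub S) :
    (lengthFn.{u, max u v} (Sring p k)).quo (M.frobSpan S) (M.frobSpan (satX S)) ≠ ⊤ ∧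
    ((((lengthFn.{u, max u v} (Sring p k)).quo (M.frobSpan S) (M.frobSpan (satX S))).toNat : ℚ)
      - ((lengthFn.{u, v} (Sring p k)).quo S (satX S)).toNat) / E.natDegree
    ≤ torsionDeg (M.sub (satX S)) - torsionDeg (M.sub S) := by
  have hq2 := length_quo_frobSpan_le hE hM S
  rw [torsionDeg_sub hE hS.1 (torsion_isObj_sub hM hS), torsionDeg_sub hE (isEtaleSub_satX hE hM hS).1
    (torsion_isObj_sub hM (isEtaleSub_satX hE hM hS)), ← sub_div]
  have hM' := hM
  obtain ⟨hfin, het, ⟨N, hN⟩, hu⟩ := hM'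
  have hNi : ∀ y : Inv (E : Sring p k) M, (p : Sring p k) ^ N • y = 0 := smul_inv_of_forall hN
  obtain ⟨c, hc⟩ := exists_pow_smul_satX_le S
  obtain ⟨d, h1, h2⟩ := exists_pow_smul_lattice_le hE het hN
  have hJfg : (satX S).FG := IsNoetherian.noetherian _
  have hSfg : S.FG := IsNoetherian.noetherian _
  set lam := lengthFn.{u, max u v} (Sring p k) with hlam
  obtain ⟨b, hb1, hb2⟩ := exists_pow_smul_latticeOf_le hE hM hS
  have hf : (PowerSeries.X : Sring p k) ^ (p * c) • M.frobSpan (satX S) ≤ M.frobSpan S := by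
    rw [frobSpan, ← Submodule.span_smul, Submodule.span_le]
    rintro _ ⟨_, ⟨x, hx, rfl⟩, rfl⟩
    refine Submodule.subset_span ⟨(PowerSeries.X : Sring p k) ^ c • x,
      hc (Submodule.smul_mem_pointwise_smul _ _ _ hx), ?_⟩
    rw [M.frob.map_smulₛₗ, map_pow, frobS_X, ← pow_mul]
  have hl : (PowerSeries.X : Sring p k) ^ c • M.latticeOf (satX S) ≤ M.latticeOf S := by
    rw [latticeOf, latticeOf, ← Submodule.map_pointwise_smul]
    exact Submodule.map_mono hc
  have hlSJ : M.latticeOf S ≤ M.latticeOf (satX S) := latticeOf_mono (le_satX S)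
  have hfSJ : M.frobSpan S ≤ M.frobSpan (satX S) := frobSpan_mono (le_satX S)
  have hK1 : (PowerSeries.X : Sring p k) ^ b • M.latticeOf S ≤ M.latticeOf S := smul_submodule_le _ _
  have f1 : lam.quo ((PowerSeries.X : Sring p k) ^ b • M.latticeOf S) (M.latticeOf S) ≠ ⊤ :=
    length_quo_X_pow_smul_ne_top hNi (latticeOf_fg hSfg) (j := 0) (by rw [pow_zero, one_smul]) _
  have f2 : lam.quo ((PowerSeries.X : Sring p k) ^ b • M.latticeOf S) (M.latticeOf (satX S)) ≠ ⊤ :=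
    length_quo_X_pow_smul_ne_top hNi (latticeOf_fg hJfg) hl _
  have f3 : lam.quo ((PowerSeries.X : Sring p k) ^ b • M.latticeOf S) (M.frobSpan S) ≠ ⊤ :=
    length_quo_X_pow_smul_ne_top hNi (frobSpan_fg hSfg) hb2 _
  have f4 : lam.quo ((PowerSeries.X : Sring p k) ^ b • M.latticeOf S) (M.frobSpan (satX S)) ≠ ⊤ :=
    length_quo_X_pow_smul_ne_top hNi (frobSpan_fg hJfg) (j := b + p * c) (by
      rw [pow_add, mul_smul]
      exact (smul_mono_right _ hf).trans hb2) _
  have e1 := lam.idx_add hK1 (hK1.trans hlSJ) (hb1.trans hfSJ) f1 f2 f4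
  have e2 := lam.idx_add hK1 hb1 (hb1.trans hfSJ) f1 f3 f4
  rw [lam.idx_of_le hlSJ] at e1
  rw [lam.idx_of_le hfSJ] at e2
  have hinj := hE.toInv_injective hN hu
  have hcm : ∀ K : Submodule (Sring p k) M, (M.latticeOf K).comap (toInv (E : Sring p k) M) = K :=
    fun K => Submodule.comap_map_eq_of_injective hinj K
  have q1 : lam.quo (M.latticeOf S) (M.latticeOf (satX S))
      ≤ (lengthFn.{u, v} (Sring p k)).quo S (satX S) := by
    have h := length_quo_le_of_strictMonoOn (fun P => P.comap (toInv (E : Sring p k) M)) hlSJ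
      (fun P Q h => Submodule.comap_mono h) (fun P Q _ _ hQ h y hy => by
        obtain ⟨x, hx, rfl⟩ := hQ hy
        exact h hy)
    simp only [hcm] at h
    exact h
  have q3 : lam.quo (M.frobSpan S) (M.frobSpan (satX S)) ≠ ⊤ :=
    ne_top_of_le_ne_top f4 (lam.quo_anti_left hb1 hfSJ)
  have q4 : (lam.quo (M.latticeOf S) (M.latticeOf (satX S))).toNat
      ≤ ((lengthFn.{u, v} (Sring p k)).quo S (satX S)).toNat :=
    ENat.toNat_le_toNat q1 (ne_top_of_le_ne_top q3 hq2)
  refine ⟨q3, div_le_div_of_nonneg_right ?_ (Nat.cast_nonneg _)⟩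
  have q5 : ((lam.quo (M.frobSpan S) (M.frobSpan (satX S))).toNat : ℤ)
      - ((lengthFn.{u, v} (Sring p k)).quo S (satX S)).toNat
      ≤ lam.idx (M.latticeOf (satX S)) (M.frobSpan (satX S)) - lam.idx (M.latticeOf S) (M.frobSpan S) := by
    omega
  exact_mod_cast q5

/-- The `u`-saturation does not decrease the degree: the Frobenius is `u ↦ u ^ p` on a cokernel
which is killed by a power of `u`, so that its length increases. -/
theorem torsionDeg_le_satX (hE : IsEis E) (hM : (torsionData E).IsObj M) {S : Submodule (Sring p k) M}
    (hS : M.IsEtaleSub S) : torsionDeg (M.sub S) ≤ torsionDeg (M.sub (satX S)) := by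
  obtain ⟨h1, h2⟩ := torsionDeg_satX_sub hE hM hS
  refine sub_nonneg.mp ((div_nonneg ?_ (Nat.cast_nonneg _)).trans h2)
  rw [sub_nonneg, Nat.cast_le]
  exact ENat.toNat_le_toNat (length_quo_frobSpan_le hE hM S) h1

/-- The degree determines whether an étale submodule is `u`-saturated. -/
theorem satX_eq_of_torsionDeg_eq (hE : IsEis E) (hM : (torsionData E).IsObj M)
    {S : Submodule (Sring p k) M} (hS : M.IsEtaleSub S)
    (h : torsionDeg (M.sub (satX S)) ≤ torsionDeg (M.sub S)) : satX S = S := by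
  obtain ⟨h1, h2⟩ := torsionDeg_satX_sub hE hM hS
  refine le_antisymm ?_ (le_satX S)
  by_contra hne
  -- An element `x` of the socle of `satX S / S`.
  obtain ⟨x, hxJ, hxS, hXx, hpx⟩ : ∃ x ∈ satX S, x ∉ S ∧ (PowerSeries.X : Sring p k) • x ∈ S ∧
      (p : Sring p k) • x ∈ S := by
    obtain ⟨y, ⟨n, hn⟩, hyS⟩ := SetLike.not_le_iff_exists.mp hne
    obtain ⟨N, hN⟩ := hM.2.2.1
    have hex1 : ∃ n, (PowerSeries.X : Sring p k) ^ n • y ∈ S := ⟨n, hn⟩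
    obtain ⟨m, hm⟩ := Nat.exists_eq_succ_of_ne_zero (n := Nat.find hex1) fun h0 => hyS (by
      have h3 := Nat.find_spec hex1
      rwa [h0, pow_zero, one_smul] at h3)
    have hz1 := Nat.find_min hex1 (m := m) (by omega)
    have hz2 := Nat.find_spec hex1
    rw [hm, pow_succ', mul_smul] at hz2
    set z := (PowerSeries.X : Sring p k) ^ m • y with hz
    have hex2 : ∃ n, (p : Sring p k) ^ n • z ∈ S := ⟨N, by rw [hN]; exact S.zero_mem⟩
    obtain ⟨l, hl⟩ := Nat.exists_eq_succ_of_ne_zero (n := Nat.find hex2) fun h0 => hz1 (by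
      have h3 := Nat.find_spec hex2
      rwa [h0, pow_zero, one_smul] at h3)
    have hw1 := Nat.find_min hex2 (m := l) (by omega)
    have hw2 := Nat.find_spec hex2
    rw [hl, pow_succ', mul_smul] at hw2
    refine ⟨_, Submodule.smul_mem _ _ (Submodule.smul_mem _ _ ⟨n, hn⟩), hw1, ?_, hw2⟩
    rw [smul_comm]
    exact S.smul_mem _ hz2
  set S₁ := S ⊔ Submodule.span (Sring p k) {x} with hS₁
  have hSS₁ : S ≤ S₁ := le_sup_left
  have hS₁J : S₁ ≤ satX S := sup_le (le_satX S) ((Submodule.span_singleton_le_iff_mem _ _).mpr hxJ)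
  obtain ⟨hfin, het, ⟨N, hN⟩, hu⟩ := hM
  have hM : (torsionData E).IsObj M := ⟨hfin, het, ⟨N, hN⟩, hu⟩
  -- The coefficient of `u ^ i φ(x)` on the Frobenius lattice of `S`.
  have hcoef : ∀ i : Fin p, (PowerSeries.X : Sring p k) ^ (i : ℕ) • M.frob x ∉ M.frobSpan S := by
    intro i hi
    obtain ⟨y, hy, hxy⟩ := mem_span_frob_iff.mp hi
    have h0 : ∑ j : Fin p, (PowerSeries.X : Sring p k) ^ (j : ℕ) •
        M.frob (y j - if j = i then x else 0) = 0 := by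
      simp only [map_sub, smul_sub, Finset.sum_sub_distrib]
      rw [← hxy, Finset.sum_eq_single i]
      · simp
      · intro j _ hj
        simp [hj]
      · simp
    have h3 := eq_zero_of_sum_frob_eq_zero hE het hN hu h0 i
    rw [if_pos rfl, sub_eq_zero] at h3
    exact hxS (h3 ▸ hy _)
  -- As `p ≥ 2`, both `u φ(x)` and `φ(x)` are new: enlarging `S` by `x` adds at least two to the length of
  -- the Frobenius lattice, and only one to the length of `S`.
  set G := M.frobSpan S ⊔ Submodule.span (Sring p k) {(PowerSeries.X : Sring p k) • M.frob x} with hG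
  have hfS₁ : M.frob x ∈ M.frobSpan S₁ :=
    Submodule.subset_span ⟨x, Submodule.mem_sup_right (Submodule.mem_span_singleton_self x), rfl⟩
  have hGS₁ : G ≤ M.frobSpan S₁ := sup_le (frobSpan_mono hSS₁)
    ((Submodule.span_singleton_le_iff_mem _ _).mpr (Submodule.smul_mem _ _ hfS₁))
  have g1 : 1 ≤ (lengthFn.{u, max u v} (Sring p k)).quo (M.frobSpan S) G :=
    one_le_length_quo fun hle => hcoef ⟨1, hp.out.one_lt⟩ (by
      rw [pow_one]
      exact hle (Submodule.mem_sup_right (Submodule.mem_span_singleton_self _)))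
  have g2 : 1 ≤ (lengthFn.{u, max u v} (Sring p k)).quo G (M.frobSpan S₁) :=
    one_le_length_quo fun hle => by
      obtain ⟨y, hy, z, hz, hyz⟩ := Submodule.mem_sup.mp (hle hfS₁)
      obtain ⟨a, rfl⟩ := Submodule.mem_span_singleton.mp hz
      have hunit : IsUnit (1 - a * PowerSeries.X : Sring p k) := by
        rw [PowerSeries.isUnit_iff_constantCoeff]
        simp
      obtain ⟨w, hw⟩ := hunit.exists_left_inv
      have h3 : M.frob x = w • y := by
        have h4 : y = (1 - a * PowerSeries.X : Sring p k) • M.frob x := by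
          rw [sub_smul, one_smul, mul_smul]
          exact eq_sub_of_add_eq hyz
        rw [h4, smul_smul, hw, one_smul]
      refine hcoef ⟨0, hp.out.pos⟩ ?_
      rw [pow_zero, one_smul, h3]
      exact Submodule.smul_mem _ _ hy
  have g3 : (lengthFn.{u, v} (Sring p k)).quo S₁ (satX S)
      ≤ (lengthFn.{u, max u v} (Sring p k)).quo (M.frobSpan S₁) (M.frobSpan (satX S)) :=
    length_quo_le_of_strictMonoOn M.frobSpan hS₁J (fun _ _ h => frobSpan_mono h)
      (fun _ _ _ _ _ h => frobSpan_le_frobSpan hE hM h)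
  have g4 : (lengthFn.{u, v} (Sring p k)).quo S S₁ = 1 := length_quo_span_singleton hxS fun a ha => by
    rw [maximalIdeal_S, Ideal.mem_span_pair] at ha
    obtain ⟨c, d, rfl⟩ := ha
    rw [add_smul, mul_smul, mul_smul]
    exact S.add_mem (S.smul_mem _ hpx) (S.smul_mem _ hXx)
  have g5 : (lengthFn.{u, v} (Sring p k)).quo S (satX S) + 1
      ≤ (lengthFn.{u, max u v} (Sring p k)).quo (M.frobSpan S) (M.frobSpan (satX S)) := by
    rw [LengthFn.quo_add _ hSS₁ hS₁J, g4, LengthFn.quo_add _ (frobSpan_mono hSS₁) (frobSpan_mono hS₁J),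
      LengthFn.quo_add _ (le_sup_left : M.frobSpan S ≤ G) hGS₁, add_right_comm]
    exact add_le_add (add_le_add g1 g2) g3
  have g6 := ENat.toNat_le_toNat g5 h1
  rw [ENat.toNat_add (ne_top_of_le_ne_top h1 (le_self_add.trans g5)) ENat.one_ne_top, ENat.toNat_one] at g6
  have g7 : (((lengthFn.{u, v} (Sring p k)).quo S (satX S)).toNat : ℚ) + 1
      ≤ ((lengthFn.{u, max u v} (Sring p k)).quo (M.frobSpan S) (M.frobSpan (satX S))).toNat := by
    exact_mod_cast g6
  have g8 : (0 : ℚ) < E.natDegree := Nat.cast_pos.mpr hE.pos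
  have g9 := div_pos (sub_pos.mpr (lt_of_lt_of_le (lt_add_one _) g7)) g8
  linarith

theorem torsionRank_subquot {N N' : Submodule (Sring p k) M} (hM : (torsionData E).IsObj M)
    (hN' : M.IsEtaleSub N') {Q : PhiMod.{u, v} E} (hQ : (torsionData E).IsObj Q)
    (h : Subquot M N N' Q) :
    torsionRank (M.sub N') = torsionRank (M.sub N) + torsionRank Q :=
  torsionRank_exact (f := inclOfLE h.le) (g := h.π)
    (fun x y hxy => M.incl_injective N (by rw [← incl_inclOfLE h.le, ← incl_inclOfLE h.le, hxy]))
    h.surj (h.exact) (torsion_isObj_sub hM hN') hQ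

theorem torsionDeg_subquot (hE : IsEis E) {N N' : Submodule (Sring p k) M}
    (hM : (torsionData E).IsObj M) (hN : M.IsEtaleSub N)
    (hN' : M.IsEtaleSub N') {Q : PhiMod.{u, v} E} (hQ : (torsionData E).IsObj Q)
    (h : Subquot M N N' Q) :
    torsionDeg (M.sub N') = torsionDeg (M.sub N) + torsionDeg Q :=
  torsionDeg_exact hE (f := inclOfLE h.le) (g := h.π) (isHom_inclOfLE h.le hN.1 hN'.1) h.isHom
    (fun x y hxy => M.incl_injective N (by rw [← incl_inclOfLE h.le, ← incl_inclOfLE h.le, hxy]))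
    h.surj (h.exact) (torsion_isObj_sub hM hN) (torsion_isObj_sub hM hN') hQ

theorem torsion_isObj_subquot {N N' : Submodule (Sring p k) M} (hM : (torsionData E).IsObj M)
    (hN : M.IsEtaleSub N) (hN' : M.IsEtaleSub N')
    (hu : ∀ x, (PowerSeries.X : Sring p k) • x ∈ N → x ∈ N' → x ∈ N) {Q : PhiMod.{u, v} E}
    (h : Subquot M N N' Q) : (torsionData E).IsObj Q := by
  obtain ⟨hfin, het, ⟨n, hn⟩, -⟩ := torsion_isObj_sub hM hN'
  refine ⟨Module.Finite.of_surjective _ h.surj, h.isEtale hM.2.1 hN hN', ⟨n, fun x => ?_⟩, fun x hx => ?_⟩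
  · obtain ⟨y, rfl⟩ := h.surj x
    rw [← map_smul, hn, map_zero]
  · obtain ⟨y, rfl⟩ := h.surj x
    rw [← map_smul, h.ker, map_smul] at hx
    exact (h.ker y).mpr (hu _ hx (incl_mem y))

theorem torsionData_isGood (hE : IsEis E) : (torsionData.{u, v} E).IsGood where
  iso_obj := torsion_iso_obj
  iso_rank := torsionRank_iso
  iso_deg := torsionDeg_iso
  null_iff hM := ⟨fun h => by
    have : Subsingleton _ := h
    exact torsionRank_subsingleton, torsion_subsingleton hM⟩
  deg_null {M} hM h := by
    have := torsion_subsingleton hM h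
    have h1 : Subsingleton (Inv (E : Sring p k) M) := by
      refine subsingleton_of_forall_eq 0 fun y => ?_
      obtain ⟨n, x, hx⟩ := exists_pow_smul_eq_toInv y
      refine pow_smul_inv_injective (a := (E : Sring p k)) n ?_
      simp only [hx, Subsingleton.elim x 0, map_zero, smul_zero]
    change torsionDeg M = 0
    rw [torsionDeg_eq hE hM, Subsingleton.elim M.lattice M.frobLattice, LengthFn.idx_self,
      Int.cast_zero, zero_div]
  quot_top hM := ((torsion_isStrictSub_iff hM).mpr
    ⟨hM.2.1.isEtaleSub_top, fun _ _ => trivial⟩).2.2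
  ext {M N} h1 h2 h3 := by
    obtain ⟨hf2, he2, ⟨n, hn⟩, hu2⟩ := h2
    obtain ⟨hf3, he3, ⟨m, hm⟩, hu3⟩ := h3
    have hx0 : ∀ x, M.proj N x = 0 → ∃ y, M.incl N y = x := fun x hx => by
      rwa [← LinearMap.mem_ker, ker_proj, ← range_incl N] at hx
    have : Module.Finite (Sring p k) N := hf2
    have : Module.Finite (Sring p k) (M ⧸ N) := hf3
    refine ⟨Module.Finite.of_submodule_quotient N, h1.isEtale_of_sub_quot he2 he3, ⟨n + m, fun x => ?_⟩,
      fun x hx => ?_⟩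
    · obtain ⟨y, hy⟩ := hx0 ((p : Sring p k) ^ m • x) (by rw [map_smul, hm])
      rw [pow_add, mul_smul, ← hy, ← map_smul, hn, map_zero]
    · obtain ⟨y, rfl⟩ := hx0 x (hu3 _ (by rw [← map_smul, hx, map_zero]))
      rw [hu2 y (M.incl_injective N (by rw [map_smul, hx, map_zero])), map_zero]
  ker {M N} hM h1 h3 := torsion_isObj_sub hM (h1.isEtaleSub_of_quot hM.2.1 h3.2.1)
  rank_add {M N} hM h := torsionRank_exact (M.incl_injective N) (M.proj_surjective N)
    (exact_incl_proj N) hM h.2.2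
  deg_add {M N} hM h := torsionDeg_exact hE (isHom_incl h.1) (isHom_proj h.1) (M.incl_injective N)
    (M.proj_surjective N) (exact_incl_proj N) h.2.1 hM h.2.2
  inf {M N N'} hM h h' := by
    rw [torsion_isStrictSub_iff hM] at h h' ⊢
    exact ⟨h.1.inf hM.2.1 h'.1, fun x hx => ⟨h.2 x hx.1, h'.2 x hx.2⟩⟩
  sup {M N N'} hM h h' := by
    rw [torsion_isStrictSub_iff hM] at h h'
    have hS := h.1.sup h'.1
    have hI := h.1.inf hM.2.1 h'.1
    refine ⟨satX (N ⊔ N'), isStrictSub_satX hE hM hS, le_sup_left.trans (le_satX _),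
      le_sup_right.trans (le_satX _), fun Z hZ h1 h2 => satX_le (sup_le h1 h2)
        ((torsion_isStrictSub_iff hM).mp hZ).2, ?_⟩
    -- The isomorphism `N' / (N ⊓ N') ≃ (N ⊔ N') / N`.
    have q1 := Subquot.ofGr hI.1 h'.1.1 (inf_le_right : N ⊓ N' ≤ N')
    have q2 := Subquot.ofGr h.1.1 hS.1 (le_sup_left : N ≤ N ⊔ N')
    have hiso := q1.iso_of_le q2 inf_le_left le_sup_right (by rw [inf_comm])
      (by rw [sup_comm])
    have o1 := torsion_isObj_subquot hM hI h'.1 (fun x hx hx' => ⟨h.2 x hx.1, hx'⟩) q1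
    have o2 := torsion_isObj_subquot hM h.1 hS (fun x hx _ => h.2 x hx) q2
    have r1 := torsionRank_subquot hM h'.1 o1 q1
    have r2 := torsionRank_subquot hM hS o2 q2
    have d1 := torsionDeg_subquot hE hM hI h'.1 o1 q1
    have d2 := torsionDeg_subquot hE hM h.1 hS o2 q2
    have r3 := torsionRank_iso hiso
    have d3 := torsionDeg_iso hiso
    have r4 := torsionRank_satX hM (N ⊔ N')
    have d4 := torsionDeg_le_satX hE hM hS
    change torsionRank _ + torsionRank _ = torsionRank _ + torsionRank _ ∧
      torsionDeg _ + torsionDeg _ ≤ torsionDeg _ + torsionDeg _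
    constructor
    · omega
    · linarith

theorem torsionData_isReduced : (torsionData.{u, v} E).IsReduced :=
  fun hM h => torsion_subsingleton hM h

theorem exists_int_torsionDeg (hE : IsEis E) (M : PhiMod.{u, v} E) :
    ∃ z : ℤ, (E.natDegree : ℚ) * torsionDeg M = z := by
  rw [torsionDeg, mul_div_cancel₀ _ (Nat.cast_ne_zero.mpr hE.pos.ne')]
  exact ⟨_ * _ - ((_ : ℕ) : ℤ), by push_cast; rfl⟩

/-- The degrees of the strict subobjects of `M` are bounded: the exponent `twistExp M` also bounds the
denominators of the Frobenius of a strict subobject. -/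
theorem torsionDeg_sub_le (hE : IsEis E) (hM : (torsionData E).IsObj M)
    {N : Submodule (Sring p k) M} (hN : (torsionData E).IsStrictSub M N) :
    torsionDeg (M.sub N) ≤ (twistExp M : ℚ) * torsionRank M / E.natDegree := by
  have hgood := torsionData_isGood.{u, v} hE
  obtain ⟨hfin, het, ⟨n, hn⟩, hu⟩ := hM
  have hrk : torsionRank (M.sub N) ≤ torsionRank M :=
    (Nat.le_add_right _ _).trans (hgood.rank_add ⟨hfin, het, ⟨n, hn⟩, hu⟩ hN).ge
  have hinj := hE.toInv_injective hn hu
  have htw : twistExp (M.sub N) ≤ twistExp M := by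
    refine Nat.sInf_le ?_
    obtain ⟨c, -, h2⟩ := exists_pow_smul_lattice_le hE het hn
    have hi : (PowerSeries.X : Sring p k) ^ twistExp M • M.frobLattice ≤ M.lattice :=
      Nat.sInf_mem (s := {i | (PowerSeries.X : Sring p k) ^ i • M.frobLattice ≤ M.lattice}) ⟨c, h2⟩
    rw [Set.mem_ofPred_eq]
    rintro _ ⟨y, hy, rfl⟩
    change (PowerSeries.X : Sring p k) ^ twistExp M • y ∈ _
    have hy' : invMap (E : Sring p k) (M.incl N) y ∈ M.frobLattice := by
      have h3 : invMap (E : Sring p k) (M.incl N) y ∈ (M.sub N).frobLattice.map (invMap (E : Sring p k) (M.incl N)) :=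
        ⟨y, hy, rfl⟩
      rw [(isHom_incl hN.1).map_frobLattice] at h3
      rw [frobLattice_eq_frobSpan]
      exact frobSpan_mono le_top h3
    obtain ⟨m, hm⟩ := hi (Submodule.smul_mem_pointwise_smul _ _ _ hy')
    rw [← map_smul] at hm
    obtain ⟨l, x, hx⟩ := exists_pow_smul_eq_toInv ((PowerSeries.X : Sring p k) ^ twistExp M • y)
    have h4 : (E : Sring p k) ^ l • m = M.incl N x := hinj (by
      rw [map_smul, hm, ← map_smul, hx, invMap_toInv])
    obtain ⟨-, -, ⟨n', hn'⟩, hu'⟩ := hN.2.2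
    have h5 : M.proj N m = 0 := hE.E_smul_eq_zero hn' hu' (n := l) (by
      rw [← map_smul, h4, ← LinearMap.mem_ker, ker_proj]
      exact incl_mem x)
    rw [← LinearMap.mem_ker, ker_proj, ← range_incl N] at h5
    obtain ⟨m', rfl⟩ := h5
    exact ⟨m', invMap_injective (M.incl_injective N) (by rw [invMap_toInv, hm])⟩
  rw [torsionDeg]
  refine div_le_div_of_nonneg_right ?_ (Nat.cast_nonneg _)
  have h1 : (twistExp (M.sub N) : ℚ) * torsionRank (M.sub N) ≤ (twistExp M : ℚ) * torsionRank M := by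
    exact_mod_cast Nat.mul_le_mul htw hrk
  exact (sub_le_self _ (Nat.cast_nonneg _)).trans h1

/-- Every `p^∞`-torsion Kisin module has a Harder-Narasimhan flag. -/
theorem exists_isHNFlag_torsion (hE : IsEis E) (hM : (torsionData E).IsObj M) :
    ∃ (r : ℕ) (N : ℕ → Submodule (Sring p k) M), (torsionData E).IsHNFlag M r N :=
  (torsionData_isGood hE).exists_isHNFlag torsionData_isReduced hM
    ⟨E.natDegree, hE.pos, fun P _ => exists_int_torsionDeg hE (M.sub P)⟩
    ⟨_, fun _ hP => torsionDeg_sub_le hE hM hP⟩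

end

end Kisin

end

noncomputable section

namespace Kisin

/-! ### Rank and degree up to isogeny -/

section

open PhiModule

variable {p : ℕ} [hp : Fact p.Prime] {k : Type u} [Field k] [CharP k p] [PerfectRing k p]

theorem IsAlmostFG.of_surjective {Y : Type v₁} {Y' : Type v₂} [AddCommGroup Y] [Module (Sring p k) Y]
    [AddCommGroup Y'] [Module (Sring p k) Y'] (h : IsAlmostFG p k Y) {f : Y →ₗ[Sring p k] Y'}
    (hf : Function.Surjective f) : IsAlmostFG p k Y' := by
  obtain ⟨N, hN, h⟩ := h
  refine ⟨N.map f, hN.map f, fun y => ?_⟩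
  obtain ⟨x, rfl⟩ := hf y
  obtain ⟨n, hn⟩ := h x
  exact ⟨n, (p : Sring p k) ^ n • x, hn, map_smul _ _ _⟩

theorem IsAlmostFG.of_injective {Y : Type v₁} {Y' : Type v₂} [AddCommGroup Y] [Module (Sring p k) Y]
    [AddCommGroup Y'] [Module (Sring p k) Y'] (h : IsAlmostFG p k Y') {f : Y →ₗ[Sring p k] Y'}
    (hf : Function.Injective f) : IsAlmostFG p k Y := by
  obtain ⟨N, hN, h⟩ := h
  have hNf : Module.Finite (Sring p k) N := Module.Finite.iff_fg.mpr hN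
  have h1 : ((N.comap f).map f).FG := by
    have h2 : (N ⊓ LinearMap.range f).FG :=
      Submodule.FG.of_le hN inf_le_left
    rwa [Submodule.map_comap_eq, inf_comm]
  refine ⟨N.comap f, Submodule.fg_of_fg_map_injective f hf h1, fun y => ?_⟩
  obtain ⟨n, hn⟩ := h (f y)
  exact ⟨n, by rwa [Submodule.mem_comap, map_smul]⟩

/-- The rank over `𝔖` is additive in short exact sequences. -/
theorem finrank_exact {Y Y' Y'' : Type v} [AddCommGroup Y] [Module (Sring p k) Y]
    [AddCommGroup Y'] [Module (Sring p k) Y'] [AddCommGroup Y''] [Module (Sring p k) Y'']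
    {f : Y →ₗ[Sring p k] Y'} {g : Y' →ₗ[Sring p k] Y''} (hf : Function.Injective f)
    (hg : Function.Surjective g) (hex : Function.Exact f g) (h' : IsAlmostFG p k Y') :
    Module.finrank (Sring p k) Y' = Module.finrank (Sring p k) Y + Module.finrank (Sring p k) Y'' := by
  have h1 := rank_quotient_add_rank_of_isDomain (LinearMap.ker g)
  have e1 := (g.quotKerEquivOfSurjective hg).rank_eq
  have e2 : Module.rank (Sring p k) Y = Module.rank (Sring p k) (LinearMap.ker g) := by
    rw [LinearMap.exact_iff.mp hex]
    exact (LinearEquiv.ofInjective f hf).rank_eq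
  have hfin : Module.rank (Sring p k) Y' < Cardinal.aleph0 := by
    obtain ⟨N, hN, h⟩ := h'
    have hNf : Module.Finite (Sring p k) N := Module.Finite.iff_fg.mpr hN
    rw [← rank_quotient_add_rank_of_isDomain N, rank_eq_zero_iff.mpr, zero_add]
    · exact Module.rank_lt_aleph0 _ _
    · intro y
      obtain ⟨x, rfl⟩ := N.mkQ_surjective y
      obtain ⟨n, hn⟩ := h x
      refine ⟨(p : Sring p k) ^ n, pow_ne_zero _ p_ne_zero, ?_⟩
      rw [← map_smul, Submodule.mkQ_apply, Submodule.Quotient.mk_eq_zero N]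
      exact hn
  rw [e1, ← e2] at h1
  rw [← h1] at hfin
  rw [Module.finrank, ← h1, Cardinal.toNat_add ((self_le_add_right _ _).trans_lt hfin)
    ((self_le_add_left _ _).trans_lt hfin), add_comm]
  rfl

variable {E : (WittVector p k)[X]}

/-- Lattices which differ by a module of length zero have the same relative indices. -/
theorem LengthFn.idx_congr {A : Type u} [CommRing A] (lam : LengthFn.{u, w} A) {V : Type w}
    [AddCommGroup V] [Module A V] {K L₁ L₂ L₁' L₂' : Submodule A V}
    (h1 : K ≤ L₁) (h2 : K ≤ L₂) (h1' : L₁ ≤ L₁') (h2' : L₂ ≤ L₂') (hf1 : lam.quo K L₁ ≠ ⊤)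
    (hf2 : lam.quo K L₂ ≠ ⊤) (e1 : lam.quo L₁ L₁' = 0) (e2 : lam.quo L₂ L₂' = 0) :
    lam.idx L₁' L₂' = lam.idx L₁ L₂ := by
  have q1 := lam.quo_add h1 h1'
  have q2 := lam.quo_add h2 h2'
  rw [e1, add_zero] at q1
  rw [e2, add_zero] at q2
  rw [lam.idx_eq h1 h2 hf1 hf2, lam.idx_eq (h1.trans h1') (h2.trans h2') (by rwa [q1]) (by rwa [q2]),
    q1, q2]

/-- A finitely generated module which is torsion for the powers of `p` and of `E` has finite length
after localization at `(E)`. -/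
theorem localLength_quo_ne_top (hE : IsEis E) {V : Type (max u v)} [AddCommGroup V]
    [Module (Sring p k) V] {K L : Submodule (Sring p k) V} (hL : L.FG)
    (h : ∀ x ∈ L, ∃ b n : ℕ, (p : Sring p k) ^ b • (E : Sring p k) ^ n • x ∈ K) :
    (localLengthFn.{u, max u v} (away (E : Sring p k))).quo K L ≠ ⊤ := by
  -- Modulo the elements of `L` with a `p`-power multiple in `K`, the quotient has no `p`-torsion.
  let T : Submodule (Sring p k) V :=
    { carrier := {x | x ∈ L ∧ ∃ b : ℕ, (p : Sring p k) ^ b • x ∈ K}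
      add_mem' := by
        rintro x y ⟨hx, b, hb⟩ ⟨hy, c, hc⟩
        refine ⟨L.add_mem hx hy, b + c, ?_⟩
        rw [smul_add, pow_add, mul_smul, mul_smul _ _ y]
        refine K.add_mem ?_ (K.smul_mem _ hc)
        rw [smul_comm]
        exact K.smul_mem _ hb
      zero_mem' := ⟨L.zero_mem, 0, by rw [smul_zero]; exact K.zero_mem⟩
      smul_mem' := by
        rintro a x ⟨hx, b, hb⟩
        exact ⟨L.smul_mem _ hx, b, by rw [smul_comm]; exact K.smul_mem _ hb⟩ }
  have hTL : T ≤ L := fun x hx => hx.1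
  have hKT : K ⊓ L ≤ T := fun x hx => ⟨hx.2, 0, by rw [pow_zero, one_smul]; exact hx.1⟩
  set lam := localLengthFn.{u, max u v} (away (E : Sring p k)) with hlam
  have h0 : lam.quo (K ⊓ L) T = 0 := localLengthFn_quo_eq_zero _ fun x hx => by
    obtain ⟨hx, b, hb⟩ := hx
    exact ⟨_, hE.pow_mem_away b, hb, L.smul_mem _ hx⟩
  rw [← lam.quo_inf, lam.quo_add hKT hTL, h0, zero_add]
  obtain ⟨n, hn⟩ := exists_le_of_fg hL
    (P := fun n => {
      carrier := {x | ∃ b : ℕ, (p : Sring p k) ^ b • (E : Sring p k) ^ n • x ∈ K}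
      add_mem' := by
        rintro x y ⟨b, hb⟩ ⟨c, hc⟩
        refine ⟨b + c, ?_⟩
        rw [smul_add, smul_add, pow_add, mul_smul, mul_smul _ _ ((E : Sring p k) ^ n • y)]
        refine K.add_mem ?_ (K.smul_mem _ hc)
        rw [smul_comm]
        exact K.smul_mem _ hb
      zero_mem' := ⟨0, by rw [smul_zero, smul_zero]; exact K.zero_mem⟩
      smul_mem' := by
        rintro a x ⟨b, hb⟩
        refine ⟨b, ?_⟩
        rw [smul_comm _ a, smul_comm _ a]
        exact K.smul_mem _ hb : Submodule (Sring p k) V })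
    (monotone_nat_of_le_succ fun n x hx => by
      obtain ⟨b, hb⟩ := hx
      refine ⟨b, ?_⟩
      rw [pow_succ', mul_smul, smul_comm]
      exact K.smul_mem _ hb) (fun x hx => by
        obtain ⟨b, n, hb⟩ := h x hx
        exact ⟨n, b, hb⟩)
  have hLf : Module.Finite (Sring p k) L := Module.Finite.iff_fg.mpr hL
  have hz : ∀ x : L, (T.submoduleOf L).mkQ x = 0 ↔ (x : V) ∈ T := fun x => by
    rw [Submodule.mkQ_apply, Submodule.Quotient.mk_eq_zero (T.submoduleOf L)]
    rfl
  refine (hE.length_quo_p_eq (Q := L ⧸ T.submoduleOf L) n (fun y => ?_) (fun y hy => ?_)).1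
  · obtain ⟨x, rfl⟩ := Submodule.mkQ_surjective _ y
    obtain ⟨b, hb⟩ := hn x.2
    rw [← map_smul, hz]
    exact ⟨L.smul_mem _ x.2, b, hb⟩
  · obtain ⟨x, rfl⟩ := Submodule.mkQ_surjective _ y
    rw [← map_smul, hz] at hy
    obtain ⟨-, b, hb⟩ := hy
    rw [hz]
    exact ⟨x.2, b + 1, by rw [pow_succ, mul_smul]; exact hb⟩

section

variable {X : PhiMod.{u, v} E}

/-- A finitely generated submodule which contains a multiple by a power of `p` of each element
determines the lattices up to modules of length zero. -/
theorem exists_sublattice (hE : IsEis E) (hX : X.IsEtale) {N : Submodule (Sring p k) X} (hN : N.FG)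
    (h : ∀ x : X, ∃ n : ℕ, (p : Sring p k) ^ n • x ∈ N) :
    (localLengthFn.{u, max u v} (away (E : Sring p k))).quo (X.latticeOf N ⊓ X.frobSpan N) X.lattice ≠ ⊤ ∧
    (localLengthFn.{u, max u v} (away (E : Sring p k))).quo (X.latticeOf N ⊓ X.frobSpan N) X.frobLattice ≠ ⊤ ∧
    (localLengthFn.{u, max u v} (away (E : Sring p k))).quo (X.latticeOf N) X.lattice = 0 ∧
    (localLengthFn.{u, max u v} (away (E : Sring p k))).quo (X.frobSpan N) X.frobLattice = 0 := by
  set lam := localLengthFn.{u, max u v} (away (E : Sring p k)) with hlam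
  have hfin : ∀ x : Fin p → X, ∃ b : ℕ, ∀ j, (p : Sring p k) ^ b • x j ∈ N := by
    intro x
    choose b hb using fun j => h (x j)
    refine ⟨∑ j, b j, fun j => ?_⟩
    rw [← Finset.sum_erase_add _ _ (Finset.mem_univ j), pow_add, mul_smul]
    exact N.smul_mem _ (hb j)
  have hfrob : ∀ y ∈ X.frobLattice, ∃ b : ℕ, (p : Sring p k) ^ b • y ∈ X.frobSpan N := by
    intro y hy
    obtain ⟨x, rfl⟩ := mem_frobLattice_iff.mp hy
    obtain ⟨b, hb⟩ := hfin x
    refine ⟨b, mem_span_frob_iff.mpr ⟨fun j => (p : Sring p k) ^ b • x j, hb, ?_⟩⟩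
    rw [Finset.smul_sum]
    exact Finset.sum_congr rfl fun j _ => by
      rw [X.frob.map_smulₛₗ, map_pow, frobS_natCast, smul_comm]
  -- The length function is that of the localization at `(E)`, where `p` is invertible.
  have e1 : lam.quo (X.latticeOf N) X.lattice = 0 := localLengthFn_quo_eq_zero _ fun y hy => by
    obtain ⟨x, rfl⟩ := hy
    obtain ⟨n, hn⟩ := h x
    exact ⟨_, hE.pow_mem_away n, (p : Sring p k) ^ n • x, hn, map_smul _ _ _⟩
  have e2 : lam.quo (X.frobSpan N) X.frobLattice = 0 := localLengthFn_quo_eq_zero _ fun y hy => by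
    obtain ⟨b, hb⟩ := hfrob y hy
    exact ⟨_, hE.pow_mem_away b, hb⟩
  have f1 : lam.quo (X.latticeOf N ⊓ X.frobSpan N) (X.latticeOf N) ≠ ⊤ := by
    rw [inf_comm, lam.quo_inf]
    refine localLength_quo_ne_top hE (latticeOf_fg hN) ?_
    rintro _ ⟨x, -, rfl⟩
    obtain ⟨n, x', hx'⟩ := exists_pow_smul_toInv_eq hX x
    obtain ⟨b, hb⟩ := hfrob _ (mem_frobLattice_iff.mpr ⟨x', hx'⟩)
    exact ⟨b, n, hb⟩
  have f2 : lam.quo (X.latticeOf N ⊓ X.frobSpan N) (X.frobSpan N) ≠ ⊤ := by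
    rw [lam.quo_inf]
    refine localLength_quo_ne_top hE (frobSpan_fg hN) ?_
    intro y _
    obtain ⟨n, x, hx⟩ := exists_pow_smul_eq_toInv y
    obtain ⟨b, hb⟩ := h x
    exact ⟨b, n, (p : Sring p k) ^ b • x, hb, by rw [map_smul, hx]⟩
  have l1 : X.latticeOf N ≤ X.lattice := by
    rw [lattice_eq]
    exact latticeOf_mono le_top
  have l2 : X.frobSpan N ≤ X.frobLattice := by
    rw [frobLattice_eq_frobSpan]
    exact frobSpan_mono le_top
  refine ⟨?_, ?_, e1, e2⟩
  · rwa [lam.quo_add inf_le_left l1, e1, add_zero]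
  · rwa [lam.quo_add inf_le_right l2, e2, add_zero]

theorem deg_eq_zero_of_torsion (hE : IsEis E) (h : ∀ x : X, ∃ n : ℕ, (p : Sring p k) ^ n • x = 0) :
    deg X = 0 := by
  have h1 : ∀ y : Inv (E : Sring p k) X, ∃ n : ℕ, (p : Sring p k) ^ n • y = 0 := fun y => by
    obtain ⟨m, x, hx⟩ := exists_pow_smul_eq_toInv y
    obtain ⟨n, hn⟩ := h x
    refine ⟨n, pow_smul_inv_injective (a := (E : Sring p k)) m ?_⟩
    simp only [smul_zero]
    rw [smul_comm, hx, ← map_smul, hn, map_zero]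
  have h2 : ∀ K L : Submodule (Sring p k) (Inv (E : Sring p k) X),
      (localLengthFn.{u, max u v} (away (E : Sring p k))).quo K L = 0 := fun K L =>
    localLengthFn_quo_eq_zero _ fun x _ => by
      obtain ⟨n, hn⟩ := h1 x
      exact ⟨_, hE.pow_mem_away n, by rw [hn]; exact K.zero_mem⟩
  rw [deg, relIndex_eq_idx, LengthFn.idx, h2, h2]
  simp

theorem rank_eq_zero_iff_torsion (hE : IsEis E) (hX : X.IsEtale) (hfg : IsAlmostFG p k X) :
    rank X = 0 ↔ ∀ x : X, ∃ n : ℕ, (p : Sring p k) ^ n • x = 0 := by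
  constructor
  · intro h x
    obtain ⟨N, hN, h1⟩ := hfg
    have hNf : Module.Finite (Sring p k) N := Module.Finite.iff_fg.mpr hN
    have h2 : Module.finrank (Sring p k) N = 0 := by
      have h3 := finrank_exact N.injective_subtype N.mkQ_surjective
        (LinearMap.exact_iff.mpr (by rw [Submodule.ker_mkQ, Submodule.range_subtype])) ⟨N, hN, h1⟩
      change Module.finrank (Sring p k) X = 0 at h
      omega
    rw [Module.finrank_eq_zero_iff] at h2
    obtain ⟨n, hn⟩ := h1 x
    obtain ⟨a, ha, hax⟩ := h2 ⟨_, hn⟩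
    refine exists_p_pow_smul_eq_zero hE hX ⟨N, hN, h1⟩ (a := a * (p : Sring p k) ^ n)
      (mul_ne_zero ha (pow_ne_zero _ p_ne_zero)) ?_
    rw [mul_smul]
    exact congrArg Subtype.val hax
  · intro h
    refine Module.finrank_eq_zero_of_rank_eq_zero (rank_eq_zero_iff.mpr fun x => ?_)
    obtain ⟨n, hn⟩ := h x
    exact ⟨_, pow_ne_zero _ p_ne_zero, hn⟩

end

theorem deg_iso {X : PhiMod.{u, v₁} E} {X' : PhiMod.{u, v₂} E} (h : Iso X X') : deg X = deg X' := by
  obtain ⟨e, he⟩ := h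
  have h1 := relIndex_map_of_injective (E : Sring p k)
    (invMap_injective (a := (E : Sring p k)) (f := e.toLinearMap) e.injective) X.lattice X.frobLattice
  rw [map_lattice, he.map_frobLattice, LinearMap.range_eq_top.mpr e.surjective, ← lattice_eq,
    ← frobLattice_eq_frobSpan] at h1
  rw [deg, deg, h1]

theorem rank_iso {X : PhiMod.{u, v₁} E} {X' : PhiMod.{u, v₂} E} (h : Iso X X') : rank X = rank X' := by
  obtain ⟨e, -⟩ := h
  exact e.finrank_eq

/-- The degree is invariant under isogenies. -/
theorem deg_eq_of_injective (hE : IsEis E) {X : PhiMod.{u, v₁} E} {X' : PhiMod.{u, v₂} E}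
    {f : X →ₗ[Sring p k] X'} (hf : IsHom f) (hi : Function.Injective f)
    (hX' : X'.IsEtale) (hfg : IsAlmostFG p k X)
    (hc : ∀ y : X', ∃ n : ℕ, (p : Sring p k) ^ n • y ∈ LinearMap.range f) : deg X = deg X' := by
  obtain ⟨N, hN, h⟩ := hfg
  have h1 := relIndex_map_of_injective (E : Sring p k)
    (invMap_injective (a := (E : Sring p k)) hi) X.lattice X.frobLattice
  rw [map_lattice, hf.map_frobLattice] at h1
  obtain ⟨f1, f2, e1, e2⟩ := exists_sublattice hE hX' (N := N.map f) (hN.map f) fun y => by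
    obtain ⟨n, x, hx⟩ := hc y
    obtain ⟨m, hm⟩ := h x
    exact ⟨m + n, (p : Sring p k) ^ m • x, hm, by rw [map_smul, hx, pow_add, mul_smul]⟩
  have hNr : N.map f ≤ LinearMap.range f := LinearMap.map_le_range
  have l1 : X'.latticeOf (LinearMap.range f) ≤ X'.lattice := by
    rw [lattice_eq]
    exact latticeOf_mono le_top
  have l2 : X'.frobSpan (LinearMap.range f) ≤ X'.frobLattice := by
    rw [frobLattice_eq_frobSpan]
    exact frobSpan_mono le_top
  set lam := localLengthFn.{u, max u v₂} (away (E : Sring p k)) with hlam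
  have k1 : X'.latticeOf (N.map f) ⊓ X'.frobSpan (N.map f) ≤ X'.latticeOf (LinearMap.range f) :=
    inf_le_left.trans (latticeOf_mono hNr)
  have k2 : X'.latticeOf (N.map f) ⊓ X'.frobSpan (N.map f) ≤ X'.frobSpan (LinearMap.range f) :=
    inf_le_right.trans (frobSpan_mono hNr)
  rw [deg, deg, ← h1, relIndex_eq_idx, relIndex_eq_idx]
  refine congrArg _ (lam.idx_congr k1 k2 l1 l2 ?_ ?_ ?_ ?_).symm
  · exact ne_top_of_le_ne_top f1 (lam.quo_mono_right k1 l1)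
  · exact ne_top_of_le_ne_top f2 (lam.quo_mono_right k2 l2)
  · rw [lam.quo_add (latticeOf_mono hNr) l1, add_eq_zero] at e1
    exact e1.2
  · rw [lam.quo_add (frobSpan_mono hNr) l2, add_eq_zero] at e2
    exact e2.2

section

variable {X X' X'' : PhiMod.{u, v} E}

/-- The degree `ν(M_(E), φ_M (φ^* M)_(E))` is additive in short exact sequences. -/
theorem deg_exact (hE : IsEis E) {f : X →ₗ[Sring p k] X'} {g : X' →ₗ[Sring p k] X''}
    (hfh : IsHom f) (hgh : IsHom g) (hf : Function.Injective f) (hg : Function.Surjective g)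
    (hex : Function.Exact f g) (hX : X.IsEtale) (hX' : X'.IsEtale) (hX'' : X''.IsEtale)
    (hfg : IsAlmostFG p k X') : deg X' = deg X + deg X'' := by
  have hfg'' : IsAlmostFG p k X'' := hfg.of_surjective hg
  have hfi : Function.Injective (invMap (E : Sring p k) f) := invMap_injective hf
  have hrange : LinearMap.range g = ⊤ := LinearMap.range_eq_top.mpr hg
  obtain ⟨N, hN, hNX⟩ := hfg.of_injective hf
  obtain ⟨N', hN', hNX'⟩ := hfg
  obtain ⟨f1, f2, e1, e2⟩ := exists_sublattice hE hX hN hNX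
  obtain ⟨f1', f2', -, -⟩ := exists_sublattice hE hX' hN' hNX'
  have l1 : X.latticeOf N ≤ X.lattice := by
    rw [lattice_eq]
    exact latticeOf_mono le_top
  have l2 : X.frobSpan N ≤ X.frobLattice := by
    rw [frobLattice_eq_frobSpan]
    exact frobSpan_mono le_top
  have l1' : X'.latticeOf N' ≤ X'.lattice := by
    rw [lattice_eq]
    exact latticeOf_mono le_top
  have l2' : X'.frobSpan N' ≤ X'.frobLattice := by
    rw [frobLattice_eq_frobSpan]
    exact frobSpan_mono le_top
  set lam := localLengthFn.{u, max u v} (away (E : Sring p k)) with hlam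
  have e := lam.idx_exact (invMap_exact (a := (E : Sring p k)) hex)
    (inf_le_left.trans l1') (inf_le_right.trans l2') f1' f2'
  have h3 : X'.lattice.map (invMap (E : Sring p k) g) = X''.lattice := by
    rw [map_lattice, hrange, lattice_eq]
  have h4 : X'.frobLattice.map (invMap (E : Sring p k) g) = X''.frobLattice := by
    rw [hgh.map_frobLattice, hrange, frobLattice_eq_frobSpan]
  have h5 : X.lattice ≤ X'.lattice.comap (invMap (E : Sring p k) f) := by
    rintro _ ⟨x, rfl⟩
    exact ⟨f x, (invMap_toInv f x).symm⟩
  have h6 : X.frobLattice ≤ X'.frobLattice.comap (invMap (E : Sring p k) f) := by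
    rw [← Submodule.map_le_iff_le_comap, hfh.map_frobLattice, frobLattice_eq_frobSpan]
    exact frobSpan_mono le_top
  -- The lattices of `X` and the traces of the lattices of `X'` agree up to `p`-power torsion.
  have t1 : lam.quo X.lattice (X'.lattice.comap (invMap (E : Sring p k) f)) = 0 := by
    refine localLengthFn_quo_eq_zero _ fun y hy => ?_
    obtain ⟨m, hm⟩ := hy
    obtain ⟨n, x, hx⟩ := exists_pow_smul_eq_toInv y
    have h7 : toInv (E : Sring p k) X' ((E : Sring p k) ^ n • m - f x) = 0 := by
      rw [map_sub, map_smul, hm, ← map_smul, hx, invMap_toInv, sub_self]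
    obtain ⟨l, hl⟩ := toInv_eq_zero.mp h7
    obtain ⟨b, hb⟩ := exists_p_pow_smul_eq_zero hE hX'' hfg'' (x := g m)
      (a := (E : Sring p k) ^ (l + n)) (pow_ne_zero _ hE.ne_zero) (by
        have h8 := congrArg g hl
        rwa [map_smul, map_sub, map_smul, hex.apply_apply_eq_zero, sub_zero, map_zero, ← mul_smul,
          ← pow_add] at h8)
    rw [← map_smul] at hb
    obtain ⟨m', hm'⟩ := (hex _).mp hb
    refine ⟨_, hE.pow_mem_away b, m', hfi ?_⟩
    rw [invMap_toInv, hm', map_smul, hm, map_smul]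
  have t2 : lam.quo X.frobLattice (X'.frobLattice.comap (invMap (E : Sring p k) f)) = 0 := by
    refine localLengthFn_quo_eq_zero _ fun y hy => ?_
    obtain ⟨x, hx⟩ := mem_frobLattice_iff.mp hy
    have h7 : ∑ j : Fin p, (PowerSeries.X : Sring p k) ^ (j : ℕ) • X''.frob (g (x j)) = 0 := by
      have h8 := congrArg (invMap (E : Sring p k) g) hx
      rw [(invMap_exact hex).apply_apply_eq_zero, map_sum] at h8
      rw [h8]
      exact Finset.sum_congr rfl fun j _ => by rw [map_smul, hgh]
    obtain ⟨b, hb0, hb⟩ := exists_frob_torsion hE hX'' (one_ne_zero : (1 : Sring p k) ≠ 0)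
      (by rw [h7, smul_zero])
    choose m hm using fun j => exists_p_pow_smul_eq_zero hE hX'' hfg'' hb0 (hb j)
    have hm' : ∀ j, ∃ x', f x' = (p : Sring p k) ^ (∑ j, m j) • x j := fun j => by
      refine (hex _).mp ?_
      rw [map_smul, ← Finset.sum_erase_add _ _ (Finset.mem_univ j), pow_add, mul_smul, hm, smul_zero]
    choose x' hx' using hm'
    refine ⟨_, hE.pow_mem_away (∑ j, m j), mem_frobLattice_iff.mpr ⟨x', hfi ?_⟩⟩
    rw [map_smul, hx, map_sum, Finset.smul_sum]
    exact Finset.sum_congr rfl fun j _ => by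
      rw [map_smul, hfh, hx', X'.frob.map_smulₛₗ, map_pow, frobS_natCast, smul_comm]
  have e' := lam.idx_congr (K := X.latticeOf N ⊓ X.frobSpan N) (inf_le_left.trans l1)
    (inf_le_right.trans l2) h5 h6 f1 f2 t1 t2
  rw [e', h3, h4] at e
  rw [deg, deg, deg, relIndex_eq_idx, relIndex_eq_idx, relIndex_eq_idx, e]
  push_cast
  rfl

theorem rank_subquot {N N' : Submodule (Sring p k) X} (hfg : IsAlmostFG p k X)
    {Q : PhiMod.{u, v} E} (h : Subquot X N N' Q) : rank (X.sub N') = rank (X.sub N) + rank Q :=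
  finrank_exact (f := inclOfLE h.le) (g := h.π)
    (fun x y hxy => X.incl_injective N (by rw [← incl_inclOfLE h.le, ← incl_inclOfLE h.le, hxy]))
    h.surj h.exact (hfg.of_injective (X.incl_injective N'))

theorem deg_subquot (hE : IsEis E) {N N' : Submodule (Sring p k) X} (hX : X.IsEtale)
    (hfg : IsAlmostFG p k X) (hN : X.IsEtaleSub N) (hN' : X.IsEtaleSub N')
    {Q : PhiMod.{u, v} E} (h : Subquot X N N' Q) : deg (X.sub N') = deg (X.sub N) + deg Q :=
  deg_exact hE (f := inclOfLE h.le) (g := h.π) (isHom_inclOfLE h.le hN.1 hN'.1) h.isHom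
    (fun x y hxy => X.incl_injective N (by rw [← incl_inclOfLE h.le, ← incl_inclOfLE h.le, hxy]))
    h.surj h.exact (hN.sub_isEtale hX) (hN'.sub_isEtale hX) (h.isEtale hX hN hN')
    (hfg.of_injective (X.incl_injective N'))

/-- Rank and degree are modular. -/
theorem rank_deg_sup (hE : IsEis E) {N N' : Submodule (Sring p k) X} (hX : X.IsEtale)
    (hfg : IsAlmostFG p k X) (hN : X.IsEtaleSub N) (hN' : X.IsEtaleSub N') :
    rank (X.sub (N ⊔ N')) + rank (X.sub (N ⊓ N')) = rank (X.sub N) + rank (X.sub N') ∧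
    deg (X.sub N) + deg (X.sub N') = deg (X.sub (N ⊔ N')) + deg (X.sub (N ⊓ N')) := by
  have hS := hN.sup hN'
  have hI := hN.inf hX hN'
  have q1 := Subquot.ofGr hI.1 hN'.1 (inf_le_right : N ⊓ N' ≤ N')
  have q2 := Subquot.ofGr hN.1 hS.1 (le_sup_left : N ≤ N ⊔ N')
  have hiso := q1.iso_of_le q2 inf_le_left le_sup_right (by rw [inf_comm]) (by rw [sup_comm])
  have r1 := rank_subquot hfg q1
  have r2 := rank_subquot hfg q2
  have d1 := deg_subquot hE hX hfg hI hN' q1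
  have d2 := deg_subquot hE hX hfg hN hS q2
  have r3 := rank_iso hiso
  have d3 := deg_iso hiso
  constructor
  · omega
  · linarith

end

/-! ### The isogeny category and the category over `𝔖[1/p]` -/

section

variable {M M' : PhiMod.{u, v} E}

theorem isogeny_isStrictSub_iff (hM : (isogenyData E).IsObj M) {N : Submodule (Sring p k) M} :
    (isogenyData E).IsStrictSub M N ↔ M.IsEtaleSub N := by
  obtain ⟨hfin, het⟩ := hM
  constructor
  · rintro ⟨h1, h2, h3⟩
    exact h1.isEtaleSub_of_quot het h3.2
  · intro h
    exact ⟨h.1, ⟨inferInstanceAs (Module.Finite (Sring p k) N), h.sub_isEtale het⟩,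
      Module.Finite.of_surjective _ (M.proj_surjective N), h.quot_isEtale het⟩

theorem isogenyData_isGood (hE : IsEis E) : (isogenyData.{u, v} E).IsGood where
  iso_obj h hM := by
    have het := h.isEtale hM.2
    obtain ⟨e, -⟩ := h
    have := hM.1
    exact ⟨Module.Finite.equiv e, het⟩
  iso_rank := rank_iso
  iso_deg := deg_iso
  null_iff {M} hM := by
    have := hM.1
    rw [show (isogenyData E).rank M = rank M from rfl,
      rank_eq_zero_iff_torsion hE hM.2 (IsAlmostFG.of_finite M)]
    constructor
    · rintro ⟨n, hn⟩ x
      exact ⟨n, hn x⟩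
    · intro h
      obtain ⟨n, hn⟩ := exists_le_of_fg (Module.Finite.fg_top (R := Sring p k) (M := M))
        (P := fun n => LinearMap.ker (DistribSMul.toLinearMap (Sring p k) M ((p : Sring p k) ^ n)))
        (monotone_nat_of_le_succ fun n x hx => by
          change (p : Sring p k) ^ (n + 1) • x = 0
          rw [pow_succ', mul_smul]
          exact (congrArg _ hx).trans (smul_zero _)) (fun x _ => h x)
      exact ⟨n, fun x => hn (trivial : x ∈ ⊤)⟩
  deg_null {M} hM h := by
    have := hM.1
    exact deg_eq_zero_of_torsion hE ((rank_eq_zero_iff_torsion hE hM.2 (IsAlmostFG.of_finite M)).mp h)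
  quot_top hM := ((isogeny_isStrictSub_iff hM).mpr hM.2.isEtaleSub_top).2.2
  ext {M N} h1 h2 h3 := by
    have : Module.Finite (Sring p k) N := h2.1
    have : Module.Finite (Sring p k) (M ⧸ N) := h3.1
    exact ⟨Module.Finite.of_submodule_quotient N, h1.isEtale_of_sub_quot h2.2 h3.2⟩
  ker {M N} hM h1 h3 := ((isogeny_isStrictSub_iff hM).mpr (h1.isEtaleSub_of_quot hM.2 h3.2)).2.1
  rank_add {M N} hM h := by
    have := hM.1
    exact finrank_exact (M.incl_injective N) (M.proj_surjective N) (exact_incl_proj N)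
      (IsAlmostFG.of_finite M)
  deg_add {M N} hM h := by
    have := hM.1
    exact deg_exact hE (isHom_incl h.1) (isHom_proj h.1) (M.incl_injective N)
      (M.proj_surjective N) (exact_incl_proj N) h.2.1.2 hM.2 h.2.2.2 (IsAlmostFG.of_finite M)
  inf {M N N'} hM h h' := by
    rw [isogeny_isStrictSub_iff hM] at h h' ⊢
    exact h.inf hM.2 h'
  sup {M N N'} hM h h' := by
    rw [isogeny_isStrictSub_iff hM] at h h'
    have := hM.1
    obtain ⟨h1, h2⟩ := rank_deg_sup hE hM.2 (IsAlmostFG.of_finite M) h h'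
    exact ⟨N ⊔ N', (isogeny_isStrictSub_iff hM).mpr (h.sup h'), le_sup_left, le_sup_right,
      fun Z _ h1 h2 => sup_le h1 h2, h1, h2.le⟩

theorem rational_isStrictSub_iff (hM : (rationalData E).IsObj M) {N : Submodule (Sring p k) M} :
    (rationalData E).IsStrictSub M N ↔ M.IsEtaleSub N ∧ ∀ x, (p : Sring p k) • x ∈ N → x ∈ N := by
  have hx0 : ∀ x, M.proj N x = 0 ↔ x ∈ N := fun x => by
    rw [← LinearMap.mem_ker, ker_proj]
  obtain ⟨hb, hfg, het⟩ := hM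
  constructor
  · rintro ⟨h1, h2, h3⟩
    refine ⟨h1.isEtaleSub_of_quot het h3.2.2, fun x hx => ?_⟩
    rw [← hx0] at hx ⊢
    exact h3.1.1 (by simp only [← map_smul, hx, smul_zero])
  · rintro ⟨h1, h2⟩
    refine ⟨h1.1, ⟨⟨fun x y hxy => ?_, fun x => ?_⟩, IsAlmostFG.of_injective hfg (M.incl_injective N),
      h1.sub_isEtale het⟩, ⟨fun x y hxy => ?_, fun x => ?_⟩, IsAlmostFG.of_surjective hfg (M.proj_surjective N),
      h1.quot_isEtale het⟩
    · exact M.incl_injective N (hb.1 (by simp only [← map_smul]; exact congrArg _ hxy))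
    · obtain ⟨y, hy⟩ := hb.2 (M.incl N x)
      have hy' : y ∈ N := h2 y (by rw [show (p : Sring p k) • y = _ from hy]; exact incl_mem x)
      exact ⟨mkSub y hy', M.incl_injective N (by rw [map_smul, incl_mkSub]; exact hy)⟩
    · obtain ⟨x, rfl⟩ := M.proj_surjective N x
      obtain ⟨y, rfl⟩ := M.proj_surjective N y
      simp only [← map_smul] at hxy
      rw [← sub_eq_zero, ← map_sub, ← smul_sub, hx0] at hxy
      rw [← sub_eq_zero, ← map_sub, hx0]
      exact h2 _ hxy
    · obtain ⟨x, rfl⟩ := M.proj_surjective N x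
      obtain ⟨y, hy⟩ := hb.2 x
      exact ⟨M.proj N y, by simp only [← map_smul]; exact congrArg _ hy⟩

theorem rationalData_isReduced (hE : IsEis E) : (rationalData.{u, v} E).IsReduced := by
  intro M hM h
  have h1 := (rank_eq_zero_iff_torsion hE hM.2.2 hM.2.1).mp h
  refine subsingleton_of_forall_eq 0 fun x => ?_
  obtain ⟨n, hn⟩ := h1 x
  exact pow_smul_eq_zero_imp (fun x hx => hM.1.1 (by simp only [hx, smul_zero])) n hn

theorem rationalData_isGood (hE : IsEis E) : (rationalData.{u, v} E).IsGood where
  iso_obj h hM := by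
    have het := h.isEtale hM.2.2
    obtain ⟨e, -⟩ := h
    refine ⟨⟨fun x y hxy => ?_, fun x => ?_⟩, IsAlmostFG.of_surjective hM.2.1 (f := e.toLinearMap) e.surjective, het⟩
    · exact e.symm.injective (hM.1.1 (by simp only [← map_smul]; exact congrArg _ hxy))
    · obtain ⟨y, hy⟩ := hM.1.2 (e.symm x)
      exact ⟨e y, by simp only [← map_smul]; rw [show (p : Sring p k) • y = _ from hy, e.apply_symm_apply]⟩
  iso_rank := rank_iso
  iso_deg := deg_iso
  null_iff {M} hM := by
    constructor
    · intro h
      have : Subsingleton M := h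
      exact (rank_eq_zero_iff_torsion hE hM.2.2 hM.2.1).mpr fun x => ⟨0, Subsingleton.elim _ _⟩
    · exact rationalData_isReduced hE hM
  deg_null {M} hM h :=
    deg_eq_zero_of_torsion hE ((rank_eq_zero_iff_torsion hE hM.2.2 hM.2.1).mp h)
  quot_top hM := ((rational_isStrictSub_iff hM).mpr
    ⟨hM.2.2.isEtaleSub_top, fun _ _ => trivial⟩).2.2
  ext {M N} h1 h2 h3 := by
    obtain ⟨hb, ⟨L, hL, hLN⟩, het⟩ := h2
    obtain ⟨hb', ⟨L', hL', hLN'⟩, het'⟩ := h3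
    have hx0 : ∀ x, M.proj N x = 0 → ∃ y, M.incl N y = x := fun x hx => by
      rwa [← LinearMap.mem_ker, ker_proj, ← range_incl N] at hx
    refine ⟨⟨fun x y hxy => ?_, fun x => ?_⟩, ?_, h1.isEtale_of_sub_quot het het'⟩
    · obtain ⟨z, hz⟩ := hx0 (x - y) (hb'.1 (by
        simp only [← map_smul, smul_sub]
        rw [show (p : Sring p k) • x = (p : Sring p k) • y from hxy, sub_self, map_zero, smul_zero]))
      have hz0 : z = 0 := hb.1 (M.incl_injective N (by
        simp only [map_smul, hz, smul_sub]
        rw [show (p : Sring p k) • x = (p : Sring p k) • y from hxy, sub_self, map_zero, smul_zero]))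
      rw [hz0, map_zero] at hz
      exact (sub_eq_zero.mp hz.symm)
    · obtain ⟨y', hy'⟩ := hb'.2 (M.proj N x)
      obtain ⟨y, rfl⟩ := M.proj_surjective N y'
      simp only [← map_smul] at hy'
      obtain ⟨z, hz⟩ := hx0 (x - (p : Sring p k) • y) (by rw [map_sub, hy', sub_self])
      obtain ⟨t, ht⟩ := hb.2 z
      refine ⟨y + M.incl N t, ?_⟩
      simp only [smul_add, ← map_smul]
      rw [show (p : Sring p k) • t = z from ht, hz, add_sub_cancel]
    · obtain ⟨s, rfl⟩ := hL'
      -- A lattice of the extension is spanned by one of `N` and by lifts of generators of one of `M / N`.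
      choose c hc using M.proj_surjective N
      refine ⟨L.map (M.incl N) ⊔ Submodule.span (Sring p k) (c '' s), (hL.map _).sup
        (Submodule.fg_span (s.finite_toSet.image _)), fun x => ?_⟩
      obtain ⟨n, hn⟩ := hLN' (M.proj N x)
      have h4 : Submodule.span (Sring p k) (s : Set (M.quot N))
          = (Submodule.span (Sring p k) (c '' s)).map (M.proj N) := by
        rw [Submodule.map_span, ← Set.image_comp]
        congr 1
        conv_lhs => rw [← Set.image_id (s : Set (M.quot N))]
        exact Set.image_congr fun a _ => (hc a).symm
      rw [h4] at hn
      obtain ⟨y, hy, hxy⟩ := hn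
      obtain ⟨z, hz⟩ := hx0 ((p : Sring p k) ^ n • x - y) (by rw [map_sub, hxy, map_smul, sub_self])
      obtain ⟨m, hm⟩ := hLN z
      refine ⟨m + n, ?_⟩
      rw [pow_add, mul_smul, ← sub_add_cancel ((p : Sring p k) ^ n • x) y, ← hz, smul_add, ← map_smul]
      exact Submodule.add_mem_sup ⟨_, hm, rfl⟩ (Submodule.smul_mem _ _ hy)
  ker {M N} hM h1 h3 := by
    refine ((rational_isStrictSub_iff hM).mpr ⟨h1.isEtaleSub_of_quot hM.2.2 h3.2.2, fun x hx => ?_⟩).2.1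
    rw [← ker_proj N, LinearMap.mem_ker] at hx ⊢
    exact h3.1.1 (by simp only [← map_smul, hx, smul_zero])
  rank_add {M N} hM h :=
    finrank_exact (M.incl_injective N) (M.proj_surjective N) (exact_incl_proj N) hM.2.1
  deg_add {M N} hM h :=
    deg_exact hE (isHom_incl h.1) (isHom_proj h.1) (M.incl_injective N)
      (M.proj_surjective N) (exact_incl_proj N) h.2.1.2.2 hM.2.2 h.2.2.2.2 hM.2.1
  inf {M N N'} hM h h' := by
    rw [rational_isStrictSub_iff hM] at h h' ⊢
    exact ⟨h.1.inf hM.2.2 h'.1, fun x hx => ⟨h.2 x hx.1, h'.2 x hx.2⟩⟩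
  sup {M N N'} hM h h' := by
    rw [rational_isStrictSub_iff hM] at h h'
    obtain ⟨h1, h2⟩ := rank_deg_sup hE hM.2.2 hM.2.1 h.1 h'.1
    refine ⟨N ⊔ N', (rational_isStrictSub_iff hM).mpr ⟨h.1.sup h'.1, fun x hx => ?_⟩, le_sup_left,
      le_sup_right, fun Z _ h1 h2 => sup_le h1 h2, h1, h2.le⟩
    obtain ⟨a, ha, b, hb, hab⟩ := Submodule.mem_sup.mp hx
    obtain ⟨a', rfl⟩ := hM.1.2 a
    obtain ⟨b', rfl⟩ := hM.1.2 b
    simp only [← smul_add] at hab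
    rw [← hM.1.1 hab]
    exact Submodule.add_mem_sup (h.2 _ ha) (h'.2 _ hb)

end

end

end Kisin

end

noncomputable section

namespace Kisin

/-! ### Reductions of Kisin modules -/

section

open PhiModule

variable {p : ℕ} [hp : Fact p.Prime] {k : Type u} [Field k] [CharP k p] [PerfectRing k p]
variable {E : (WittVector p k)[X]} {M : PhiMod.{u, v} E}

theorem mem_pPow {n : ℕ} {x : M} : x ∈ M.pPow p n ↔ ∃ z, (p : Sring p k) ^ n • z = x := by
  rw [pPow, Submodule.mem_smul_pointwise_iff_exists]
  simp

theorem reduce_eq_zero {n : ℕ} {x : M} : M.reduce p n x = 0 ↔ ∃ z, (p : Sring p k) ^ n • z = x := by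
  rw [← mem_pPow, ← LinearMap.mem_ker]
  exact iff_of_eq (congrArg (x ∈ ·) (ker_proj (M.pPow p n)))

theorem reduce_surjective (n : ℕ) : Function.Surjective (M.reduce p n) := M.proj_surjective _

/-- Membership in the image of a submodule under the reduction. -/
theorem mem_map_reduce {n : ℕ} {N : Submodule (Sring p k) M} {x : M} :
    M.reduce p n x ∈ N.map (M.reduce p n) ↔ ∃ z, x - (p : Sring p k) ^ n • z ∈ N := by
  constructor
  · rintro ⟨y, hy, hxy⟩
    rw [eq_comm, ← sub_eq_zero, ← map_sub, reduce_eq_zero] at hxy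
    obtain ⟨z, hz⟩ := hxy
    exact ⟨z, by rw [hz, sub_sub_cancel]; exact hy⟩
  · rintro ⟨z, hz⟩
    refine ⟨_, hz, ?_⟩
    rw [map_sub, reduce_eq_zero.mpr ⟨z, rfl⟩, sub_zero]

theorem isHom_pow_smul (M : PhiMod.{u, v} E) (n : ℕ) :
    IsHom ((p : Sring p k) ^ n • LinearMap.id : M →ₗ[Sring p k] M) := by
  have h := isHom_natCast_smul (M := M) (p ^ n)
  rwa [Nat.cast_pow] at h

theorem isStable_pPow (M : PhiMod.{u, v} E) (n : ℕ) : M.IsStable (M.pPow p n) := by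
  have h := (isHom_pow_smul M n).isStable_map M.isStable_top
  convert h using 1
  ext x
  rw [mem_pPow, Submodule.mem_map]
  simp

theorem isEtaleSub_pPow (hM : M.IsEtale) (n : ℕ) : M.IsEtaleSub (M.pPow p n) := by
  have h := (isHom_pow_smul M n).isEtaleSub_map hM.isEtaleSub_top
  convert h using 1
  ext x
  rw [mem_pPow, Submodule.mem_map]
  simp

theorem isHom_reduce (M : PhiMod.{u, v} E) (n : ℕ) : IsHom (M.reduce p n) := isHom_proj (isStable_pPow M n)

theorem IsKisin.p_smul (hM : IsKisin M) (x : M) (hx : (p : Sring p k) • x = 0) : x = 0 := by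
  have := hM.2.1
  exact (smul_eq_zero.mp hx).resolve_left p_ne_zero

theorem IsKisin.p_pow_smul (hM : IsKisin M) {n : ℕ} {x y : M}
    (h : (p : Sring p k) ^ n • x = (p : Sring p k) ^ n • y) : x = y := by
  have := hM.2.1
  exact smul_right_injective _ (pow_ne_zero n p_ne_zero) h

theorem IsKisin.exists_eq_pow_smul (hM : IsKisin M) {n : ℕ} {y z : M}
    (h : (PowerSeries.X : Sring p k) • y = (p : Sring p k) ^ n • z) :
    ∃ t, (p : Sring p k) ^ n • t = y := by
  have := hM.2.1
  let b := Module.Free.chooseBasis (Sring p k) M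
  have h1 : ∀ i, (p : Sring p k) ^ n ∣ b.repr y i := fun i => by
    have h2 := congrArg (fun x => b.repr x i) h
    simp only [map_smul, Finsupp.smul_apply, smul_eq_mul] at h2
    refine p_prime.pow_dvd_of_dvd_mul_left n (fun hd => ?_) ⟨_, h2⟩
    rw [← redS_eq_zero_iff, redS_X] at hd
    exact PowerSeries.X_ne_zero hd
  choose c hc using h1
  have hs : ∀ i, b.repr y i = 0 → c i = 0 := fun i hi => by
    exact (mul_eq_zero.mp ((hc i).symm.trans hi)).resolve_left (pow_ne_zero n p_ne_zero)
  refine ⟨b.repr.symm (Finsupp.onFinset (b.repr y).support c fun i hi => by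
    rw [Finsupp.mem_support_iff]
    exact fun h0 => hi (hs i h0)), b.repr.injective ?_⟩
  ext1 i
  rw [map_smul, LinearEquiv.apply_symm_apply, Finsupp.smul_apply, Finsupp.onFinset_apply, hc i, smul_eq_mul]

theorem p_pow_smul_modPow (M : PhiMod.{u, v} E) (n : ℕ) (y : M.modPow p n) :
    (p : Sring p k) ^ n • y = 0 := by
  obtain ⟨x, rfl⟩ := reduce_surjective n y
  rw [← map_smul, reduce_eq_zero]
  exact ⟨x, rfl⟩

theorem modPow_isEtale (hM : M.IsEtale) (n : ℕ) : (M.modPow p n).IsEtale :=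
  (isEtaleSub_pPow hM n).quot_isEtale hM

theorem IsKisin.modPow_isObj (hM : IsKisin M) (n : ℕ) : (torsionData E).IsObj (M.modPow p n) := by
  have hfin := hM.1
  refine ⟨Module.Finite.of_surjective _ (reduce_surjective n), modPow_isEtale hM.2.2 n,
    ⟨n, p_pow_smul_modPow M n⟩, fun y hy => ?_⟩
  obtain ⟨x, rfl⟩ := reduce_surjective n y
  rw [← map_smul, reduce_eq_zero] at hy
  obtain ⟨z, hz⟩ := hy
  exact reduce_eq_zero.mpr (hM.exists_eq_pow_smul hz.symm)

/-- Multiplication by `p ^ b`, as a map `M / p ^ a M → M / p ^ (a + b) M`. -/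
def mulMap (M : PhiMod.{u, v} E) (a b : ℕ) : M.modPow p a →ₗ[Sring p k] M.modPow p (a + b) :=
  Submodule.mapQ (M.pPow p a) (M.pPow p (a + b)) ((p : Sring p k) ^ b • LinearMap.id) (by
    intro x hx
    obtain ⟨z, rfl⟩ := mem_pPow.mp hx
    refine mem_pPow.mpr ⟨z, ?_⟩
    rw [LinearMap.smul_apply, LinearMap.id_apply, smul_smul, ← pow_add, add_comm])

/-- The projection `M / p ^ (a + b) M → M / p ^ b M`. -/
def redMap (M : PhiMod.{u, v} E) (a b : ℕ) : M.modPow p (a + b) →ₗ[Sring p k] M.modPow p b :=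
  Submodule.mapQ (M.pPow p (a + b)) (M.pPow p b) LinearMap.id (by
    intro x hx
    obtain ⟨z, rfl⟩ := mem_pPow.mp hx
    refine mem_pPow.mpr ⟨(p : Sring p k) ^ a • z, ?_⟩
    rw [smul_smul, ← pow_add, add_comm])

theorem mulMap_reduce (a b : ℕ) (x : M) :
    mulMap M a b (M.reduce p a x) = M.reduce p (a + b) ((p : Sring p k) ^ b • x) := rfl

theorem redMap_reduce (a b : ℕ) (x : M) : redMap M a b (M.reduce p (a + b) x) = M.reduce p b x := rfl

theorem isHom_mulMap (a b : ℕ) : IsHom (mulMap M a b) :=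
  (isHom_reduce M a).of_comp_surjective (reduce_surjective a)
    ((isHom_reduce M (a + b)).comp (isHom_pow_smul M b))

theorem isHom_redMap (a b : ℕ) : IsHom (redMap M a b) :=
  (isHom_reduce M (a + b)).of_comp_surjective (reduce_surjective (a + b)) (isHom_reduce M b)

theorem redMap_surjective (a b : ℕ) : Function.Surjective (redMap M a b) := fun y => by
  obtain ⟨x, rfl⟩ := reduce_surjective b y
  exact ⟨M.reduce p (a + b) x, rfl⟩

theorem IsKisin.mulMap_injective (hM : IsKisin M) (a b : ℕ) : Function.Injective (mulMap M a b) := by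
  rw [injective_iff_map_eq_zero]
  intro y hy
  obtain ⟨x, rfl⟩ := reduce_surjective a y
  rw [mulMap_reduce, reduce_eq_zero] at hy
  obtain ⟨z, hz⟩ := hy
  rw [add_comm, pow_add, mul_smul] at hz
  exact reduce_eq_zero.mpr ⟨z, hM.p_pow_smul hz⟩

theorem exact_mulMap_redMap (a b : ℕ) : Function.Exact (mulMap M a b) (redMap M a b) := by
  intro y
  obtain ⟨x, rfl⟩ := reduce_surjective (a + b) y
  rw [redMap_reduce, reduce_eq_zero]
  constructor
  · rintro ⟨z, rfl⟩
    exact ⟨M.reduce p a z, mulMap_reduce a b z⟩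
  · rintro ⟨w, hw⟩
    obtain ⟨z, rfl⟩ := reduce_surjective a w
    rw [mulMap_reduce, ← sub_eq_zero, ← map_sub, reduce_eq_zero] at hw
    obtain ⟨t, ht⟩ := hw
    refine ⟨z - (p : Sring p k) ^ a • t, ?_⟩
    rw [smul_sub, smul_smul, ← pow_add, add_comm b, ht, sub_sub_cancel]

theorem IsKisin.torsionRank_modPow_add (hM : IsKisin M) (a b : ℕ) :
    torsionRank (M.modPow p (a + b)) = torsionRank (M.modPow p a) + torsionRank (M.modPow p b) :=
  torsionRank_exact (hM.mulMap_injective a b) (redMap_surjective a b) (exact_mulMap_redMap a b)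
    (hM.modPow_isObj _) (hM.modPow_isObj _)

theorem IsKisin.torsionDeg_modPow_add (hE : IsEis E) (hM : IsKisin M) (a b : ℕ) :
    torsionDeg (M.modPow p (a + b)) = torsionDeg (M.modPow p a) + torsionDeg (M.modPow p b) :=
  torsionDeg_exact hE (isHom_mulMap a b) (isHom_redMap a b)
    (hM.mulMap_injective a b) (redMap_surjective a b) (exact_mulMap_redMap a b)
    (hM.modPow_isObj _) (hM.modPow_isObj _) (hM.modPow_isObj _)

/-- The rank of `M / p M` is the rank of `M`. -/
theorem IsKisin.torsionRank_modPow_one (hM : IsKisin M) : torsionRank (M.modPow p 1) = rank M := by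
  have := hM.1
  have := hM.2.1
  let b := Module.Free.chooseBasis (Sring p k) M
  let ι := Module.Free.ChooseBasisIndex (Sring p k) M
  let R := Sring p k ⧸ IsLocalRing.maximalIdeal (Sring p k)
  -- The coordinates modulo the maximal ideal `(p, u)` identify `M / (p, u) M` with a power of the residue
  -- field.
  let g : M →ₗ[Sring p k] (ι → R) :=
    ((IsLocalRing.maximalIdeal (Sring p k)).mkQ.compLeft ι) ∘ₗ b.equivFun.toLinearMap
  have hg : Function.Surjective g := by
    intro c
    choose c' hc' using fun i => Submodule.mkQ_surjective _ (c i)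
    refine ⟨b.equivFun.symm c', ?_⟩
    ext1 i
    exact (congrArg (IsLocalRing.maximalIdeal (Sring p k)).mkQ
      (congrFun (b.equivFun.apply_symm_apply c') i)).trans (hc' i)
  have hker : ∀ x : M, g x = 0 ↔ ∃ y z : M, (p : Sring p k) • y + (PowerSeries.X : Sring p k) • z = x := by
    intro x
    constructor
    · intro hx
      have h1 : ∀ i, ∃ c d : Sring p k, c * (p : Sring p k) + d * PowerSeries.X = b.equivFun x i := fun i => by
        rw [← Ideal.mem_span_pair, ← maximalIdeal_S, ← Submodule.Quotient.mk_eq_zero]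
        exact congrFun hx i
      choose c d hcd using h1
      refine ⟨b.equivFun.symm c, b.equivFun.symm d, b.equivFun.injective ?_⟩
      ext1 i
      rw [map_add, map_smul, map_smul, LinearEquiv.apply_symm_apply, LinearEquiv.apply_symm_apply,
        ← hcd i]
      simp [mul_comm]
    · rintro ⟨y, z, rfl⟩
      ext1 i
      refine (Submodule.Quotient.mk_eq_zero _).mpr ?_
      change b.equivFun ((p : Sring p k) • y + (PowerSeries.X : Sring p k) • z) i ∈ _
      rw [map_add, map_smul, map_smul, maximalIdeal_S, Ideal.mem_span_pair]
      exact ⟨b.equivFun y i, b.equivFun z i, by simp [mul_comm]⟩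
  let g' : M.modPow p 1 →ₗ[Sring p k] (ι → R) := (M.pPow p 1).liftQ g (fun x hx => by
    obtain ⟨z, rfl⟩ := mem_pPow.mp hx
    exact (hker _).mpr ⟨z, 0, by rw [smul_zero, add_zero, pow_one]⟩)
  have hg' : Function.Surjective g' := fun c => by
    obtain ⟨x, rfl⟩ := hg c
    exact ⟨M.reduce p 1 x, rfl⟩
  have hk' : LinearMap.ker g' = (PowerSeries.X : Sring p k) • ⊤ := by
    ext y
    obtain ⟨x, rfl⟩ := reduce_surjective 1 y
    rw [LinearMap.mem_ker, Submodule.mem_smul_pointwise_iff_exists]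
    change g x = 0 ↔ _
    rw [hker]
    constructor
    · rintro ⟨y, z, rfl⟩
      refine ⟨M.reduce p 1 z, trivial, ?_⟩
      rw [map_add, (reduce_eq_zero (x := (p : Sring p k) • y)).mpr ⟨y, by rw [pow_one]⟩, zero_add, map_smul]
    · rintro ⟨w, -, hw⟩
      obtain ⟨z, rfl⟩ := reduce_surjective 1 w
      rw [← map_smul, eq_comm, ← sub_eq_zero, ← map_sub, reduce_eq_zero] at hw
      obtain ⟨y, hy⟩ := hw
      exact ⟨y, z, by rw [pow_one] at hy; rw [hy, sub_add_cancel]⟩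
  have hlen : Module.length (Sring p k) R = 1 := by
    rw [Module.length_eq_one_iff]
    exact isSimpleModule_iff_quot_maximal.mpr ⟨_, inferInstance, ⟨LinearEquiv.refl _ _⟩⟩
  have h1 := ((Submodule.quotEquivOfEq _ _ hk'.symm).trans (g'.quotKerEquivOfSurjective hg')).length_eq
  rw [torsionRank, h1, Module.length_pi, hlen, rank, Module.finrank_eq_card_basis b]
  rw [mul_one, ENat.card_eq_coe_fintype_card, ENat.toNat_natCast]

theorem IsKisin.torsionRank_modPow (hM : IsKisin M) (n : ℕ) :
    torsionRank (M.modPow p n) = n * rank M := by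
  induction n with
  | zero =>
    have h : Subsingleton (M.modPow p 0) := subsingleton_of_forall_eq 0 fun y => by
      have h1 := p_pow_smul_modPow M 0 y
      rwa [pow_zero, one_smul] at h1
    rw [torsionRank_subsingleton, zero_mul]
  | succ n ih => rw [hM.torsionRank_modPow_add, ih, hM.torsionRank_modPow_one, add_mul, one_mul]

/-- For lattices `B ≤ A` with `A / B` killed by a power of `E` and without `p`-torsion, the length of
the reduction of `A / B` modulo `p` is `e` times its length at `(E)`. -/
theorem length_quo_map_of_saturated (hE : IsEis E) {V V' : Type (max u v)} [AddCommGroup V]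
    [Module (Sring p k) V] [AddCommGroup V'] [Module (Sring p k) V'] {π : V →ₗ[Sring p k] V'}
    (hπ : ∀ x, π x = 0 ↔ ∃ y, (p : Sring p k) • y = x)
    {A B : Submodule (Sring p k) V} (hBA : B ≤ A) (hA : A.FG)
    {n : ℕ} (hn : ∀ x ∈ A, (E : Sring p k) ^ n • x ∈ B) (hpA : ∀ x, (p : Sring p k) • x ∈ A → x ∈ A)
    (hpB : ∀ x, (p : Sring p k) • x ∈ B → x ∈ B) :
    (localLengthFn.{u, max u v} (away (E : Sring p k))).quo B A ≠ ⊤ ∧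
    (lengthFn.{u, max u v} (Sring p k)).quo (B.map π) (A.map π)
      = E.natDegree * (localLengthFn.{u, max u v} (away (E : Sring p k))).quo B A := by
  have hAf : Module.Finite (Sring p k) A := Module.Finite.iff_fg.mpr hA
  have hz : ∀ x : A, (B.submoduleOf A).mkQ x = 0 ↔ (x : V) ∈ B := fun x => by
    rw [Submodule.mkQ_apply, Submodule.Quotient.mk_eq_zero (B.submoduleOf A)]
    rfl
  obtain ⟨h1, h2⟩ := hE.length_quo_p_eq (Q := A ⧸ B.submoduleOf A) n (fun y => by
    obtain ⟨x, rfl⟩ := Submodule.mkQ_surjective _ y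
    rw [← map_smul, hz]
    exact hn _ x.2) (fun y hy => by
    obtain ⟨x, rfl⟩ := Submodule.mkQ_surjective _ y
    rw [← map_smul, hz] at hy
    rw [hz]
    exact hpB _ hy)
  refine ⟨h1, ?_⟩
  set lam := lengthFn.{u, max u v} (Sring p k) with hlam
  change _ = (E.natDegree : ℕ∞) * (localLengthFn.{u, max u v} (away (E : Sring p k))).toFun (A ⧸ B.submoduleOf A)
  rw [← h2]
  let Q := A ⧸ B.submoduleOf A
  let g : A.map π →ₗ[Sring p k] _ := ((B.map π).submoduleOf (A.map π)).mkQ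
  let h : A →ₗ[Sring p k] A.map π := π.restrict (p := A) (q := A.map π) fun x hx => ⟨x, hx, rfl⟩
  have hh : Function.Surjective h := by
    rintro ⟨_, x, hx, rfl⟩
    exact ⟨⟨x, hx⟩, rfl⟩
  -- Both sides are the length of `A / (B + p A)`.
  have hker1 : ∀ x : A, g (h x) = 0 ↔ ∃ y : A, (x : V) - (p : Sring p k) • (y : V) ∈ B := by
    intro x
    rw [Submodule.mkQ_apply, Submodule.Quotient.mk_eq_zero ((B.map π).submoduleOf (A.map π))]
    change π x ∈ B.map π ↔ _
    constructor
    · rintro ⟨b, hb, hbx⟩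
      rw [eq_comm, ← sub_eq_zero, ← map_sub, hπ] at hbx
      obtain ⟨y, hy⟩ := hbx
      refine ⟨⟨y, hpA _ (by rw [hy]; exact A.sub_mem x.2 (hBA hb))⟩, ?_⟩
      change (x : V) - (p : Sring p k) • y ∈ B
      rw [hy, sub_sub_cancel]
      exact hb
    · rintro ⟨y, hy⟩
      refine ⟨_, hy, ?_⟩
      rw [map_sub, (hπ _).mpr ⟨(y : V), rfl⟩, sub_zero]
  let g' : A →ₗ[Sring p k] Q ⧸ ((p : Sring p k) • (⊤ : Submodule (Sring p k) Q)) :=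
    Submodule.mkQ _ ∘ₗ (B.submoduleOf A).mkQ
  have hker2 : ∀ x : A, g' x = 0 ↔ ∃ y : A, (x : V) - (p : Sring p k) • (y : V) ∈ B := by
    intro x
    change Submodule.mkQ ((p : Sring p k) • (⊤ : Submodule (Sring p k) Q)) ((B.submoduleOf A).mkQ x) = 0 ↔ _
    rw [Submodule.mkQ_apply, Submodule.Quotient.mk_eq_zero, Submodule.mem_smul_pointwise_iff_exists]
    constructor
    · rintro ⟨q, -, hq⟩
      obtain ⟨y, rfl⟩ := Submodule.mkQ_surjective _ q
      rw [← map_smul, eq_comm, ← sub_eq_zero, ← map_sub, hz] at hq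
      exact ⟨y, hq⟩
    · rintro ⟨y, hy⟩
      refine ⟨(B.submoduleOf A).mkQ y, trivial, ?_⟩
      rw [← map_smul, eq_comm, ← sub_eq_zero, ← map_sub, hz]
      exact hy
  have hkk : LinearMap.ker (g ∘ₗ h) = LinearMap.ker g' := by
    ext x
    rw [LinearMap.mem_ker, LinearMap.mem_ker, hker2]
    exact hker1 x
  have e1 := (g ∘ₗ h).quotKerEquivOfSurjective ((Submodule.mkQ_surjective _).comp hh)
  have e2 := g'.quotKerEquivOfSurjective ((Submodule.mkQ_surjective _).comp (Submodule.mkQ_surjective _))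
  rw [LengthFn.quo_top]
  exact lam.congr (e1.symm.trans ((Submodule.quotEquivOfEq _ _ hkk).trans e2))

theorem exists_E_pow_smul_lattice_le [Module.Finite (Sring p k) M] (hM : M.IsEtale) :
    ∃ c : ℕ, (E : Sring p k) ^ c • M.lattice ≤ M.frobLattice ∧
      (E : Sring p k) ^ c • M.frobLattice ≤ M.lattice := by
  have key : ∀ K L : Submodule (Sring p k) (Inv (E : Sring p k) M), K.FG →
      (∀ x ∈ K, ∃ n : ℕ, (E : Sring p k) ^ n • x ∈ L) →
      ∃ c₀ : ℕ, ∀ c, c₀ ≤ c → (E : Sring p k) ^ c • K ≤ L := by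
    intro K L hK h
    obtain ⟨n, hn⟩ := exists_le_of_fg hK
      (P := fun n => L.comap (DistribSMul.toLinearMap (Sring p k) _ ((E : Sring p k) ^ n)))
      (monotone_nat_of_le_succ fun n x hx => by
        change (E : Sring p k) ^ (n + 1) • x ∈ L
        rw [pow_succ', mul_smul]
        exact L.smul_mem _ hx) h
    refine ⟨n, fun c' hc' => ?_⟩
    rintro _ ⟨x, hx, rfl⟩
    change (E : Sring p k) ^ c' • x ∈ L
    rw [← Nat.sub_add_cancel hc', pow_add, mul_smul]
    exact L.smul_mem _ (hn hx)
  obtain ⟨c, hc⟩ := key M.lattice M.frobLattice lattice_fg (by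
      rintro _ ⟨x, rfl⟩
      obtain ⟨n, x', h⟩ := exists_pow_smul_toInv_eq hM x
      exact ⟨n, mem_frobLattice_iff.mpr ⟨x', h⟩⟩)
  obtain ⟨c', hc'⟩ := key M.frobLattice M.lattice frobLattice_fg (by
      intro y _
      obtain ⟨n, x, h⟩ := exists_pow_smul_eq_toInv y
      exact ⟨n, x, h.symm⟩)
  exact ⟨max c c', hc _ (le_max_left _ _), hc' _ (le_max_right _ _)⟩

/-- The degree of `M / p M` is the degree of `M`. -/
theorem IsKisin.torsionDeg_modPow_one (hE : IsEis E) (hM : IsKisin M) :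
    torsionDeg (M.modPow p 1) = deg M := by
  have hobj := hM.modPow_isObj 1
  have hfin := hM.1
  rw [torsionDeg_eq hE hobj]
  set π := invMap (E : Sring p k) (M.reduce p 1) with hπdef
  have hps : ∀ x : Inv (E : Sring p k) M, (p : Sring p k) • x = 0 → x = 0 := smul_inv_eq_zero hM.p_smul
  have hinj : Function.Injective (toInv (E : Sring p k) M) := by
    rw [injective_iff_map_eq_zero]
    intro x hx
    obtain ⟨n, hn⟩ := toInv_eq_zero.mp hx
    have := hM.2.1
    exact (smul_eq_zero.mp hn).resolve_left (pow_ne_zero _ hE.ne_zero)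
  have hπ : ∀ x, π x = 0 ↔ ∃ y, (p : Sring p k) • y = x := by
    intro x
    constructor
    · intro hx
      obtain ⟨n, m, hm⟩ := exists_pow_smul_eq_toInv x
      have h1 : toInv (E : Sring p k) (M.modPow p 1) (M.reduce p 1 m) = 0 := by
        rw [← invMap_toInv, ← hm, map_smul, ← hπdef, hx, smul_zero]
      rw [(map_eq_zero_iff _ (hE.toInv_injective (p_pow_smul_modPow M 1) hobj.2.2.2)), reduce_eq_zero] at h1
      obtain ⟨z, hz⟩ := h1
      obtain ⟨y, hy⟩ := pow_smul_inv_surjective (a := (E : Sring p k)) n (toInv (E : Sring p k) M z)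
      refine ⟨y, pow_smul_inv_injective (a := (E : Sring p k)) n ?_⟩
      simp only at hy ⊢
      rw [smul_comm, hy, hm, ← hz, pow_one, map_smul]
    · rintro ⟨y, rfl⟩
      have h1 : (p : Sring p k) • π y = 0 := by
        have h2 := smul_inv_of_forall (a := (E : Sring p k)) (p_pow_smul_modPow M 1) (π y)
        rwa [pow_one] at h2
      rw [map_smul, h1]
  have hL : M.lattice.map π = (M.modPow p 1).lattice := by
    rw [hπdef, map_lattice, LinearMap.range_eq_top.mpr (reduce_surjective 1), lattice_eq]
  have hF : M.frobLattice.map π = (M.modPow p 1).frobLattice := by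
    rw [hπdef, (isHom_reduce M 1).map_frobLattice, LinearMap.range_eq_top.mpr (reduce_surjective 1),
      frobLattice_eq_frobSpan]
  -- Both lattices are saturated with respect to `p`.
  have hpL : ∀ x, (p : Sring p k) • x ∈ M.lattice → x ∈ M.lattice := by
    rintro x ⟨m, hm⟩
    have h1 : toInv (E : Sring p k) (M.modPow p 1) (M.reduce p 1 m) = 0 := by
      rw [← invMap_toInv, hm]
      exact (hπ _).mpr ⟨x, rfl⟩
    rw [(map_eq_zero_iff _ (hE.toInv_injective (p_pow_smul_modPow M 1) hobj.2.2.2)), reduce_eq_zero] at h1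
    obtain ⟨z, hz⟩ := h1
    refine ⟨z, sub_eq_zero.mp (hps _ ?_)⟩
    rw [smul_sub, ← hm, ← hz, pow_one, map_smul, sub_self]
  have hpF : ∀ x, (p : Sring p k) • x ∈ M.frobLattice → x ∈ M.frobLattice := by
    intro x hx
    obtain ⟨y, hy⟩ := mem_frobLattice_iff.mp hx
    have h1 : ∑ j : Fin p, (PowerSeries.X : Sring p k) ^ (j : ℕ) • (M.modPow p 1).frob (M.reduce p 1 (y j)) = 0 := by
      have h2 := (hπ _).mpr ⟨x, rfl⟩
      rw [hy, map_sum] at h2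
      rw [← h2]
      exact Finset.sum_congr rfl fun j _ => by rw [map_smul, hπdef, isHom_reduce M 1]
    choose z hz using fun j => reduce_eq_zero.mp
      (eq_zero_of_sum_frob_eq_zero hE hobj.2.1 (p_pow_smul_modPow M 1) hobj.2.2.2 h1 j)
    refine mem_frobLattice_iff.mpr ⟨z, sub_eq_zero.mp (hps _ ?_)⟩
    rw [smul_sub, hy, Finset.smul_sum, sub_eq_zero]
    exact Finset.sum_congr rfl fun j _ => by
      rw [← hz, pow_one, M.frob.map_smulₛₗ, frobS_natCast, smul_comm]
  -- Both relative indices are computed from the common sublattice `E ^ c • M.lattice`, also saturated.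
  -- Reduction modulo `p` multiplies the lengths by `deg E`.
  obtain ⟨c, h1, h2⟩ := exists_E_pow_smul_lattice_le (M := M) hM.2.2
  set B := (E : Sring p k) ^ c • M.lattice with hB
  have hBL : B ≤ M.lattice := smul_submodule_le _ _
  have hpB : ∀ x, (p : Sring p k) • x ∈ B → x ∈ B := by
    intro x hx
    obtain ⟨l, hl, hlx⟩ := Submodule.mem_smul_pointwise_iff_exists _ _ _ |>.mp hx
    obtain ⟨y, hy⟩ := pow_smul_inv_surjective (a := (E : Sring p k)) c x
    simp only at hy
    rw [← hy] at hlx ⊢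
    refine Submodule.smul_mem_pointwise_smul _ _ _ (hpL y ?_)
    rw [smul_comm] at hlx
    rwa [← pow_smul_inv_injective (a := (E : Sring p k)) c hlx]
  obtain ⟨f1, e1⟩ := length_quo_map_of_saturated hE hπ hBL lattice_fg (n := c)
    (fun x hx => Submodule.smul_mem_pointwise_smul _ _ _ hx) hpL hpB
  obtain ⟨f2, e2⟩ := length_quo_map_of_saturated hE hπ h1 frobLattice_fg (n := c + c)
    (fun x hx => by
      rw [pow_add, mul_smul]
      exact Submodule.smul_mem_pointwise_smul _ _ _ (h2 (Submodule.smul_mem_pointwise_smul _ _ _ hx))) hpF hpB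
  rw [hL] at e1
  rw [hF] at e2
  rw [deg, relIndex_eq_idx, LengthFn.idx_eq _ hBL h1 f1 f2,
    LengthFn.idx_eq _ (hL ▸ Submodule.map_mono hBL) (hF ▸ Submodule.map_mono h1)
    (by rw [e1]; exact WithTop.mul_ne_top (ENat.natCast_ne_top _) f1)
    (by rw [e2]; exact WithTop.mul_ne_top (ENat.natCast_ne_top _) f2), e1, e2, ENat.toNat_mul, ENat.toNat_mul,
    ENat.toNat_natCast]
  have he : (E.natDegree : ℚ) ≠ 0 := Nat.cast_ne_zero.mpr hE.pos.ne'
  push_cast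
  field_simp

theorem IsKisin.torsionDeg_modPow (hE : IsEis E) (hM : IsKisin M) (n : ℕ) :
    torsionDeg (M.modPow p n) = n * deg M := by
  induction n with
  | zero =>
    have h := hM.torsionDeg_modPow_add hE 0 0
    rw [Nat.cast_zero, zero_mul]
    rw [add_zero] at h
    linarith
  | succ n ih =>
    rw [hM.torsionDeg_modPow_add hE, ih, hM.torsionDeg_modPow_one hE]
    push_cast
    ring

theorem IsKisin.slope_modPow (hE : IsEis E) (hM : IsKisin M) {n : ℕ} (hn : 1 ≤ n) :
    (torsionData E).slope (M.modPow p n) = slope M := by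
  have hn' : (n : ℚ) ≠ 0 := Nat.cast_ne_zero.mpr (by omega)
  change torsionDeg _ / (torsionRank _ : ℚ) = _
  rw [hM.torsionDeg_modPow hE, hM.torsionRank_modPow, slope, Nat.cast_mul, mul_div_mul_left _ _ hn']

end

end Kisin

end

noncomputable section

namespace Kisin

/-! ### Subobjects of the reductions of a Kisin module -/

section

open PhiModule

namespace PhiModule

variable {A : Type u} [CommRing A] {φ : A →+* A} {e : A} {X : PhiModule.{u, v₁} φ e}
  {Y : PhiModule.{u, v₂} φ e}

/-- The restriction of a map to stable submodules. -/
def subMap (f : X →ₗ[A] Y) {N : Submodule A X} {N' : Submodule A Y} (h : ∀ x ∈ N, f x ∈ N') :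
    X.sub N →ₗ[A] Y.sub N' :=
  f.restrict (p := N) (q := N') h

theorem incl_subMap (f : X →ₗ[A] Y) {N : Submodule A X} {N' : Submodule A Y} (h : ∀ x ∈ N, f x ∈ N')
    (x : X.sub N) : Y.incl N' (subMap f h x) = f (X.incl N x) := rfl

theorem isHom_subMap {f : X →ₗ[A] Y} (hf : IsHom f) {N : Submodule A X} {N' : Submodule A Y}
    (hN : X.IsStable N) (hN' : Y.IsStable N') (h : ∀ x ∈ N, f x ∈ N') : IsHom (subMap f h) :=
  IsHom.of_comp_injective (isHom_incl hN') (Y.incl_injective N') (hf.comp (isHom_incl hN))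

theorem subMap_injective {f : X →ₗ[A] Y} (hf : Function.Injective f) {N : Submodule A X}
    {N' : Submodule A Y} (h : ∀ x ∈ N, f x ∈ N') : Function.Injective (subMap f h) := fun x y hxy =>
  X.incl_injective N (hf (by rw [← incl_subMap f h, ← incl_subMap f h, hxy]))

theorem exists_incl_eq {N : Submodule A X} {x : X} (hx : x ∈ N) : ∃ y, X.incl N y = x :=
  ⟨mkSub x hx, incl_mkSub x hx⟩

end PhiModule

variable {p : ℕ} [hp : Fact p.Prime] {k : Type u} [Field k] [CharP k p] [PerfectRing k p]
variable {E : (WittVector p k)[X]}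

/-- The height `deg N - γ rank N` of a subobject above the line of slope `γ`. -/
def dev (γ : ℚ) {M : PhiMod.{u, v} E} (N : Submodule (Sring p k) M) : ℚ :=
  torsionDeg (M.sub N) - γ * torsionRank (M.sub N)

section

variable {X' X X'' : PhiMod.{u, v} E}

/-- Rank and degree of a subobject of an extension. -/
theorem torsion_sub_exact (hE : IsEis E) {α : X' →ₗ[Sring p k] X} {β : X →ₗ[Sring p k] X''}
    (hα : IsHom α) (hβ : IsHom β) (hi : Function.Injective α) (hex : Function.Exact α β)
    (hX' : (torsionData E).IsObj X') (hX : (torsionData E).IsObj X)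
    (hX'' : (torsionData E).IsObj X'') {P : Submodule (Sring p k) X} (hP : X.IsEtaleSub P) :
    torsionRank (X.sub P) = torsionRank (X'.sub (P.comap α)) + torsionRank (X''.sub (P.map β)) ∧
    torsionDeg (X.sub P) = torsionDeg (X'.sub (P.comap α)) + torsionDeg (X''.sub (P.map β)) := by
  have h1 := hα.isEtaleSub_comap hX'.2.1 hX.2.1 hP
  have h2 := hβ.isEtaleSub_map hP
  have o1 := torsion_isObj_sub hX' h1
  have o2 := torsion_isObj_sub hX hP
  have o3 := torsion_isObj_sub hX'' h2
  let f := subMap (X := X') (Y := X) α (N := P.comap α) (N' := P) fun x hx => hx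
  let g := subMap (X := X) (Y := X'') β (N := P) (N' := P.map β) fun x hx => ⟨x, hx, rfl⟩
  have hfi : ∀ x, X.incl P (f x) = α (X'.incl _ x) := fun _ => rfl
  have hgi : ∀ x, X''.incl _ (g x) = β (X.incl P x) := fun _ => rfl
  have hf : Function.Injective f := subMap_injective hi _
  have hg : Function.Surjective g := by
    intro y
    obtain ⟨x, hx, hxy⟩ := incl_mem y
    exact ⟨mkSub x hx, X''.incl_injective _ (by rw [hgi, incl_mkSub, hxy])⟩
  have hfg : Function.Exact f g := by
    intro y
    constructor
    · intro hy
      have h3 := congrArg (X''.incl (P.map β)) hy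
      rw [hgi, map_zero] at h3
      obtain ⟨x, hx⟩ := (hex _).mp h3
      have hx' : x ∈ P.comap α := by
        rw [Submodule.mem_comap, hx]
        exact incl_mem y
      exact ⟨mkSub x hx', X.incl_injective P (by rw [hfi, incl_mkSub, hx])⟩
    · rintro ⟨x, rfl⟩
      exact X''.incl_injective _ (by rw [hgi, hfi, hex.apply_apply_eq_zero, map_zero])
  exact ⟨torsionRank_exact hf hg hfg o2 o3, torsionDeg_exact hE (isHom_subMap hα h1.1 hP.1 _)
    (isHom_subMap hβ hP.1 h2.1 _) hf hg hfg o1 o2 o3⟩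

theorem dev_le_satX (hE : IsEis E) (hX : (torsionData E).IsObj X) {S : Submodule (Sring p k) X}
    (hS : X.IsEtaleSub S) (γ : ℚ) : dev γ S ≤ dev γ (satX S) := by
  rw [dev, dev, torsionRank_satX hX]
  exact sub_le_sub_right (torsionDeg_le_satX hE hX hS) _

theorem satX_eq_of_dev (hE : IsEis E) (hX : (torsionData E).IsObj X) {S : Submodule (Sring p k) X}
    (hS : X.IsEtaleSub S) (γ : ℚ) (h : dev γ (satX S) ≤ dev γ S) : satX S = S := by
  rw [dev, dev, torsionRank_satX hX, sub_le_sub_iff_right] at h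
  exact satX_eq_of_torsionDeg_eq hE hX hS h

end

section

variable {M : PhiMod.{u, v} E}

theorem dev_modPow_add (hE : IsEis E) (hM : IsKisin M) (a b : ℕ) (γ : ℚ)
    {P : Submodule (Sring p k) (M.modPow p (a + b))} (hP : (M.modPow p (a + b)).IsEtaleSub P) :
    dev γ P = dev γ (P.comap (mulMap M a b)) + dev γ (P.map (redMap M a b)) := by
  obtain ⟨h1, h2⟩ := torsion_sub_exact hE (isHom_mulMap a b) (isHom_redMap a b)
    (hM.mulMap_injective a b) (exact_mulMap_redMap a b) (hM.modPow_isObj _) (hM.modPow_isObj _)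
    (hM.modPow_isObj _) hP
  rw [dev, dev, dev, h1, h2]
  push_cast
  ring

theorem isStrictSub_comap_mulMap (hM : IsKisin M) (a b : ℕ)
    {P : Submodule (Sring p k) (M.modPow p (a + b))}
    (hP : (torsionData E).IsStrictSub (M.modPow p (a + b)) P) :
    (torsionData E).IsStrictSub (M.modPow p a) (P.comap (mulMap M a b)) := by
  rw [torsion_isStrictSub_iff (hM.modPow_isObj _)] at hP ⊢
  exact ⟨(isHom_mulMap a b).isEtaleSub_comap (modPow_isEtale hM.2.2 _) (modPow_isEtale hM.2.2 _) hP.1,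
    fun x hx => hP.2 _ (by rwa [Submodule.mem_comap, map_smul] at hx)⟩

/-- The heights of the subobjects of `M / p ^ n M` are bounded by `n` times those of the subobjects
of `M / p M`. -/
theorem dev_modPow_le (hE : IsEis E) (hM : IsKisin M) {γ B : ℚ}
    (h : ∀ P, (torsionData E).IsStrictSub (M.modPow p 1) P → dev γ P ≤ B) (n : ℕ) :
    ∀ P, (torsionData E).IsStrictSub (M.modPow p n) P → dev γ P ≤ n * B := by
  induction n with
  | zero =>
    intro P hP
    have h1 : torsionRank (M.modPow p 0) = 0 := by rw [hM.torsionRank_modPow, zero_mul]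
    have hgood := torsionData_isGood.{u, v} hE
    have hobj := hM.modPow_isObj 0
    have := torsion_subsingleton hobj h1
    have h2 : P = ⊥ := Subsingleton.elim _ _
    rw [h2, dev]
    have r1 := hgood.rank_bot hobj
    have d1 := hgood.deg_bot hobj
    change torsionRank _ = 0 at r1
    change torsionDeg _ = 0 at d1
    rw [r1, d1]
    simp
  | succ n ih =>
    intro P hP
    have hP' := (torsion_isStrictSub_iff (hM.modPow_isObj _)).mp hP
    have himg := (isHom_redMap n 1).isEtaleSub_map hP'.1
    rw [dev_modPow_add hE hM n 1 γ hP'.1]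
    have h1 := ih _ (isStrictSub_comap_mulMap hM n 1 hP)
    have h2 := (dev_le_satX hE (hM.modPow_isObj _) himg γ).trans
      (h _ (isStrictSub_satX hE (hM.modPow_isObj _) himg))
    push_cast
    linarith

/-- A subobject of maximal height has maximal height in each step of an extension. -/
theorem dev_modPow_eq (hE : IsEis E) (hM : IsKisin M) {γ B : ℚ}
    (h : ∀ P, (torsionData E).IsStrictSub (M.modPow p 1) P → dev γ P ≤ B) (a b : ℕ)
    {P : Submodule (Sring p k) (M.modPow p (a + b))}
    (hP : (torsionData E).IsStrictSub (M.modPow p (a + b)) P) (hdev : ((a + b : ℕ) : ℚ) * B ≤ dev γ P) :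
    a * B ≤ dev γ (P.comap (mulMap M a b)) ∧
    (torsionData E).IsStrictSub (M.modPow p b) (P.map (redMap M a b)) ∧
    b * B ≤ dev γ (P.map (redMap M a b)) := by
  have hP' := (torsion_isStrictSub_iff (hM.modPow_isObj _)).mp hP
  have himg := (isHom_redMap a b).isEtaleSub_map hP'.1
  rw [dev_modPow_add hE hM a b γ hP'.1] at hdev
  have h1 := dev_modPow_le hE hM h a _ (isStrictSub_comap_mulMap hM a b hP)
  have h2 := dev_le_satX hE (hM.modPow_isObj _) himg γ
  have h3 := dev_modPow_le hE hM h b _ (isStrictSub_satX hE (hM.modPow_isObj _) himg)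
  push_cast at hdev
  have h4 := satX_eq_of_dev hE (hM.modPow_isObj _) himg γ (by linarith)
  refine ⟨by linarith, ?_, by linarith⟩
  rw [← h4]
  exact isStrictSub_satX hE (hM.modPow_isObj _) himg

/-- A saturated étale submodule of a Kisin module is a Kisin module. -/
theorem IsKisin.sub (hM : IsKisin M) {N : Submodule (Sring p k) M} (hN : M.IsEtaleSub N)
    (hs : ∀ x, (p : Sring p k) • x ∈ N → x ∈ N) : IsKisin (M.sub N) := by
  have := hM.1
  have hfin : Module.Finite (Sring p k) (M.sub N) := inferInstanceAs (Module.Finite (Sring p k) N)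
  refine ⟨hfin, free_of_regular maximalIdeal_S (fun y hy => ?_) (fun y z hyz => ?_), hN.sub_isEtale hM.2.2⟩
  · exact M.incl_injective N (by rw [map_zero, hM.p_smul (M.incl N y) (by rw [← map_smul, hy, map_zero])])
  · have h1 := congrArg (M.incl N) hyz
    rw [map_smul, map_smul, ← pow_one (p : Sring p k)] at h1
    obtain ⟨t, ht⟩ := hM.exists_eq_pow_smul h1
    rw [pow_one] at ht
    obtain ⟨t', rfl⟩ := exists_incl_eq (hs t (by rw [ht]; exact incl_mem y))
    exact ⟨t', M.incl_injective N (by rw [map_smul, ht])⟩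

theorem p_pow_smul_mem {V : Type w} [AddCommGroup V] [Module (Sring p k) V] {N : Submodule (Sring p k) V}
    (hs : ∀ x, (p : Sring p k) • x ∈ N → x ∈ N) (n : ℕ) {x : V} (hx : (p : Sring p k) ^ n • x ∈ N) : x ∈ N := by
  induction n with
  | zero => rwa [pow_zero, one_smul] at hx
  | succ n ih => exact ih (hs _ (by rwa [smul_smul, ← pow_succ']))

/-- Reduction modulo `p ^ n` commutes with the passage to a subquotient `N' / N` with `N'`
saturated. -/
theorem iso_gr_modPow {N N' : Submodule (Sring p k) M} (hN : M.IsStable N)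
    (hN' : M.IsStable N') (hle : N ≤ N') (hs : ∀ x, (p : Sring p k) • x ∈ N' → x ∈ N') (n : ℕ) :
    Iso ((M.gr N N').modPow p n)
      ((M.modPow p n).gr (N.map (M.reduce p n)) (N'.map (M.reduce p n))) := by
  have hr := isHom_reduce M n
  let q := Subquot.ofSurjective hr (reduce_surjective n)
  have q1 := q.gr (hr.isStable_map hN) (hr.isStable_map hN') (Submodule.map_mono hle)
  let q0 := Subquot.ofGr hN hN' hle
  have q2 := q0.trans (Subquot.ofSurjective (isHom_reduce (M.gr N N') n) (reduce_surjective n))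
  have hm : ∀ (L : Submodule (Sring p k) M) (x : M),
      x ∈ q.lift (L.map (M.reduce p n)) ↔ ∃ z, x - (p : Sring p k) ^ n • z ∈ L := fun L x => by
    rw [← mem_map_reduce, Subquot.mem_lift]
    exact ⟨fun ⟨y, hy, hyP⟩ => hy ▸ hyP, fun hx => ⟨mkSub x trivial, rfl, hx⟩⟩
  have hm0 : ∀ (x : M), x ∈ q0.lift (LinearMap.ker ((M.gr N N').reduce p n)) ↔
      x ∈ N' ∧ ∃ z ∈ N', x - (p : Sring p k) ^ n • z ∈ N := by
    intro x
    rw [Subquot.mem_lift]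
    constructor
    · rintro ⟨y, rfl, hy⟩
      obtain ⟨z, hz⟩ := reduce_eq_zero.mp hy
      obtain ⟨z, rfl⟩ := q0.surj z
      rw [← map_smul, eq_comm, ← sub_eq_zero, ← map_sub, q0.ker, map_sub, map_smul] at hz
      exact ⟨incl_mem y, _, incl_mem z, hz⟩
    · rintro ⟨hx, z, hz, hxz⟩
      refine ⟨mkSub x hx, incl_mkSub x hx, reduce_eq_zero.mpr ⟨q0.π (mkSub z hz), ?_⟩⟩
      rw [← map_smul, eq_comm, ← sub_eq_zero, ← map_sub, q0.ker, map_sub, map_smul, incl_mkSub, incl_mkSub]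
      exact hxz
  -- Both sides are subquotients of `M`; compare the submodules of `M` which present them.
  refine q2.iso_of_le q1 ?_ ?_ ?_ ?_
  · intro x hx
    obtain ⟨-, z, -, hz⟩ := (hm0 x).mp hx
    exact (hm N x).mpr ⟨z, hz⟩
  · rw [q0.lift_top]
    intro x hx
    exact (hm N' x).mpr ⟨0, by rwa [smul_zero, sub_zero]⟩
  · rw [q0.lift_top]
    rintro x ⟨hx, hx'⟩
    obtain ⟨z, hz⟩ := (hm N x).mp hx'
    refine (hm0 x).mpr ⟨hx, z, p_pow_smul_mem hs n ?_, hz⟩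
    have h1 := N'.sub_mem hx (hle hz)
    rwa [sub_sub_cancel] at h1
  · rw [q0.lift_top]
    intro x hx
    obtain ⟨z, hz⟩ := (hm N' x).mp hx
    rw [← sub_add_cancel x ((p : Sring p k) ^ n • z)]
    refine Submodule.add_mem_sup hz ((hm N _).mpr ⟨z, ?_⟩)
    rw [sub_self]
    exact zero_mem _

end

end

end Kisin

end

noncomputable section

namespace Kisin

/-! ### Semistable Kisin modules -/

section

open PhiModule

variable {p : ℕ} [hp : Fact p.Prime] {k : Type u} [Field k] [CharP k p] [PerfectRing k p]
variable {E : (WittVector p k)[X]}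

theorem iso_sub_modPow {M : PhiMod.{u, v} E} {N : Submodule (Sring p k) M} (hN : M.IsStable N)
    (hs : ∀ x, (p : Sring p k) • x ∈ N → x ∈ N) (n : ℕ) :
    Iso ((M.sub N).modPow p n) ((M.modPow p n).sub (N.map (M.reduce p n))) := by
  have hr := isHom_reduce M n
  let f := subMap (X := M) (Y := M.modPow p n) (M.reduce p n) (N := N)
    (N' := N.map (M.reduce p n)) fun x hx => ⟨x, hx, rfl⟩
  have hfi : ∀ x, (M.modPow p n).incl _ (f x) = M.reduce p n (M.incl N x) := fun _ => rfl
  have hf : IsHom f := isHom_subMap hr hN (hr.isStable_map hN) _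
  have hfs : Function.Surjective f := fun y => by
    obtain ⟨x, hx, hxy⟩ := incl_mem y
    exact ⟨mkSub x hx, (M.modPow p n).incl_injective _ (by rw [hfi, incl_mkSub, hxy])⟩
  have hk : LinearMap.ker ((M.sub N).reduce p n) = LinearMap.ker f := by
    ext x
    rw [LinearMap.mem_ker, LinearMap.mem_ker, reduce_eq_zero,
      ← map_eq_zero_iff _ ((M.modPow p n).incl_injective _), hfi, reduce_eq_zero]
    constructor
    · rintro ⟨z, rfl⟩
      exact ⟨M.incl N z, by rw [map_smul]⟩
    · rintro ⟨z, hz⟩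
      have hz' : z ∈ N := p_pow_smul_mem hs n (by rw [hz]; exact incl_mem x)
      exact ⟨mkSub z hz', M.incl_injective N (by rw [map_smul, incl_mkSub, hz])⟩
  exact (Subquot.ofSurjective (isHom_reduce (M.sub N) n) (reduce_surjective n)).iso_of_le
    (Subquot.ofSurjective hf hfs) hk.le le_rfl (inf_le_right.trans hk.ge) le_sup_left

section

variable {K : PhiMod.{u, v} E}

theorem IsSemistable.rank_ne_zero (hE : IsEis E) (hK : IsSemistable K) : rank K ≠ 0 := by
  have h1 := hK.2.2.1
  rw [(torsionData_isGood hE).null_iff hK.2.1] at h1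
  change torsionRank _ ≠ 0 at h1
  rwa [hK.1.torsionRank_modPow_one] at h1

theorem IsSemistable.dev_le (hE : IsEis E) (hK : IsSemistable K)
    {P : Submodule (Sring p k) (K.modPow p 1)}
    (hP : (torsionData E).IsStrictSub (K.modPow p 1) P) : dev (slope K) P ≤ 0 := by
  have hD := torsionData_isGood.{u, v} hE
  have h1 := hD.slope_mul_rank hP.2.1
  change _ * (torsionRank _ : ℚ) = torsionDeg _ at h1
  rw [dev, ← h1, ← sub_mul]
  by_cases h0 : (torsionData E).IsNull ((K.modPow p 1).sub P)
  · rw [hD.null_iff hP.2.1] at h0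
    change torsionRank _ = 0 at h0
    rw [h0, Nat.cast_zero, mul_zero]
  · have h2 := hK.2.2.2 P hP h0
    rw [hK.1.slope_modPow hE le_rfl] at h2
    exact mul_nonpos_of_nonpos_of_nonneg (sub_nonpos.mpr h2) (Nat.cast_nonneg _)

theorem IsSemistable.modPow (hE : IsEis E) (hK : IsSemistable K) {n : ℕ} (hn : 1 ≤ n) :
    (torsionData E).IsSemistable (K.modPow p n) := by
  have hD := torsionData_isGood.{u, v} hE
  have ho := hK.1.modPow_isObj n
  refine ⟨ho, ?_, fun P hP h0 => ?_⟩
  · rw [hD.null_iff ho]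
    change torsionRank _ ≠ 0
    rw [hK.1.torsionRank_modPow]
    exact mul_ne_zero (by omega) (hK.rank_ne_zero hE)
  · have h1 := dev_modPow_le hE hK.1 (γ := slope K) (B := 0) (fun P hP => hK.dev_le hE hP) n P hP
    rw [hK.1.slope_modPow hE hn]
    have h2 : 0 < (torsionRank ((K.modPow p n).sub P) : ℚ) := by
      rw [hD.null_iff hP.2.1] at h0
      exact_mod_cast Nat.pos_of_ne_zero h0
    rw [SlopeData.slope]
    change torsionDeg _ / (torsionRank _ : ℚ) ≤ _
    rw [div_le_iff₀ h2]
    rw [dev] at h1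
    linarith

end

theorem rank_eq_of_injective {X : PhiMod.{u, v₁} E} {X' : PhiMod.{u, v₂} E}
    {f : X →ₗ[Sring p k] X'} (hi : Function.Injective f) (hfg : IsAlmostFG p k X')
    (hc : ∀ y : X', ∃ n : ℕ, (p : Sring p k) ^ n • y ∈ LinearMap.range f) :
    rank X = rank X' := by
  have h1 := finrank_exact (LinearMap.range f).injective_subtype (LinearMap.range f).mkQ_surjective
    (LinearMap.exact_subtype_mkQ _) hfg
  have h2 : Module.finrank (Sring p k) (X' ⧸ LinearMap.range f) = 0 := by
    refine Module.finrank_eq_zero_of_rank_eq_zero (rank_eq_zero_iff.mpr fun y => ?_)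
    obtain ⟨y, rfl⟩ := (LinearMap.range f).mkQ_surjective y
    obtain ⟨n, hn⟩ := hc y
    exact ⟨_, pow_ne_zero n p_ne_zero, by
      rw [← map_smul]; exact (Submodule.Quotient.mk_eq_zero _).mpr hn⟩
  rw [h2, add_zero] at h1
  exact (LinearEquiv.ofInjective f hi).finrank_eq.trans h1.symm

/-- The degrees of the subobjects of a module isogenous to a semistable Kisin module: such a
subobject is isogenous to a saturated submodule `Q` of the Kisin module, whose slope is that of the
subobject `Q / p Q` of its reduction. -/
theorem IsSemistable.deg_sub_le (hE : IsEis E) {K : PhiMod.{u, v₁} E} (hK : IsSemistable K)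
    {X : PhiMod.{u, v₂} E} {f : K →ₗ[Sring p k] X} (hf : IsHom f) (hi : Function.Injective f)
    (hX : X.IsEtale) (hfg : IsAlmostFG p k X)
    (hc : ∀ y : X, ∃ n : ℕ, (p : Sring p k) ^ n • y ∈ LinearMap.range f)
    {P : Submodule (Sring p k) X} (hP : X.IsEtaleSub P) :
    deg (X.sub P) ≤ slope K * rank (X.sub P) := by
  have := hK.1.1
  let S := P.comap f
  have hS : K.IsEtaleSub S := hf.isEtaleSub_comap hK.1.2.2 hX hP
  -- The saturation of `S` is the union of the submodules `{x | p ^ n x ∈ S}`, a stationary sequence.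
  let F : ℕ →o Submodule (Sring p k) K :=
    ⟨fun n => S.comap ((p : Sring p k) ^ n • LinearMap.id), monotone_nat_of_le_succ fun n x hx => by
      change (p : Sring p k) ^ (n + 1) • x ∈ S
      rw [pow_succ', mul_smul]
      exact S.smul_mem _ hx⟩
  obtain ⟨n, hn⟩ := monotone_stabilizes_iff_noetherian.mpr inferInstance F
  have hQ : K.IsEtaleSub (F n) := (isHom_pow_smul K n).isEtaleSub_comap hK.1.2.2 hK.1.2.2 hS
  have hQs : ∀ x, (p : Sring p k) • x ∈ F n → x ∈ F n := fun x hx => by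
    rw [hn (n + 1) n.le_succ]
    change (p : Sring p k) ^ (n + 1) • x ∈ S
    rw [pow_succ, mul_smul]
    exact hx
  have hQk := hK.1.sub hQ hQs
  have hR := (isHom_reduce K 1).isEtaleSub_map hQ
  have h1 := (dev_le_satX hE (hK.1.modPow_isObj 1) hR (slope K)).trans
    (hK.dev_le hE (isStrictSub_satX hE (hK.1.modPow_isObj 1) hR))
  have hiso := iso_sub_modPow hQ.1 hQs 1
  rw [dev, ← torsionRank_iso hiso, ← torsionDeg_iso hiso, hQk.torsionRank_modPow_one,
    hQk.torsionDeg_modPow_one hE] at h1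
  -- Multiplication by `p ^ n` followed by `f` is an isogeny from the saturation to `P`.
  let g := subMap (X := K) (Y := X) (f ∘ₗ ((p : Sring p k) ^ n • LinearMap.id)) (N := F n) (N' := P)
    fun x hx => hx
  have hgi : ∀ x, X.incl P (g x) = f ((p : Sring p k) ^ n • K.incl (F n) x) := fun _ => rfl
  have hg : IsHom g := isHom_subMap (hf.comp (isHom_pow_smul K n)) hQ.1 hP.1 _
  have hgi' : Function.Injective g := fun x y hxy => by
    have h2 := congrArg (X.incl P) hxy
    rw [hgi, hgi] at h2
    exact K.incl_injective _ (hK.1.p_pow_smul (hi h2))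
  have hgc : ∀ y : X.sub P, ∃ n : ℕ, (p : Sring p k) ^ n • y ∈ LinearMap.range g := fun y => by
    obtain ⟨m, x, hx⟩ := hc (X.incl P y)
    have hxS : x ∈ S := by
      change f x ∈ P
      rw [hx]
      exact P.smul_mem _ (incl_mem y)
    have hxQ : x ∈ F n := S.smul_mem _ hxS
    refine ⟨n + m, mkSub x hxQ, X.incl_injective P ?_⟩
    rw [hgi, incl_mkSub, map_smul, hx, map_smul, smul_smul, pow_add]
  have hfin : Module.Finite (Sring p k) (K.sub (F n)) :=
    inferInstanceAs (Module.Finite (Sring p k) (F n))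
  rw [← deg_eq_of_injective hE hg hgi' (hP.sub_isEtale hX) (IsAlmostFG.of_finite _) hgc,
    ← rank_eq_of_injective hgi' (hfg.of_injective (X.incl_injective P)) hgc]
  linarith

theorem slope_le_of_deg_le {d c : ℚ} {n : ℕ} (hn : n ≠ 0) (h : d ≤ c * n) : d / n ≤ c := by
  rwa [div_le_iff₀ (by exact_mod_cast Nat.pos_of_ne_zero hn)]

theorem IsSemistable.isogeny (hE : IsEis E) {K : PhiMod.{u, v} E} (hK : IsSemistable K) :
    (isogenyData E).IsSemistable K := by
  have hfin := hK.1.1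
  have hD := isogenyData_isGood.{u, v} hE
  have ho : (isogenyData E).IsObj K := ⟨hK.1.1, hK.1.2.2⟩
  refine ⟨ho, (hD.null_iff ho).not.mpr (hK.rank_ne_zero hE), fun P hP h0 => ?_⟩
  exact slope_le_of_deg_le ((hD.null_iff hP.2.1).not.mp h0) (hK.deg_sub_le hE isHom_id
    Function.injective_id ho.2 (IsAlmostFG.of_finite _) (fun y => ⟨0, y, by simp⟩)
    ((isogeny_isStrictSub_iff ho).mp hP))

/-- A rational module is semistable when it contains a semistable Kisin module as a lattice. -/
theorem IsSemistable.rational (hE : IsEis E) {K : PhiMod.{u, v₁} E} (hK : IsSemistable K)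
    {X : PhiMod.{u, v₂} E} {f : K →ₗ[Sring p k] X} (hf : IsHom f) (hi : Function.Injective f)
    (hX : (rationalData E).IsObj X)
    (hc : ∀ y : X, ∃ n : ℕ, (p : Sring p k) ^ n • y ∈ LinearMap.range f) :
    (rationalData E).IsSemistable X ∧ (rationalData E).slope X = slope K := by
  have hfin := hK.1.1
  have hD := rationalData_isGood.{u, v₂} hE
  have hr := rank_eq_of_injective hi hX.2.1 hc
  have hsl : (rationalData E).slope X = slope K := by
    change deg X / (rank X : ℚ) = _
    rw [← deg_eq_of_injective hE hf hi hX.2.2 (IsAlmostFG.of_finite _) hc, ← hr, slope]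
  refine ⟨⟨hX, (hD.null_iff hX).not.mpr ?_, fun P hP h0 => ?_⟩, hsl⟩
  · change rank X ≠ 0
    rw [← hr]
    exact hK.rank_ne_zero hE
  · rw [hsl]
    exact slope_le_of_deg_le ((hD.null_iff hP.2.1).not.mp h0) (hK.deg_sub_le hE hf hi hX.2.2 hX.2.1 hc
      ((rational_isStrictSub_iff hX).mp hP).1)

end

end Kisin

end

noncomputable section

namespace Kisin

/-! ### Consequences of the existence of a flag -/

section

open PhiModule

variable {p : ℕ} [hp : Fact p.Prime] {k : Type u} [Field k] [CharP k p] [PerfectRing k p]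
variable {E : (WittVector p k)[X]}

namespace IsHNFlag

variable {M : PhiMod.{u, v} E} {r : ℕ} {N : ℕ → Submodule (Sring p k) M}

theorem isEtaleSub (hM : IsKisin M) (h : IsHNFlag M r N) {i : ℕ} (hi : i ≤ r) :
    M.IsEtaleSub (N i) :=
  ((h.kisin i hi).1.sub_isEtale_iff hM.2.2).mp (h.kisin i hi).2.2.2

theorem gr_kisin (h : IsHNFlag M r N) {i : ℕ} (hi : i < r) : IsKisin (M.gr (N i) (N (i + 1))) :=
  (h.semistable i hi).1

/-- The members of the flag are saturated, also modulo the powers of `p`. -/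
theorem saturated (h : IsHNFlag M r N) {i : ℕ} (hi : i ≤ r) :
    (∀ x, (p : Sring p k) • x ∈ N i → x ∈ N i) ∧
    ∀ n x, (∃ z, (PowerSeries.X : Sring p k) • x - (p : Sring p k) ^ n • z ∈ N i) →
      ∃ z, x - (p : Sring p k) ^ n • z ∈ N i := by
  -- Descend along the flag, from `M` itself: the quotients `N (i + 1) / N i` are free, so that `p`, and
  -- `u` modulo `p ^ n`, act injectively.
  induction hi using Nat.decreasingInduction with
  | self =>
    rw [h.last]
    exact ⟨fun _ _ => trivial, fun _ _ _ => ⟨0, trivial⟩⟩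
  | of_succ i hi ih =>
    obtain ⟨ih1, ih2⟩ := ih
    have hle := h.le_succ i hi
    let q := Subquot.ofGr (h.kisin i hi.le).1 (h.kisin (i + 1) hi).1 hle
    have hK := h.gr_kisin hi
    refine ⟨fun x hx => ?_, fun n x => ?_⟩
    · have hx' := ih1 x (hle hx)
      have h1 : q.π (mkSub x hx') = 0 := hK.p_smul _ (by
        rw [← map_smul, q.ker, map_smul, incl_mkSub]
        exact hx)
      rwa [q.ker, incl_mkSub] at h1
    · rintro ⟨z, hz⟩
      obtain ⟨z', hy⟩ := ih2 n x ⟨z, hle hz⟩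
      set y := x - (p : Sring p k) ^ n • z' with hy0
      set w := z - (PowerSeries.X : Sring p k) • z' with hw0
      have h1 : (PowerSeries.X : Sring p k) • y - (p : Sring p k) ^ n • w ∈ N i := by
        convert hz using 1
        rw [hy0, hw0, smul_sub, smul_sub, smul_comm (PowerSeries.X : Sring p k)]
        abel
      have hw : w ∈ N (i + 1) := p_pow_smul_mem ih1 n (by
        have h2 := (N (i + 1)).sub_mem ((N (i + 1)).smul_mem PowerSeries.X hy) (hle h1)
        rwa [sub_sub_cancel] at h2)
      have h3 : (PowerSeries.X : Sring p k) • q.π (mkSub y hy) =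
          (p : Sring p k) ^ n • q.π (mkSub w hw) := by
        rw [← map_smul, ← map_smul, ← sub_eq_zero, ← map_sub, q.ker, map_sub, map_smul, map_smul,
          incl_mkSub, incl_mkSub]
        exact h1
      obtain ⟨t, ht⟩ := hK.exists_eq_pow_smul h3
      obtain ⟨t, rfl⟩ := q.surj t
      rw [← map_smul, eq_comm, ← sub_eq_zero, ← map_sub, q.ker, map_sub, map_smul, incl_mkSub] at ht
      refine ⟨z' + M.incl _ t, ?_⟩
      rwa [smul_add, ← sub_sub, ← hy0]

theorem iso_gr (h : IsHNFlag M r N) {i : ℕ} (hi : i < r) (n : ℕ) :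
    Iso ((M.gr (N i) (N (i + 1))).modPow p n)
      ((M.modPow p n).gr ((N i).map (M.reduce p n)) ((N (i + 1)).map (M.reduce p n))) :=
  iso_gr_modPow (h.kisin i hi.le).1 (h.kisin (i + 1) hi).1 (h.le_succ i hi) (h.saturated hi).1 n

theorem slope_gr_modPow (hE : IsEis E) (h : IsHNFlag M r N) {n : ℕ} (hn : 1 ≤ n) {i : ℕ}
    (hi : i < r) : (torsionData E).slope
      ((M.modPow p n).gr ((N i).map (M.reduce p n)) ((N (i + 1)).map (M.reduce p n))) =
        slope (M.gr (N i) (N (i + 1))) := by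
  rw [← (torsionData_isGood hE).iso_slope (h.iso_gr hi n), (h.gr_kisin hi).slope_modPow hE hn]

/-- The reduction of the flag modulo `p ^ n` is a Harder-Narasimhan flag. -/
theorem modPow (hE : IsEis E) (hM : IsKisin M) (h : IsHNFlag M r N) {n : ℕ} (hn : 1 ≤ n) :
    (torsionData E).IsHNFlag (M.modPow p n) r (fun i => (N i).map (M.reduce p n)) where
  zero := by rw [h.zero, Submodule.map_bot]
  last := by rw [h.last, Submodule.map_top, LinearMap.range_eq_top.mpr (reduce_surjective n)]
  le_succ i hi := Submodule.map_mono (h.le_succ i hi)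
  strict i hi := by
    refine (torsion_isStrictSub_iff (hM.modPow_isObj n)).mpr
      ⟨(isHom_reduce M n).isEtaleSub_map (h.isEtaleSub hM hi), fun x hx => ?_⟩
    obtain ⟨x, rfl⟩ := reduce_surjective n x
    rw [← map_smul] at hx
    exact mem_map_reduce.mpr ((h.saturated hi).2 n x (mem_map_reduce.mp hx))
  semistable i hi := (torsionData_isGood hE).iso_isSemistable (h.iso_gr hi n)
    ((h.semistable i hi).modPow hE hn)
  slope_lt i j hij hj := by
    rw [h.slope_gr_modPow hE hn hj, h.slope_gr_modPow hE hn (hij.trans hj)]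
    exact h.slope_lt i j hij hj

theorem mem_of_forall (hM : IsKisin M) {N : Submodule (Sring p k) M} {x : M}
    (h : ∀ n : ℕ, 1 ≤ n → M.reduce p n x ∈ N.map (M.reduce p n)) : x ∈ N := by
  have := hM.1
  refine mem_of_forall_mem_pow not_isUnit_p fun n => ?_
  rcases Nat.eq_zero_or_pos n with rfl | hn
  · exact ⟨x, by simp⟩
  · exact mem_map_reduce.mp (h n hn)

theorem unique (hE : IsEis E) (hM : IsKisin M) (h : IsHNFlag M r N) {r' : ℕ}
    {N' : ℕ → Submodule (Sring p k) M} (h' : IsHNFlag M r' N') :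
    r' = r ∧ ∀ i ≤ r, N' i = N i := by
  have hu : ∀ n : ℕ, 1 ≤ n → _ := fun n hn => SlopeData.IsHNFlag.unique (torsionData_isGood hE)
    torsionData_isReduced (h.modPow hE hM hn) (h'.modPow hE hM hn)
  refine ⟨(hu 1 le_rfl).1, fun i hi => le_antisymm (fun x hx => ?_) fun x hx => ?_⟩
  · refine mem_of_forall hM fun n hn => ?_
    rw [← (hu n hn).2 i hi]
    exact ⟨x, hx, rfl⟩
  · refine mem_of_forall hM fun n hn => ?_
    rw [(hu n hn).2 i hi]
    exact ⟨x, hx, rfl⟩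

theorem hnFil_modPow (hE : IsEis E) (hM : IsKisin M) (h : IsHNFlag M r N) {n : ℕ} (hn : 1 ≤ n)
    {i : ℕ} (hi : i < r) :
    (torsionData E).hnFil (M.modPow p n) (slope (M.gr (N i) (N (i + 1)))) =
      (N (i + 1)).map (M.reduce p n) := by
  have hD := torsionData_isGood.{u, v} hE
  have h1 := h.modPow hE hM hn
  rw [← h.slope_gr_modPow hE hn hi]
  exact h1.hnFil_slope hD hi fun P hP hr =>
    torsionData_isReduced.le_of_rank_inf hD (hM.modPow_isObj n) (h1.strict (i + 1) hi) hP hr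

theorem eq_iInf_hnFil (hE : IsEis E) (hM : IsKisin M) (h : IsHNFlag M r N) {i : ℕ} (hi : i < r) :
    N (i + 1) = ⨅ n : ℕ+, Submodule.comap (M.reduce p n)
      ((torsionData E).hnFil (M.modPow p n) (slope (M.gr (N i) (N (i + 1))))) := by
  apply le_antisymm
  · refine le_iInf fun n => ?_
    rw [h.hnFil_modPow (n := (n : ℕ)) hE hM n.2 hi]
    exact Submodule.le_comap_map _ _
  · intro x hx
    refine mem_of_forall hM fun n hn => ?_
    rw [← h.hnFil_modPow hE hM hn hi]
    exact (Submodule.mem_iInf _).mp hx ⟨n, hn⟩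

theorem tF_eq (hE : IsEis E) (hM : IsKisin M) (h : IsHNFlag M r N) {n : ℕ} (hn : 1 ≤ n) (x : ℝ) :
    tF M n x = polygon r (fun i => rank (M.gr (N i) (N (i + 1))))
      (fun i => slope (M.gr (N i) (N (i + 1)))) x := by
  rw [tF, (h.modPow hE hM hn).hnPolygon_eq (torsionData_isGood hE) torsionData_isReduced,
    ← polygon_scale (μ := fun i => slope (M.gr (N i) (N (i + 1)))) hn]
  congr 1
  refine polygon_congr (fun i hi => ?_) (fun i hi => h.slope_gr_modPow hE hn hi) _
  rw [← (h.gr_kisin hi).torsionRank_modPow]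
  exact (torsionRank_iso (h.iso_gr hi n)).symm

theorem tFInf_eq (hE : IsEis E) (hM : IsKisin M) (h : IsHNFlag M r N) (x : ℝ) :
    tFInf M x = polygon r (fun i => rank (M.gr (N i) (N (i + 1))))
      (fun i => slope (M.gr (N i) (N (i + 1)))) x := by
  rw [tFInf, iInf_congr fun n : ℕ+ => h.tF_eq (n := (n : ℕ)) hE hM n.2 x]
  exact ciInf_const

theorem isogeny (hE : IsEis E) (hM : IsKisin M) (h : IsHNFlag M r N) :
    (isogenyData E).IsHNFlag M r N where
  zero := h.zero
  last := h.last
  le_succ := h.le_succ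
  strict _ hi := (isogeny_isStrictSub_iff ⟨hM.1, hM.2.2⟩).mpr (h.isEtaleSub hM hi)
  semistable _ hi := (h.semistable _ hi).isogeny hE
  slope_lt := h.slope_lt

theorem hnFil_isogeny (hE : IsEis E) (hM : IsKisin M) (h : IsHNFlag M r N) {i : ℕ} (hi : i < r) :
    (isogenyData E).hnFil M (slope (M.gr (N i) (N (i + 1)))) = N (i + 1) := by
  have hfin := hM.1
  have hD := isogenyData_isGood.{u, v} hE
  have h1 := h.isogeny hE hM
  refine h1.hnFil_slope hD hi fun P hP hr => ?_
  have hN := h1.strict (i + 1) hi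
  have hPN := hD.inf ⟨hM.1, hM.2.2⟩ hP hN
  let q := Subquot.ofGr hPN.1 hP.1 inf_le_left
  have h2 := hD.rank_subquot q hPN hP
  have h3 : rank (M.gr (P ⊓ N (i + 1)) P) = 0 := by
    change rank _ = rank _ + rank _ at h2
    change rank _ = rank _ at hr
    omega
  have ho := hD.isObj_of_subquot q hPN hP
  have hfin' := ho.1
  rw [rank_eq_zero_iff_torsion hE ho.2 (IsAlmostFG.of_finite _)] at h3
  intro x hx
  obtain ⟨n, hn⟩ := h3 (q.π (mkSub x hx))
  rw [← map_smul, q.ker, map_smul, incl_mkSub] at hn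
  exact p_pow_smul_mem (h.saturated hi).1 n hn.2

end IsHNFlag

end

end Kisin

end

noncomputable section

namespace Kisin

/-! ### Inverting `p` -/

section

open PhiModule

variable {p : ℕ} [hp : Fact p.Prime] {k : Type u} [Field k] [CharP k p] [PerfectRing k p]
variable {E : (WittVector p k)[X]} {M : PhiMod.{u, v} E}

/-- The canonical map `M → M[1/p]`. -/
def toInvert (M : PhiMod.{u, v} E) : M →ₗ[Sring p k] M.invert p := toInv (p : Sring p k) M

theorem isHom_toInvert (M : PhiMod.{u, v} E) : IsHom (toInvert M) := fun x => by
  let g : M →ₗ[Sring p k] Twist (frobS p k) (Inv (E : Sring p k) (Inv (p : Sring p k) M)) :=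
    { toFun := fun m => Twist.equiv.symm (invMap (E : Sring p k) (toInv (p : Sring p k) M) (M.frob m))
      map_add' := fun m m' => by
        rw [map_add, map_add, map_add]
      map_smul' := fun a m => by
        rw [M.frob.map_smulₛₗ, map_smul]
        rfl }
  exact (congrArg Twist.equiv (LinearMap.congr_fun (LocalizedModule.lift_comp
    (Submonoid.powers (p : Sring p k)) g (isUnit_twist p M)) x)).symm

theorem IsKisin.toInvert_injective (hM : IsKisin M) : Function.Injective (toInvert M) := by
  rw [injective_iff_map_eq_zero]
  intro x hx
  obtain ⟨n, hn⟩ := toInv_eq_zero.mp hx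
  exact hM.p_pow_smul (n := n) (by rw [hn, smul_zero])

theorem exists_pow_smul_eq_toInvert (y : M.invert p) :
    ∃ (n : ℕ) (x : M), (p : Sring p k) ^ n • y = toInvert M x :=
  exists_pow_smul_eq_toInv y

/-- Multiplication by `p ^ n` on `M[1/p]`. -/
def powEquiv (M : PhiMod.{u, v} E) (n : ℕ) : M.invert p ≃ₗ[Sring p k] M.invert p :=
  LinearEquiv.ofBijective ((p : Sring p k) ^ n • LinearMap.id)
    ⟨fun _ _ h => pow_smul_inv_injective (a := (p : Sring p k)) (T := M) n h,
      fun y =>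
        let ⟨x, hx⟩ := pow_smul_inv_surjective (a := (p : Sring p k)) (T := M) n y
        ⟨x, hx⟩⟩

theorem powEquiv_apply (n : ℕ) (y : M.invert p) : powEquiv M n y = (p : Sring p k) ^ n • y := rfl

theorem isHom_powEquiv_symm (n : ℕ) : IsHom (powEquiv M n).symm.toLinearMap :=
  IsHom.symm (e := powEquiv M n) (isHom_pow_smul (M.invert p) n)

theorem mem_localized_powers {A : Type u} [CommRing A] {a : A} {T : Type v} [AddCommGroup T]
    [Module A T] {N : Submodule A T} {y : Inv a T} :
    y ∈ N.localized₀ (Submonoid.powers a) (toInv a T) ↔ ∃ n : ℕ, a ^ n • y ∈ N.map (toInv a T) := by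
  rw [Submodule.mem_localized₀]
  constructor
  · rintro ⟨m, hm, ⟨_, n, rfl⟩, h⟩
    exact ⟨n, m, hm, IsLocalizedModule.mk'_eq_iff.mp h⟩
  · rintro ⟨n, m, hm, h⟩
    exact ⟨m, hm, ⟨_, n, rfl⟩, IsLocalizedModule.mk'_eq_iff.mpr h⟩

theorem mem_invertSub {N : Submodule (Sring p k) M} {y : M.invert p} :
    y ∈ M.invertSub p N ↔ ∃ n : ℕ, (p : Sring p k) ^ n • y ∈ N.map (toInvert M) :=
  mem_localized_powers (a := (p : Sring p k)) (T := M)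

theorem toInvert_mem_invertSub {N : Submodule (Sring p k) M} {x : M} (hx : x ∈ N) :
    toInvert M x ∈ M.invertSub p N :=
  mem_invertSub.mpr ⟨0, x, hx, by rw [pow_zero, one_smul]⟩

theorem IsKisin.mem_of_toInvert_mem (hM : IsKisin M) {N : Submodule (Sring p k) M}
    (hs : ∀ x, (p : Sring p k) • x ∈ N → x ∈ N) {x : M} (hx : toInvert M x ∈ M.invertSub p N) :
    x ∈ N := by
  obtain ⟨n, z, hz, hzx⟩ := mem_invertSub.mp hx
  rw [← map_smul] at hzx
  exact p_pow_smul_mem hs n (hM.toInvert_injective hzx ▸ hz)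

theorem invertSub_saturated {N : Submodule (Sring p k) M} {y : M.invert p}
    (hy : (p : Sring p k) • y ∈ M.invertSub p N) : y ∈ M.invertSub p N := by
  obtain ⟨n, hn⟩ := mem_invertSub.mp hy
  exact mem_invertSub.mpr ⟨n + 1, by rwa [pow_succ, mul_smul]⟩

/-- `N[1/p]` is the union of the images of `N` under the morphisms `x ↦ p ^ (-n) x`. -/
theorem isEtaleSub_invertSub {N : Submodule (Sring p k) M} (hN : M.IsEtaleSub N) :
    (M.invert p).IsEtaleSub (M.invertSub p N) := by
  have key : ∀ y ∈ M.invertSub p N, ∃ P, (M.invert p).IsEtaleSub P ∧ y ∈ P ∧ P ≤ M.invertSub p N := by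
    intro y hy
    obtain ⟨n, x, hx, hxy⟩ := mem_invertSub.mp hy
    refine ⟨_, (isHom_powEquiv_symm n).isEtaleSub_map ((isHom_toInvert M).isEtaleSub_map hN),
      ⟨_, ⟨x, hx, rfl⟩, ?_⟩, ?_⟩
    · exact (LinearEquiv.symm_apply_eq _).mpr hxy
    · rintro _ ⟨_, ⟨z, hz, rfl⟩, rfl⟩
      refine mem_invertSub.mpr ⟨n, z, hz, ?_⟩
      exact ((powEquiv M n).apply_symm_apply _).symm
  refine ⟨fun y hy => ?_, fun y hy => ?_⟩
  · obtain ⟨P, hP, hyP, hle⟩ := key y hy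
    exact loc_mono hle (hP.1 y hyP)
  · obtain ⟨P, hP, hyP, hle⟩ := key y hy
    exact gen_mono hle (hP.2 y hyP)

theorem invertSub_mono {N N' : Submodule (Sring p k) M} (h : N ≤ N') :
    M.invertSub p N ≤ M.invertSub p N' := fun y hy => by
  obtain ⟨n, hn⟩ := mem_invertSub.mp hy
  exact mem_invertSub.mpr ⟨n, Submodule.map_mono h hn⟩

theorem invertSub_top : M.invertSub p ⊤ = ⊤ := by
  refine eq_top_iff.mpr fun y _ => ?_
  obtain ⟨n, x, hx⟩ := exists_pow_smul_eq_toInvert y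
  exact mem_invertSub.mpr ⟨n, x, trivial, hx.symm⟩

theorem invertSub_bot : M.invertSub p ⊥ = ⊥ := by
  refine eq_bot_iff.mpr fun y hy => ?_
  obtain ⟨n, hn⟩ := mem_invertSub.mp hy
  rw [Submodule.map_bot, Submodule.mem_bot] at hn
  exact pow_smul_inv_injective n (hn.trans (smul_zero _).symm)

theorem IsKisin.invert_isEtale (hM : IsKisin M) : (M.invert p).IsEtale := by
  refine ⟨?_, ?_⟩
  · rw [injective_iff_map_eq_zero]
    intro t ht
    -- A tensor over `M[1/p]` comes from one over `M` after multiplication by a power of `p`.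
    have key : ∃ (n : ℕ) (s : Twist (frobS p k) (Localization.Away (E : Sring p k)) ⊗[Sring p k] M),
        (p : Sring p k) ^ n • t = (toInvert M).lTensor _ s := by
      clear ht
      induction t using TensorProduct.induction_on with
      | zero => exact ⟨0, 0, by rw [map_zero, smul_zero]⟩
      | tmul c y =>
        obtain ⟨n, x, hx⟩ := exists_pow_smul_eq_toInvert y
        exact ⟨n, c ⊗ₜ x, by rw [← TensorProduct.tmul_smul, hx, LinearMap.lTensor_tmul]⟩
      | add t t' h h' =>
        obtain ⟨n, s, hs⟩ := h
        obtain ⟨n', s', hs'⟩ := h'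
        refine ⟨n + n', (p : Sring p k) ^ n' • s + (p : Sring p k) ^ n • s', ?_⟩
        rw [map_add, map_smul, map_smul, ← hs, ← hs', smul_smul, smul_smul, smul_add, pow_add,
          mul_comm]
    obtain ⟨n, s, hs⟩ := key
    have h1 : (M.invert p).linearization ((p : Sring p k) ^ n • t) = 0 := by
      rw [← Nat.cast_pow, Nat.cast_smul_eq_nsmul, map_nsmul, ht, nsmul_zero]
    rw [hs, ← (isHom_toInvert M).map_linearization,
      map_eq_zero_iff _ (invMap_injective hM.toInvert_injective),
      map_eq_zero_iff _ hM.2.2.1] at h1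
    rw [h1, map_zero] at hs
    refine (LinearEquiv.lTensor _ (powEquiv M n)).injective ?_
    rw [map_zero, ← hs]
    clear ht h1 hs
    induction t using TensorProduct.induction_on with
    | zero => rw [map_zero, smul_zero]
    | tmul c y => rw [LinearEquiv.lTensor_tmul, powEquiv_apply, TensorProduct.tmul_smul]
    | add t t' h h' => rw [map_add, smul_add, h, h']
  · rw [← gen_top_iff]
    intro y
    have h1 := isEtaleSub_invertSub hM.2.2.isEtaleSub_top
    rw [invertSub_top] at h1
    exact h1.2 y trivial

theorem IsKisin.invert_isObj (hM : IsKisin M) : (rationalData E).IsObj (M.invert p) := by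
  have := hM.1
  refine ⟨?_, ⟨LinearMap.range (toInvert M), ?_, fun y => ?_⟩, hM.invert_isEtale⟩
  · have h1 := (powEquiv M 1).bijective
    have h2 : ⇑(powEquiv M 1) = fun y => (p : Sring p k) • y :=
      funext fun y => by rw [powEquiv_apply, pow_one]
    rwa [h2] at h1
  · exact Submodule.fg_range _
  · obtain ⟨n, x, hx⟩ := exists_pow_smul_eq_toInvert y
    exact ⟨n, x, hx.symm⟩

/-- A saturated subquotient `N' / N` of a Kisin module embeds in `N'[1/p] / N[1/p]`, with
`p`-power torsion cokernel. -/
theorem exists_gr_toInvert (hM : IsKisin M) {N N' : Submodule (Sring p k) M} (hN : M.IsEtaleSub N)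
    (hN' : M.IsEtaleSub N') (hle : N ≤ N') (hs : ∀ x, (p : Sring p k) • x ∈ N → x ∈ N) :
    ∃ f : M.gr N N' →ₗ[Sring p k] (M.invert p).gr (M.invertSub p N) (M.invertSub p N'),
      IsHom f ∧ Function.Injective f ∧
      ∀ y, ∃ n : ℕ, (p : Sring p k) ^ n • y ∈ LinearMap.range f := by
  have hiN := isEtaleSub_invertSub hN
  have hiN' := isEtaleSub_invertSub hN'
  let q := Subquot.ofGr hN.1 hN'.1 hle
  let q' := Subquot.ofGr hiN.1 hiN'.1 (invertSub_mono hle)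
  let a := subMap (X := M) (Y := M.invert p) (toInvert M) (N := N') (N' := M.invertSub p N')
    fun x hx => toInvert_mem_invertSub hx
  have hai : ∀ x, (M.invert p).incl _ (a x) = toInvert M (M.incl N' x) := fun _ => rfl
  have ha : IsHom a := isHom_subMap (isHom_toInvert M) hN'.1 hiN'.1 _
  let b := q'.π ∘ₗ a
  have hb : IsHom b := q'.isHom.comp ha
  have hb0 : ∀ x, b x = 0 ↔ q.π x = 0 := fun x => by
    rw [q.ker]
    refine (q'.ker _).trans ?_
    rw [hai]
    exact ⟨fun h => hM.mem_of_toInvert_mem hs h, fun h => toInvert_mem_invertSub h⟩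
  have hk : LinearMap.ker q.π ≤ LinearMap.ker b := fun x hx => (hb0 x).mpr hx
  -- The map `N' → N'[1/p] / N[1/p]` has kernel `N`, since `N` is saturated.
  let f : M.gr N N' →ₗ[Sring p k] (M.invert p).gr (M.invertSub p N) (M.invertSub p N') :=
    (LinearMap.ker q.π).liftQ b hk ∘ₗ
      (q.π.quotKerEquivOfSurjective q.surj).symm.toLinearMap
  have hfq : ∀ x, f (q.π x) = b x := fun x => by
    change (LinearMap.ker q.π).liftQ b hk ((q.π.quotKerEquivOfSurjective q.surj).symm (q.π x)) = b x
    rw [show (q.π.quotKerEquivOfSurjective q.surj).symm (q.π x) = Submodule.Quotient.mk x from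
      (LinearEquiv.symm_apply_eq _).mpr rfl]
    rfl
  refine ⟨f, q.isHom.of_comp_surjective q.surj ?_, ?_, fun y => ?_⟩
  · rwa [show f ∘ₗ q.π = b from LinearMap.ext hfq]
  · rw [injective_iff_map_eq_zero]
    intro y hy
    obtain ⟨x, rfl⟩ := q.surj y
    rw [hfq] at hy
    exact (hb0 x).mp hy
  · obtain ⟨y, rfl⟩ := q'.surj y
    obtain ⟨n, x, hx, hxy⟩ := mem_invertSub.mp (incl_mem y)
    refine ⟨n, q.π (mkSub x hx), ?_⟩
    rw [hfq, ← map_smul]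
    refine congrArg q'.π ((M.invert p).incl_injective _ ?_)
    rw [hai, incl_mkSub, map_smul, hxy]

namespace IsHNFlag

variable {r : ℕ} {N : ℕ → Submodule (Sring p k) M}

theorem gr_rational (hE : IsEis E) (hM : IsKisin M) (h : IsHNFlag M r N) {i : ℕ} (hi : i < r) :
    (rationalData E).IsSemistable ((M.invert p).gr (M.invertSub p (N i)) (M.invertSub p (N (i + 1)))) ∧
    (rationalData E).slope ((M.invert p).gr (M.invertSub p (N i)) (M.invertSub p (N (i + 1)))) =
      slope (M.gr (N i) (N (i + 1))) := by
  have h1 := h.isEtaleSub hM hi.le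
  have h2 := h.isEtaleSub hM (Nat.succ_le_of_lt hi)
  obtain ⟨f, hf, hi', hc⟩ := exists_gr_toInvert hM h1 h2 (h.le_succ i hi) (h.saturated hi.le).1
  have hs := fun (j : ℕ) (hj : j ≤ r) => (rational_isStrictSub_iff hM.invert_isObj).mpr
    ⟨isEtaleSub_invertSub (h.isEtaleSub hM hj), fun _ => invertSub_saturated (N := N j)⟩
  refine (h.semistable i hi).rational hE hf hi' ?_ hc
  exact (rationalData_isGood hE).isObj_of_subquot
    (Subquot.ofGr (isEtaleSub_invertSub h1).1 (isEtaleSub_invertSub h2).1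
      (invertSub_mono (h.le_succ i hi))) (hs i hi.le) (hs (i + 1) hi)

theorem rational (hE : IsEis E) (hM : IsKisin M) (h : IsHNFlag M r N) :
    (rationalData E).IsHNFlag (M.invert p) r (fun i => M.invertSub p (N i)) where
  zero := by rw [h.zero, invertSub_bot]
  last := by rw [h.last, invertSub_top]
  le_succ i hi := invertSub_mono (h.le_succ i hi)
  strict i hi := (rational_isStrictSub_iff hM.invert_isObj).mpr
    ⟨isEtaleSub_invertSub (h.isEtaleSub hM hi), fun _ => invertSub_saturated⟩
  semistable i hi := (h.gr_rational hE hM hi).1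
  slope_lt i j hij hj := by
    rw [(h.gr_rational hE hM hj).2, (h.gr_rational hE hM (hij.trans hj)).2]
    exact h.slope_lt i j hij hj

theorem hnFil_rational (hE : IsEis E) (hM : IsKisin M) (h : IsHNFlag M r N) {i : ℕ} (hi : i < r) :
    (rationalData E).hnFil (M.invert p) (slope (M.gr (N i) (N (i + 1)))) =
      M.invertSub p (N (i + 1)) := by
  have hD := rationalData_isGood.{u, max u v} hE
  have h1 := h.rational hE hM
  rw [← (h.gr_rational hE hM hi).2]
  exact h1.hnFil_slope hD hi fun P hP hr =>
    SlopeData.IsReduced.le_of_rank_inf (rationalData_isReduced hE) hD hM.invert_isObj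
      (h1.strict (i + 1) hi) hP hr

end IsHNFlag

end

end Kisin

end

noncomputable section

namespace Kisin

/-! ### Steps of the filtrations of the reductions, and their limit -/

section

open PhiModule

namespace SlopeData

variable {A : Type u} [CommRing A] {φ : A →+* A} {e : A} {D : SlopeData.{u, v} φ e}
  {X : PhiModule.{u, v} φ e} {r : ℕ} {F : ℕ → Submodule A X}

theorem IsFlag.sum_rank (hD : D.IsGood) (h : D.IsFlag X r F) {j : ℕ} (hj : j ≤ r) :
    ∑ i ∈ Finset.range j, (D.rank (X.gr (F i) (F (i + 1))) : ℝ) = D.rank (X.sub (F j)) := by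
  rw [h.rank_eq_sum hD hj, Nat.cast_sum]

theorem IsFlag.sum_slope_sub (hD : D.IsGood) (h : D.IsFlag X r F) {j : ℕ} (hj : j ≤ r) (γ : ℚ) :
    ∑ i ∈ Finset.range j, ((D.slope (X.gr (F i) (F (i + 1))) : ℝ) - γ) *
      D.rank (X.gr (F i) (F (i + 1))) =
      ((D.deg (X.sub (F j)) - γ * D.rank (X.sub (F j)) : ℚ) : ℝ) := by
  rw [h.deg_eq_sum hD hj, h.rank_eq_sum hD hj]
  push_cast
  rw [Finset.mul_sum, ← Finset.sum_sub_distrib]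
  exact Finset.sum_congr rfl fun i _ => by ring

theorem hnFil_anti {γ γ' : ℚ} (h : γ ≤ γ') : D.hnFil X γ' ≤ D.hnFil X γ :=
  sSup_le_sSup fun _ ⟨r, N, i, h1, h2, h3, h4⟩ => ⟨r, N, i, h1, h2, h.trans h3, h4⟩

end SlopeData

variable {p : ℕ} [hp : Fact p.Prime] {k : Type u} [Field k] [CharP k p] [PerfectRing k p]

/-- The intersection of a compatible system of submodules `H n` containing `p ^ n Y` surjects onto
each of them modulo `p ^ n`. -/
theorem exists_sub_mem_iInf {Y : Type v} [AddCommGroup Y] [Module (Sring p k) Y]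
    [Module.Finite (Sring p k) Y] {H : ℕ → Submodule (Sring p k) Y} (hanti : Antitone H)
    (hpow : ∀ n x, (p : Sring p k) ^ n • x ∈ H n)
    (hlift : ∀ n, ∀ x ∈ H n, ∃ z, x - (p : Sring p k) ^ n • z ∈ H (n + 1)) {n : ℕ} {x : Y}
    (hx : x ∈ H n) : ∃ z, x - (p : Sring p k) ^ n • z ∈ ⨅ n, H n := by
  choose! f hf using hlift
  let s : ℕ → Y := fun i => Nat.rec x (fun i y => y - (p : Sring p k) ^ (n + i) • f (n + i) y) i
  have hs : ∀ i, s i ∈ H (n + i) := fun i => by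
    induction i with
    | zero => exact hx
    | succ i ih => exact hf (n + i) _ ih
  obtain ⟨y, hy⟩ := exists_sum_pow_smul (p := p) (k := k) fun i => f (n + i) (s i)
  have hsum : ∀ i, x - (p : Sring p k) ^ n •
      ∑ l ∈ Finset.range i, (p : Sring p k) ^ l • f (n + l) (s l) = s i := fun i => by
    induction i with
    | zero =>
      rw [Finset.sum_range_zero, smul_zero, sub_zero]
      rfl
    | succ i ih => rw [Finset.sum_range_succ, smul_add, ← sub_sub, ih, smul_smul, ← pow_add]
  refine ⟨y, (Submodule.mem_iInf _).mpr fun i => hanti (Nat.le_add_left i n) ?_⟩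
  obtain ⟨t, ht⟩ := hy i
  rw [ht, smul_add, ← sub_sub, hsum, smul_smul, ← pow_add]
  exact (H (n + i)).sub_mem (hs i) (hpow _ _)

variable {E : (WittVector p k)[X]} {M : PhiMod.{u, v} E}

/-- An intersection of kernels of morphisms to torsion objects is an étale submodule. -/
theorem isEtaleSub_iInf_ker (hE : IsEis E) (hM : M.IsEtale) {ι : Type*} {R : ι → PhiMod.{u, v} E}
    (hR : ∀ i, (torsionData E).IsObj (R i)) {π : ∀ i, M →ₗ[Sring p k] R i}
    (hπ : ∀ i, IsHom (π i)) : M.IsEtaleSub (⨅ i, LinearMap.ker (π i)) := by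
  refine ⟨fun x hx => ?_, fun x hx => ?_⟩
  · obtain ⟨m, y, hy⟩ := exists_pow_smul_eq_toInv (M.frob x)
    refine mem_loc.mpr ⟨m, y, (Submodule.mem_iInf _).mpr fun i => ?_, hy⟩
    obtain ⟨c, hc⟩ := (hR i).2.2.1
    have hxi : π i x = 0 := (Submodule.mem_iInf _).mp hx i
    have h1 := congrArg (invMap (E : Sring p k) (π i)) hy
    rw [map_smul, hπ i, hxi, map_zero, smul_zero, invMap_toInv] at h1
    exact hE.toInv_injective hc (hR i).2.2.2 (h1.symm.trans (map_zero _).symm)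
  · obtain ⟨m, y, hy⟩ := exists_pow_smul_toInv_eq hM x
    refine mem_gen_iff_exists_pow.mpr ⟨m, mem_span_frob_iff.mpr
      ⟨y, fun j => (Submodule.mem_iInf _).mpr fun i => ?_, hy⟩⟩
    obtain ⟨c, hc⟩ := (hR i).2.2.1
    have hxi : π i x = 0 := (Submodule.mem_iInf _).mp hx i
    have h1 := congrArg (invMap (E : Sring p k) (π i)) hy
    rw [map_smul, invMap_toInv, hxi, map_zero, smul_zero, map_sum] at h1
    refine eq_zero_of_sum_frob_eq_zero hE (hR i).2.1 hc (hR i).2.2.2 (x := fun j => π i (y j)) ?_ j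
    rw [h1]
    exact Finset.sum_congr rfl fun j _ => by rw [map_smul, hπ i]

theorem rank_sub_top {X : PhiMod.{u, v} E} : torsionRank (X.sub ⊤) = torsionRank X :=
  torsionRank_iso (SlopeData.IsGood.iso_sub_top X)

/-- The polygons of the reductions lie above the segment with the same end points. -/
theorem slope_mul_le_tF (hE : IsEis E) (hM : IsKisin M) {n : ℕ} (hn : 1 ≤ n) {x : ℝ}
    (hx : x ∈ Set.Icc (0 : ℝ) (rank M)) : slope M * x ≤ tF M n x := by
  have hD := torsionData_isGood.{u, v} hE
  have ho := hM.modPow_isObj n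
  obtain ⟨r, F, hF⟩ := exists_isHNFlag_torsion hE ho
  have hn' : (0 : ℝ) < n := by exact_mod_cast hn
  obtain ⟨j, -, h1, h2⟩ := exists_slope_split hF.slope_lt (slope M)
  have hs1 := hF.isFlag.sum_rank hD le_rfl
  have hs2 := hF.isFlag.sum_slope_sub hD le_rfl (slope M)
  have hr : (torsionData E).rank ((M.modPow p n).sub ⊤) = torsionRank (M.modPow p n) := rank_sub_top
  have hd : (torsionData E).deg ((M.modPow p n).sub ⊤) = torsionDeg (M.modPow p n) :=
    torsionDeg_iso (SlopeData.IsGood.iso_sub_top _)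
  rw [hF.last, hr] at hs1
  rw [hF.last, hr, hd, ← hM.slope_modPow hE hn] at hs2
  have h0 := hD.slope_mul_rank ho
  change _ * (torsionRank _ : ℚ) = torsionDeg _ at h0
  rw [h0, sub_self, Rat.cast_zero, hM.slope_modPow hE hn] at hs2
  rw [hM.torsionRank_modPow, Nat.cast_mul] at hs1
  have h3 := le_polygon (x := n * x) (mul_nonneg hn'.le hx.1)
    (by rw [hs1]; exact mul_le_mul_of_nonneg_left hx.2 hn'.le) h1 (fun i hi hi' => (h2 i hi hi').le) hs2
  rw [tF, hF.hnPolygon_eq hD torsionData_isReduced, div_mul_eq_mul_div, one_mul, le_div_iff₀ hn']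
  linarith

theorem tF_one_le (hE : IsEis E) (hM : IsKisin M)
    (h : ∀ x ∈ Set.Icc (0 : ℝ) (rank M), tFInf M x = tF M 1 x) {n : ℕ} (hn : 1 ≤ n) {x : ℝ}
    (hx : x ∈ Set.Icc (0 : ℝ) (rank M)) : tF M 1 x ≤ tF M n x := by
  rw [← h x hx]
  refine ciInf_le (f := fun n : ℕ+ => tF M n x) ⟨slope M * x, ?_⟩ ⟨n, hn⟩
  rintro _ ⟨m, rfl⟩
  exact slope_mul_le_tF hE hM m.2 hx

section

variable {r : ℕ} {F : ℕ → Submodule (Sring p k) (M.modPow p 1)} {j : ℕ} {γ : ℚ}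

theorem dev_le_flag (hE : IsEis E) (hF : (torsionData E).IsHNFlag (M.modPow p 1) r F) (hj : j ≤ r)
    (h1 : ∀ i < j, γ < (torsionData E).slope ((M.modPow p 1).gr (F i) (F (i + 1))))
    (h2 : ∀ i, j ≤ i → i < r → (torsionData E).slope ((M.modPow p 1).gr (F i) (F (i + 1))) < γ)
    (P : Submodule (Sring p k) (M.modPow p 1))
    (hP : (torsionData E).IsStrictSub (M.modPow p 1) P) : dev γ P ≤ dev γ (F j) :=
  hF.isFlag.bound (torsionData_isGood hE) hP hj (fun i hi => (h1 i hi).le)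
    fun i hi hi' => (h2 i hi hi').le

theorem rank_of_dev_eq (hE : IsEis E) (hM : IsKisin M)
    (hF : (torsionData E).IsHNFlag (M.modPow p 1) r F) (hj : j ≤ r)
    (h1 : ∀ i < j, γ < (torsionData E).slope ((M.modPow p 1).gr (F i) (F (i + 1))))
    (h2 : ∀ i, j ≤ i → i < r → (torsionData E).slope ((M.modPow p 1).gr (F i) (F (i + 1))) < γ)
    (n : ℕ) : ∀ P, (torsionData E).IsStrictSub (M.modPow p n) P → n * dev γ (F j) ≤ dev γ P →
      torsionRank ((M.modPow p n).sub P) = n * torsionRank ((M.modPow p 1).sub (F j)) := by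
  have hD := torsionData_isGood.{u, v} hE
  induction n with
  | zero =>
    intro P hP _
    have h3 : torsionRank (M.modPow p 0) = 0 := by rw [hM.torsionRank_modPow, zero_mul]
    have h4 := hD.rank_mono le_top hP (hD.strict_top (hM.modPow_isObj 0))
    change torsionRank _ ≤ torsionRank _ at h4
    rw [rank_sub_top, h3] at h4
    omega
  | succ n ih =>
    intro P hP hdev
    obtain ⟨h3, h4, h5⟩ := dev_modPow_eq hE hM (dev_le_flag hE hF hj h1 h2) n 1 hP hdev
    rw [Nat.cast_one, one_mul] at h5
    rw [(torsion_sub_exact hE (isHom_mulMap n 1) (isHom_redMap n 1) (hM.mulMap_injective n 1)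
      (exact_mulMap_redMap n 1) (hM.modPow_isObj _) (hM.modPow_isObj _) (hM.modPow_isObj _)
      ((torsion_isStrictSub_iff (hM.modPow_isObj _)).mp hP).1).1,
      ih _ (isStrictSub_comap_mulMap hM n 1 hP) h3, add_mul, one_mul]
    congr 1
    exact (hF.isFlag.rank_inf_eq hD h4 hj (fun i hi => (h1 i hi).le) h2 h5).symm.trans
      (hF.isFlag.rank_inf_eq' hD h4 hj h1 (fun i hi hi' => (h2 i hi hi').le) h5)

/-- If the polygon of `M / p M` lies below those of the `M / p ^ n M`, then a step of the
filtration of `M / p ^ n M` is the only subobject of height `n` times that of the corresponding step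
for `M / p M`. -/
theorem hnFil_unique (hE : IsEis E) (hM : IsKisin M)
    (hF : (torsionData E).IsHNFlag (M.modPow p 1) r F) (hj : j ≤ r)
    (h1 : ∀ i < j, γ < (torsionData E).slope ((M.modPow p 1).gr (F i) (F (i + 1))))
    (h2 : ∀ i, j ≤ i → i < r → (torsionData E).slope ((M.modPow p 1).gr (F i) (F (i + 1))) < γ)
    {n : ℕ} (hn : 1 ≤ n) (hpoly : ∀ x ∈ Set.Icc (0 : ℝ) (rank M), tF M 1 x ≤ tF M n x) :
    (torsionData E).IsStrictSub (M.modPow p n) ((torsionData E).hnFil (M.modPow p n) γ) ∧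
    n * dev γ (F j) ≤ dev γ ((torsionData E).hnFil (M.modPow p n) γ) ∧
    ∀ P, (torsionData E).IsStrictSub (M.modPow p n) P → n * dev γ (F j) ≤ dev γ P →
      P = (torsionData E).hnFil (M.modPow p n) γ := by
  have hD := torsionData_isGood.{u, v} hE
  have hR : (torsionData.{u, v} E).IsReduced := torsionData_isReduced
  have ho := hM.modPow_isObj n
  have hn' : (0 : ℝ) < n := by exact_mod_cast hn
  obtain ⟨s, G, hG⟩ := exists_isHNFlag_torsion hE ho
  obtain ⟨l, hl, h3, h4⟩ := exists_slope_split hG.slope_lt γ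
  have hst := hG.strict l hl
  have hmax : ∀ P, (torsionData E).IsStrictSub (M.modPow p n) P → dev γ P ≤ dev γ (G l) :=
    fun P hP => hG.isFlag.bound hD hP hl h3 fun i hi hi' => (h4 i hi hi').le
  rw [hG.hnFil_eq hD hl h3 h4 fun P hP h => hR.le_of_rank_inf hD ho hst hP h]
  have hrk := hF.isFlag.sum_rank hD hj
  change _ = (torsionRank _ : ℝ) at hrk
  have hle : torsionRank ((M.modPow p 1).sub (F j)) ≤ rank M := by
    have h5 := hD.rank_mono le_top (hF.strict j hj) (hD.strict_top (hM.modPow_isObj 1))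
    change torsionRank _ ≤ torsionRank _ at h5
    rwa [rank_sub_top, hM.torsionRank_modPow_one] at h5
  have hx : (torsionRank ((M.modPow p 1).sub (F j)) : ℝ) ∈ Set.Icc (0 : ℝ) (rank M) :=
    ⟨Nat.cast_nonneg _, by exact_mod_cast hle⟩
  -- Compare the two polygons at the rank of `F j`, a vertex of the polygon of `M / p M`; the polygon of
  -- `M / p ^ n M` lies below its tangent of slope `γ`, which passes through the vertex of `G l`.
  have hdev : n * dev γ (F j) ≤ dev γ (G l) := by
    have h5 := hpoly _ hx
    have hs := hG.isFlag.sum_rank hD le_rfl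
    change _ = (torsionRank _ : ℝ) at hs
    rw [hG.last, rank_sub_top, hM.torsionRank_modPow, Nat.cast_mul] at hs
    have h6 := polygon_le (x := n * (torsionRank ((M.modPow p 1).sub (F j)) : ℝ))
      (mul_nonneg hn'.le hx.1) (by rw [hs]; exact mul_le_mul_of_nonneg_left hx.2 hn'.le) hl h3
      (fun i hi hi' => (h4 i hi hi').le)
    rw [hG.isFlag.sum_slope_sub hD hl γ] at h6
    have h7 := polygon_breakpoint (r := r)
      (m := fun i => (torsionData E).rank ((M.modPow p 1).gr (F i) (F (i + 1))))
      (μ := fun i => (torsionData E).slope ((M.modPow p 1).gr (F i) (F (i + 1)))) hj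
    have h8 := hF.isFlag.sum_slope_sub hD hj 0
    simp only [Rat.cast_zero, sub_zero, zero_mul] at h8
    rw [hrk, h8] at h7
    rw [tF, tF, hF.hnPolygon_eq hD hR, hG.hnPolygon_eq hD hR, Nat.cast_one, div_one, one_mul, one_mul,
      h7, div_mul_eq_mul_div, one_mul, le_div_iff₀ hn'] at h5
    have h9 := h5.trans h6
    change ((torsionDeg _ : ℚ) : ℝ) * n ≤ _ + ((torsionDeg _ - γ * (torsionRank _ : ℚ) : ℚ) : ℝ) at h9
    rw [dev, dev]
    have h10 : torsionDeg ((M.modPow p 1).sub (F j)) * n ≤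
      γ * (n * torsionRank ((M.modPow p 1).sub (F j))) +
      (torsionDeg ((M.modPow p n).sub (G l)) - γ * torsionRank ((M.modPow p n).sub (G l))) := by
      exact_mod_cast h9
    linarith
  refine ⟨hst, hdev, fun P hP hPdev => ?_⟩
  have hle' : P ≤ G l := hR.le_of_rank_inf hD ho hst hP
    (hG.isFlag.rank_inf_eq hD hP hl h3 h4 ((dev_modPow_le hE hM (dev_le_flag hE hF hj h1 h2) n _ hst).trans hPdev))
  exact hR.eq_of_rank_eq hD hle' hP hst ((rank_of_dev_eq hE hM hF hj h1 h2 n P hP hPdev).trans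
    (rank_of_dev_eq hE hM hF hj h1 h2 n _ hst hdev).symm)

/-- The limit of the steps of the filtrations of the reductions is a saturated étale submodule which
lifts the step of the filtration of `M / p M`. -/
theorem limit_hnFil (hE : IsEis E) (hM : IsKisin M)
    (hF : (torsionData E).IsHNFlag (M.modPow p 1) r F) (hj : j ≤ r)
    (h1 : ∀ i < j, γ < (torsionData E).slope ((M.modPow p 1).gr (F i) (F (i + 1))))
    (h2 : ∀ i, j ≤ i → i < r → (torsionData E).slope ((M.modPow p 1).gr (F i) (F (i + 1))) < γ)
    (hpoly : ∀ n : ℕ, 1 ≤ n → ∀ x ∈ Set.Icc (0 : ℝ) (rank M), tF M 1 x ≤ tF M n x)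
    {N : Submodule (Sring p k) M}
    (hN : N = ⨅ n : ℕ, ((torsionData E).hnFil (M.modPow p n) γ).comap (M.reduce p n)) :
    M.IsEtaleSub N ∧ (∀ x, (p : Sring p k) • x ∈ N → x ∈ N) ∧ N.map (M.reduce p 1) = F j := by
  have hfin := hM.1
  have hD := torsionData_isGood.{u, v} hE
  let Q : ∀ n : ℕ, Submodule (Sring p k) (M.modPow p n) := fun n => (torsionData E).hnFil (M.modPow p n) γ
  let H : ℕ → Submodule (Sring p k) M := fun n => (Q n).comap (M.reduce p n)
  have hu := fun n (hn : 1 ≤ n) => hnFil_unique hE hM hF hj h1 h2 hn (hpoly n hn)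
  -- The filtration is only controlled for `n ≥ 1`, but `M / p ^ 0 M` is zero.
  have hsub : Subsingleton (M.modPow p 0) := torsion_subsingleton (hM.modPow_isObj 0)
    (by rw [hM.torsionRank_modPow, zero_mul])
  have hQ : ∀ n, (torsionData E).IsStrictSub (M.modPow p n) (Q n) := fun n => by
    rcases Nat.eq_zero_or_pos n with rfl | hn
    · rw [Subsingleton.elim (Q 0) ⊤]
      exact hD.strict_top (hM.modPow_isObj 0)
    · exact (hu n hn).1
  have hH0 : ∀ x, x ∈ H 0 := fun x => by
    change M.reduce p 0 x ∈ Q 0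
    rw [Subsingleton.elim (M.reduce p 0 x) 0]
    exact zero_mem _
  -- Along `0 → M / p ^ a → M / p ^ (a + b) → M / p ^ b → 0` a subobject of maximal height induces
  -- subobjects of maximal height; by uniqueness, these are the steps of the filtrations.
  have hcomp : ∀ a b, 1 ≤ a → 1 ≤ b → (Q (a + b)).comap (mulMap M a b) = Q a ∧
      (Q (a + b)).map (redMap M a b) = Q b := fun a b ha hb => by
    have hab := hu (a + b) (by omega)
    obtain ⟨h3, h4, h5⟩ := dev_modPow_eq hE hM (dev_le_flag hE hF hj h1 h2) a b hab.1 hab.2.1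
    exact ⟨(hu a ha).2.2 _ (isStrictSub_comap_mulMap hM a b hab.1) h3, (hu b hb).2.2 _ h4 h5⟩
  have hsat : ∀ n x, (p : Sring p k) • x ∈ H (n + 1) → x ∈ H n := fun n x hx => by
    rcases Nat.eq_zero_or_pos n with rfl | hn
    · exact hH0 x
    · change M.reduce p n x ∈ Q n
      rw [← (hcomp n 1 hn le_rfl).1, Submodule.mem_comap, mulMap_reduce, pow_one]
      exact hx
  have hanti : Antitone H := antitone_nat_of_succ_le fun n x hx => by
    rcases Nat.eq_zero_or_pos n with rfl | hn
    · exact hH0 x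
    · rw [add_comm] at hx
      change M.reduce p n x ∈ Q n
      rw [← (hcomp 1 n le_rfl hn).2]
      exact ⟨M.reduce p (1 + n) x, hx, redMap_reduce 1 n x⟩
  have hpow : ∀ n x, (p : Sring p k) ^ n • x ∈ H n := fun n x => by
    change M.reduce p n _ ∈ Q n
    rw [reduce_eq_zero.mpr ⟨x, rfl⟩]
    exact zero_mem _
  have hlift : ∀ n, ∀ x ∈ H n, ∃ z, x - (p : Sring p k) ^ n • z ∈ H (n + 1) := fun n x hx => by
    rcases Nat.eq_zero_or_pos n with rfl | hn
    · exact ⟨x, by rw [pow_zero, one_smul, sub_self]; exact zero_mem _⟩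
    · change M.reduce p n x ∈ Q n at hx
      rw [← (hcomp 1 n le_rfl hn).2] at hx
      obtain ⟨y, hy, hyx⟩ := hx
      obtain ⟨y, rfl⟩ := reduce_surjective _ y
      rw [redMap_reduce, eq_comm, ← sub_eq_zero, ← map_sub, reduce_eq_zero] at hyx
      obtain ⟨z, hz⟩ := hyx
      refine ⟨z, ?_⟩
      rw [hz, sub_sub_cancel, add_comm]
      exact hy
  refine ⟨?_, fun x hx => ?_, ?_⟩
  · have h3 := isEtaleSub_iInf_ker hE hM.2.2 (R := fun n => (M.modPow p n).quot (Q n))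
      (fun n => (hQ n).2.2) (π := fun n => (M.modPow p n).proj (Q n) ∘ₗ M.reduce p n)
      fun n => (isHom_proj (hQ n).1).comp (isHom_reduce M n)
    simp_rw [LinearMap.ker_comp, ker_proj] at h3
    rw [hN]
    exact h3
  · rw [hN, Submodule.mem_iInf] at hx ⊢
    exact fun n => hsat n x (hx (n + 1))
  · have h3 : F j = Q 1 := (hu 1 le_rfl).2.2 _ (hF.strict j hj) (by rw [Nat.cast_one, one_mul])
    rw [h3]
    apply le_antisymm
    · rintro _ ⟨x, hx, rfl⟩
      rw [hN] at hx
      exact (Submodule.mem_iInf _).mp hx 1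
    · intro y hy
      obtain ⟨x, rfl⟩ := reduce_surjective 1 y
      rw [mem_map_reduce, hN]
      exact exists_sub_mem_iInf hanti hpow hlift (n := 1) hy

end

/-- Saturated étale submodules which lift the Harder-Narasimhan flag of `M / p M` form a flag of
Kisin submodules. -/
theorem isHNFlag_of_lift (hE : IsEis E) (hM : IsKisin M) {r : ℕ}
    {F : ℕ → Submodule (Sring p k) (M.modPow p 1)}
    (hF : (torsionData E).IsHNFlag (M.modPow p 1) r F) {N : ℕ → Submodule (Sring p k) M}
    (hle : ∀ j < r, N j ≤ N (j + 1)) (hN : ∀ j ≤ r, M.IsEtaleSub (N j))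
    (hs : ∀ j ≤ r, ∀ x, (p : Sring p k) • x ∈ N j → x ∈ N j)
    (hred : ∀ j ≤ r, (N j).map (M.reduce p 1) = F j) : IsHNFlag M r N := by
  have hfin := hM.1
  have hD := torsionData_isGood.{u, v} hE
  have hmem : ∀ j ≤ r, ∀ x, M.reduce p 1 x ∈ F j ↔ ∃ z, x - (p : Sring p k) • z ∈ N j := by
    intro j hj x
    rw [← hred j hj, mem_map_reduce, pow_one]
  have hiso : ∀ j < r, Iso ((M.gr (N j) (N (j + 1))).modPow p 1)
      ((M.modPow p 1).gr (F j) (F (j + 1))) := fun j hj => by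
    rw [← hred j hj.le, ← hred (j + 1) hj]
    exact iso_gr_modPow (hN j hj.le).1 (hN (j + 1) hj).1 (hle j hj) (hs (j + 1) hj) 1
  have hk : ∀ j < r, IsKisin (M.gr (N j) (N (j + 1))) := fun j hj => by
    let q := Subquot.ofGr (hN j hj.le).1 (hN (j + 1) hj).1 (hle j hj)
    have hf1 : Module.Finite (Sring p k) (M.sub (N (j + 1))) :=
      inferInstanceAs (Module.Finite (Sring p k) (N (j + 1)))
    have hf : Module.Finite (Sring p k) (M.gr (N j) (N (j + 1))) := Module.Finite.of_surjective q.π q.surj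
    refine ⟨hf, free_of_regular maximalIdeal_S (fun y hy => ?_) (fun y z hyz => ?_),
      q.isEtale hM.2.2 (hN j hj.le) (hN (j + 1) hj)⟩
    · obtain ⟨x, rfl⟩ := q.surj y
      rw [← map_smul, q.ker, map_smul] at hy
      exact (q.ker x).mpr (hs j hj.le _ hy)
    · obtain ⟨x, rfl⟩ := q.surj y
      obtain ⟨z, rfl⟩ := q.surj z
      rw [← map_smul, ← map_smul, ← sub_eq_zero, ← map_sub, q.ker, map_sub, map_smul, map_smul] at hyz
      have h1 := (hmem j hj.le _).mpr ⟨0, by rw [smul_zero, sub_zero]; exact hyz⟩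
      have h3 : M.reduce p 1 ((p : Sring p k) • M.incl _ z) = 0 :=
        reduce_eq_zero.mpr ⟨M.incl _ z, by rw [pow_one]⟩
      rw [map_sub, h3, sub_zero, map_smul] at h1
      obtain ⟨w, hw⟩ := (hmem j hj.le _).mp
        (((torsion_isStrictSub_iff (hM.modPow_isObj 1)).mp (hF.strict j hj.le)).2 _ h1)
      have hw' : w ∈ N (j + 1) := hs (j + 1) hj _ (by
        have h2 := (N (j + 1)).sub_mem (incl_mem x) (hle j hj hw)
        rwa [sub_sub_cancel] at h2)
      refine ⟨q.π (mkSub w hw'), ?_⟩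
      rw [← map_smul, ← sub_eq_zero, ← map_sub, q.ker, map_sub, map_smul, incl_mkSub]
      exact hw
  have hslope : ∀ j < r, slope (M.gr (N j) (N (j + 1))) =
      (torsionData E).slope ((M.modPow p 1).gr (F j) (F (j + 1))) := fun j hj => by
    rw [← (hk j hj).slope_modPow hE le_rfl, hD.iso_slope (hiso j hj)]
  -- `N 0` vanishes and `N r` is everything modulo `p`; Nakayama's lemma applies, as `N 0` is saturated.
  refine ⟨?_, ?_, hle, fun j hj => ⟨(hN j hj).1, hM.sub (hN j hj) (hs j hj)⟩,
    fun j hj => (hk j hj).2.1, fun j hj => ⟨hk j hj, hD.iso_isSemistable (hiso j hj).symm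
      (hF.semistable j hj)⟩, fun i j hij hj => ?_⟩
  · refine eq_bot_iff.mpr (nakayama (not_isUnit_p (p := p) (k := k)) fun y hy => ?_)
    have h1 : M.reduce p 1 y = 0 := by
      have h2 : M.reduce p 1 y ∈ F 0 := hred 0 (Nat.zero_le r) ▸ ⟨y, hy, rfl⟩
      rwa [hF.zero, Submodule.mem_bot] at h2
    obtain ⟨z, hz⟩ := reduce_eq_zero.mp h1
    rw [pow_one] at hz
    exact ⟨z, hs 0 (Nat.zero_le r) z (hz ▸ hy), by rw [hz, sub_self]; exact zero_mem _⟩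
  · refine eq_top_iff.mpr (nakayama (not_isUnit_p (p := p) (k := k)) fun y _ => ?_)
    obtain ⟨z, hz⟩ := (hmem r le_rfl y).mp (by rw [hF.last]; trivial)
    exact ⟨z, trivial, hz⟩
  · rw [hslope j hj, hslope i (hij.trans hj)]
    exact hF.slope_lt i j hij hj

/-- The polygon criterion for the existence of a flag. -/
theorem exists_isHNFlag (hE : IsEis E) (hM : IsKisin M)
    (h : ∀ x ∈ Set.Icc (0 : ℝ) (rank M), tFInf M x = tF M 1 x) :
    ∃ (r : ℕ) (N : ℕ → Submodule (Sring p k) M), IsHNFlag M r N := by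
  obtain ⟨r, F, hF⟩ := exists_isHNFlag_torsion hE (hM.modPow_isObj 1)
  let μ : ℕ → ℚ := fun i => (torsionData E).slope ((M.modPow p 1).gr (F i) (F (i + 1)))
  have hγ : ∀ j, j ≤ r → ∃ γ : ℚ, (∀ i < j, γ < μ i) ∧ ∀ i, j ≤ i → i < r → μ i < γ := by
    intro j hj
    obtain ⟨γ, h1, h2⟩ := Order.exists_between_finsets ((Finset.Ico j r).image μ)
      ((Finset.range j).image μ) (by
        intro a ha b hb
        obtain ⟨i, hi, rfl⟩ := Finset.mem_image.mp ha
        obtain ⟨l, hl, rfl⟩ := Finset.mem_image.mp hb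
        rw [Finset.mem_Ico] at hi
        exact hF.slope_lt l i ((Finset.mem_range.mp hl).trans_le hi.1) hi.2)
    exact ⟨γ, fun i hi => h2 _ (Finset.mem_image_of_mem _ (Finset.mem_range.mpr hi)),
      fun i hi hi' => h1 _ (Finset.mem_image_of_mem _ (Finset.mem_Ico.mpr ⟨hi, hi'⟩))⟩
  choose! γ hγ1 hγ2 using hγ
  have hlim := fun j (hj : j ≤ r) => limit_hnFil hE hM hF hj (hγ1 j hj) (hγ2 j hj)
    (fun n hn x hx => tF_one_le hE hM h hn hx) rfl
  refine ⟨r, _, isHNFlag_of_lift hE hM hF (fun j hj => ?_) (fun j hj => (hlim j hj).1)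
    (fun j hj => (hlim j hj).2.1) (fun j hj => (hlim j hj).2.2)⟩
  exact iInf_mono fun n => Submodule.comap_mono (SlopeData.hnFil_anti
    ((hγ1 (j + 1) hj j j.lt_succ_self).trans (hγ2 j hj.le j le_rfl hj)).le)

end

end Kisin

end

theorem proposition3p23 {p : ℕ} [Fact p.Prime] {k : Type u} [Field k] [CharP k p] [PerfectRing k p]
    (E : (WittVector p k)[X]) (hE_monic : E.Monic)
    (hE_eisenstein : E.IsEisensteinAt (Ideal.span {(p : WittVector p k)}))
    (hE_degree : 0 < E.natDegree)
    (M : Kisin.PhiMod.{u, v} E) (hM : Kisin.IsKisin M) :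
    ((∃ (r : ℕ) (N : ℕ → Submodule (Kisin.Sring p k) M), Kisin.IsHNFlag M r N) ↔
      ∀ x ∈ Set.Icc (0 : ℝ) (Kisin.rank M), Kisin.tFInf M x = Kisin.tF M 1 x) ∧
    ∀ (r : ℕ) (N : ℕ → Submodule (Kisin.Sring p k) M), Kisin.IsHNFlag M r N →
      -- the flag is unique
      (∀ (r' : ℕ) (N' : ℕ → Submodule (Kisin.Sring p k) M), Kisin.IsHNFlag M r' N' →
        r' = r ∧ ∀ i ≤ r, N' i = N i) ∧
      -- its members are the limits of the steps of the filtrations of the `M / p ^ n M`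
      (∀ i < r, N (i + 1) = ⨅ n : ℕ+, Submodule.comap (M.reduce p n)
        ((Kisin.torsionData E).hnFil (M.modPow p n) (Kisin.slope (M.gr (N i) (N (i + 1)))))) ∧
      -- the Fargues polygon has the slopes of the flag, with multiplicities
      (∀ x ∈ Set.Icc (0 : ℝ) (Kisin.rank M), Kisin.tFInf M x =
        Kisin.polygon r (fun i => Kisin.rank (M.gr (N i) (N (i + 1))))
          (fun i => Kisin.slope (M.gr (N i) (N (i + 1)))) x) ∧
      -- the reduction modulo `p ^ n` is the Harder-Narasimhan flag of `M / p ^ n M`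
      (∀ n : ℕ, 1 ≤ n →
        (Kisin.torsionData E).IsHNFlag (M.modPow p n) r (fun i => (N i).map (M.reduce p n)) ∧
        ∀ i < r, (Kisin.torsionData E).slope
          ((M.modPow p n).gr ((N i).map (M.reduce p n)) ((N (i + 1)).map (M.reduce p n))) =
            Kisin.slope (M.gr (N i) (N (i + 1)))) ∧
      -- the flag is compatible with the filtration of `M ⊗ ℚ_p` in the isogeny category
      (∀ i < r, Kisin.IsogenySame (N (i + 1))
        ((Kisin.isogenyData E).hnFil M (Kisin.slope (M.gr (N i) (N (i + 1)))))) ∧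
      -- the flag is compatible with the filtration of `M[1/p]`
      (∀ i < r, M.invertSub p (N (i + 1)) =
        (Kisin.rationalData E).hnFil (M.invert p) (Kisin.slope (M.gr (N i) (N (i + 1))))) := by
  have hE : Kisin.IsEis E := ⟨hE_monic, hE_eisenstein, hE_degree⟩
  refine ⟨⟨fun ⟨r, N, h⟩ x _ => ?_, Kisin.exists_isHNFlag hE hM⟩, fun r N h =>
    ⟨fun r' N' h' => h.unique hE hM h', fun i hi => h.eq_iInf_hnFil hE hM hi,
      fun x _ => h.tFInf_eq hE hM x,
      fun n hn => ⟨h.modPow hE hM hn, fun i hi => h.slope_gr_modPow hE hn hi⟩, fun i hi => ?_,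
      fun i hi => (h.hnFil_rational hE hM hi).symm⟩⟩
  · rw [h.tFInf_eq hE hM, h.tF_eq hE hM le_rfl]
  · rw [h.hnFil_isogeny hE hM hi]
    exact ⟨0, by rw [pow_zero, one_smul], by rw [pow_zero, one_smul]⟩
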